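/- Let $r\ge 1$ and let $D$ be a compact domain in $\mathbb{R}^d$ or $\mathbb{T}^d$ (the closure of its interior) whose boundary is $\partial D=\Gamma_1\cup\dots\cup\Gamma_n$, where the $\Gamma_i$ are closed $C^{r+1}$ hypersurfaces with (possibly empty) boundary; let $\Gamma^*=\bigcup_i\partial\Gamma_i$ be the corner set. Let $b_t$ be the billiard flow in $D$: free motion $\dot q=p$, $\dot p=0$ inside $D$, and $p_{out}=p_{in}-2\langle p_{in},n(q)\rangle n(q)$ at $q\in\partial D\setminus\Gamma^*$, $n(q)$ being the inward unit normal; it is not defined along trajectories that meet $\Gamma^*$. For $\epsilon>0$ let $V(\cdot;\epsilon)$ be a real $C^{r+1}$ potential and let $h^\epsilon_t$ be the time-$t$ map of the Hamiltonian flow of $H=\tfrac12 p^2+V(q;\epsilon)$. Assume: (I) for every compact $K\subset \mathrm{int}\,D$, $\|V(\cdot;\epsilon)\|_{C^{r+1}(K)}\to0$ as $\epsilon\to+0$. (II) There are a function $Q(q;\epsilon)$, $\epsilon\ge0$, on an open neighbourhood $\tilde D$ of $D\setminus\Gamma^*$, which is $C^{r+1}$ in $q$ and depends continuously on $\epsilon\ge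 0$ in the $C^{r+1}$ topology (uniformly on compact subsets of $\tilde D$), and, for each $i$, a constant $Q_i$, an open neighbourhood $N_i\subset\tilde D$ of $\Gamma_i\setminus\Gamma^*$, a number $w_i>0$ and functions $W_i(\cdot;\epsilon):\mathbb{R}\to\mathbb{R}$, $\epsilon>0$, of class $C^{r+1}$ on $(-w_i,w_i)$, such that (a) $Q(q;0)=Q_i$ for $q\in\Gamma_i\setminus\Gamma^*$; (b) $V(q;\epsilon)=W_i(Q(q;\epsilon)-Q_i;\epsilon)$ for $q\in N_i$, $\epsilon>0$; (c) $\nabla Q(q;\epsilon)\ne0$ for $q\in N_i$, $\epsilon\ge0$, and $W_i'(x;\epsilon)\neq0$ for $|x|<w_i$, $\epsilon>0$. (III) There is a constant $\mathcal{E}\in(0,+\infty]$ such that for every $i$, as $\epsilon\to+0$, $W_i(Q(q;0)-Q_i;\epsilon)$ tends to $0$ for every $q\in N_i\cap\mathrm{int}\,D$ and to $\mathcal{E}$ for every $q\in N_i\setminus D$. (IV) For every $i$, let $\mathcal{Q}_i(\cdot;\epsilon)$ be the inverse of $W_i(\cdot;\epsilon)|_{(-w_i,w_i)}$. For all $0<W_1<W_2<\mathcal{E}$,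 as $\epsilon\to+0$, $\mathcal{Q}_i(\cdot;\epsilon)$ tends to zero uniformly on $[W_1,W_2]$ along with all its derivatives up to order $r+1$. Let $0<T<\infty$, and let $\rho_0=(q_0,p_0)$ and $\rho_T=b_T\rho_0$ be inner phase points (that is, with positions in $\mathrm{int}\,D$), with energy $H^*=\tfrac12p_0^2<\mathcal{E}$. Assume that on $[0,T]$ the billiard trajectory of $\rho_0$ has finitely many collisions with $\partial D$, none of them at $\Gamma^*$ and none of them tangent to the boundary. Then $h^\epsilon_t\to b_t$ as $\epsilon\to+0$ in the $C^r$ topology in a small neighbourhood of $\rho_0$ and for all $t$ close to $T$. Precisely, there is $\delta\in(0,T)$ such that, for all $t\in(T-\delta,T+\delta)$, the map $b_t$ is defined and $C^r$ on the $\delta$-ball $U$ around $\rho_0$ in phase space, with no tangent collisions; for all sufficiently small $\epsilon>0$ and all such $t$, the map $h^\epsilon_t$ is defined and $C^r$ on $U$; and all partial derivatives with respect to $\rho$ of order at most $r$ (including order $0$) of $h^\epsilon_t(\rho)$ converge to those of $b_t(\rho)$ as $\epsilon\to+0$, uniformly in $\rho\in U$ and $t\in(T-\delta,T+\delta)$.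 -/

import Mathlib

open Set Filter Topology

/-- Positions (and momenta) in `ℝ^d`. -/
abbrev Config (d : ℕ) := EuclideanSpace ℝ (Fin d)

/-- Phase points `ρ = (q, p)`. -/
abbrev PhaseSpace (d : ℕ) := Config d × Config d

/-! ### The billiard table -/

/-- The points of `S` near which `S` is a `C^{r+1}` hypersurface without boundary. -/
def smoothPart {d : ℕ} (r : ℕ) (S : Set (Config d)) : Set (Config d) :=
  {x | x ∈ S ∧ ∃ f : Config d → ℝ, ContDiffAt ℝ (r + 1 : ℕ) f x ∧ fderiv ℝ f x ≠ 0 ∧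
    ∀ᶠ y in 𝓝 x, (y ∈ S ↔ f y = 0)}

/-- The boundary of a `(d-1)`-dimensional submanifold with boundary: the points at which it is
not locally a hypersurface without boundary. -/
def hypersurfaceBoundary {d : ℕ} (r : ℕ) (S : Set (Config d)) : Set (Config d) :=
  S \ smoothPart r S

/-- A compact billiard table in `ℝ^d / L`, described by its `L`-periodic lift to `ℝ^d`.
For `L = 0` this is a table in `ℝ^d`, for `L = ℤ^d` it is a table in the torus `𝕋^d`.
Its boundary is the union of the `C^{r+1}` pieces `Γ 0, …, Γ (n-1)`. -/
structure BilliardTable (d r n : ℕ) (L : AddSubgroup (Config d)) where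
  /-- the domain `D` -/
  D : Set (Config d)
  /-- the boundary pieces -/
  Γ : Fin n → Set (Config d)
  isClosed_D : IsClosed D
  D_eq_closure : D = closure (interior D)
  compact_mod : ∃ K : Set (Config d), IsCompact K ∧ ∀ x ∈ D, ∃ l ∈ L, x + l ∈ K
  D_periodic : ∀ l ∈ L, ∀ x, x + l ∈ D ↔ x ∈ D
  frontier_eq : frontier D = ⋃ i, Γ i
  isClosed_Γ : ∀ i, IsClosed (Γ i)
  Γ_smooth : ∀ i, Γ i ⊆ closure (smoothPart r (Γ i))
  Γ_periodic : ∀ i, ∀ l ∈ L, ∀ x, x + l ∈ Γ i ↔ x ∈ Γ i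

/-- The corner set `Γ^*`: the union of the boundaries of the boundary pieces. -/
def BilliardTable.corners {d r n : ℕ} {L : AddSubgroup (Config d)}
    (B : BilliardTable d r n L) : Set (Config d) :=
  ⋃ i, hypersurfaceBoundary r (B.Γ i)

/-! ### The billiard flow -/

/-- `v` is the inward unit normal to the boundary of `D` at `q`: near `q` the set `D` is
`{f ≥ 0}` with `f` of class `C^1`, `f q = 0` and `∇ f q = v`. -/
def IsInwardUnitNormal {d : ℕ} (D : Set (Config d)) (q v : Config d) : Prop :=
  ‖v‖ = 1 ∧ ∃ f : Config d → ℝ, ContDiffAt ℝ 1 f q ∧ f q = 0 ∧ HasGradientAt f v q ∧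
    ∀ᶠ x in 𝓝 q, (x ∈ D ↔ 0 ≤ f x)

/-- `γ = (q, p)`, restricted to `[0, T]`, is a billiard trajectory with finitely many
collisions connecting two inner points and avoiding the corners. Between the collisions it moves
freely; at a collision the momentum jumps according to the elastic reflection law. (The value of
the momentum at the very instant of a collision is immaterial.) -/
structure IsBilliardTrajectory {d r n : ℕ} {L : AddSubgroup (Config d)}
    (B : BilliardTable d r n L) (T : ℝ) (γ : ℝ → PhaseSpace d) : Prop where
  continuousOn : ContinuousOn (fun s => (γ s).1) (Icc 0 T)
  mem : ∀ s ∈ Icc 0 T, (γ s).1 ∈ B.D \ B.corners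
  start_inner : (γ 0).1 ∈ interior B.D
  end_inner : (γ T).1 ∈ interior B.D
  finite_collisions : {s | s ∈ Icc 0 T ∧ (γ s).1 ∈ frontier B.D}.Finite
  free : ∀ s ∈ Icc 0 T, (γ s).1 ∈ interior B.D →
    HasDerivWithinAt γ ((γ s).2, 0) (Icc 0 T) s
  reflection : ∀ s ∈ Ioo 0 T, (γ s).1 ∈ frontier B.D →
    ∃ v pin pout : Config d, IsInwardUnitNormal B.D (γ s).1 v ∧
      Tendsto (fun u => (γ u).2) (𝓝[<] s) (𝓝 pin) ∧
      Tendsto (fun u => (γ u).2) (𝓝[>] s) (𝓝 pout) ∧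
      pout = pin - (2 * inner ℝ pin v) • v

/-- No collision of `γ` on `[0, T]` is tangent to the boundary. -/
def NoTangency {d r n : ℕ} {L : AddSubgroup (Config d)}
    (B : BilliardTable d r n L) (T : ℝ) (γ : ℝ → PhaseSpace d) : Prop :=
  ∀ s ∈ Ioo 0 T, (γ s).1 ∈ frontier B.D → ∀ v pin : Config d,
    IsInwardUnitNormal B.D (γ s).1 v → Tendsto (fun u => (γ u).2) (𝓝[<] s) (𝓝 pin) →
    inner ℝ pin v ≠ 0

open Classical in
/-- The time `t` map `b_t` of the billiard flow (the identity where it is not defined). -/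
noncomputable def billiardFlow {d r n : ℕ} {L : AddSubgroup (Config d)}
    (B : BilliardTable d r n L) (t : ℝ) (ρ : PhaseSpace d) : PhaseSpace d :=
  if h : ∃ γ : ℝ → PhaseSpace d, γ 0 = ρ ∧ IsBilliardTrajectory B t γ then h.choose t else ρ

/-! ### The smooth Hamiltonian flow -/

/-- `γ = (q, p)` solves `q' = p`, `p' = -∇U(q)` on `[0, T]`, the equations of motion of the
Hamiltonian `p² / 2 + U(q)`. -/
def IsHamiltonianTrajectory {d : ℕ} (U : Config d → ℝ) (T : ℝ) (γ : ℝ → PhaseSpace d) : Prop :=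
  ∀ s ∈ Icc 0 T, HasDerivWithinAt γ ((γ s).2, -gradient U (γ s).1) (Icc 0 T) s

open Classical in
/-- The time `t` map of the Hamiltonian flow of `p² / 2 + U(q)` (the identity where the solution
does not exist up to time `t`). -/
noncomputable def hamiltonianFlow {d : ℕ} (U : Config d → ℝ) (t : ℝ) (ρ : PhaseSpace d) :
    PhaseSpace d :=
  if h : ∃ γ : ℝ → PhaseSpace d, γ 0 = ρ ∧ IsHamiltonianTrajectory U t γ then h.choose t else ρ

/-! ### Steep potentials -/

/-- A pattern function `Q(q; ε)`, `ε ≥ 0`, on an open neighbourhood `dom` of `D \ Γ^*`: it is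
`C^{r+1}` in `q` and depends continuously on `ε ≥ 0` in the `C^{r+1}` topology. -/
structure PatternFunction {d r n : ℕ} {L : AddSubgroup (Config d)}
    (B : BilliardTable d r n L) where
  /-- the domain of definition -/
  dom : Set (Config d)
  /-- the function; the first argument is `ε` -/
  Q : ℝ → Config d → ℝ
  isOpen_dom : IsOpen dom
  subset_dom : B.D \ B.corners ⊆ dom
  contDiffOn : ∀ ε, 0 ≤ ε → ContDiffOn ℝ (r + 1 : ℕ) (Q ε) dom
  continuous_param : ∀ ε₀, 0 ≤ ε₀ → ∀ K ⊆ dom, IsCompact K → ∀ k ≤ r + 1,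
    TendstoUniformlyOn (fun ε => iteratedFDeriv ℝ k (Q ε)) (iteratedFDeriv ℝ k (Q ε₀))
      (𝓝[Ici 0] ε₀) K
  dom_periodic : ∀ l ∈ L, ∀ x, x + l ∈ dom ↔ x ∈ dom
  Q_periodic : ∀ ε, 0 ≤ ε → ∀ l ∈ L, ∀ x ∈ dom, Q ε (x + l) = Q ε x

/-- Barrier functions: for every boundary piece `Γ i` the number `Q_i`, a neighbourhood `N_i` of
`Γ i` away from the corners, and the barrier function `W_i(x; ε)`, `ε > 0`, of the variable
`x = Q - Q_i`, smooth in the range `|x| < w_i`. -/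
structure BarrierFunctions {d r n : ℕ} {L : AddSubgroup (Config d)}
    {B : BilliardTable d r n L} (P : PatternFunction B) where
  /-- the constants `Q_i` -/
  level : Fin n → ℝ
  /-- the neighbourhoods `N_i` -/
  N : Fin n → Set (Config d)
  /-- the half-width of the range of values of `Q - Q_i` -/
  w : Fin n → ℝ
  /-- the barrier functions; the second argument is `ε` -/
  W : Fin n → ℝ → ℝ → ℝ
  isOpen_N : ∀ i, IsOpen (N i)
  N_subset : ∀ i, N i ⊆ P.dom
  Γ_subset : ∀ i, B.Γ i \ B.corners ⊆ N i
  N_periodic : ∀ i, ∀ l ∈ L, ∀ x, x + l ∈ N i ↔ x ∈ N i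
  w_pos : ∀ i, 0 < w i
  contDiffOn_W : ∀ i ε, 0 < ε → ContDiffOn ℝ (r + 1 : ℕ) (W i ε) (Ioo (-w i) (w i))

section Conditions

variable {d r n : ℕ} {L : AddSubgroup (Config d)}

/-- Condition I: on compact subsets of the interior of `D` the potential tends to zero in
`C^{r+1}`. -/
def ConditionI (B : BilliardTable d r n L) (V : ℝ → Config d → ℝ) : Prop :=
  ∀ K ⊆ interior B.D, IsCompact K → ∀ k ≤ r + 1,
    TendstoUniformlyOn (fun ε => iteratedFDeriv ℝ k (V ε)) 0 (𝓝[>] 0) K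

/-- Condition IIa: the boundary pieces lie on level sets of `Q(·; 0)`. -/
def ConditionIIa {B : BilliardTable d r n L} {P : PatternFunction B}
    (A : BarrierFunctions P) : Prop :=
  ∀ i, ∀ q ∈ B.Γ i \ B.corners, P.Q 0 q = A.level i

/-- Condition IIb: `V(q; ε) = W_i(Q(q; ε) - Q_i; ε)` near `Γ_i`. -/
def ConditionIIb {B : BilliardTable d r n L} {P : PatternFunction B}
    (A : BarrierFunctions P) (V : ℝ → Config d → ℝ) : Prop :=
  ∀ i ε, 0 < ε → ∀ q ∈ A.N i, V ε q = A.W i ε (P.Q ε q - A.level i)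

/-- Condition IIc: near `Γ_i` neither `∇Q` nor `W_i'` vanishes. -/
def ConditionIIc {B : BilliardTable d r n L} {P : PatternFunction B}
    (A : BarrierFunctions P) : Prop :=
  (∀ i ε, 0 ≤ ε → ∀ q ∈ A.N i, fderiv ℝ (P.Q ε) q ≠ 0) ∧
  (∀ i ε, 0 < ε → ∀ x ∈ Ioo (-A.w i) (A.w i), deriv (A.W i ε) x ≠ 0)

/-- Condition III: as `ε → +0` the barrier function tends to `0` at the values of `Q(·; 0)`
inside `D`, and to `𝓔` at the values outside `D`. -/
def ConditionIII {B : BilliardTable d r n L} {P : PatternFunction B}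
    (A : BarrierFunctions P) (𝓔 : EReal) : Prop :=
  ∀ i,
    (∀ q ∈ A.N i ∩ interior B.D,
      Tendsto (fun ε => A.W i ε (P.Q 0 q - A.level i)) (𝓝[>] 0) (𝓝 0)) ∧
    (∀ q ∈ A.N i \ B.D,
      Tendsto (fun ε => (A.W i ε (P.Q 0 q - A.level i) : EReal)) (𝓝[>] 0) (𝓝 𝓔))

/-- The inverse barrier function `𝒬_i(·; ε)`: the inverse of `W_i(·; ε)` on `|x| < w_i`. -/
noncomputable def BarrierFunctions.inverse {B : BilliardTable d r n L} {P : PatternFunction B}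
    (A : BarrierFunctions P) (i : Fin n) (ε : ℝ) : ℝ → ℝ :=
  Function.invFunOn (A.W i ε) (Ioo (-A.w i) (A.w i))

/-- Condition IV: `𝒬_i(·; ε) → 0` as `ε → +0`, uniformly on `[W₁, W₂]` along with its `r + 1`
derivatives, whenever `0 < W₁ < W₂ < 𝓔`. -/
def ConditionIV {B : BilliardTable d r n L} {P : PatternFunction B}
    (A : BarrierFunctions P) (𝓔 : EReal) : Prop :=
  ∀ i, ∀ W₁ W₂ : ℝ, 0 < W₁ → W₁ < W₂ → (W₂ : EReal) < 𝓔 → ∀ k ≤ r + 1,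
    TendstoUniformlyOn (fun ε => iteratedDeriv k (A.inverse i ε)) 0 (𝓝[>] 0) (Icc W₁ W₂)

end Conditions

/-! Fix a sequence ε_n → 0 and index everything by `OnePoint ℕ`: n stands for the potential at ε_n,
and ∞ for the billiard. A family of maps whose derivatives of order at most r are jointly continuous
in (κ, x) near (∞, x₀) (`ContDiffFamAt`) encodes C^r convergence to the member at ∞, and such
families can be composed. It is therefore enough to cut the motion near the given trajectory into
finitely many pieces and to find for each piece a family whose members at n follow the Hamiltonian
flow and whose member at ∞ follows the billiard flow (`FamilyLink`, `TimedArc`). Time is carried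
along as a coordinate, so that a piece may last differently long for different initial points and
different κ.

Free flights are harmless, since by Condition I the force tends to 0. A collision is treated in two
regimes. Write g for the defining function of the wall, so that the potential is w_n(g).

Deep in the boundary layer, where the potential lies in a compact subinterval of (0, 𝓔), its height
v serves as a coordinate in place of the distance to the wall: g = χ(v) with χ the inverse barrier.
After a change of time the equations contain only χ', which tends to 0 together with its derivatives
by Condition IV. In the limit position and time stand still, while the momentum moves along ∇g with
‖p‖²/2 + v conserved (`exists_kick_family`).

At the edge of the layer, where the height rises from almost 0 to a fixed w₀, neither w_n nor its
inverse is controlled in C^r. There the graph of w_n is parametrized by σ, the sum of the horizontal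
and the vertical displacement. The horizontal speed a lies in [-1, 0) and the vertical speed is 1 +
a. Monotonicity and the pointwise limits in Condition III force a → -1 for σ < c and a → 0 for σ > c
in L¹ (`SteepBarrier.exists_layer_curve`). In this parameter Hamilton's equations read z' = ∑ a_j(σ)
F_j(z) with F_j convergent in C^r: the singular behaviour sits entirely in scalar densities which do
not depend on z. Convergence of the densities in L¹ then suffices for convergence of the solutions
in C^r (`exists_flow_family`).

This last fact is the inverse function theorem in the Banach space C(`OnePoint ℕ` × [0, S], E),
which treats all parameter values at once. Superposition operators are C^r there, and the linearized
equation is the identity minus a Volterra operator, hence invertible. A C^r map into continuous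
functions of κ is, after evaluation, a family in the above sense.

A collision is the composition of an approach to g = c, a passage of the edge, a kick beyond the
turning point, a kick down to the old height, and the passage of the edge backwards
(`CollisionChart.collision_link`). In the limit the momentum changes along the normal only, the
energy is restored and the normal component changes sign; this forces the reflection law
(`eq_reflection`). Transversality keeps the normal velocity, by which the edge equations are
divided, away from 0; the energy bound keeps the limiting heights below 𝓔. The relations are checked
for all nearby points, also at κ = ∞, so that smoothness of the billiard flow comes out at the same
time.

A continuation argument along the trajectory composes the pieces. Uniqueness of both motions
identifies the families with the two flow maps, and an argument by contradiction with compactness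
passes from sequences to uniform convergence. -/

set_option linter.unusedSectionVars false

/-! ### Continuous families of `C^r` maps -/

section Families

universe u v

variable {K : Type v} [TopologicalSpace K]
  {E : Type u} [NormedAddCommGroup E] [NormedSpace ℝ E]
  {G : Type u} [NormedAddCommGroup G] [NormedSpace ℝ G]
  {G' : Type u} [NormedAddCommGroup G'] [NormedSpace ℝ G']
  {G'' : Type u} [NormedAddCommGroup G''] [NormedSpace ℝ G'']

/-- Near `y = (κ, x)` the maps `F κ'` are of class `C^r`, and their derivatives of order at most
`r` are jointly continuous in the parameter and the point. -/
def ContDiffFamAt (r : ℕ) (F : K → E → G) (y : K × E) : Prop :=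
  ∀ᶠ z in 𝓝 y, ContDiffAt ℝ r (F z.1) z.2 ∧
    ∀ k ≤ r, ContinuousAt (fun w : K × E => iteratedFDeriv ℝ k (F w.1) w.2) z

namespace ContDiffFamAt

variable {r : ℕ} {F : K → E → G} {y : K × E}

theorem eventually (h : ContDiffFamAt r F y) : ∀ᶠ z in 𝓝 y, ContDiffFamAt r F z :=
  eventually_eventually_nhds.2 h

theorem mono {m : ℕ} (h : ContDiffFamAt r F y) (hm : m ≤ r) : ContDiffFamAt m F y := by
  filter_upwards [h] with z hz
  exact ⟨hz.1.of_le (by exact_mod_cast hm), fun k hk => hz.2 k (hk.trans hm)⟩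

theorem contDiffAt (h : ContDiffFamAt r F y) : ContDiffAt ℝ r (F y.1) y.2 := h.self_of_nhds.1

/-- Derivatives are taken in x for fixed κ. An equality that holds near a point of the product gives
equality of germs in x on each slice, which is what the derivatives see. -/
theorem congr {F' : K → E → G} (h : ContDiffFamAt r F y)
    (hF : ∀ᶠ z in 𝓝 y, F z.1 z.2 = F' z.1 z.2) : ContDiffFamAt r F' y := by
  have h2 : ∀ᶠ z in 𝓝 y, F z.1 =ᶠ[𝓝 z.2] F' z.1 := by
    filter_upwards [eventually_eventually_nhds.2 hF] with z hz
    rw [← Prod.mk.eta (p := z), nhds_prod_eq] at hz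
    exact hz.curry.self_of_nhds
  filter_upwards [h, eventually_eventually_nhds.2 h2] with z hz hz2
  refine ⟨hz.1.congr_of_eventuallyEq hz2.self_of_nhds.symm, fun k hk => ?_⟩
  refine (hz.2 k hk).congr ?_
  filter_upwards [hz2] with w hw
  exact (hw.iteratedFDeriv ℝ k).self_of_nhds

theorem eventually_continuousAt (h : ContDiffFamAt r F y) :
    ∀ᶠ z in 𝓝 y, ContinuousAt (fun w : K × E => F w.1 w.2) z := by
  filter_upwards [h] with z hz
  have := hz.2 0 (Nat.zero_le _)
  simp only [iteratedFDeriv_zero_eq_comp, Function.comp_def] at this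
  have h2 := (continuousMultilinearCurryFin0 ℝ E G).continuous.continuousAt.comp this
  simpa [Function.comp_def] using h2

theorem continuousAt (h : ContDiffFamAt r F y) :
    ContinuousAt (fun w : K × E => F w.1 w.2) y := h.eventually_continuousAt.self_of_nhds

theorem zero_iff :
    ContDiffFamAt 0 F y ↔ ∀ᶠ z in 𝓝 y, ContinuousAt (fun w : K × E => F w.1 w.2) z := by
  refine ⟨fun h => h.eventually_continuousAt, fun h => ?_⟩
  filter_upwards [eventually_eventually_nhds.2 h] with z hz
  constructor
  · rw [Nat.cast_zero, contDiffAt_zero]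
    rw [← Prod.mk.eta (p := z), nhds_prod_eq] at hz
    have h3 := hz.curry.self_of_nhds
    refine ⟨_, h3, fun x hx => ?_⟩
    have : ContinuousAt (fun w : K × E => F w.1 w.2) (z.1, x) := hx
    exact (this.comp (f := fun x => (z.1, x)) (by fun_prop)).continuousWithinAt
  · intro k hk
    obtain rfl : k = 0 := by omega
    simp only [iteratedFDeriv_zero_eq_comp, Function.comp_def]
    exact (continuousMultilinearCurryFin0 ℝ E G).symm.continuous.continuousAt.comp
      hz.self_of_nhds

/-- The form in which the notion is used: all closure properties below follow by induction on r,
with the target space varying because the derivative takes values in linear maps. -/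
theorem succ_iff :
    ContDiffFamAt (r + 1) F y ↔
      (∀ᶠ z in 𝓝 y, ContinuousAt (fun w : K × E => F w.1 w.2) z) ∧
      (∀ᶠ z in 𝓝 y, DifferentiableAt ℝ (F z.1) z.2) ∧
      ContDiffFamAt r (fun κ => fderiv ℝ (F κ)) y := by
  constructor
  · intro h
    refine ⟨h.eventually_continuousAt, ?_, ?_⟩
    · filter_upwards [h] with z hz
      exact hz.1.differentiableAt (by simp)
    · filter_upwards [h] with z hz
      refine ⟨hz.1.fderiv_right (by simp), fun k hk => ?_⟩
      have := hz.2 (k + 1) (by omega)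
      simp only [iteratedFDeriv_succ_eq_comp_right, Function.comp_def] at this
      have h2 := (continuousMultilinearCurryRightEquiv' ℝ k E G).continuous.continuousAt.comp this
      simpa [Function.comp_def] using h2
  · rintro ⟨h0, h1, h2⟩
    filter_upwards [eventually_eventually_nhds.2 h0, eventually_eventually_nhds.2 h1, h2]
      with z hz0 hz1 hz2
    constructor
    · push_cast
      rw [contDiffAt_succ_iff_hasFDerivAt]
      refine ⟨fderiv ℝ (F z.1), ?_, hz2.1⟩
      rw [← Prod.mk.eta (p := z), nhds_prod_eq] at hz1
      have h3 := hz1.curry.self_of_nhds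
      exact ⟨_, h3, fun x hx => DifferentiableAt.hasFDerivAt hx⟩
    · intro k hk
      rcases k with _ | k
      · simp only [iteratedFDeriv_zero_eq_comp, Function.comp_def]
        exact (continuousMultilinearCurryFin0 ℝ E G).symm.continuous.continuousAt.comp
          hz0.self_of_nhds
      · simp only [iteratedFDeriv_succ_eq_comp_right, Function.comp_def]
        exact (continuousMultilinearCurryRightEquiv' ℝ k E G).symm.continuous.continuousAt.comp
          (hz2.2 k (by omega))

theorem fderiv_family (h : ContDiffFamAt (r + 1) F y) :
    ContDiffFamAt r (fun κ => fderiv ℝ (F κ)) y := (succ_iff.1 h).2.2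

theorem eventually_differentiableAt (h : ContDiffFamAt (r + 1) F y) :
    ∀ᶠ z in 𝓝 y, DifferentiableAt ℝ (F z.1) z.2 := (succ_iff.1 h).2.1

theorem of_contDiffAt {f : E → G} {x : E} (h : ContDiffAt ℝ r f x) (κ : K) :
    ContDiffFamAt r (fun _ => f) (κ, x) := by
  have h1 : ∀ᶠ z in 𝓝 (κ, x), ContDiffAt ℝ r f z.2 :=
    (continuous_snd.tendsto (κ, x)).eventually (h.eventually (by simp))
  filter_upwards [h1] with z hz
  refine ⟨hz, fun k hk => ?_⟩
  exact (hz.continuousAt_iteratedFDeriv (by exact_mod_cast hk)).comp continuousAt_snd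

theorem comp_param {K' : Type*} [TopologicalSpace K'] {φ : K' → K} (hφ : Continuous φ)
    {κ : K'} {x : E} (h : ContDiffFamAt r F (φ κ, x)) :
    ContDiffFamAt r (fun κ' => F (φ κ')) (κ, x) := by
  have hc : Continuous (fun z : K' × E => (φ z.1, z.2)) := by fun_prop
  filter_upwards [(hc.tendsto (κ, x)).eventually h] with z hz
  exact ⟨hz.1, fun k hk => ContinuousAt.comp (f := fun z : K' × E => (φ z.1, z.2))
    (g := fun w : K × E => iteratedFDeriv ℝ k (F w.1) w.2) (hz.2 k hk) hc.continuousAt⟩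

theorem clm_comp (h : ContDiffFamAt r F y) (L : G →L[ℝ] G') :
    ContDiffFamAt r (fun κ x => L (F κ x)) y := by
  filter_upwards [eventually_eventually_nhds.2 h] with z hz
  refine ⟨L.contDiff.contDiffAt.comp _ hz.self_of_nhds.1, fun k hk => ?_⟩
  have h2 : ContinuousAt (fun w : K × E =>
      L.compContinuousMultilinearMap (iteratedFDeriv ℝ k (F w.1) w.2)) z :=
    (ContinuousLinearMap.compContinuousMultilinearMapL ℝ (fun _ : Fin k => E) G G' L).continuous
      |>.continuousAt.comp (hz.self_of_nhds.2 k hk)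
  refine h2.congr ?_
  filter_upwards [hz] with w hw
  exact (L.iteratedFDeriv_comp_left hw.1 (by exact_mod_cast hk)).symm

theorem prodMk {F' : K → E → G'} (h : ContDiffFamAt r F y) (h' : ContDiffFamAt r F' y) :
    ContDiffFamAt r (fun κ x => (F κ x, F' κ x)) y := by
  induction r generalizing G G' with
  | zero =>
    rw [zero_iff] at *
    filter_upwards [h, h'] with z hz hz'
    exact hz.prodMk hz'
  | succ r ih =>
    have H := succ_iff.1 h
    have H' := succ_iff.1 h'
    refine succ_iff.2 ⟨?_, ?_, ?_⟩
    · filter_upwards [H.1, H'.1] with z hz hz'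
      exact hz.prodMk hz'
    · filter_upwards [H.2.1, H'.2.1] with z hz hz'
      exact hz.prodMk hz'
    · refine ((ih H.2.2 H'.2.2).clm_comp
        (ContinuousLinearMap.prodL ℝ (E := E) (F := G) (G := G')).toContinuousLinearMap).congr ?_
      filter_upwards [H.2.1, H'.2.1] with z hz hz'
      rw [DifferentiableAt.fderiv_prodMk hz hz']
      rfl

theorem add {F' : K → E → G} (h : ContDiffFamAt r F y) (h' : ContDiffFamAt r F' y) :
    ContDiffFamAt r (fun κ x => F κ x + F' κ x) y :=
  (h.prodMk h').clm_comp (ContinuousLinearMap.fst ℝ G G + ContinuousLinearMap.snd ℝ G G)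

theorem neg (h : ContDiffFamAt r F y) : ContDiffFamAt r (fun κ x => -F κ x) y :=
  h.clm_comp (-ContinuousLinearMap.id ℝ G)

theorem sub {F' : K → E → G} (h : ContDiffFamAt r F y) (h' : ContDiffFamAt r F' y) :
    ContDiffFamAt r (fun κ x => F κ x - F' κ x) y := by
  simpa only [sub_eq_add_neg] using h.add h'.neg

/-- By the Leibniz rule the derivative is a sum of two bilinear expressions of order r, so the
induction runs over all bilinear maps and spaces at once. -/
theorem bilin {F' : K → E → G'} (B : G →L[ℝ] G' →L[ℝ] G'') (h : ContDiffFamAt r F y)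
    (h' : ContDiffFamAt r F' y) : ContDiffFamAt r (fun κ x => B (F κ x) (F' κ x)) y := by
  have hc : ∀ z, ContinuousAt (fun w : K × E => F w.1 w.2) z →
      ContinuousAt (fun w : K × E => F' w.1 w.2) z →
      ContinuousAt (fun w : K × E => B (F w.1 w.2) (F' w.1 w.2)) z := fun z hz hz' =>
    (B.continuous.continuousAt.comp hz).clm_apply hz'
  induction r generalizing G G' G'' with
  | zero =>
    rw [zero_iff] at *
    filter_upwards [h, h'] with z hz hz'
    exact hc z hz hz'
  | succ r ih =>
    have H := succ_iff.1 h
    have H' := succ_iff.1 h'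
    refine succ_iff.2 ⟨?_, ?_, ?_⟩
    · filter_upwards [H.1, H'.1] with z hz hz'
      exact hc z hz hz'
    · filter_upwards [H.2.1, H'.2.1] with z hz hz'
      exact (B.hasFDerivAt_of_bilinear hz.hasFDerivAt hz'.hasFDerivAt).differentiableAt
    · have A1 := ih (ContinuousLinearMap.precompR E B) (h.mono (Nat.le_succ r)) H'.2.2
        (fun z hz hz' => by
          exact ((ContinuousLinearMap.precompR E B).continuous.continuousAt.comp hz).clm_apply hz')
      have A2 := ih (ContinuousLinearMap.precompL E B) H.2.2 (h'.mono (Nat.le_succ r))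
        (fun z hz hz' => by
          exact ((ContinuousLinearMap.precompL E B).continuous.continuousAt.comp hz).clm_apply hz')
      refine (A1.add A2).congr ?_
      filter_upwards [H.2.1, H'.2.1] with z hz hz'
      exact (B.fderiv_of_bilinear hz hz').symm

/-- By the chain rule the derivative is the bilinear composition of a family of the same kind, one
order lower, with the derivative of the inner family. This lemma allows the flow to be treated piece
by piece. -/
theorem comp {F' : K → G → G'} (h' : ContDiffFamAt r F' (y.1, F y.1 y.2))
    (h : ContDiffFamAt r F y) : ContDiffFamAt r (fun κ x => F' κ (F κ x)) y := by
  have ht : Tendsto (fun w : K × E => (w.1, F w.1 w.2)) (𝓝 y) (𝓝 (y.1, F y.1 y.2)) :=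
    (continuousAt_fst.prodMk h.continuousAt)
  induction r generalizing G' with
  | zero =>
    rw [zero_iff] at *
    filter_upwards [h, ht.eventually h'] with z hz hz'
    exact ContinuousAt.comp (f := fun w : K × E => (w.1, F w.1 w.2))
      (g := fun w : K × G => F' w.1 w.2) hz' (continuousAt_fst.prodMk hz)
  | succ r ih =>
    have H := succ_iff.1 h
    have H' := succ_iff.1 h'
    refine succ_iff.2 ⟨?_, ?_, ?_⟩
    · filter_upwards [H.1, ht.eventually H'.1] with z hz hz'
      exact ContinuousAt.comp (f := fun w : K × E => (w.1, F w.1 w.2))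
        (g := fun w : K × G => F' w.1 w.2) hz' (continuousAt_fst.prodMk hz)
    · filter_upwards [H.2.1, ht.eventually H'.2.1] with z hz hz'
      exact hz'.comp z.2 hz
    · have A := ih H'.2.2 (h.mono (Nat.le_succ r))
      refine (bilin (ContinuousLinearMap.compL ℝ E G G') A H.2.2).congr ?_
      filter_upwards [H.2.1, ht.eventually H'.2.1] with z hz hz'
      exact (fderiv_comp z.2 hz' hz).symm

theorem comp_contDiffAt {f : G → G'} (hf : ContDiffAt ℝ r f (F y.1 y.2))
    (h : ContDiffFamAt r F y) : ContDiffFamAt r (fun κ x => f (F κ x)) y :=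
  comp (of_contDiffAt hf y.1) h

/-- Part of the variables of a family may be considered as parameters. -/
theorem partial_snd {P : Type u} [NormedAddCommGroup P] [NormedSpace ℝ P] {F : K → P × E → G}
    {κ : K} {t : P} {x : E} (h : ContDiffFamAt r F (κ, (t, x))) :
    ContDiffFamAt r (fun (κ : K × P) x => F κ.1 (κ.2, x)) ((κ, t), x) := by
  have ht : Tendsto (fun z : (K × P) × E => (z.1.1, (z.1.2, z.2))) (𝓝 ((κ, t), x))
      (𝓝 (κ, (t, x))) := Continuous.tendsto (by fun_prop) _
  have hc : ∀ z : (K × P) × E,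
      ContinuousAt (fun w : K × P × E => F w.1 w.2) (z.1.1, (z.1.2, z.2)) →
      ContinuousAt (fun w : (K × P) × E => F w.1.1 (w.1.2, w.2)) z := fun z hz =>
    ContinuousAt.comp (f := fun z : (K × P) × E => (z.1.1, (z.1.2, z.2)))
      (g := fun w : K × P × E => F w.1 w.2) hz (by fun_prop)
  induction r generalizing G with
  | zero =>
    rw [zero_iff] at *
    filter_upwards [ht.eventually h] with z hz
    exact hc z hz
  | succ r ih =>
    have H := succ_iff.1 h
    refine succ_iff.2 ⟨?_, ?_, ?_⟩
    · filter_upwards [ht.eventually H.1] with z hz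
      exact hc z hz
    · filter_upwards [ht.eventually H.2.1] with z hz
      exact hz.comp (f := fun x => (z.1.2, x)) z.2 (by fun_prop)
    · have A := ih H.2.2 (fun z hz => ContinuousAt.comp
        (f := fun z : (K × P) × E => (z.1.1, (z.1.2, z.2)))
        (g := fun w : K × P × E => fderiv ℝ (F w.1) w.2) hz (by fun_prop))
      refine (A.clm_comp ((ContinuousLinearMap.compL ℝ E (P × E) G).flip
        (ContinuousLinearMap.inr ℝ P E))).congr ?_
      filter_upwards [ht.eventually H.2.1] with z hz
      have h1 : HasFDerivAt (fun x : E => (z.1.2, x)) (ContinuousLinearMap.inr ℝ P E) z.2 :=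
        (hasFDerivAt_const z.1.2 z.2).prodMk (hasFDerivAt_id z.2)
      exact (HasFDerivAt.comp (f := fun x : E => (z.1.2, x)) z.2 hz.hasFDerivAt h1).fderiv.symm

end ContDiffFamAt

/-- Linear maps into a space of continuous functions are continuous functions with values in
linear maps, if their domain is finite dimensional. -/
noncomputable def ContinuousMap.ofCLM [CompactSpace K] [FiniteDimensional ℝ E] :
    (E →L[ℝ] C(K, G)) →L[ℝ] C(K, E →L[ℝ] G) :=
  LinearMap.mkContinuous (σ := RingHom.id ℝ) (E := E →L[ℝ] C(K, G)) (F := C(K, E →L[ℝ] G))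
    { toFun := fun A => ⟨fun κ => (ContinuousMap.evalCLM ℝ κ).comp A, by
        -- Finite dimension of `E` enters here: norm continuity of a family of linear maps is
        -- continuity at each vector.
        rw [continuous_clm_apply]
        intro e
        exact (A e).continuous⟩
      map_add' := fun A A' => by ext; simp
      map_smul' := fun c A => by ext; simp } 1 (fun A => by
    rw [one_mul, ContinuousMap.norm_le _ (norm_nonneg _)]
    intro κ
    refine ContinuousLinearMap.opNorm_le_bound _ (norm_nonneg _) fun e => ?_
    exact ((A e).norm_coe_le_norm κ).trans (A.le_opNorm e))

/-- The way back from the Banach space of continuous functions of κ to families. In the induction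
the derivative is read, by `ContinuousMap.ofCLM`, as a map into continuous functions with values in
linear maps. -/
theorem ContDiffFamAt.of_contDiffAt_continuousMap [CompactSpace K] [FiniteDimensional ℝ E]
    {r : ℕ} {s : E → C(K, G)} {x : E} (h : ContDiffAt ℝ r s x) (κ : K) :
    ContDiffFamAt r (fun κ x => s x κ) (κ, x) := by
  have ht : Tendsto (fun z : K × E => z.2) (𝓝 (κ, x)) (𝓝 x) := continuous_snd.tendsto _
  have hcont : ∀ᶠ z in 𝓝 (κ, x), ContinuousAt (fun w : K × E => s w.2 w.1) z := by
    filter_upwards [ht.eventually (h.eventually (by simp))] with z hz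
    have h1 : ContinuousAt (fun w : K × E => (s w.2, w.1)) z :=
      (hz.continuousAt.comp continuousAt_snd).prodMk continuousAt_fst
    exact ContinuousAt.comp (f := fun w : K × E => (s w.2, w.1))
      (g := fun w : C(K, G) × K => w.1 w.2) (by fun_prop) h1
  induction r generalizing G with
  | zero => exact ContDiffFamAt.zero_iff.2 hcont
  | succ r ih =>
    have hd : ∀ᶠ z in 𝓝 (κ, x), DifferentiableAt ℝ s z.2 := by
      filter_upwards [ht.eventually (h.eventually (by simp))] with z hz
      exact hz.differentiableAt (by simp)
    have hL : ContDiff ℝ r (fun A : E →L[ℝ] C(K, G) => ContinuousMap.ofCLM A) :=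
      ContinuousLinearMap.contDiff (𝕜 := ℝ) (n := r) (E := E →L[ℝ] C(K, G))
        (F := C(K, E →L[ℝ] G)) (ContinuousMap.ofCLM (K := K) (E := E) (G := G))
    have h1 : ContDiffAt ℝ r (fun x => ContinuousMap.ofCLM (fderiv ℝ s x)) x :=
      hL.contDiffAt.comp x (h.fderiv_right (m := r) (by simp))
    refine ContDiffFamAt.succ_iff.2 ⟨hcont, ?_, ?_⟩
    · filter_upwards [hd] with z hz
      exact (ContinuousMap.evalCLM ℝ z.1).differentiableAt.comp z.2 hz
    · refine (ih h1 ?_).congr ?_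
      · filter_upwards [ht.eventually (h1.eventually (by simp))] with z hz
        have h2 : ContinuousAt (fun w : K × E => (ContinuousMap.ofCLM (fderiv ℝ s w.2), w.1)) z :=
          ((hz.continuousAt (x := z.2)).comp continuousAt_snd).prodMk continuousAt_fst
        exact ContinuousAt.comp (f := fun w : K × E => (ContinuousMap.ofCLM (fderiv ℝ s w.2), w.1))
          (g := fun w : C(K, E →L[ℝ] G) × K => w.1 w.2) (by fun_prop) h2
      · filter_upwards [hd] with z hz
        have := ((ContinuousMap.evalCLM ℝ z.1 (M := G)).hasFDerivAt.comp z.2 hz.hasFDerivAt).fderiv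
        exact this.symm

end Families

/-! ### Superposition operators on spaces of continuous functions -/

section Superposition

universe u v

variable {K : Type v} [TopologicalSpace K] [CompactSpace K]
  {E : Type u} [NormedAddCommGroup E] [NormedSpace ℝ E]
  {G : Type u} [NormedAddCommGroup G] [NormedSpace ℝ G]

open Classical in
/-- The superposition operator `z ↦ (κ ↦ F κ (z κ))` (zero where the right-hand side is not
continuous). -/
noncomputable def superposition (F : K → E → G) (z : C(K, E)) : C(K, G) :=
  if h : Continuous (fun κ => F κ (z κ)) then ⟨_, h⟩ else 0

theorem superposition_apply {F : K → E → G} {z : C(K, E)}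
    (h : ∀ κ, ContinuousAt (fun w : K × E => F w.1 w.2) (κ, z κ)) (κ : K) :
    superposition F z κ = F κ (z κ) := by
  have hc : Continuous (fun κ => F κ (z κ)) := continuous_iff_continuousAt.2 fun κ =>
    ContinuousAt.comp (f := fun κ => (κ, z κ)) (g := fun w : K × E => F w.1 w.2) (h κ)
      (by fun_prop)
  simp [superposition, hc]

/-- The pointwise application of a continuous function with values in linear maps. -/
noncomputable def ContinuousMap.applyCLM :
    C(K, E →L[ℝ] G) →L[ℝ] C(K, E) →L[ℝ] C(K, G) :=
  LinearMap.mkContinuous₂ (σ₁₃ := RingHom.id ℝ) (σ₂₃ := RingHom.id ℝ) (E := C(K, E →L[ℝ] G))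
    (F := C(K, E)) (G := C(K, G))
    (LinearMap.mk₂ ℝ (fun A f => ⟨fun κ => A κ (f κ), by fun_prop⟩)
      (fun A A' f => by ext; simp) (fun c A f => by ext; simp)
      (fun A f f' => by ext; simp) (fun c A f => by ext; simp)) 1 (fun A f => by
    rw [one_mul, ContinuousMap.norm_le _ (by positivity)]
    intro κ
    exact ((A κ).le_opNorm _).trans (mul_le_mul (A.norm_coe_le_norm κ) (f.norm_coe_le_norm κ)
      (norm_nonneg _) (norm_nonneg A)))

@[simp]
theorem ContinuousMap.applyCLM_apply (A : C(K, E →L[ℝ] G)) (f : C(K, E)) (κ : K) :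
    ContinuousMap.applyCLM A f κ = A κ (f κ) := rfl

/-- Compactness of `K` together with continuity of evaluation: local conditions along the graph of
`z₀` hold along the graphs of all uniformly close functions. -/
theorem ContinuousMap.eventually_forall {z₀ : C(K, E)} {P : K × E → Prop}
    (h : ∀ κ, ∀ᶠ y in 𝓝 (κ, z₀ κ), P y) : ∀ᶠ z in 𝓝 z₀, ∀ κ, P (κ, z κ) := by
  have := isCompact_univ (X := K).eventually_forall_of_forall_eventually (x₀ := z₀)
    (P := fun z κ => P (κ, z κ)) (fun κ _ => by
      have hc : ContinuousAt (fun p : C(K, E) × K => (p.2, p.1 p.2)) (z₀, κ) := by fun_prop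
      exact hc.eventually (h κ))
  filter_upwards [this] with z hz κ using hz κ trivial

theorem continuousAt_superposition {F : K → E → G} {z₀ : C(K, E)}
    (h : ∀ κ, ∀ᶠ y in 𝓝 (κ, z₀ κ), ContinuousAt (fun w : K × E => F w.1 w.2) y) :
    ContinuousAt (superposition F) z₀ := by
  rw [Metric.continuousAt_iff']
  intro ε hε
  have h1 : ∀ κ, ∀ᶠ y in 𝓝 (κ, z₀ κ), dist (F y.1 y.2) (F y.1 (z₀ y.1)) < ε / 2 := by
    intro κ
    have hc := (h κ).self_of_nhds
    have hc' : ContinuousAt (fun w : K × E => F w.1 (z₀ w.1)) (κ, z₀ κ) :=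
      ContinuousAt.comp (f := fun w : K × E => (w.1, z₀ w.1)) (g := fun w : K × E => F w.1 w.2)
        hc (by fun_prop)
    have := hc.dist hc'
    simp only [dist_self] at this
    exact this.eventually_lt_const (by positivity)
  filter_upwards [ContinuousMap.eventually_forall h1, ContinuousMap.eventually_forall h]
    with z hz hz'
  refine lt_of_le_of_lt ?_ (half_lt_self hε)
  rw [ContinuousMap.dist_le (by positivity)]
  intro κ
  rw [superposition_apply (fun κ => (hz' κ)),
    superposition_apply (fun κ => (h κ).self_of_nhds)]
  exact (hz κ).le

/-- The mean value inequality on a small ball, applied for each fixed parameter. Joint continuity of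
the derivative makes the estimate uniform in the parameter, which is what differentiability of the
superposition operator in the sup norm needs. -/
theorem eventually_norm_sub_sub_le {F : K → E → G} {F' : K → E → E →L[ℝ] G} {κ : K} {x₀ : E}
    (hd : ∀ᶠ y in 𝓝 (κ, x₀), HasFDerivAt (F y.1) (F' y.1 y.2) y.2)
    (hc : ContinuousAt (fun w : K × E => F' w.1 w.2) (κ, x₀)) {ε : ℝ} (hε : 0 < ε) :
    ∀ᶠ w : K × E × E in 𝓝 (κ, x₀, x₀),
      ‖F w.1 w.2.1 - F w.1 w.2.2 - F' w.1 w.2.2 (w.2.1 - w.2.2)‖ ≤ ε * ‖w.2.1 - w.2.2‖ := by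
  have h1 : ∀ᶠ y in 𝓝 (κ, x₀), dist (F' y.1 y.2) (F' κ x₀) < ε / 2 :=
    Metric.continuousAt_iff'.1 hc _ (by positivity)
  have h2 := hd.and h1
  rw [nhds_prod_eq, eventually_prod_iff] at h2
  obtain ⟨p, hp, q, hq, hpq⟩ := h2
  obtain ⟨δ, hδ, hball⟩ := Metric.eventually_nhds_iff_ball.1 hq
  have h3 : ∀ᶠ w : K × E × E in 𝓝 (κ, x₀, x₀), p w.1 ∧ w.2.1 ∈ Metric.ball x₀ δ ∧
      w.2.2 ∈ Metric.ball x₀ δ := by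
    have hb : ∀ᶠ x in 𝓝 x₀, x ∈ Metric.ball x₀ δ := Metric.ball_mem_nhds x₀ hδ
    rw [nhds_prod_eq, nhds_prod_eq]
    exact hp.prod_mk (hb.prod_mk hb)
  filter_upwards [h3] with w ⟨hw1, hw2, hw3⟩
  refine Convex.norm_image_sub_le_of_norm_hasFDerivWithin_le' (f' := fun x => F' w.1 x)
    (s := Metric.ball x₀ δ) (fun x hx => (hpq hw1 (hball x hx)).1.hasFDerivWithinAt)
    (fun x hx => ?_) (convex_ball _ _) hw3 hw2
  have a := (hpq hw1 (hball x hx)).2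
  have b := (hpq hw1 (hball _ hw3)).2
  rw [← dist_eq_norm]
  calc dist (F' w.1 x) (F' w.1 w.2.2) ≤ dist (F' w.1 x) (F' κ x₀) +
        dist (F' w.1 w.2.2) (F' κ x₀) := dist_triangle_right _ _ _
    _ ≤ ε := by simp only at a b; linarith

theorem hasFDerivAt_superposition {F : K → E → G} {z₀ : C(K, E)}
    (h : ∀ κ, ContDiffFamAt 1 F (κ, z₀ κ)) :
    HasFDerivAt (superposition F)
      (ContinuousMap.applyCLM (superposition (fun κ => fderiv ℝ (F κ)) z₀)) z₀ := by
  have hF' : ∀ κ, ContinuousAt (fun w : K × E => fderiv ℝ (F w.1) w.2) (κ, z₀ κ) :=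
    fun κ => (h κ).fderiv_family.continuousAt
  rw [hasFDerivAt_iff_isLittleO_nhds_zero, Asymptotics.isLittleO_iff]
  intro ε hε
  have h1 : ∀ κ, ∀ᶠ y in 𝓝 (κ, z₀ κ), ‖F y.1 y.2 - F y.1 (z₀ y.1) -
      fderiv ℝ (F y.1) (z₀ y.1) (y.2 - z₀ y.1)‖ ≤ ε * ‖y.2 - z₀ y.1‖ := by
    intro κ
    have hcont : ContinuousAt (fun y : K × E => (y.1, y.2, z₀ y.1)) (κ, z₀ κ) := by fun_prop
    exact hcont.eventually (eventually_norm_sub_sub_le (F' := fun κ => fderiv ℝ (F κ))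
      ((h κ).eventually_differentiableAt.mono fun y hy => hy.hasFDerivAt) (hF' κ) hε)
  have h2 : ∀ᶠ z in 𝓝 z₀, ‖superposition F z - superposition F z₀ -
      ContinuousMap.applyCLM (superposition (fun κ => fderiv ℝ (F κ)) z₀) (z - z₀)‖ ≤
        ε * ‖z - z₀‖ := by
    filter_upwards [ContinuousMap.eventually_forall h1,
      ContinuousMap.eventually_forall fun κ => (h κ).eventually_continuousAt] with z hz hz'
    rw [ContinuousMap.norm_le _ (by positivity)]
    intro κ
    have e1 := superposition_apply (fun κ => hz' κ) κ
    have e2 := superposition_apply (fun κ => (h κ).continuousAt) κ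
    have e3 := superposition_apply (F := fun κ => fderiv ℝ (F κ)) (fun κ => hF' κ) κ
    simp only [ContinuousMap.sub_apply, ContinuousMap.applyCLM_apply, e1, e2, e3]
    refine (hz κ).trans (mul_le_mul_of_nonneg_left ?_ hε.le)
    exact (z - z₀).norm_coe_le_norm κ
  have h3 : Tendsto (fun f : C(K, E) => z₀ + f) (𝓝 0) (𝓝 z₀) := by
    have : Continuous (fun f : C(K, E) => z₀ + f) := by fun_prop
    simpa using this.tendsto 0
  filter_upwards [h3.eventually h2] with f hf
  simpa using hf

/-- The derivative at `z` is pointwise application of the superposition of the fibre derivatives,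
hence a bounded linear map after a superposition operator of one order less. -/
theorem contDiffAt_superposition {r : ℕ} {F : K → E → G} {z₀ : C(K, E)}
    (h : ∀ κ, ContDiffFamAt r F (κ, z₀ κ)) : ContDiffAt ℝ r (superposition F) z₀ := by
  induction r generalizing G with
  | zero =>
    have h1 := ContinuousMap.eventually_forall fun κ => (h κ).eventually
    rw [Nat.cast_zero, contDiffAt_zero]
    refine ⟨_, h1, fun z hz => ?_⟩
    have hz' : ∀ κ, ContDiffFamAt 0 F (κ, z κ) := hz
    exact (continuousAt_superposition fun κ =>
      (hz' κ).eventually_continuousAt).continuousWithinAt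
  | succ r ih =>
    have h1 := ContinuousMap.eventually_forall fun κ => (h κ).eventually
    push_cast
    rw [contDiffAt_succ_iff_hasFDerivAt]
    refine ⟨fun z => ContinuousMap.applyCLM (superposition (fun κ => fderiv ℝ (F κ)) z),
      ⟨_, h1, fun z hz => ?_⟩, ?_⟩
    · have hz' : ∀ κ, ContDiffFamAt (r + 1) F (κ, z κ) := hz
      exact hasFDerivAt_superposition fun κ => (hz' κ).mono (by omega)
    · have h2 := ih fun κ => (h κ).fderiv_family
      have hL : ContDiff ℝ r (fun A : C(K, E →L[ℝ] G) => ContinuousMap.applyCLM A) :=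
        ContinuousLinearMap.contDiff (𝕜 := ℝ) (n := r) (E := C(K, E →L[ℝ] G))
          (F := C(K, E) →L[ℝ] C(K, G)) (ContinuousMap.applyCLM (K := K) (E := E) (G := G))
      exact hL.contDiffAt.comp z₀ h2

end Superposition

/-! ### Integral equations with converging densities -/

section IntegralEquation

variable {K : Type} [TopologicalSpace K] {S : ℝ}
  {E : Type} [NormedAddCommGroup E] [NormedSpace ℝ E]

/-- A family of bounded densities on `[0, S]` which depends continuously on a parameter in the
`L^1` norm. -/
structure DensityFamily (K : Type) [TopologicalSpace K] (S : ℝ) where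
  /-- the densities -/
  a : K → ℝ → ℝ
  /-- a uniform bound -/
  M : ℝ
  bound : ∀ κ s, |a κ s| ≤ M
  integrable : ∀ κ, IntervalIntegrable (a κ) MeasureTheory.volume 0 S
  tendsto : ∀ κ₀, Tendsto (fun κ => ∫ s in (0 : ℝ)..S, |a κ s - a κ₀ s|) (𝓝 κ₀) (𝓝 0)

namespace DensityFamily

theorem M_nonneg (A : DensityFamily K S) [Nonempty K] : 0 ≤ A.M :=
  (abs_nonneg _).trans (A.bound (Classical.arbitrary K) 0)

/-- Change of parameters. -/
def comp {K' : Type} [TopologicalSpace K'] (A : DensityFamily K S) (φ : K' → K)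
    (hφ : Continuous φ) : DensityFamily K' S where
  a κ := A.a (φ κ)
  M := A.M
  bound κ := A.bound (φ κ)
  integrable κ := A.integrable (φ κ)
  tendsto κ₀ := (A.tendsto (φ κ₀)).comp (hφ.tendsto κ₀)

theorem intervalIntegrable (A : DensityFamily K S) (κ : K) {σ : ℝ} (hσ : σ ∈ Icc 0 S) :
    IntervalIntegrable (A.a κ) MeasureTheory.volume 0 σ :=
  (A.integrable κ).mono_set (by
    rw [uIcc_of_le hσ.1, uIcc_of_le (hσ.1.trans hσ.2)]
    exact Icc_subset_Icc_right hσ.2)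

theorem norm_integral_le (A : DensityFamily K S) (κ : K) {σ : ℝ} (hσ : 0 ≤ σ) {g : ℝ → E}
    (hg : Continuous g) :
    ‖∫ s in (0 : ℝ)..σ, A.a κ s • g s‖ ≤ A.M * ∫ s in (0 : ℝ)..σ, ‖g s‖ := by
  rw [← intervalIntegral.integral_const_mul]
  refine intervalIntegral.norm_integral_le_of_norm_le hσ ?_
    ((hg.norm.intervalIntegrable _ _).const_mul _)
  refine Eventually.of_forall fun s _ => ?_
  rw [norm_smul, Real.norm_eq_abs]
  exact mul_le_mul_of_nonneg_right (A.bound κ s) (norm_nonneg _)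

variable [CompactSpace K] [Nonempty K] (hS : 0 ≤ S)

theorem continuous_integral (A : DensityFamily K S) (f : C(K × Icc 0 S, E)) :
    Continuous (fun x : K × Icc 0 S =>
      ∫ s in (0 : ℝ)..x.2, A.a x.1 s • f (x.1, projIcc 0 S hS s)) := by
  rw [continuous_iff_continuousAt]
  rintro ⟨κ₀, σ₀⟩
  have hM := A.M_nonneg
  set g : K → ℝ → E := fun κ s => f (κ, projIcc 0 S hS s) with hg
  have hgc : ∀ κ, Continuous (g κ) := fun κ => by
    have : Continuous (projIcc 0 S hS) := continuous_projIcc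
    simp only [hg]; fun_prop
  have hgn : ∀ κ s, ‖g κ s‖ ≤ ‖f‖ := fun κ s => f.norm_coe_le_norm _
  have hd : ∀ κ s, ‖g κ s - g κ₀ s‖ ≤ ‖f.curry κ - f.curry κ₀‖ := fun κ s =>
    (f.curry κ - f.curry κ₀).norm_coe_le_norm (projIcc 0 S hS s)
  have hint : ∀ κ κ' (σ σ' : Icc 0 S),
      IntervalIntegrable (fun s => A.a κ s • g κ' s) MeasureTheory.volume (σ : ℝ) σ' := by
    intro κ κ' σ σ'
    refine IntervalIntegrable.smul_continuousOn ?_ (hgc κ').continuousOn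
    exact (A.intervalIntegrable κ σ.2).symm.trans (A.intervalIntegrable κ σ'.2)
  have hz : (0 : ℝ) ∈ Icc 0 S := ⟨le_rfl, hS⟩
  have key : ∀ x : K × Icc 0 S,
      dist (∫ s in (0 : ℝ)..x.2, A.a x.1 s • g x.1 s) (∫ s in (0 : ℝ)..σ₀, A.a κ₀ s • g κ₀ s) ≤
      (∫ s in (0 : ℝ)..S, |A.a x.1 s - A.a κ₀ s|) * ‖f‖ +
        A.M * ‖f.curry x.1 - f.curry κ₀‖ * S + A.M * ‖f‖ * |(x.2 : ℝ) - σ₀| := by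
    rintro ⟨κ, σ⟩
    -- The three terms are the change of the density, small in L¹ against a bounded integrand, the
    -- change of the integrand against a bounded density, and the change of the end point.
    have e : (∫ s in (0 : ℝ)..σ, A.a κ s • g κ s) - ∫ s in (0 : ℝ)..σ₀, A.a κ₀ s • g κ₀ s =
        (∫ s in (0 : ℝ)..σ, (A.a κ s - A.a κ₀ s) • g κ s) +
        (∫ s in (0 : ℝ)..σ, A.a κ₀ s • (g κ s - g κ₀ s)) +
        ∫ s in (σ₀ : ℝ)..σ, A.a κ₀ s • g κ₀ s := by
      have e1 := intervalIntegral.integral_interval_sub_left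
        (hint κ₀ κ₀ ⟨0, hz⟩ σ) (hint κ₀ κ₀ ⟨0, hz⟩ σ₀)
      simp only at e1
      simp only [sub_smul, smul_sub]
      rw [intervalIntegral.integral_sub (hint κ κ ⟨0, hz⟩ σ) (hint κ₀ κ ⟨0, hz⟩ σ),
        intervalIntegral.integral_sub (hint κ₀ κ ⟨0, hz⟩ σ) (hint κ₀ κ₀ ⟨0, hz⟩ σ), ← e1]
      abel
    rw [dist_eq_norm, e]
    refine (norm_add_le _ _).trans (add_le_add ((norm_add_le _ _).trans (add_le_add ?_ ?_)) ?_)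
    · have i1 : IntervalIntegrable (fun s => |A.a κ s - A.a κ₀ s|) MeasureTheory.volume 0 S :=
        ((A.integrable κ).sub (A.integrable κ₀)).abs
      rw [← intervalIntegral.integral_mul_const]
      refine (intervalIntegral.norm_integral_le_of_norm_le (g := fun s =>
        |A.a κ s - A.a κ₀ s| * ‖f‖) σ.2.1 (Eventually.of_forall fun s _ => ?_) ?_).trans ?_
      · rw [norm_smul, Real.norm_eq_abs]
        exact mul_le_mul_of_nonneg_left (hgn κ s) (abs_nonneg _)
      · exact (((A.intervalIntegrable κ σ.2).sub (A.intervalIntegrable κ₀ σ.2)).abs).mul_const _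
      · exact intervalIntegral.integral_mono_interval le_rfl σ.2.1 σ.2.2
          (Eventually.of_forall fun s => mul_nonneg (abs_nonneg _) (norm_nonneg _))
          (i1.mul_const _)
    · refine (intervalIntegral.norm_integral_le_of_norm_le_const
        (C := A.M * ‖f.curry κ - f.curry κ₀‖) fun s _ => ?_).trans ?_
      · rw [norm_smul, Real.norm_eq_abs]
        exact mul_le_mul (A.bound κ₀ s) (hd κ s) (norm_nonneg _) hM
      · refine mul_le_mul_of_nonneg_left ?_ (by positivity)
        rw [sub_zero, abs_of_nonneg σ.2.1]
        exact σ.2.2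
    · refine intervalIntegral.norm_integral_le_of_norm_le_const fun s _ => ?_
      rw [norm_smul, Real.norm_eq_abs]
      exact mul_le_mul (A.bound κ₀ s) (hgn κ₀ s) (norm_nonneg _) hM
  rw [ContinuousAt, tendsto_iff_dist_tendsto_zero]
  refine squeeze_zero (fun _ => dist_nonneg) key ?_
  have t1 : Tendsto (fun x : K × Icc 0 S => ∫ s in (0 : ℝ)..S, |A.a x.1 s - A.a κ₀ s|)
      (𝓝 (κ₀, σ₀)) (𝓝 0) := (A.tendsto κ₀).comp (continuous_fst.tendsto (κ₀, σ₀))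
  have t2 : Tendsto (fun x : K × Icc 0 S => ‖f.curry x.1 - f.curry κ₀‖) (𝓝 (κ₀, σ₀)) (𝓝 0) := by
    have : Continuous (fun x : K × Icc 0 S => ‖f.curry x.1 - f.curry κ₀‖) := by fun_prop
    simpa using this.tendsto (κ₀, σ₀)
  have t3 : Tendsto (fun x : K × Icc 0 S => |(x.2 : ℝ) - σ₀|) (𝓝 (κ₀, σ₀)) (𝓝 0) := by
    have : Continuous (fun x : K × Icc 0 S => |(x.2 : ℝ) - σ₀|) := by fun_prop
    simpa using this.tendsto (κ₀, σ₀)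
  simpa using ((t1.mul_const ‖f‖).add ((t2.const_mul A.M).mul_const S)).add
    (t3.const_mul (A.M * ‖f‖))

/-- The operator of integration against a family of densities. -/
noncomputable def integralCLM (A : DensityFamily K S) :
    C(K × Icc 0 S, E) →L[ℝ] C(K × Icc 0 S, E) :=
  have hproj : Continuous (projIcc 0 S hS) := continuous_projIcc
  have hint : ∀ (f : C(K × Icc 0 S, E)) (x : K × Icc 0 S), IntervalIntegrable
      (fun s => A.a x.1 s • f (x.1, projIcc 0 S hS s)) MeasureTheory.volume 0 x.2 := fun f x =>
    IntervalIntegrable.smul_continuousOn (A.intervalIntegrable x.1 x.2.2)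
      (by fun_prop : Continuous fun s => f (x.1, projIcc 0 S hS s)).continuousOn
  LinearMap.mkContinuous (σ := RingHom.id ℝ) (E := C(K × Icc 0 S, E)) (F := C(K × Icc 0 S, E))
    { toFun := fun f => ⟨_, A.continuous_integral hS f⟩
      map_add' := fun f f' => by
        ext x
        simp [smul_add, intervalIntegral.integral_add (hint f x) (hint f' x)]
      map_smul' := fun c f => by
        ext x
        simp [smul_comm _ c] } (A.M * S) (fun f => by
    have hM := A.M_nonneg
    rw [ContinuousMap.norm_le _ (by positivity)]
    intro x
    refine (intervalIntegral.norm_integral_le_of_norm_le_const (C := A.M * ‖f‖)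
      fun s _ => ?_).trans ?_
    · rw [norm_smul, Real.norm_eq_abs]
      exact mul_le_mul (A.bound _ _) (f.norm_coe_le_norm _) (norm_nonneg _) hM
    · rw [sub_zero, abs_of_nonneg x.2.2.1, mul_right_comm]
      exact mul_le_mul_of_nonneg_right (mul_le_mul_of_nonneg_left x.2.2.2 hM) (norm_nonneg f))

theorem integralCLM_apply (A : DensityFamily K S) (f : C(K × Icc 0 S, E)) (x : K × Icc 0 S) :
    A.integralCLM hS f x = ∫ s in (0 : ℝ)..x.2, A.a x.1 s • f (x.1, projIcc 0 S hS s) := rfl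

end DensityFamily

/-- Operators of Volterra type on families of paths. -/
def IsVolterra [CompactSpace K] (hS : 0 ≤ S)
    (T : C(K × Icc 0 S, E) →L[ℝ] C(K × Icc 0 S, E)) : Prop :=
  ∃ C : ℝ, 0 ≤ C ∧ ∀ (f : C(K × Icc 0 S, E)) (x : K × Icc 0 S),
    ‖T f x‖ ≤ C * ∫ s in (0 : ℝ)..x.2, ‖f (x.1, projIcc 0 S hS s)‖

section Volterra

variable [CompactSpace K] (hS : 0 ≤ S)

theorem isVolterra_sum {ι : Type} (s : Finset ι)
    {T : ι → C(K × Icc 0 S, E) →L[ℝ] C(K × Icc 0 S, E)} (h : ∀ i, IsVolterra hS (T i)) :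
    IsVolterra hS (∑ i ∈ s, T i) := by
  choose C hC h using h
  refine ⟨∑ i ∈ s, C i, Finset.sum_nonneg fun i _ => hC i, fun f x => ?_⟩
  rw [sum_apply, ContinuousMap.sum_apply, Finset.sum_mul]
  exact norm_sum_le_of_le _ fun i _ => h i f x

theorem isVolterra_integralCLM_comp [Nonempty K] (A : DensityFamily K S)
    (D : C(K × Icc 0 S, E →L[ℝ] E)) :
    IsVolterra hS ((A.integralCLM hS).comp (ContinuousMap.applyCLM D)) := by
  refine ⟨A.M * ‖D‖, mul_nonneg A.M_nonneg (norm_nonneg D), fun f x => ?_⟩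
  have hproj : Continuous (projIcc 0 S hS) := continuous_projIcc
  rw [ContinuousLinearMap.comp_apply, A.integralCLM_apply]
  refine (A.norm_integral_le x.1 x.2.2.1 (by fun_prop)).trans ?_
  rw [mul_assoc, ← intervalIntegral.integral_const_mul ‖D‖]
  refine mul_le_mul_of_nonneg_left ?_ A.M_nonneg
  refine intervalIntegral.integral_mono_on x.2.2.1
    ((by fun_prop : Continuous _).intervalIntegrable _ _)
    ((by fun_prop : Continuous _).intervalIntegrable _ _) fun s _ => ?_
  exact ((D _).le_opNorm _).trans
    (mul_le_mul_of_nonneg_right (D.norm_coe_le_norm _) (norm_nonneg _))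

/-- Iterating the integral bound integrates powers of the end point; this produces the factorial. -/
theorem IsVolterra.norm_pow_le {T : C(K × Icc 0 S, E) →L[ℝ] C(K × Icc 0 S, E)} {C : ℝ}
    (hC : 0 ≤ C) (h : ∀ (f : C(K × Icc 0 S, E)) (x : K × Icc 0 S),
      ‖T f x‖ ≤ C * ∫ s in (0 : ℝ)..x.2, ‖f (x.1, projIcc 0 S hS s)‖)
    (k : ℕ) (f : C(K × Icc 0 S, E)) (x : K × Icc 0 S) :
    ‖(T ^ k) f x‖ ≤ (C * x.2) ^ k / k.factorial * ‖f‖ := by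
  have hproj : Continuous (projIcc 0 S hS) := continuous_projIcc
  induction k generalizing x with
  | zero => simpa using f.norm_coe_le_norm x
  | succ k ih =>
    rw [pow_succ', mul_apply_eq_comp]
    refine (h _ x).trans ?_
    have h1 : ∫ s in (0 : ℝ)..x.2, ‖(T ^ k) f (x.1, projIcc 0 S hS s)‖ ≤
        ∫ s in (0 : ℝ)..x.2, C ^ k / k.factorial * ‖f‖ * s ^ k := by
      refine intervalIntegral.integral_mono_on x.2.2.1
        ((by fun_prop : Continuous _).intervalIntegrable _ _)
        ((by fun_prop : Continuous _).intervalIntegrable _ _) fun s hs => ?_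
      have hs' : s ∈ Icc 0 S := ⟨hs.1, hs.2.trans x.2.2.2⟩
      refine (ih (x.1, projIcc 0 S hS s)).trans (le_of_eq ?_)
      rw [projIcc_of_mem hS hs', mul_pow]
      ring
    refine (mul_le_mul_of_nonneg_left h1 hC).trans (le_of_eq ?_)
    rw [intervalIntegral.integral_const_mul, integral_pow, Nat.factorial_succ]
    push_cast
    field_simp
    ring

/-- Some power of `T` has norm less than 1, so 1 - `T`^k is invertible. It is the product of the
commuting factors 1 - `T` and 1 + `T` + … + `T`^(k-1), so each factor is invertible. -/
theorem IsVolterra.isUnit_one_sub [CompleteSpace E]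
    {T : C(K × Icc 0 S, E) →L[ℝ] C(K × Icc 0 S, E)}
    (h : IsVolterra hS T) : IsUnit (1 - T) := by
  obtain ⟨C, hC, h⟩ := h
  have ht := FloorSemiring.tendsto_pow_div_factorial_atTop (C * S)
  obtain ⟨k, hk⟩ := (ht.eventually_lt_const (show (0 : ℝ) < 1 / 2 by norm_num)).exists
  have h1 : ‖T ^ k‖ < 1 := by
    refine lt_of_le_of_lt (ContinuousLinearMap.opNorm_le_bound _ (M := 1 / 2) (by norm_num)
      fun f => ?_) (by norm_num)
    rw [ContinuousMap.norm_le _ (by positivity)]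
    intro x
    refine (IsVolterra.norm_pow_le hS hC h k f x).trans
      (mul_le_mul_of_nonneg_right (le_trans ?_ hk.le) (norm_nonneg f))
    have h2 : C * (x.2 : ℝ) ≤ C * S := mul_le_mul_of_nonneg_left x.2.2.2 hC
    have h3 : 0 ≤ C * (x.2 : ℝ) := mul_nonneg hC x.2.2.1
    gcongr
  have h2 := isUnit_one_sub_of_norm_lt_one
    (R := C(K × Icc 0 S, E) →L[ℝ] C(K × Icc 0 S, E)) (x := T ^ k) h1
  rw [← mul_neg_geom_sum] at h2
  refine ((Commute.isUnit_mul_iff ?_).1 h2).1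
  exact Commute.sum_right _ _ _ fun i _ =>
    ((Commute.one_left _).sub_left ((Commute.refl T).pow_right i))

end Volterra

end IntegralEquation

/-! ### Solutions of the integral equations as convergent C^r families -/

section SolutionFamily

variable {S : ℝ} {E : Type} [NormedAddCommGroup E] [NormedSpace ℝ E] {ι : Type} [Fintype ι]

section Residual

variable {K : Type} [TopologicalSpace K] [CompactSpace K] [Nonempty K] (hS : 0 ≤ S)
  (A : ι → DensityFamily K S) (F : ι → K → E → E)

/-- The left-hand side of the integral equation `z - ∑ j, ∫ a_j F_j(z) = y`. -/
noncomputable def integralResidual (z : C(K × Icc 0 S, E)) : C(K × Icc 0 S, E) :=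
  z - ∑ j, (A j).integralCLM hS (superposition (fun x : K × Icc 0 S => F j x.1) z)

variable {hS A F}

theorem continuousAt_family_fst {G : Type} [TopologicalSpace G] {f : K → E → G} {x : K × Icc 0 S}
    {e : E} (h : ContinuousAt (fun w : K × E => f w.1 w.2) (x.1, e)) :
    ContinuousAt (fun w : (K × Icc 0 S) × E => f w.1.1 w.2) (x, e) :=
  ContinuousAt.comp (f := fun w : (K × Icc 0 S) × E => (w.1.1, w.2))
    (g := fun w : K × E => f w.1 w.2) h (by fun_prop)

theorem integralResidual_apply {z : C(K × Icc 0 S, E)}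
    (h : ∀ j x, ContinuousAt (fun w : K × E => F j w.1 w.2) (x.1, z x)) (x : K × Icc 0 S) :
    integralResidual hS A F z x = z x - ∑ j, ∫ s in (0 : ℝ)..x.2,
      (A j).a x.1 s • F j x.1 (z (x.1, projIcc 0 S hS s)) := by
  simp only [integralResidual, ContinuousMap.sub_apply, ContinuousMap.sum_apply,
    DensityFamily.integralCLM_apply]
  congr 1
  refine Finset.sum_congr rfl fun j _ => ?_
  refine intervalIntegral.integral_congr fun s _ => ?_
  rw [superposition_apply (F := fun x : K × Icc 0 S => F j x.1)
    (fun κ => continuousAt_family_fst (h j κ))]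

/-- The inverse function theorem: the linearization of the residual at `z₀` is the identity minus a
finite sum of Volterra operators. It is not required that `z₀` solve the equation. -/
theorem exists_inverse_integralResidual [CompleteSpace E] {r : ℕ} (hr : 1 ≤ r)
    {z₀ : C(K × Icc 0 S, E)}
    (h : ∀ j x, ContDiffFamAt r (F j) (x.1, z₀ x)) :
    ∃ Φ : C(K × Icc 0 S, E) → C(K × Icc 0 S, E),
      ContDiffAt ℝ r Φ (integralResidual hS A F z₀) ∧
      Φ (integralResidual hS A F z₀) = z₀ ∧
      (∀ᶠ y in 𝓝 (integralResidual hS A F z₀), integralResidual hS A F (Φ y) = y) ∧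
      ∀ᶠ z in 𝓝 z₀, Φ (integralResidual hS A F z) = z := by
  have h' : ∀ j (x : K × Icc 0 S),
      ContDiffFamAt r (fun x : K × Icc 0 S => F j x.1) (x, z₀ x) := fun j x =>
    ContDiffFamAt.comp_param (F := F j) (φ := fun x : K × Icc 0 S => x.1) continuous_fst (h j x)
  set N : ι → C(K × Icc 0 S, E) → C(K × Icc 0 S, E) := fun j =>
    superposition (fun x : K × Icc 0 S => F j x.1) with hN
  set D : ι → C(K × Icc 0 S, E →L[ℝ] E) := fun j =>
    superposition (fun x : K × Icc 0 S => fderiv ℝ (F j x.1)) z₀ with hD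
  have hsm : ContDiffAt ℝ r (integralResidual hS A F) z₀ := by
    refine contDiffAt_id.sub (ContDiffAt.sum fun j _ => ?_)
    have hL : ContDiff ℝ r (fun f : C(K × Icc 0 S, E) => (A j).integralCLM hS f) :=
      ContinuousLinearMap.contDiff (𝕜 := ℝ) (n := r) (E := C(K × Icc 0 S, E))
        (F := C(K × Icc 0 S, E)) ((A j).integralCLM hS)
    exact hL.contDiffAt.comp z₀ (contDiffAt_superposition (h' j))
  set T : C(K × Icc 0 S, E) →L[ℝ] C(K × Icc 0 S, E) :=
    ∑ j, ((A j).integralCLM hS).comp (ContinuousMap.applyCLM (D j)) with hT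
  have hd : HasFDerivAt (integralResidual hS A F) (1 - T) z₀ := by
    refine (hasFDerivAt_id z₀).sub (HasFDerivAt.fun_sum fun j _ => ?_)
    exact ((A j).integralCLM hS).hasFDerivAt.comp z₀
      (hasFDerivAt_superposition fun κ => (h' j κ).mono hr)
  obtain ⟨U, hU⟩ := (isVolterra_sum hS Finset.univ fun j =>
    isVolterra_integralCLM_comp hS (A j) (D j)).isUnit_one_sub
  set e := ContinuousLinearEquiv.unitsEquiv ℝ C(K × Icc 0 S, E) U with he
  have hee : (e : C(K × Icc 0 S, E) →L[ℝ] C(K × Icc 0 S, E)) = 1 - T := by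
    rw [hT, ← hU]; rfl
  rw [← hee] at hd
  have hr0 : (r : WithTop ℕ∞) ≠ 0 := by
    have : r ≠ 0 := by omega
    exact_mod_cast this
  have hs := hsm.hasStrictFDerivAt' hd hr0
  exact ⟨hs.localInverse, hsm.to_localInverse hd hr0, hs.localInverse_apply_image,
    hs.eventually_right_inverse, hs.eventually_left_inverse⟩

end Residual

open OnePoint

theorem OnePoint.eventually_nhds_infty {P : OnePoint ℕ → Prop} :
    (∀ᶠ κ in 𝓝 (∞ : OnePoint ℕ), P κ) ↔ P ∞ ∧ ∀ᶠ n : ℕ in atTop, P n := by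
  rw [OnePoint.nhds_infty_eq, eventually_sup, eventually_map, eventually_pure]
  simp [coclosedCompact_eq_cocompact, and_comm]

/-- The retraction of `ℕ ∪ {∞}` which maps all numbers less than `m` to `∞`. -/
def OnePoint.tail (m : ℕ) (κ : OnePoint ℕ) : OnePoint ℕ :=
  κ.elim ∞ (fun n => if m ≤ n then (n : OnePoint ℕ) else ∞)

theorem OnePoint.continuous_tail (m : ℕ) : Continuous (OnePoint.tail m) := by
  rw [OnePoint.continuous_iff_from_nat]
  have h : Tendsto (fun n : ℕ => (n : OnePoint ℕ)) atTop (𝓝 ∞) :=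
    (OnePoint.continuous_iff_from_nat id).1 continuous_id
  refine h.congr' ?_
  filter_upwards [eventually_ge_atTop m] with n hn
  simp [OnePoint.tail, hn]

theorem OnePoint.eventually_tail_eq (m : ℕ) :
    ∀ᶠ κ in 𝓝 (∞ : OnePoint ℕ), OnePoint.tail m κ = κ := by
  rw [OnePoint.eventually_nhds_infty]
  refine ⟨rfl, ?_⟩
  filter_upwards [eventually_ge_atTop m] with n hn
  simp [OnePoint.tail, hn]

/-- The indicator function of `{m, m + 1, …} ∪ {∞}`. -/
def OnePoint.tailIndicator (m : ℕ) : C(OnePoint ℕ, ℝ) where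
  toFun κ := κ.elim 1 (fun n => if m ≤ n then 1 else 0)
  continuous_toFun := by
    rw [OnePoint.continuous_iff_from_nat]
    refine tendsto_const_nhds.congr' ?_
    filter_upwards [eventually_ge_atTop m] with n hn
    simp [hn]

theorem OnePoint.tailIndicator_coe (m n : ℕ) :
    OnePoint.tailIndicator m n = if m ≤ n then 1 else 0 := rfl

theorem OnePoint.tailIndicator_infty (m : ℕ) : OnePoint.tailIndicator m ∞ = 1 := rfl

theorem OnePoint.abs_tailIndicator_le (m : ℕ) (κ : OnePoint ℕ) :
    |OnePoint.tailIndicator m κ| ≤ 1 := by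
  induction κ using OnePoint.rec with
  | infty => simp [OnePoint.tailIndicator_infty]
  | coe n => rw [OnePoint.tailIndicator_coe]; split_ifs <;> simp

theorem OnePoint.eventually_tailIndicator_eq (m : ℕ) :
    ∀ᶠ κ in 𝓝 (∞ : OnePoint ℕ), OnePoint.tailIndicator m κ = 1 := by
  rw [OnePoint.eventually_nhds_infty]
  refine ⟨rfl, ?_⟩
  filter_upwards [eventually_ge_atTop m] with n hn
  simp [OnePoint.tailIndicator_coe, hn]

/-- By compactness of `I` a function vanishing at ∞ is uniformly small for all large indices; the
cut-off removes the finitely many others. -/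
theorem exists_tailIndicator_norm_le {I : Type} [TopologicalSpace I] [CompactSpace I]
    (f : C(OnePoint ℕ × I, E)) (hf : ∀ s, f (∞, s) = 0) {ρ : ℝ} (hρ : 0 < ρ) :
    ∃ m, ∀ κ s, ‖OnePoint.tailIndicator m κ • f (κ, s)‖ < ρ := by
  have h1 : ∀ᶠ κ in 𝓝 (∞ : OnePoint ℕ), ∀ s ∈ (univ : Set I), ‖f (κ, s)‖ < ρ := by
    refine isCompact_univ.eventually_forall_of_forall_eventually fun s _ => ?_
    have : Tendsto (fun z : OnePoint ℕ × I => ‖f (z.1, z.2)‖) (𝓝 (∞, s)) (𝓝 ‖f (∞, s)‖) :=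
      Continuous.tendsto (by fun_prop) _
    rw [hf, norm_zero] at this
    exact this.eventually_lt_const hρ
  rw [OnePoint.eventually_nhds_infty, eventually_atTop] at h1
  obtain ⟨h0, m, hm⟩ := h1
  refine ⟨m, fun κ s => ?_⟩
  induction κ using OnePoint.rec with
  | infty => simpa [OnePoint.tailIndicator_infty] using h0 s trivial
  | coe n =>
    rw [OnePoint.tailIndicator_coe]
    split_ifs with h
    · simpa using hm n h s trivial
    · simpa using hρ

/-- The given path solves the equation at ∞ only. Extended independently of κ it has a residual
which is close to the constant `z₀ 0` for large indices, so the local inverse of the residual can be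
applied to right-hand sides which equal the initial value on a tail and the old residual elsewhere.
-/
theorem exists_solution_family [FiniteDimensional ℝ E] {r : ℕ} (hr : 1 ≤ r) (hS : 0 ≤ S)
    (A : ι → DensityFamily (OnePoint ℕ) S) (F : ι → OnePoint ℕ → E → E) (z₀ : ℝ → E)
    (hz₀ : ContinuousOn z₀ (Icc 0 S))
    (heq : ∀ σ ∈ Icc 0 S, z₀ σ = z₀ 0 + ∑ j, ∫ s in (0 : ℝ)..σ, (A j).a ∞ s • F j ∞ (z₀ s))
    (hF : ∀ j, ∀ σ ∈ Icc 0 S, ContDiffFamAt r (F j) (∞, z₀ σ)) :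
    ∃ Z : OnePoint ℕ → E → ℝ → E,
      (∀ σ ∈ Icc 0 S, ContDiffFamAt r (fun κ ζ => Z κ ζ σ) (∞, z₀ 0)) ∧
      (∀ σ ∈ Icc 0 S, Z ∞ (z₀ 0) σ = z₀ σ) ∧
      (∀ P : OnePoint ℕ × E → Prop, (∀ σ ∈ Icc 0 S, ∀ᶠ y in 𝓝 (∞, z₀ σ), P y) →
        ∀ᶠ y in 𝓝 (∞, z₀ 0), ∀ σ ∈ Icc 0 S, P (y.1, Z y.1 y.2 σ)) ∧
      ∀ᶠ y in 𝓝 (∞, z₀ 0), Continuous (Z y.1 y.2) ∧ ∀ σ ∈ Icc 0 S,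
        Z y.1 y.2 σ = y.2 + ∑ j, ∫ s in (0 : ℝ)..σ, (A j).a y.1 s • F j y.1 (Z y.1 y.2 s) := by
  have : CompleteSpace E := FiniteDimensional.complete ℝ E
  have hproj : Continuous (projIcc 0 S hS) := continuous_projIcc
  set ζ₀ := z₀ 0 with hζ₀
  let zb : C(Icc (0 : ℝ) S, E) := ⟨fun s => z₀ s, hz₀.domRestrict⟩
  have hzb : ∀ s, zb s = z₀ s := fun s => rfl
  -- restrict to a tail of the sequence on which the families are smooth along `z₀`
  obtain ⟨m, hm⟩ : ∃ m, ∀ κ, ∀ j (s : Icc (0 : ℝ) S),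
      ContDiffFamAt r (F j) (OnePoint.tail m κ, zb s) := by
    have h1 : ∀ᶠ κ in 𝓝 (∞ : OnePoint ℕ), ∀ s ∈ (univ : Set (Icc (0 : ℝ) S)),
        ∀ j, ContDiffFamAt r (F j) (κ, zb s) := by
      refine isCompact_univ.eventually_forall_of_forall_eventually fun s _ => ?_
      rw [eventually_all]
      intro j
      have hc : ContinuousAt (fun z : OnePoint ℕ × Icc (0 : ℝ) S => (z.1, zb z.2)) (∞, s) := by
        fun_prop
      exact hc.eventually (hF j s s.2).eventually
    rw [OnePoint.eventually_nhds_infty, eventually_atTop] at h1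
    obtain ⟨h0, m, hm⟩ := h1
    refine ⟨m, fun κ j s => ?_⟩
    induction κ using OnePoint.rec with
    | infty => exact h0 s trivial j
    | coe n =>
      simp only [OnePoint.tail, OnePoint.elim_some]
      split_ifs with h
      · exact hm n h s trivial j
      · exact h0 s trivial j
  -- One prime: small indices are replaced by ∞, so that the hypotheses hold for every κ. Two
  -- primes: the problem at ∞ alone, over a one-point parameter space.
  let A' : ι → DensityFamily (OnePoint ℕ) S := fun j =>
    (A j).comp (OnePoint.tail m) (OnePoint.continuous_tail m)
  let F' : ι → OnePoint ℕ → E → E := fun j κ => F j (OnePoint.tail m κ)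
  let A'' : ι → DensityFamily Unit S := fun j => (A j).comp (fun _ => ∞) continuous_const
  let F'' : ι → Unit → E → E := fun j _ => F j ∞
  have hF' : ∀ j (x : OnePoint ℕ × Icc 0 S), ContDiffFamAt r (F' j) (x.1, zb x.2) := fun j x =>
    ContDiffFamAt.comp_param (OnePoint.continuous_tail m) (hm x.1 j x.2)
  have hF'' : ∀ j (x : Unit × Icc 0 S), ContDiffFamAt r (F'' j) (x.1, zb x.2) := fun j x =>
    ContDiffFamAt.comp_param (φ := fun _ : Unit => (∞ : OnePoint ℕ)) continuous_const
      (hF j x.2 x.2.2)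
  let zK : C(OnePoint ℕ × Icc 0 S, E) := zb.comp ⟨_, continuous_snd⟩
  let zU : C(Unit × Icc 0 S, E) := zb.comp ⟨_, continuous_snd⟩
  obtain ⟨Φ, hΦ, hΦ0, hΦr, -⟩ := exists_inverse_integralResidual (hS := hS) (A := A')
    (z₀ := zK) hr hF'
  -- Only the left inverse is kept: it is local uniqueness for the limit equation, used to recognize
  -- the given path in the solution family.
  obtain ⟨Φ'', -, hΦ0'', -, hΦl''⟩ := exists_inverse_integralResidual (hS := hS) (A := A'')
    (z₀ := zU) hr hF''
  set y₀ := integralResidual hS A' F' zK with hy₀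
  have hy₀_infty : ∀ s : Icc (0 : ℝ) S, y₀ (∞, s) = ζ₀ := by
    intro s
    rw [hy₀, integralResidual_apply fun j x => (hF' j x).continuousAt]
    rw [sub_eq_iff_eq_add, show zK (∞, s) = z₀ s from rfl, heq s s.2]
    congr 1
    refine Finset.sum_congr rfl fun j _ => intervalIntegral.integral_congr fun t ht => ?_
    simp only at ht ⊢
    rw [uIcc_of_le s.2.1] at ht
    change (A j).a ∞ t • F j ∞ (z₀ t) = (A j).a ∞ t • F j ∞ (z₀ (projIcc 0 S hS t : ℝ))
    rw [projIcc_of_mem hS ⟨ht.1, ht.2.trans s.2.2⟩]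
  let R : C(OnePoint ℕ × Icc 0 S, E) → C(Unit × Icc 0 S, E) := fun z =>
    z.comp ⟨fun x => (∞, x.2), by fun_prop⟩
  have hR : Continuous R := ContinuousMap.continuous_precomp _
  have hgood : ∀ᶠ z in 𝓝 zK, ∀ x : OnePoint ℕ × Icc 0 S, ∀ j,
      ContinuousAt (fun w : OnePoint ℕ × E => F' j w.1 w.2) (x.1, z x) := by
    refine ContinuousMap.eventually_forall (P := fun p : (OnePoint ℕ × Icc 0 S) × E =>
      ∀ j, ContinuousAt (fun w : OnePoint ℕ × E => F' j w.1 w.2) (p.1.1, p.2)) fun x => ?_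
    rw [eventually_all]
    intro j
    have hc : ContinuousAt (fun p : (OnePoint ℕ × Icc 0 S) × E => (p.1.1, p.2)) (x, zK x) := by
      fun_prop
    exact hc.eventually (hF' j x).eventually_continuousAt
  have hRes : ∀ z : C(OnePoint ℕ × Icc 0 S, E), (∀ x : OnePoint ℕ × Icc 0 S, ∀ j,
      ContinuousAt (fun w : OnePoint ℕ × E => F' j w.1 w.2) (x.1, z x)) →
      integralResidual hS A'' F'' (R z) = R (integralResidual hS A' F' z) := by
    intro z hz
    ext x
    change _ = integralResidual hS A' F' z (∞, x.2)
    rw [integralResidual_apply fun j x => hz x j, integralResidual_apply]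
    · rfl
    · intro j x
      have := hz (∞, x.2) j
      exact ContinuousAt.comp (f := fun w : Unit × E => ((∞ : OnePoint ℕ), w.2))
        (g := fun w : OnePoint ℕ × E => F' j w.1 w.2) this (by fun_prop)
  have hΦt : Tendsto Φ (𝓝 y₀) (𝓝 zK) := by
    have := hΦ.continuousAt.tendsto
    rwa [hΦ0] at this
  have hO : ∀ᶠ y in 𝓝 y₀, ContDiffAt ℝ r Φ y ∧ integralResidual hS A' F' (Φ y) = y ∧
      (∀ x : OnePoint ℕ × Icc 0 S, ∀ j,
        ContinuousAt (fun w : OnePoint ℕ × E => F' j w.1 w.2) (x.1, Φ y x)) ∧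
      Φ'' (integralResidual hS A'' F'' (R (Φ y))) = R (Φ y) :=
    (hΦ.eventually (by simp)).and (hΦr.and ((hΦt.eventually hgood).and
      (((hR.tendsto zK).comp hΦt).eventually hΦl'')))
  obtain ⟨ρ, hρ, hball⟩ := Metric.eventually_nhds_iff_ball.1 hO
  -- Chosen so that replacing the residual by the constant initial value on the tail moves it by
  -- less than the radius of the ball of validity.
  obtain ⟨l, hl⟩ := exists_tailIndicator_norm_le
    (⟨fun x => ζ₀ - y₀ x, by fun_prop⟩ : C(OnePoint ℕ × Icc 0 S, E))
    (by intro s; simp [hy₀_infty]) (half_pos hρ)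
  let Λ : E →L[ℝ] C(OnePoint ℕ × Icc 0 S, E) :=
    LinearMap.mkContinuous (σ := RingHom.id ℝ) (E := E) (F := C(OnePoint ℕ × Icc 0 S, E))
      { toFun := fun ζ => ⟨fun x => OnePoint.tailIndicator l x.1 • ζ, by fun_prop⟩
        map_add' := fun ζ ζ' => by ext; simp
        map_smul' := fun c ζ => by ext; simp [smul_comm c] } 1 (fun ζ => by
      rw [one_mul, ContinuousMap.norm_le _ (norm_nonneg _)]
      intro x
      change ‖OnePoint.tailIndicator l x.1 • ζ‖ ≤ _
      rw [norm_smul, Real.norm_eq_abs]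
      exact mul_le_of_le_one_left (norm_nonneg _) (OnePoint.abs_tailIndicator_le l x.1))
  let yb : C(OnePoint ℕ × Icc 0 S, E) :=
    ⟨fun x => y₀ x - OnePoint.tailIndicator l x.1 • y₀ x, by fun_prop⟩
  -- The right-hand side is ζ on the tail and the unchanged residual at the other indices. It is
  -- affine in ζ, hence smooth.
  let Y : E → C(OnePoint ℕ × Icc 0 S, E) := fun ζ => yb + Λ ζ
  have hYapp : ∀ ζ x, Y ζ x = y₀ x + OnePoint.tailIndicator l x.1 • (ζ - y₀ x) := by
    intro ζ x
    change y₀ x - OnePoint.tailIndicator l x.1 • y₀ x + OnePoint.tailIndicator l x.1 • ζ = _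
    rw [smul_sub]; abel
  have hYc : ContDiff ℝ r Y := contDiff_const.add Λ.contDiff
  have hY0 : Y ζ₀ ∈ Metric.ball y₀ ρ := by
    rw [mem_ball_iff_norm]
    refine lt_of_le_of_lt ?_ (half_lt_self hρ)
    rw [ContinuousMap.norm_le _ (by positivity)]
    intro x
    rw [ContinuousMap.sub_apply, hYapp, add_sub_cancel_left]
    exact (hl x.1 x.2).le
  obtain ⟨hsm0, -, hg0, hinv0⟩ := hball _ hY0
  have hΦY : ContDiffAt ℝ r (fun ζ => Φ (Y ζ)) ζ₀ := hsm0.comp ζ₀ hYc.contDiffAt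
  -- the limit solution is the given one
  have hbase : ∀ s : Icc (0 : ℝ) S, Φ (Y ζ₀) (∞, s) = z₀ s := by
    have hres0 := (hball _ hY0).2.1
    have e1 : integralResidual hS A'' F'' (R (Φ (Y ζ₀))) = integralResidual hS A'' F'' zU := by
      rw [hRes _ hg0, hres0, show zU = R zK from rfl, hRes _ (fun x j => (hF' j x).continuousAt)]
      ext x
      change Y ζ₀ (∞, x.2) = y₀ (∞, x.2)
      rw [hYapp, hy₀_infty]; simp
    rw [e1, hΦ0''] at hinv0
    intro s
    have := congrArg (fun f : C(Unit × Icc 0 S, E) => f ((), s)) hinv0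
    exact this.symm
  refine ⟨fun κ ζ σ => Φ (Y ζ) (κ, projIcc 0 S hS σ), fun σ _ => ?_, fun σ hσ => ?_,
    fun P hP => ?_, ?_⟩
  · have := ContDiffFamAt.of_contDiffAt_continuousMap hΦY ((∞ : OnePoint ℕ), projIcc 0 S hS σ)
    exact ContDiffFamAt.comp_param (φ := fun κ : OnePoint ℕ => (κ, projIcc 0 S hS σ))
      (by fun_prop) this
  · simp only [hbase, projIcc_of_mem hS hσ]
  · have h1 : ∀ᶠ y in 𝓝 ((∞ : OnePoint ℕ), ζ₀), ∀ s ∈ (univ : Set (Icc (0 : ℝ) S)),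
        P (y.1, Φ (Y y.2) (y.1, s)) := by
      refine isCompact_univ.eventually_forall_of_forall_eventually fun s _ => ?_
      have hc1 : ContinuousAt (fun p : (OnePoint ℕ × E) × Icc (0 : ℝ) S =>
          (Φ (Y p.1.2), (p.1.1, p.2))) ((∞, ζ₀), s) := by
        refine ContinuousAt.prodMk ?_ (by fun_prop)
        exact ContinuousAt.comp (f := fun p : (OnePoint ℕ × E) × Icc (0 : ℝ) S => p.1.2)
          (g := fun ζ => Φ (Y ζ)) hΦY.continuousAt (by fun_prop)
      have hc2 : ContinuousAt (fun p : (OnePoint ℕ × E) × Icc (0 : ℝ) S =>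
          Φ (Y p.1.2) (p.1.1, p.2)) ((∞, ζ₀), s) :=
        ContinuousAt.comp (f := fun p : (OnePoint ℕ × E) × Icc (0 : ℝ) S =>
          (Φ (Y p.1.2), (p.1.1, p.2)))
          (g := fun w : C(OnePoint ℕ × Icc 0 S, E) × (OnePoint ℕ × Icc 0 S) => w.1 w.2)
          (by fun_prop) hc1
      have hc3 : Tendsto (fun p : (OnePoint ℕ × E) × Icc (0 : ℝ) S =>
          (p.1.1, Φ (Y p.1.2) (p.1.1, p.2))) (𝓝 ((∞, ζ₀), s)) (𝓝 (∞, z₀ s)) := by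
        have : ContinuousAt (fun p : (OnePoint ℕ × E) × Icc (0 : ℝ) S =>
          (p.1.1, Φ (Y p.1.2) (p.1.1, p.2))) ((∞, ζ₀), s) :=
            ContinuousAt.prodMk (by fun_prop) hc2
        simpa [ContinuousAt, hbase] using this
      exact hc3.eventually (hP s s.2)
    filter_upwards [h1] with y hy σ _ using hy _ trivial
  · have h1 : ∀ᶠ y in 𝓝 ((∞ : OnePoint ℕ), ζ₀), Y y.2 ∈ Metric.ball y₀ ρ :=
      ((hYc.continuous.comp continuous_snd).tendsto (∞, ζ₀)).eventually
        (Metric.isOpen_ball.mem_nhds hY0)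
    have h2 := (continuous_fst.tendsto ((∞ : OnePoint ℕ), ζ₀)).eventually
      ((OnePoint.eventually_tail_eq m).and (OnePoint.eventually_tailIndicator_eq l))
    filter_upwards [h1, h2] with y hy1 hy2
    obtain ⟨-, hres, hg, -⟩ := hball _ hy1
    refine ⟨by fun_prop, fun σ hσ => ?_⟩
    have e := congrArg (fun f : C(OnePoint ℕ × Icc 0 S, E) => f (y.1, projIcc 0 S hS σ)) hres
    rw [hYapp, integralResidual_apply fun j x => hg x j] at e
    simp only [hy2.2, one_smul, add_sub_cancel] at e
    rw [sub_eq_iff_eq_add] at e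
    simp only [A', F', DensityFamily.comp, hy2.1] at e
    rw [e, projIcc_of_mem hS hσ]

end SolutionFamily

/-! ### Differential form of the integral equations -/

section Calculus

variable {E : Type} [NormedAddCommGroup E] [NormedSpace ℝ E]

theorem hasDerivWithinAt_integral_smul [CompleteSpace E] {S : ℝ} {a : ℝ → ℝ} {G : ℝ → E}
    (ha : IntervalIntegrable a MeasureTheory.volume 0 S) (hG : ContinuousOn G (Icc 0 S)) {σ : ℝ}
    (hσ : σ ∈ Icc 0 S) (hc : ContinuousWithinAt a (Icc 0 S) σ) :
    HasDerivWithinAt (fun u => ∫ s in (0 : ℝ)..u, a s • G s) (a σ • G σ) (Icc 0 S) σ := by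
  have hS : (0 : ℝ) ≤ S := hσ.1.trans hσ.2
  have hint : IntervalIntegrable (fun s => a s • G s) MeasureTheory.volume 0 S :=
    ha.smul_continuousOn (by rwa [uIcc_of_le hS])
  have : Fact (σ ∈ Icc 0 S) := ⟨hσ⟩
  refine intervalIntegral.integral_hasDerivWithinAt_right (t := Icc 0 S)
    (hint.mono_set ?_) ?_ (hc.smul (hG σ hσ))
  · rw [uIcc_of_le hσ.1, uIcc_of_le hS]
    exact Icc_subset_Icc_right hσ.2
  · refine ⟨Icc 0 S, self_mem_nhdsWithin, ?_⟩
    have := hint.aestronglyMeasurable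
    rw [MeasureTheory.Measure.restrict_congr_set MeasureTheory.Ioc_ae_eq_Icc] at this
    exact this

/-- Exceptional points have to be allowed because the limit densities jump at the edge of the layer.
-/
theorem eq_of_hasDerivAt_zero_off_countable [CompleteSpace E] {S : ℝ} {f : ℝ → E}
    (hf : ContinuousOn f (Icc 0 S)) {c : Set ℝ} (hc : c.Countable)
    (h : ∀ σ ∈ Ioo 0 S \ c, HasDerivAt f 0 σ) : ∀ σ ∈ Icc 0 S, f σ = f 0 := by
  intro σ hσ
  have := MeasureTheory.integral_eq_of_hasDerivAt_off_countable_of_le f (fun _ => 0) hσ.1 hc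
    (hf.mono (Icc_subset_Icc_right hσ.2))
    (fun x hx => h x ⟨⟨hx.1.1, hx.1.2.trans_le hσ.2⟩, hx.2⟩) intervalIntegrable_const
  rw [intervalIntegral.integral_zero] at this
  exact (sub_eq_zero.1 this.symm)

/-- This converts auxiliary parameters back into time. One-sided derivatives at the end points are
included, since arcs are glued there. -/
theorem exists_inverse_of_deriv_pos {τ τ' : ℝ → ℝ} {S : ℝ} (hS : 0 ≤ S)
    (h : ∀ σ ∈ Icc 0 S, HasDerivWithinAt τ (τ' σ) (Icc 0 S) σ)
    (hpos : ∀ σ ∈ Icc 0 S, 0 < τ' σ) :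
    τ 0 ≤ τ S ∧ ∃ θ : ℝ → ℝ, (∀ σ ∈ Icc 0 S, θ (τ σ) = σ ∧ τ σ ∈ Icc (τ 0) (τ S)) ∧
      ∀ t ∈ Icc (τ 0) (τ S), θ t ∈ Icc 0 S ∧ τ (θ t) = t ∧
        HasDerivWithinAt θ (τ' (θ t))⁻¹ (Icc (τ 0) (τ S)) t := by
  have h0 : (0 : ℝ) ∈ Icc 0 S := ⟨le_rfl, hS⟩
  have h1 : S ∈ Icc 0 S := ⟨hS, le_rfl⟩
  have hcont : ContinuousOn τ (Icc 0 S) := fun σ hσ => (h σ hσ).continuousWithinAt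
  have hmono : StrictMonoOn τ (Icc 0 S) := by
    refine strictMonoOn_of_deriv_pos (convex_Icc _ _) hcont fun σ hσ => ?_
    have hσ' : σ ∈ Icc 0 S := interior_subset hσ
    have := (h σ hσ').hasDerivAt (mem_interior_iff_mem_nhds.1 hσ)
    rw [this.deriv]
    exact hpos σ hσ'
  have hle : τ 0 ≤ τ S := hmono.monotoneOn h0 h1 hS
  have hmaps : ∀ σ ∈ Icc 0 S, τ σ ∈ Icc (τ 0) (τ S) := fun σ hσ =>
    ⟨hmono.monotoneOn h0 hσ hσ.1, hmono.monotoneOn hσ h1 hσ.2⟩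
  have hsurj : SurjOn τ (Icc 0 S) (Icc (τ 0) (τ S)) := intermediate_value_Icc hS hcont
  let f : Icc 0 S → Icc (τ 0) (τ S) := fun σ => ⟨τ σ, hmaps σ σ.2⟩
  have hf : StrictMono f := fun σ σ' hlt => hmono σ.2 σ'.2 hlt
  have hfs : Function.Surjective f := fun t => by
    obtain ⟨σ, hσ, e⟩ := hsurj t.2
    exact ⟨⟨σ, hσ⟩, Subtype.ext e⟩
  let e := StrictMono.orderIsoOfSurjective f hf hfs
  let θ : ℝ → ℝ := fun t => (IccExtend hle (fun x => e.symm x) t : Icc 0 S)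
  have hθc : Continuous θ := continuous_subtype_val.comp e.symm.continuous.Icc_extend'
  have hθ : ∀ t (ht : t ∈ Icc (τ 0) (τ S)), θ t = e.symm ⟨t, ht⟩ := fun t ht => by
    simp only [θ]; rw [IccExtend_of_mem hle _ ht]
  have hmem : ∀ t ∈ Icc (τ 0) (τ S), θ t ∈ Icc 0 S := fun t ht => by
    rw [hθ t ht]; exact (e.symm ⟨t, ht⟩).2
  have hinv : ∀ t ∈ Icc (τ 0) (τ S), τ (θ t) = t := fun t ht => by
    rw [hθ t ht]
    exact congrArg Subtype.val (e.apply_symm_apply ⟨t, ht⟩)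
  refine ⟨hle, θ, fun σ hσ => ⟨?_, hmaps σ hσ⟩, fun t ht => ⟨hmem t ht, hinv t ht, ?_⟩⟩
  · exact hmono.injOn (hmem _ (hmaps σ hσ)) hσ (hinv _ (hmaps σ hσ))
  · have hd := h _ (hmem t ht)
    have hne := (hpos _ (hmem t ht)).ne'
    have key := HasFDerivWithinAt.of_local_left_inverse (g := θ) (f := τ)
      (f' := ContinuousLinearEquiv.unitsEquivAut ℝ (Units.mk0 (τ' (θ t)) hne)) (a := t)
      (s := Icc (τ 0) (τ S)) (t := Icc 0 S)
      (hθc.continuousWithinAt.tendsto_nhdsWithin hmem)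
      (by
        refine hd.hasFDerivWithinAt.congr_fderiv ?_
        ext; simp) ht
      (by filter_upwards [self_mem_nhdsWithin] with x hx using hinv x hx)
    refine key.hasDerivWithinAt.congr_deriv ?_
    simp

theorem hasDerivWithinAt_concat {η₁ η₂ : ℝ → E} {t₁ t₂ s : ℝ} {v : E} (ht₁ : 0 ≤ t₁)
    (ht₂ : 0 ≤ t₂) (h₁ : s ≤ t₁ → HasDerivWithinAt η₁ v (Icc 0 t₁) s)
    (h₂ : t₁ ≤ s → HasDerivWithinAt η₂ v (Icc 0 t₂) (s - t₁)) (h : η₁ t₁ = η₂ 0) :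
    HasDerivWithinAt (fun u => if u ≤ t₁ then η₁ u else η₂ (u - t₁)) v (Icc 0 (t₁ + t₂)) s := by
  rw [← Icc_union_Icc_eq_Icc ht₁ (le_add_of_nonneg_right ht₂)]
  refine HasDerivWithinAt.union ?_ ?_
  · rcases le_or_gt s t₁ with hs | hs
    · exact (h₁ hs).congr (fun u hu => by simp [hu.2]) (by simp [hs])
    · refine HasFDerivWithinAt.of_notMem_closure ?_
      rw [closure_Icc]
      exact fun h => absurd h.2 (not_le.2 hs)
  · rcases le_or_gt t₁ s with hs | hs
    · have h3 : HasDerivWithinAt (fun u => η₂ (u - t₁)) v (Icc t₁ (t₁ + t₂)) s := by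
        have hm : MapsTo (fun u => u - t₁) (Icc t₁ (t₁ + t₂)) (Icc 0 t₂) := fun u hu =>
          ⟨by linarith [hu.1], by linarith [hu.2]⟩
        have := HasDerivWithinAt.scomp s (h₂ hs)
          ((hasDerivWithinAt_id s (Icc t₁ (t₁ + t₂))).sub_const t₁) hm
        simpa [Function.comp_def] using this
      have e : ∀ u, t₁ ≤ u → (if u ≤ t₁ then η₁ u else η₂ (u - t₁)) = η₂ (u - t₁) := by
        intro u hu
        split_ifs with h'
        · obtain rfl : u = t₁ := le_antisymm h' hu
          simpa using h
        · rfl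
      exact h3.congr (fun u hu => e u hu.1) (e s hs)
    · refine HasFDerivWithinAt.of_notMem_closure ?_
      rw [closure_Icc]
      exact fun h => absurd h.1 (not_le.2 hs)

end Calculus

/-! ### Differential equations whose densities converge in the mean -/

section FlowFamily

open OnePoint

variable {S : ℝ} {E : Type} [NormedAddCommGroup E] [NormedSpace ℝ E] {ι : Type} [Fintype ι]

/-- Smooth dependence on the initial value, and convergence as the parameter tends to `∞`, of the
solutions of `z' = ∑ j, a_j(σ) F_j(z)`. -/
theorem exists_flow_family [FiniteDimensional ℝ E] {r : ℕ} (hr : 1 ≤ r) (hS : 0 ≤ S)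
    (A : ι → DensityFamily (OnePoint ℕ) S) (F : ι → OnePoint ℕ → E → E) (z₀ : ℝ → E)
    (hz₀ : ContinuousOn z₀ (Icc 0 S)) {c : Set ℝ} (hc : c.Countable)
    (hd : ∀ σ ∈ Ioo 0 S \ c, HasDerivAt z₀ (∑ j, (A j).a ∞ σ • F j ∞ (z₀ σ)) σ)
    (hF : ∀ j, ∀ σ ∈ Icc 0 S, ContDiffFamAt r (F j) (∞, z₀ σ)) :
    ∃ Z : OnePoint ℕ → E → ℝ → E,
      (∀ σ ∈ Icc 0 S, ContDiffFamAt r (fun κ ζ => Z κ ζ σ) (∞, z₀ 0)) ∧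
      (∀ σ ∈ Icc 0 S, Z ∞ (z₀ 0) σ = z₀ σ) ∧
      (∀ P : OnePoint ℕ × E → Prop, (∀ σ ∈ Icc 0 S, ∀ᶠ y in 𝓝 (∞, z₀ σ), P y) →
        ∀ᶠ y in 𝓝 (∞, z₀ 0), ∀ σ ∈ Icc 0 S, P (y.1, Z y.1 y.2 σ)) ∧
      ∀ᶠ y in 𝓝 (∞, z₀ 0), Continuous (Z y.1 y.2) ∧ Z y.1 y.2 0 = y.2 ∧
        ∀ σ ∈ Icc 0 S, (∀ j, ContinuousWithinAt ((A j).a y.1) (Icc 0 S) σ) →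
          HasDerivWithinAt (Z y.1 y.2) (∑ j, (A j).a y.1 σ • F j y.1 (Z y.1 y.2 σ))
            (Icc 0 S) σ := by
  have : CompleteSpace E := FiniteDimensional.complete ℝ E
  have h0 : (0 : ℝ) ∈ Icc 0 S := ⟨le_rfl, hS⟩
  have hFc : ∀ j, ContinuousOn (fun s => F j ∞ (z₀ s)) (Icc 0 S) := fun j σ hσ => by
    have h1 : ContinuousAt (F j ∞) (z₀ σ) := (hF j σ hσ).contDiffAt.continuousAt
    exact h1.comp_continuousWithinAt (hz₀ σ hσ)
  have hi : ∀ j, ∀ σ ∈ Icc 0 S, IntervalIntegrable (fun s => (A j).a ∞ s • F j ∞ (z₀ s))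
      MeasureTheory.volume 0 σ := fun j σ hσ =>
    ((A j).intervalIntegrable ∞ hσ).smul_continuousOn (by
      rw [uIcc_of_le hσ.1]; exact (hFc j).mono (Icc_subset_Icc_right hσ.2))
  -- The limit path is continuous and satisfies the equation off a countable set, which suffices for
  -- the fundamental theorem of calculus and hence for the integral equation.
  obtain ⟨Z, h1, h2, h3, h4⟩ := exists_solution_family hr hS A F z₀ hz₀ (fun σ hσ => by
    have := MeasureTheory.integral_eq_of_hasDerivAt_off_countable_of_le z₀ _ hσ.1 hc
      (hz₀.mono (Icc_subset_Icc_right hσ.2))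
      (fun x hx => hd x ⟨⟨hx.1.1, hx.1.2.trans_le hσ.2⟩, hx.2⟩)
      (by
        have := IntervalIntegrable.sum Finset.univ fun j _ => hi j σ hσ
        simpa [Finset.sum_fn] using this)
    rw [← intervalIntegral.integral_finsetSum fun j _ => hi j σ hσ]
    rw [← sub_eq_iff_eq_add', ← this]
    ) hF
  refine ⟨Z, h1, h2, h3, ?_⟩
  -- The neighbouring solutions stay where the fields are smooth, so the integrands are continuous
  -- and the integral equation can be differentiated wherever the densities are continuous.
  have h5 := h3 (fun y => ∀ j, ContDiffFamAt r (F j) y) fun σ hσ => by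
    rw [eventually_all]
    exact fun j => (hF j σ hσ).eventually
  filter_upwards [h4, h5] with y ⟨hy1, hy2⟩ hy3
  refine ⟨hy1, by simpa using hy2 0 h0, fun σ hσ hcont => ?_⟩
  have h6 : HasDerivWithinAt (fun σ => y.2 + ∑ j, ∫ s in (0 : ℝ)..σ,
      (A j).a y.1 s • F j y.1 (Z y.1 y.2 s)) (∑ j, (A j).a y.1 σ • F j y.1 (Z y.1 y.2 σ))
      (Icc 0 S) σ := by
    refine HasDerivWithinAt.const_add _ (HasDerivWithinAt.fun_sum fun j _ => ?_)
    refine hasDerivWithinAt_integral_smul ((A j).integrable y.1) (fun s hs => ?_) hσ (hcont j)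
    have h7 : ContinuousAt (F j y.1) (Z y.1 y.2 s) := (hy3 s hs j).contDiffAt.continuousAt
    exact (h7.comp hy1.continuousAt).continuousWithinAt
  exact h6.congr hy2 (hy2 σ hσ)

/-- The constant density. -/
def DensityFamily.one (K : Type) [TopologicalSpace K] (S : ℝ) : DensityFamily K S where
  a _ _ := 1
  M := 1
  bound _ _ := by simp
  integrable _ := intervalIntegrable_const
  tendsto _ := by simp

/-- The autonomous case of `exists_flow_family`. -/
theorem exists_autonomous_flow_family [FiniteDimensional ℝ E] {r : ℕ} (hr : 1 ≤ r) (hS : 0 ≤ S)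
    (F : OnePoint ℕ → E → E) (z₀ : ℝ → E) (hd : ∀ σ ∈ Icc 0 S, HasDerivAt z₀ (F ∞ (z₀ σ)) σ)
    (hF : ∀ σ ∈ Icc 0 S, ContDiffFamAt r F (∞, z₀ σ)) :
    ∃ Z : OnePoint ℕ → E → ℝ → E,
      (∀ σ ∈ Icc 0 S, ContDiffFamAt r (fun κ ζ => Z κ ζ σ) (∞, z₀ 0)) ∧
      (∀ σ ∈ Icc 0 S, Z ∞ (z₀ 0) σ = z₀ σ) ∧
      (∀ P : OnePoint ℕ × E → Prop, (∀ σ ∈ Icc 0 S, ∀ᶠ y in 𝓝 (∞, z₀ σ), P y) →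
        ∀ᶠ y in 𝓝 (∞, z₀ 0), ∀ σ ∈ Icc 0 S, P (y.1, Z y.1 y.2 σ)) ∧
      ∀ᶠ y in 𝓝 (∞, z₀ 0), Z y.1 y.2 0 = y.2 ∧
        ∀ σ ∈ Icc 0 S, HasDerivWithinAt (Z y.1 y.2) (F y.1 (Z y.1 y.2 σ)) (Icc 0 S) σ := by
  obtain ⟨Z, h1, h2, h3, h4⟩ := exists_flow_family (ι := Unit) hr hS
    (fun _ => DensityFamily.one (OnePoint ℕ) S) (fun _ => F) z₀
    (fun σ hσ => (hd σ hσ).continuousAt.continuousWithinAt) countable_empty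
    (fun σ hσ => by simpa [DensityFamily.one] using hd σ (Ioo_subset_Icc_self hσ.1))
    (fun _ => hF)
  refine ⟨Z, h1, h2, h3, ?_⟩
  filter_upwards [h4] with y hy
  refine ⟨hy.2.1, fun σ hσ => ?_⟩
  simpa [DensityFamily.one] using hy.2.2 σ hσ (fun _ => continuousWithinAt_const)

end FlowFamily

/-! ### Arcs of Hamiltonian trajectories -/

section HamiltonianArc

variable {d : ℕ} {U : Config d → ℝ}

/-- The Hamiltonian flow moves `ρ` to `ρ'` in the time `t ≥ 0`. -/
def HamiltonianArc (U : Config d → ℝ) (ρ : PhaseSpace d) (t : ℝ) (ρ' : PhaseSpace d) : Prop :=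
  0 ≤ t ∧ ∃ η : ℝ → PhaseSpace d, η 0 = ρ ∧ η t = ρ' ∧ IsHamiltonianTrajectory U t η

theorem HamiltonianArc.trans {ρ ρ' ρ'' : PhaseSpace d} {s t : ℝ} (h : HamiltonianArc U ρ s ρ')
    (h' : HamiltonianArc U ρ' t ρ'') : HamiltonianArc U ρ (s + t) ρ'' := by
  obtain ⟨hs, η₁, h10, h11, h1⟩ := h
  obtain ⟨ht, η₂, h20, h21, h2⟩ := h'
  refine ⟨add_nonneg hs ht, fun u => if u ≤ s then η₁ u else η₂ (u - s), by simp [hs, h10],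
    ?_, fun u hu => ?_⟩
  · by_cases hts : s + t ≤ s
    · obtain rfl : t = 0 := by linarith
      simp [h11, ← h21, h20]
    · simp [hts, h21]
  · refine hasDerivWithinAt_concat hs ht (fun hus => ?_) (fun hus => ?_) (by rw [h11, h20])
    · simp only [hus, if_true]
      exact h1 u ⟨hu.1, hus⟩
    · have e : (if u ≤ s then η₁ u else η₂ (u - s)) = η₂ (u - s) := by
        split_ifs with h'
        · obtain rfl : u = s := le_antisymm h' hus
          simp [h11, h20]
        · rfl
      simp only [e]
      exact h2 (u - s) ⟨by linarith, by linarith [hu.2]⟩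

theorem contDiff_hamiltonian_field (hU : ContDiff ℝ 2 U) :
    ContDiff ℝ 1 (fun ρ : PhaseSpace d => ((ρ.2, -gradient U ρ.1) : PhaseSpace d)) := by
  have h1 : ContDiff ℝ 1 (fderiv ℝ U) := hU.fderiv_right (by norm_num)
  have h2 : ContDiff ℝ 1 (fun q => gradient U q) :=
    (InnerProductSpace.toDual ℝ (Config d)).symm.toContinuousLinearEquiv.contDiff.comp h1
  exact contDiff_snd.prodMk (h2.comp contDiff_fst).neg

theorem IsHamiltonianTrajectory.hasDerivWithinAt_Ici {T : ℝ} {η : ℝ → PhaseSpace d}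
    (h : IsHamiltonianTrajectory U T η) {t : ℝ} (ht : t ∈ Ico 0 T) :
    HasDerivWithinAt η ((η t).2, -gradient U (η t).1) (Ici t) t :=
  (h t (Ico_subset_Icc_self ht)).mono_of_mem_nhdsWithin
    (Filter.mem_of_superset (Icc_mem_nhdsGE ht.2) (Icc_subset_Icc_left ht.1))

/-- The field is only locally Lipschitz, but the two orbits fill a compact set, on which it is
Lipschitz. -/
theorem IsHamiltonianTrajectory.eqOn (hU : ContDiff ℝ 2 U) {T : ℝ} {η η' : ℝ → PhaseSpace d}
    (h : IsHamiltonianTrajectory U T η) (h' : IsHamiltonianTrajectory U T η')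
    (h0 : η 0 = η' 0) : EqOn η η' (Icc 0 T) := by
  have hc : ContinuousOn η (Icc 0 T) := fun s hs => (h s hs).continuousWithinAt
  have hc' : ContinuousOn η' (Icc 0 T) := fun s hs => (h' s hs).continuousWithinAt
  set Y : PhaseSpace d → PhaseSpace d := fun ρ => (ρ.2, -gradient U ρ.1) with hY
  set K : Set (PhaseSpace d) := η '' Icc 0 T ∪ η' '' Icc 0 T with hKdef
  have hK : IsCompact K :=
    (isCompact_Icc.image_of_continuousOn hc).union (isCompact_Icc.image_of_continuousOn hc')
  have hlip : LocallyLipschitzOn K Y :=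
    (contDiff_hamiltonian_field hU).locallyLipschitz.locallyLipschitzOn
  obtain ⟨C, hC⟩ := hlip.exists_lipschitzOnWith_of_compact hK
  exact ODE_solution_unique_of_mem_Icc_right (v := fun _ => Y) (s := fun _ => K)
    (fun t _ => hC) hc (fun t ht => h.hasDerivWithinAt_Ici ht)
    (fun t ht => Or.inl ⟨t, Ico_subset_Icc_self ht, rfl⟩) hc'
    (fun t ht => h'.hasDerivWithinAt_Ici ht)
    (fun t ht => Or.inr ⟨t, Ico_subset_Icc_self ht, rfl⟩) h0

theorem HamiltonianArc.hamiltonianFlow_eq (hU : ContDiff ℝ 2 U) {ρ ρ' : PhaseSpace d} {t : ℝ}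
    (h : HamiltonianArc U ρ t ρ') : hamiltonianFlow U t ρ = ρ' := by
  obtain ⟨ht, η, h0, h1, hη⟩ := h
  have hex : ∃ γ : ℝ → PhaseSpace d, γ 0 = ρ ∧ IsHamiltonianTrajectory U t γ := ⟨η, h0, hη⟩
  rw [hamiltonianFlow, dif_pos hex, ← h1]
  exact IsHamiltonianTrajectory.eqOn hU hex.choose_spec.2 hη
    (by rw [hex.choose_spec.1, h0]) ⟨ht, le_rfl⟩

/-- A curve which follows the Hamiltonian vector field with positive speed is an arc of a
trajectory. -/
theorem HamiltonianArc.of_reparametrization {S : ℝ} (hS : 0 ≤ S) {q p : ℝ → Config d}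
    {τ τ' : ℝ → ℝ}
    (hq : ∀ σ ∈ Icc 0 S, HasDerivWithinAt q (τ' σ • p σ) (Icc 0 S) σ)
    (hp : ∀ σ ∈ Icc 0 S, HasDerivWithinAt p (-(τ' σ • gradient U (q σ))) (Icc 0 S) σ)
    (hτ : ∀ σ ∈ Icc 0 S, HasDerivWithinAt τ (τ' σ) (Icc 0 S) σ)
    (hpos : ∀ σ ∈ Icc 0 S, 0 < τ' σ) :
    HamiltonianArc U (q 0, p 0) (τ S - τ 0) (q S, p S) := by
  obtain ⟨hle, θ, hθ1, hθ2⟩ := exists_inverse_of_deriv_pos hS hτ hpos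
  have e0 := (hθ1 0 ⟨le_rfl, hS⟩).1
  have e1 := (hθ1 S ⟨hS, le_rfl⟩).1
  refine ⟨sub_nonneg.2 hle, fun t => (q (θ (t + τ 0)), p (θ (t + τ 0))), by simp [e0],
    by simp [e1], fun t ht => ?_⟩
  have ht' : t + τ 0 ∈ Icc (τ 0) (τ S) := ⟨by linarith [ht.1], by linarith [ht.2]⟩
  obtain ⟨hm, hinv, hd⟩ := hθ2 _ ht'
  have hd' : HasDerivWithinAt (fun t => θ (t + τ 0)) (τ' (θ (t + τ 0)))⁻¹
      (Icc 0 (τ S - τ 0)) t := by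
    have hm' : MapsTo (fun u => u + τ 0) (Icc 0 (τ S - τ 0)) (Icc (τ 0) (τ S)) := fun u hu =>
      ⟨by linarith [hu.1], by linarith [hu.2]⟩
    have := HasDerivWithinAt.comp t hd
      ((hasDerivWithinAt_id t (Icc 0 (τ S - τ 0))).add_const (τ 0)) hm'
    simpa [Function.comp_def] using this
  have hmaps : MapsTo (fun t => θ (t + τ 0)) (Icc 0 (τ S - τ 0)) (Icc 0 S) := fun u hu =>
    (hθ2 _ ⟨by linarith [hu.1], by linarith [hu.2]⟩).1
  have hne := (hpos _ hm).ne'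
  have h1 := HasDerivWithinAt.scomp t (hq _ hm) hd' hmaps
  have h2 := HasDerivWithinAt.scomp t (hp _ hm) hd' hmaps
  refine (h1.prodMk h2).congr_deriv ?_
  simp [smul_smul, hne]

end HamiltonianArc

/-! ### Arcs of billiard trajectories -/

/-- Two different unit vectors are separated by the direction e = `v` - `v'`: it has positive
product with `v` and negative product with `v'`. A short step along e would lie in `D` by the first
description and outside by the second. -/
theorem IsInwardUnitNormal.unique {d : ℕ} {D : Set (Config d)} {q v v' : Config d}
    (h : IsInwardUnitNormal D q v) (h' : IsInwardUnitNormal D q v') : v = v' := by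
  obtain ⟨hv, f, -, hf0, hf, hD⟩ := h
  obtain ⟨hv', f', -, hf0', hf', hD'⟩ := h'
  by_contra hne
  have hlt : inner ℝ v v' < 1 := by
    have := inner_lt_one_iff_real_of_norm_eq_one hv hv'
    exact this.2 hne
  have hvv : inner ℝ v v = (1 : ℝ) := by rw [real_inner_self_eq_norm_sq, hv]; norm_num
  have hvv' : inner ℝ v' v' = (1 : ℝ) := by rw [real_inner_self_eq_norm_sq, hv']; norm_num
  set e := v - v' with he
  have hline : ∀ {g : Config d → ℝ} {w : Config d}, HasGradientAt g w q →
      HasDerivAt (fun t : ℝ => g (q + t • e)) (inner ℝ w e) 0 := by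
    intro g w hg
    have h1 : HasDerivAt (fun t : ℝ => q + t • e) e 0 := by
      simpa using ((hasDerivAt_id (0 : ℝ)).smul_const e).const_add q
    have h2 : HasFDerivAt g (InnerProductSpace.toDual ℝ (Config d) w) (q + (0 : ℝ) • e) := by
      simpa using hg.hasFDerivAt
    have h3 := h2.comp_hasDerivAt (0 : ℝ) h1
    rw [InnerProductSpace.toDual_apply_apply] at h3
    exact h3
  have h1 : 0 < inner ℝ v e := by rw [he, inner_sub_right, hvv]; linarith
  have h2 : inner ℝ v' e < 0 := by rw [he, inner_sub_right, hvv', real_inner_comm]; linarith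
  have hq : Tendsto (fun t : ℝ => q + t • e) (𝓝[>] 0) (𝓝 q) := by
    have : Continuous (fun t : ℝ => q + t • e) := by fun_prop
    have := this.tendsto 0
    rw [zero_smul, add_zero] at this
    exact this.mono_left nhdsWithin_le_nhds
  have p1 : ∀ᶠ t : ℝ in 𝓝[>] 0, 0 < f (q + t • e) := by
    have := (hline hf).tendsto_slope_zero_right
    filter_upwards [this.eventually (lt_mem_nhds h1), self_mem_nhdsWithin] with t ht ht0
    simp only [zero_add, zero_smul, add_zero, hf0, sub_zero, smul_eq_mul] at ht
    have ht0' : (0 : ℝ) < t := ht0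
    by_contra hcon
    exact absurd ht (not_lt.2 (mul_nonpos_of_nonneg_of_nonpos (inv_nonneg.2 ht0'.le)
      (not_lt.1 hcon)))
  have p2 : ∀ᶠ t : ℝ in 𝓝[>] 0, f' (q + t • e) < 0 := by
    have := (hline hf').tendsto_slope_zero_right
    filter_upwards [this.eventually (gt_mem_nhds h2), self_mem_nhdsWithin] with t ht ht0
    simp only [zero_add, zero_smul, add_zero, hf0', sub_zero, smul_eq_mul] at ht
    have ht0' : (0 : ℝ) < t := ht0
    by_contra hcon
    exact absurd ht (not_lt.2 (mul_nonneg (inv_nonneg.2 ht0'.le) (not_lt.1 hcon)))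
  obtain ⟨t, ht1, ht2, ht3, ht4⟩ :=
    (p1.and (p2.and ((hq.eventually hD).and (hq.eventually hD')))).exists
  exact absurd (ht4.1 (ht3.2 ht1.le)) (not_le.2 ht2)

section BilliardArc

variable {d r n : ℕ} {L : AddSubgroup (Config d)} {B : BilliardTable d r n L}

theorem BilliardTable.corners_subset_frontier (B : BilliardTable d r n L) :
    B.corners ⊆ frontier B.D := by
  rw [B.frontier_eq]
  exact iUnion_mono fun i => sdiff_subset

theorem BilliardTable.mem_of_mem_interior {q : Config d} (h : q ∈ interior B.D) :
    q ∈ B.D \ B.corners :=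
  ⟨interior_subset h, fun hc => (B.corners_subset_frontier hc).2 h⟩

theorem BilliardTable.mem_interior_or_frontier {q : Config d} (h : q ∈ B.D) :
    q ∈ interior B.D ∨ q ∈ frontier B.D := by
  by_cases hq : q ∈ interior B.D
  · exact Or.inl hq
  · exact Or.inr ⟨subset_closure h, hq⟩

namespace IsBilliardTrajectory

variable {T : ℝ} {γ : ℝ → PhaseSpace d}

theorem eventually_mem_interior (h : IsBilliardTrajectory B T γ) (s : ℝ) :
    ∀ᶠ u in 𝓝[≠] s, u ∈ Icc 0 T → (γ u).1 ∈ interior B.D := by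
  have hf := (h.finite_collisions.subset (sdiff_subset (t := {s}))).isClosed
  have h2 : ∀ᶠ u in 𝓝 s, u ∉ {s | s ∈ Icc 0 T ∧ (γ s).1 ∈ frontier B.D} \ {s} :=
    hf.isOpen_compl.mem_nhds (by simp)
  filter_upwards [h2.filter_mono nhdsWithin_le_nhds, self_mem_nhdsWithin] with u hu hus huT
  rcases BilliardTable.mem_interior_or_frontier (h.mem u huT).1 with h3 | h3
  · exact h3
  · exact absurd ⟨⟨huT, h3⟩, hus⟩ hu

theorem exists_free_right (h : IsBilliardTrajectory B T γ) {s : ℝ} (hs : s ∈ Ico 0 T) :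
    ∃ b ∈ Ioc s T, ∀ u ∈ Ioo s b, (γ u).1 ∈ interior B.D := by
  have h1 := (h.eventually_mem_interior s).filter_mono (nhdsGT_le_nhdsNE s)
  obtain ⟨b, hb, hb'⟩ := (mem_nhdsGT_iff_exists_Ioo_subset' hs.2).1 h1
  refine ⟨min b T, ⟨lt_min hb hs.2, min_le_right _ _⟩, fun u hu => ?_⟩
  exact hb' ⟨hu.1, hu.2.trans_le (min_le_left _ _)⟩
    ⟨hs.1.trans hu.1.le, (hu.2.trans_le (min_le_right _ _)).le⟩

theorem exists_free_left (h : IsBilliardTrajectory B T γ) {s : ℝ} (hs : s ∈ Ioc 0 T) :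
    ∃ a ∈ Ico 0 s, ∀ u ∈ Ioo a s, (γ u).1 ∈ interior B.D := by
  have h1 := (h.eventually_mem_interior s).filter_mono (nhdsLT_le_nhdsNE s)
  obtain ⟨a, ha, ha'⟩ := (mem_nhdsLT_iff_exists_Ioo_subset' hs.1).1 h1
  refine ⟨max a 0, ⟨le_max_right _ _, max_lt ha hs.1⟩, fun u hu => ?_⟩
  exact ha' ⟨(le_max_left _ _).trans_lt hu.1, hu.2⟩
    ⟨((le_max_right _ _).trans_lt hu.1).le, hu.2.le.trans hs.2⟩

/-- Between collisions the motion is free. -/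
theorem free_segment (h : IsBilliardTrajectory B T γ) {a b : ℝ} (ha : 0 ≤ a) (hab : a < b)
    (hb : b ≤ T) (hin : ∀ u ∈ Ioo a b, (γ u).1 ∈ interior B.D) :
    ∃ p, (∀ u ∈ Ioo a b, (γ u).2 = p) ∧ (∀ u ∈ Icc a b, (γ u).1 = (γ a).1 + (u - a) • p) ∧
      ((γ a).1 ∈ interior B.D → (γ a).2 = p) ∧ ((γ b).1 ∈ interior B.D → (γ b).2 = p) := by
  have hsub : Icc a b ⊆ Icc 0 T := Icc_subset_Icc ha hb
  have hd : ∀ u ∈ Ioo a b, HasDerivAt γ ((γ u).2, 0) u := fun u hu =>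
    (h.free u (hsub (Ioo_subset_Icc_self hu)) (hin u hu)).hasDerivAt
      (mem_of_superset (Ioo_mem_nhds hu.1 hu.2) (Ioo_subset_Icc_self.trans hsub))
  obtain ⟨m, hm⟩ := nonempty_Ioo.2 hab
  set p := (γ m).2 with hp
  have hd2 : ∀ u ∈ Ioo a b, HasDerivAt (fun u => (γ u).2) 0 u := fun u hu =>
    (hasFDerivAt_snd (𝕜 := ℝ) (p := γ u)).comp_hasDerivAt u (hd u hu)
  have hp2 : ∀ u ∈ Ioo a b, (γ u).2 = p := fun u hu =>
    isOpen_Ioo.is_const_of_deriv_eq_zero isPreconnected_Ioo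
      (fun u hu => (hd2 u hu).differentiableAt.differentiableWithinAt)
      (fun u hu => (hd2 u hu).deriv) hu hm
  have hd1 : ∀ u ∈ Ioo a b, HasDerivAt (fun u => (γ u).1 - u • p) 0 u := fun u hu => by
    have h1 : HasDerivAt (fun u => (γ u).1) (γ u).2 u :=
      (hasFDerivAt_fst (𝕜 := ℝ) (p := γ u)).comp_hasDerivAt u (hd u hu)
    have h2 : HasDerivAt (fun u : ℝ => u • p) ((1 : ℝ) • p) u :=
      (hasDerivAt_id u).smul_const p
    exact (h1.sub h2).congr_deriv (by rw [hp2 u hu, one_smul, sub_self])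
  have hq : EqOn (fun u => (γ u).1) (fun u => (γ m).1 - m • p + u • p) (Ioo a b) := fun u hu => by
    have := isOpen_Ioo.is_const_of_deriv_eq_zero isPreconnected_Ioo
      (fun u hu => (hd1 u hu).differentiableAt.differentiableWithinAt)
      (fun u hu => (hd1 u hu).deriv) hu hm
    simp only at this ⊢
    rw [← this]; abel
  have hq' : EqOn (fun u => (γ u).1) (fun u => (γ m).1 - m • p + u • p) (Icc a b) :=
    hq.of_subset_closure (h.continuousOn.mono hsub) (by fun_prop) Ioo_subset_Icc_self
      (by rw [closure_Ioo hab.ne])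
  have hend : ∀ s ∈ Icc a b, (γ s).1 ∈ interior B.D → (γ s).2 = p := by
    intro s hs hi
    have h1 : Tendsto (fun u => (γ u).2) (𝓝[Ioo a b] s) (𝓝 (γ s).2) :=
      ((h.free s (hsub hs) hi).continuousWithinAt.snd).mono (Ioo_subset_Icc_self.trans hsub)
    have h2 : Tendsto (fun u => (γ u).2) (𝓝[Ioo a b] s) (𝓝 p) :=
      tendsto_const_nhds.congr' (by
        filter_upwards [self_mem_nhdsWithin] with u hu using (hp2 u hu).symm)
    have : (𝓝[Ioo a b] s).NeBot := mem_closure_iff_nhdsWithin_neBot.1 (by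
      rwa [closure_Ioo hab.ne])
    exact tendsto_nhds_unique h1 h2
  refine ⟨p, hp2, fun u hu => ?_, hend a (left_mem_Icc.2 hab.le), hend b (right_mem_Icc.2 hab.le)⟩
  have e1 := hq' hu
  have e2 := hq' (left_mem_Icc.2 hab.le)
  simp only at e1 e2
  rw [e1, e2, sub_smul]; abel

theorem mem_Ioo_of_mem_frontier (h : IsBilliardTrajectory B T γ) {s : ℝ} (hs : s ∈ Icc 0 T)
    (hf : (γ s).1 ∈ frontier B.D) : s ∈ Ioo 0 T := by
  refine ⟨lt_of_le_of_ne hs.1 ?_, lt_of_le_of_ne hs.2 ?_⟩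
  · rintro rfl
    exact hf.2 h.start_inner
  · rintro rfl
    exact hf.2 h.end_inner

/-- The billiard motion is determined by its initial phase point. -/
theorem unique {γ' : ℝ → PhaseSpace d} (hT : 0 ≤ T) (h : IsBilliardTrajectory B T γ)
    (h' : IsBilliardTrajectory B T γ') (h0 : γ 0 = γ' 0) : γ T = γ' T := by
  -- At collision instants only the positions can be compared, since the momentum there is
  -- arbitrary.
  set Q : ℝ → Prop := fun u => (γ u).1 = (γ' u).1 ∧ ((γ u).1 ∈ interior B.D → γ u = γ' u) with hQ
  have hQeq : ∀ {u}, Q u → (γ u).1 ∈ interior B.D → γ u = γ' u := fun hu => hu.2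
  -- if the motions agree before `s`, they agree at `s`
  have hclosed : ∀ s ∈ Ioc 0 T, (∀ u ∈ Ico 0 s, Q u) → Q s := by
    intro s hs hu
    obtain ⟨a, ha, hfree⟩ := h.exists_free_left hs
    have hfree' : ∀ u ∈ Ioo a s, (γ' u).1 ∈ interior B.D := fun u hua => by
      rw [← (hu u ⟨ha.1.trans hua.1.le, hua.2⟩).1]; exact hfree u hua
    obtain ⟨p, hp, hq, -, hpe⟩ := h.free_segment ha.1 ha.2 hs.2 hfree
    obtain ⟨p', hp', hq', -, hpe'⟩ := h'.free_segment ha.1 ha.2 hs.2 hfree'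
    obtain ⟨m, hm⟩ := nonempty_Ioo.2 ha.2
    have hpp : p = p' := by
      rw [← hp m hm, ← hp' m hm, hQeq (hu m ⟨ha.1.trans hm.1.le, hm.2⟩) (hfree m hm)]
    have h1 : (γ s).1 = (γ' s).1 := by
      rw [hq s (right_mem_Icc.2 ha.2.le), hq' s (right_mem_Icc.2 ha.2.le), hpp,
        (hu a ⟨ha.1, ha.2⟩).1]
    refine ⟨h1, fun hi => Prod.ext h1 ?_⟩
    rw [hpe hi, hpe' (h1 ▸ hi), hpp]
  have hext : ∀ s ∈ Ico 0 T, (∀ u ∈ Icc 0 s, Q u) → ∃ b ∈ Ioc s T, ∀ u ∈ Icc 0 b, Q u := by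
    intro s hs hu
    obtain ⟨b, hb, hfree⟩ := h.exists_free_right hs
    obtain ⟨b', hb', hfree'⟩ := h'.exists_free_right hs
    obtain ⟨p, hp, hq, hpe, -⟩ := h.free_segment hs.1 hb.1 hb.2 hfree
    obtain ⟨p', hp', hq', hpe', -⟩ := h'.free_segment hs.1 hb'.1 hb'.2 hfree'
    have hs' : s ∈ Icc 0 s := ⟨hs.1, le_rfl⟩
    have hpp : p = p' := by
      rcases BilliardTable.mem_interior_or_frontier (h.mem s (Ico_subset_Icc_self hs)).1 with
        hi | hf
      · rw [← hpe hi, ← hpe' ((hu s hs').1 ▸ hi), (hu s hs').2 hi]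
      · have hsI := h.mem_Ioo_of_mem_frontier (Ico_subset_Icc_self hs) hf
        have hf' : (γ' s).1 ∈ frontier B.D := (hu s hs').1 ▸ hf
        obtain ⟨v, pin, pout, hv, hpin, hpout, e⟩ := h.reflection s hsI hf
        obtain ⟨v', pin', pout', hv', hpin', hpout', e'⟩ := h'.reflection s hsI hf'
        have hvv : v = v' := hv.unique ((hu s hs').1 ▸ hv')
        have hlim : ∀ {β : ℝ → PhaseSpace d} {c : ℝ} {w w' : Config d}, s < c →
            (∀ u ∈ Ioo s c, (β u).2 = w) → Tendsto (fun u => (β u).2) (𝓝[>] s) (𝓝 w') →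
            w = w' := by
          intro β c w w' hc hw ht
          refine tendsto_nhds_unique (tendsto_const_nhds.congr' ?_) ht
          filter_upwards [Ioo_mem_nhdsGT hc] with u hu using (hw u hu).symm
        -- Just before the collision the momenta agree. With equal incoming momenta and the unique
        -- normal, the reflection law gives equal outgoing ones.
        have hin : pin = pin' := by
          refine tendsto_nhds_unique hpin (hpin'.congr' ?_)
          filter_upwards [Ioo_mem_nhdsLT hsI.1,
            (h.eventually_mem_interior s).filter_mono (nhdsLT_le_nhdsNE s)] with u hu1 hu2
          rw [hQeq (hu u ⟨hu1.1.le, hu1.2.le⟩) (hu2 ⟨hu1.1.le, hu1.2.le.trans hs.2.le⟩)]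
        rw [hlim hb.1 hp hpout, hlim hb'.1 hp' hpout', e, e', hin, hvv]
    obtain ⟨c, hc⟩ := nonempty_Ioo.2 (lt_min hb.1 hb'.1)
    have hcb := hc.2.trans_le (min_le_left _ _)
    have hcb' := hc.2.trans_le (min_le_right _ _)
    refine ⟨c, ⟨hc.1, hcb.le.trans hb.2⟩, fun u hu' => ?_⟩
    rcases le_or_gt u s with hus | hus
    · exact hu u ⟨hu'.1, hus⟩
    · have h1 : (γ u).1 = (γ' u).1 := by
        rw [hq u ⟨hus.le, hu'.2.trans hcb.le⟩, hq' u ⟨hus.le, hu'.2.trans hcb'.le⟩, hpp,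
          (hu s hs').1]
      refine ⟨h1, fun _ => Prod.ext h1 ?_⟩
      rw [hp u ⟨hus, hu'.2.trans_lt hcb⟩, hp' u ⟨hus, hu'.2.trans_lt hcb'⟩, hpp]
  -- Continuation: the set of times up to which the motions agree is closed and can be extended to
  -- the right at each of its points before `T`.
  set R : Set ℝ := {s | ∀ u ∈ Icc 0 s, Q u} with hR
  have hQ0 : Q 0 := ⟨by rw [h0], fun _ => h0⟩
  have hR0 : (0 : ℝ) ∈ R := fun u hu => by
    obtain rfl : u = 0 := le_antisymm hu.2 hu.1
    exact hQ0
  have hRc : IsClosed (R ∩ Icc 0 T) := by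
    refine isClosed_of_closure_subset fun s hs => ?_
    have hsT : s ∈ Icc 0 T := closure_minimal inter_subset_right isClosed_Icc hs
    have hlt : ∀ u ∈ Ico 0 s, Q u := fun u hu => by
      obtain ⟨w, hw1, hw2⟩ := mem_closure_iff.1 hs (Ioi u) isOpen_Ioi hu.2
      exact hw2.1 u ⟨hu.1, le_of_lt hw1⟩
    refine ⟨fun u hu => ?_, hsT⟩
    rcases hu.2.lt_or_eq with h1 | rfl
    · exact hlt u ⟨hu.1, h1⟩
    · rcases hu.1.lt_or_eq with h2 | rfl
      · exact hclosed u ⟨h2, hsT.2⟩ hlt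
      · exact hQ0
  have hTR : T ∈ R := hRc.mem_of_ge_of_forall_exists_gt hR0 hT fun s hs => by
    obtain ⟨b, hb, hb'⟩ := hext s hs.2 hs.1
    exact ⟨b, hb', hb⟩
  exact (hTR T ⟨hT, le_rfl⟩).2 h.end_inner

end IsBilliardTrajectory

/-- The billiard flow moves the inner phase point `ρ` to the inner phase point `ρ'` in the time
`t ≥ 0`, without tangent collisions. -/
def BilliardArc (B : BilliardTable d r n L) (ρ : PhaseSpace d) (t : ℝ) (ρ' : PhaseSpace d) :
    Prop :=
  0 ≤ t ∧ ∃ β : ℝ → PhaseSpace d, β 0 = ρ ∧ β t = ρ' ∧ IsBilliardTrajectory B t β ∧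
    NoTangency B t β

/-- The flow map is defined by choosing a trajectory; uniqueness makes the choice irrelevant. -/
theorem BilliardArc.billiardFlow_eq {ρ ρ' : PhaseSpace d} {t : ℝ} (h : BilliardArc B ρ t ρ') :
    billiardFlow B t ρ = ρ' := by
  obtain ⟨ht, β, h0, h1, hβ, -⟩ := h
  have hex : ∃ γ : ℝ → PhaseSpace d, γ 0 = ρ ∧ IsBilliardTrajectory B t γ := ⟨β, h0, hβ⟩
  rw [billiardFlow, dif_pos hex, ← h1]
  exact IsBilliardTrajectory.unique ht hex.choose_spec.2 hβ (by rw [hex.choose_spec.1, h0])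

/-- The junction is an inner point, so no collision occurs there and each collision is seen by one
of the two arcs only. -/
theorem BilliardArc.trans {ρ ρ' ρ'' : PhaseSpace d} {s t : ℝ} (h : BilliardArc B ρ s ρ')
    (h' : BilliardArc B ρ' t ρ'') : BilliardArc B ρ (s + t) ρ'' := by
  obtain ⟨hs, β₁, h10, h11, h1, hn1⟩ := h
  obtain ⟨ht, β₂, h20, h21, h2, hn2⟩ := h'
  set β : ℝ → PhaseSpace d := fun u => if u ≤ s then β₁ u else β₂ (u - s) with hβ
  have e1 : ∀ u ≤ s, β u = β₁ u := fun u hu => by simp [hβ, hu]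
  have e2 : ∀ u, s ≤ u → β u = β₂ (u - s) := fun u hu => by
    rcases hu.lt_or_eq with hu' | rfl
    · simp [hβ, not_le.2 hu']
    · simp [hβ, h11, h20]
  have m2 : ∀ u ∈ Icc 0 (s + t), s ≤ u → u - s ∈ Icc 0 t := fun u hu hus =>
    ⟨by linarith, by linarith [hu.2]⟩
  have hins : (β s).1 ∈ interior B.D := by rw [e1 s le_rfl]; exact h1.end_inner
  have e1' : ∀ u < s, β =ᶠ[𝓝 u] β₁ := fun u hu => by
    filter_upwards [gt_mem_nhds hu] with w hw using e1 w hw.le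
  have e2' : ∀ u, s < u → β =ᶠ[𝓝 u] fun w => β₂ (w - s) := fun u hu => by
    filter_upwards [lt_mem_nhds hu] with w hw using e2 w (le_of_lt hw)
  have shiftL : ∀ u, Tendsto (fun w => w - s) (𝓝[<] u) (𝓝[<] (u - s)) := fun u =>
    tendsto_nhdsWithin_iff.2 ⟨((continuous_id.sub continuous_const).tendsto u).mono_left
      nhdsWithin_le_nhds, by
        filter_upwards [self_mem_nhdsWithin] with w hw
        exact sub_lt_sub_right (show w < u from hw) s⟩
  have shiftR : ∀ u, Tendsto (fun w => w - s) (𝓝[>] u) (𝓝[>] (u - s)) := fun u =>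
    tendsto_nhdsWithin_iff.2 ⟨((continuous_id.sub continuous_const).tendsto u).mono_left
      nhdsWithin_le_nhds, by
        filter_upwards [self_mem_nhdsWithin] with w hw
        exact sub_lt_sub_right (show u < w from hw) s⟩
  have shiftL' : ∀ u, Tendsto (fun w => w + s) (𝓝[<] (u - s)) (𝓝[<] u) := fun u =>
    tendsto_nhdsWithin_iff.2 ⟨by
      have h5 : Continuous fun w : ℝ => w + s := by fun_prop
      have := h5.tendsto (u - s)
      rw [sub_add_cancel] at this
      exact this.mono_left nhdsWithin_le_nhds, by
        filter_upwards [self_mem_nhdsWithin] with w hw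
        have : w < u - s := hw
        exact lt_sub_iff_add_lt.1 this⟩
  have hcases : ∀ u ∈ Ioo 0 (s + t), (β u).1 ∈ frontier B.D → u < s ∨ s < u := by
    intro u _ hf
    rcases lt_trichotomy u s with h | rfl | h
    · exact Or.inl h
    · exact absurd hins hf.2
    · exact Or.inr h
  refine ⟨add_nonneg hs ht, β, by rw [e1 0 hs, h10], by
    rw [e2 _ (by linarith), add_sub_cancel_left, h21], ⟨?_, ?_, ?_, ?_, ?_, ?_, ?_⟩, ?_⟩
  · have hU : Icc 0 (s + t) = Icc 0 s ∪ Icc s (s + t) :=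
      (Icc_union_Icc_eq_Icc hs (le_add_of_nonneg_right ht)).symm
    rw [hU]
    refine ContinuousOn.union_of_isClosed ?_ ?_ isClosed_Icc isClosed_Icc
    · exact h1.continuousOn.congr fun u hu => by simp only [e1 u hu.2]
    · have : ContinuousOn (fun u => (β₂ (u - s)).1) (Icc s (s + t)) :=
        h2.continuousOn.comp (f := fun u => u - s) (by fun_prop) fun u hu =>
          ⟨by linarith [hu.1], by linarith [hu.2]⟩
      exact this.congr fun u hu => by simp only [e2 u hu.1]
  · intro u hu
    rcases le_total u s with h | h
    · rw [e1 u h]; exact h1.mem u ⟨hu.1, h⟩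
    · rw [e2 u h]; exact h2.mem _ (m2 u hu h)
  · rw [e1 0 hs]; exact h1.start_inner
  · rw [e2 _ (by linarith), add_sub_cancel_left]; exact h2.end_inner
  · refine (h1.finite_collisions.union (h2.finite_collisions.image (· + s))).subset ?_
    rintro u ⟨hu, hf⟩
    rcases le_total u s with h | h
    · left
      rw [e1 u h] at hf
      exact ⟨⟨hu.1, h⟩, hf⟩
    · right
      rw [e2 u h] at hf
      exact ⟨u - s, ⟨m2 u hu h, hf⟩, by simp⟩
  · intro u hu hi
    refine hasDerivWithinAt_concat hs ht (fun hus => ?_) (fun hus => ?_) (by rw [h11, h20])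
    · rw [e1 u hus] at hi ⊢
      exact h1.free u ⟨hu.1, hus⟩ hi
    · rw [e2 u hus] at hi ⊢
      exact h2.free _ (m2 u hu hus) hi
  · intro u hu hf
    rcases hcases u hu hf with h | h
    · rw [e1 u h.le] at hf ⊢
      obtain ⟨v, pin, pout, hv, hi, ho, e⟩ := h1.reflection u ⟨hu.1, h⟩ hf
      have hev : ∀ l ≤ 𝓝 u, (fun w => (β₁ w).2) =ᶠ[l] fun w => (β w).2 := fun l hl => by
        filter_upwards [(e1' u h).filter_mono hl] with w hw using by rw [hw]
      exact ⟨v, pin, pout, hv, hi.congr' (hev _ nhdsWithin_le_nhds),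
        ho.congr' (hev _ nhdsWithin_le_nhds), e⟩
    · rw [e2 u h.le] at hf ⊢
      obtain ⟨v, pin, pout, hv, hi, ho, e⟩ := h2.reflection (u - s)
        ⟨by linarith, by linarith [hu.2]⟩ hf
      have hev : ∀ l ≤ 𝓝 u, (fun w => (β₂ (w - s)).2) =ᶠ[l] fun w => (β w).2 := fun l hl => by
        filter_upwards [(e2' u h).filter_mono hl] with w hw using by rw [hw]
      exact ⟨v, pin, pout, hv, (hi.comp (shiftL u)).congr' (hev _ nhdsWithin_le_nhds),
        (ho.comp (shiftR u)).congr' (hev _ nhdsWithin_le_nhds), e⟩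
  · intro u hu hf v pin hv hi
    rcases hcases u hu hf with h | h
    · rw [e1 u h.le] at hf hv
      refine hn1 u ⟨hu.1, h⟩ hf v pin hv (hi.congr' ?_)
      filter_upwards [(e1' u h).filter_mono nhdsWithin_le_nhds] with w hw using by rw [hw]
    · rw [e2 u h.le] at hf hv
      refine hn2 (u - s) ⟨by linarith, by linarith [hu.2]⟩ hf v pin hv ?_
      have h3 : Tendsto (fun w => (β₂ (w - s)).2) (𝓝[<] u) (𝓝 pin) := hi.congr' (by
        filter_upwards [(e2' u h).filter_mono nhdsWithin_le_nhds] with w hw using by rw [hw])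
      have h4 := h3.comp (shiftL' u)
      refine h4.congr fun w => ?_
      simp

theorem BilliardArc.of_free {q p : Config d} {t : ℝ} (ht : 0 ≤ t)
    (h : ∀ u ∈ Icc 0 t, q + u • p ∈ interior B.D) : BilliardArc B (q, p) t (q + t • p, p) := by
  have hno : ∀ u ∈ Icc 0 t, q + u • p ∉ frontier B.D := fun u hu hf => hf.2 (h u hu)
  refine ⟨ht, fun u => (q + u • p, p), by simp, rfl, ⟨by fun_prop, fun s hs =>
    BilliardTable.mem_of_mem_interior (h s hs), ?_, h t ⟨ht, le_rfl⟩, ?_, ?_, ?_⟩, ?_⟩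
  · simpa using h 0 ⟨le_rfl, ht⟩
  · convert Set.finite_empty
    ext u
    simp only [mem_ofPred_eq, mem_empty_iff_false, iff_false, not_and]
    exact hno u
  · intro s _ _
    have h1 : HasDerivAt (fun u : ℝ => q + u • p) p s := by
      simpa using ((hasDerivAt_id s).smul_const p).const_add q
    exact (h1.prodMk (hasDerivAt_const s p)).hasDerivWithinAt
  · exact fun s hs hf => absurd hf (hno s (Ioo_subset_Icc_self hs))
  · exact fun s hs hf => absurd hf (hno s (Ioo_subset_Icc_self hs))

theorem BilliardArc.of_collision {q p p' v : Config d} {t t' : ℝ} (ht : 0 < t) (ht' : 0 < t')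
    (hin : ∀ u ∈ Ico 0 t, q + u • p ∈ interior B.D)
    (hf : q + t • p ∈ frontier B.D) (hcor : q + t • p ∉ B.corners)
    (hv : IsInwardUnitNormal B.D (q + t • p) v) (hpv : inner ℝ p v ≠ 0)
    (hp' : p' = p - (2 * inner ℝ p v) • v)
    (hout : ∀ u ∈ Ioc 0 t', q + t • p + u • p' ∈ interior B.D) :
    BilliardArc B (q, p) (t + t') (q + t • p + t' • p', p') := by
  set β : ℝ → PhaseSpace d := fun u =>
    if u ≤ t then (q + u • p, p) else (q + t • p + (u - t) • p', p') with hβ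
  have e1 : ∀ u ≤ t, β u = (q + u • p, p) := fun u hu => by simp [hβ, hu]
  have e2 : ∀ u, t < u → β u = (q + t • p + (u - t) • p', p') := fun u hu => by
    simp [hβ, not_le.2 hu]
  have e2' : ∀ u, t ≤ u → (β u).1 = q + t • p + (u - t) • p' := fun u hu => by
    rcases hu.lt_or_eq with hu' | rfl
    · rw [e2 u hu']
    · rw [e1 t le_rfl]; simp
  have hint : ∀ u ∈ Icc 0 (t + t'), u ≠ t → (β u).1 ∈ interior B.D := by
    intro u hu hne
    rcases lt_or_gt_of_ne hne with h | h
    · rw [e1 u h.le]; exact hin u ⟨hu.1, h⟩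
    · rw [e2 u h]; exact hout _ ⟨by linarith, by linarith [hu.2]⟩
  have heq : ∀ u ∈ Icc 0 (t + t'), (β u).1 ∈ frontier B.D → u = t := fun u hu hfu => by
    by_contra hne
    exact hfu.2 (hint u hu hne)
  have hlimL : Tendsto (fun u => (β u).2) (𝓝[<] t) (𝓝 p) := tendsto_const_nhds.congr' (by
    filter_upwards [self_mem_nhdsWithin] with u hu
    rw [e1 u (le_of_lt hu)])
  have hlimR : Tendsto (fun u => (β u).2) (𝓝[>] t) (𝓝 p') := tendsto_const_nhds.congr' (by
    filter_upwards [self_mem_nhdsWithin] with u hu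
    rw [e2 u hu])
  have hβt : (β t).1 = q + t • p := by rw [e1 t le_rfl]
  have hline : ∀ (a b : Config d) (c u : ℝ),
      HasDerivAt (fun u : ℝ => ((a + (u - c) • b, b) : PhaseSpace d)) (b, 0) u := by
    intro a b c u
    have h1 : HasDerivAt (fun u : ℝ => a + (u - c) • b) b u := by
      simpa using (((hasDerivAt_id u).sub_const c).smul_const b).const_add a
    exact h1.prodMk (hasDerivAt_const u b)
  refine ⟨by positivity, β, by rw [e1 0 ht.le]; simp, by rw [e2 _ (by linarith)]; simp,
    ⟨?_, ?_, ?_, ?_, ?_, ?_, ?_⟩, ?_⟩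
  · have hU : Icc 0 (t + t') = Icc 0 t ∪ Icc t (t + t') :=
      (Icc_union_Icc_eq_Icc ht.le (le_add_of_nonneg_right ht'.le)).symm
    rw [hU]
    refine ContinuousOn.union_of_isClosed ?_ ?_ isClosed_Icc isClosed_Icc
    · exact (by fun_prop : ContinuousOn (fun u : ℝ => q + u • p) (Icc 0 t)).congr fun u hu => by
        simp only [e1 u hu.2]
    · exact (by fun_prop : ContinuousOn (fun u : ℝ => q + t • p + (u - t) • p')
        (Icc t (t + t'))).congr fun u hu => by simp only [e2' u hu.1]
  · intro u hu
    by_cases hne : u = t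
    · rw [hne, hβt]
      exact ⟨B.isClosed_D.frontier_subset hf, hcor⟩
    · exact BilliardTable.mem_of_mem_interior (hint u hu hne)
  · exact hint 0 ⟨le_rfl, by positivity⟩ ht.ne
  · exact hint _ ⟨by positivity, le_rfl⟩ (by linarith)
  · exact (Set.finite_singleton t).subset fun u hu => heq u hu.1 hu.2
  · intro u hu hi
    have hne : u ≠ t := by
      rintro rfl
      rw [hβt] at hi
      exact hf.2 hi
    rcases lt_or_gt_of_ne hne with h | h
    · have h3 := hline q p 0 u
      rw [e1 u h.le]
      refine (h3.congr_of_eventuallyEq ?_).hasDerivWithinAt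
      filter_upwards [gt_mem_nhds h] with w hw
      rw [e1 w hw.le]; simp
    · rw [e2 u h]
      refine ((hline (q + t • p) p' t u).congr_of_eventuallyEq ?_).hasDerivWithinAt
      filter_upwards [lt_mem_nhds h] with w hw
      rw [e2 w hw]
  · intro u hu hfu
    obtain rfl := heq u (Ioo_subset_Icc_self hu) hfu
    exact ⟨v, p, p', hβt ▸ hv, hlimL, hlimR, hp'⟩
  · intro u hu hfu w pin hw hpin
    obtain rfl := heq u (Ioo_subset_Icc_self hu) hfu
    rw [hβt] at hw
    rw [hw.unique hv, tendsto_nhds_unique hpin hlimL]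
    exact hpv

end BilliardArc

/-! ### The geometry of the boundary at a collision -/

section Wall

/-- Strict differentiability estimates differences between any two nearby points, so monotonicity
along `v` holds on all short segments near `x` and not merely on those issuing from `x`. -/
theorem HasStrictFDerivAt.eventually_lt_along {E : Type*} [NormedAddCommGroup E] [NormedSpace ℝ E]
    {f : E → ℝ} {f' : E →L[ℝ] ℝ} {x v : E} (hf : HasStrictFDerivAt f f' x) (hv : 0 < f' v) :
    ∀ᶠ y in 𝓝 (x, x), ∀ t : ℝ, 0 < t → y.2 = y.1 + t • v → f y.1 < f y.2 := by
  have hv0 : v ≠ 0 := by rintro rfl; simp at hv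
  have hn : 0 < ‖v‖ := norm_pos_iff.2 hv0
  have h1 := hf.isLittleO.def (c := f' v / (2 * ‖v‖)) (by positivity)
  filter_upwards [(continuous_swap.tendsto (x, x)).eventually h1] with y hy t ht e
  simp only [Prod.fst_swap, Prod.snd_swap, e, add_sub_cancel_left, map_smul, smul_eq_mul, norm_smul,
    Real.norm_eq_abs, _root_.abs_of_pos ht] at hy
  have h2 : f' v / (2 * ‖v‖) * (t * ‖v‖) = t * f' v / 2 := by field_simp
  rw [h2] at hy
  rw [e]
  have h3 := (abs_le.1 hy).1
  have := mul_pos ht hv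
  linarith

/-- If `f` and `g` vanish on the smooth hypersurface `h = 0` and all three functions increase in
the direction `v`, then `f` and `g` are nonnegative on the same side of it. -/
theorem eventually_nonneg_iff_nonneg {E : Type*} [NormedAddCommGroup E] [NormedSpace ℝ E]
    {f g h : E → ℝ} {f' g' h' : E →L[ℝ] ℝ} {x v : E}
    (hf : HasStrictFDerivAt f f' x) (hg : HasStrictFDerivAt g g' x)
    (hh : HasStrictFDerivAt h h' x) (hfv : 0 < f' v) (hgv : 0 < g' v) (hhv : 0 < h' v)
    (hc : ∀ᶠ y in 𝓝 x, ContinuousAt h y) (hx : h x = 0)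
    (h0 : ∀ᶠ y in 𝓝 x, h y = 0 → f y = 0 ∧ g y = 0) :
    ∀ᶠ y in 𝓝 x, (0 ≤ f y ↔ 0 ≤ g y) := by
  have e := (hf.eventually_lt_along hfv).and
    ((hg.eventually_lt_along hgv).and (hh.eventually_lt_along hhv))
  rw [nhds_prod_eq] at e
  obtain ⟨s, hs, hs'⟩ := mem_prod_self_iff.1 e
  have hev : ∀ᶠ y in 𝓝 x, y ∈ s ∧ ContinuousAt h y ∧ (h y = 0 → f y = 0 ∧ g y = 0) :=
    (eventually_mem_set.2 hs).and (hc.and h0)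
  have htend : Tendsto (fun z : E × ℝ => z.1 + z.2 • v) (𝓝 (x, 0)) (𝓝 x) := by
    have : Continuous (fun z : E × ℝ => z.1 + z.2 • v) := by fun_prop
    simpa using this.tendsto (x, 0)
  have hev2 := htend.eventually hev
  rw [nhds_prod_eq] at hev2
  obtain ⟨A, hA, C, hC, hAC⟩ := eventually_prod_iff.1 hev2
  obtain ⟨η, hη, hball⟩ := Metric.eventually_nhds_iff_ball.1 hC
  set τ := η / 2 with hτ
  have hτ0 : 0 < τ := by positivity
  have hCt : ∀ t ∈ Icc (-τ) τ, C t := fun t ht => hball t (by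
    rw [Metric.mem_ball, dist_zero_right, Real.norm_eq_abs, abs_lt]
    constructor <;> linarith [ht.1, ht.2])
  have hAx : A x := hA.self_of_nhds
  have hmem : ∀ {y}, A y → ∀ t ∈ Icc (-τ) τ, y + t • v ∈ s := fun hy t ht =>
    (hAC hy (hCt t ht)).1
  have hlt : ∀ {y}, A y → ∀ a ∈ Icc (-τ) τ, ∀ b ∈ Icc (-τ) τ, a < b →
      f (y + a • v) < f (y + b • v) ∧ g (y + a • v) < g (y + b • v) ∧
        h (y + a • v) < h (y + b • v) := by
    intro y hy a ha b hb hab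
    have hm := hs' (mk_mem_prod (hmem hy a ha) (hmem hy b hb))
    have hpos := sub_pos.2 hab
    have heq : y + b • v = y + a • v + (b - a) • v := by rw [sub_smul]; abel
    exact ⟨hm.1 _ hpos heq, hm.2.1 _ hpos heq, hm.2.2 _ hpos heq⟩
  have m0 : (0 : ℝ) ∈ Icc (-τ) τ := ⟨by linarith, hτ0.le⟩
  have m1 : τ ∈ Icc (-τ) τ := ⟨by linarith, le_rfl⟩
  have m2 : -τ ∈ Icc (-τ) τ := ⟨le_rfl, by linarith⟩
  have hp : ∀ᶠ y in 𝓝 x, 0 < h (y + τ • v) := by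
    have h1 : 0 < h (x + τ • v) := by
      have := (hlt hAx 0 m0 τ m1 hτ0).2.2
      simpa [hx] using this
    have h2 : ContinuousAt h (x + τ • v) := (hAC hAx (hCt τ m1)).2.1
    have h3 : ContinuousAt (fun y => h (y + τ • v)) x :=
      ContinuousAt.comp (f := fun y => y + τ • v) h2 (by fun_prop)
    exact h3.eventually (lt_mem_nhds h1)
  have hm : ∀ᶠ y in 𝓝 x, h (y + (-τ) • v) < 0 := by
    have h1 : h (x + (-τ) • v) < 0 := by
      have := (hlt hAx (-τ) m2 0 m0 (by linarith)).2.2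
      simpa [hx] using this
    have h2 : ContinuousAt h (x + (-τ) • v) := (hAC hAx (hCt _ m2)).2.1
    have h3 : ContinuousAt (fun y => h (y + (-τ) • v)) x :=
      ContinuousAt.comp (f := fun y => y + (-τ) • v) h2 (by fun_prop)
    exact h3.eventually (gt_mem_nhds h1)
  filter_upwards [hA, hp, hm] with y hy hyp hym
  have hcont : ContinuousOn (fun t : ℝ => h (y + t • v)) (Icc (-τ) τ) := fun t ht =>
    (ContinuousAt.comp (f := fun t : ℝ => y + t • v) (hAC hy (hCt t ht)).2.1
      (by fun_prop)).continuousWithinAt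
  -- The segment through y in the direction v meets the hypersurface at parameter t. There f and g
  -- vanish too, and as both increase along the segment their signs at y are decided by the sign of
  -- t.
  obtain ⟨t, ht, ht0⟩ := intermediate_value_Icc (by linarith) hcont
    (show (0 : ℝ) ∈ Icc _ _ from ⟨hym.le, hyp.le⟩)
  obtain ⟨hft, hgt⟩ := (hAC hy (hCt t ht)).2.2 ht0
  rcases lt_trichotomy t 0 with h' | rfl | h'
  · have := hlt hy t ht 0 m0 h'
    simp only [hft, hgt, zero_smul, add_zero] at this
    exact ⟨fun _ => this.2.1.le, fun _ => this.1.le⟩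
  · simp only [zero_smul, add_zero] at hft hgt
    simp [hft, hgt]
  · have := hlt hy 0 m0 t ht h'
    simp only [hft, hgt, zero_smul, add_zero] at this
    exact ⟨fun h => absurd h (not_le.2 this.1), fun h => absurd h (not_le.2 this.2.1)⟩

/-- Two functions which vanish on a smooth hypersurface have parallel derivatives there. -/
theorem exists_smul_of_vanishing {E : Type*} [NormedAddCommGroup E] [NormedSpace ℝ E]
    [CompleteSpace E] {g h : E → ℝ} {g' h' : E →L[ℝ] ℝ} {x : E}
    (hg : HasStrictFDerivAt g g' x) (hh : HasStrictFDerivAt h h' x) (hh0 : h' ≠ 0)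
    (hx : h x = 0) (h0 : ∀ᶠ y in 𝓝 x, h y = 0 → g y = 0) : ∃ c : ℝ, g' = c • h' := by
  -- Since g is constant on the level set of h, x is trivially a constrained extremum and Lagrange
  -- multipliers exist. The multiplier of g' is nonzero because h' is.
  have hext : IsLocalExtrOn g {y | h y = h x} x := by
    left
    have : ∀ᶠ y in 𝓝[{y | h y = h x}] x, g x ≤ g y := by
      filter_upwards [h0.filter_mono nhdsWithin_le_nhds, self_mem_nhdsWithin] with y hy hyx
      have hyx' : h y = h x := hyx
      rw [hy (hyx'.trans hx), h0.self_of_nhds hx]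
    exact this
  obtain ⟨a, b, hab, e⟩ := hext.exists_multipliers_of_hasStrictFDerivAt_1d hh hg
  have hb : b ≠ 0 := by
    rintro rfl
    rw [zero_smul, add_zero] at e
    rcases smul_eq_zero.1 e with h1 | h1
    · exact hab (by rw [h1]; rfl)
    · exact hh0 h1
  refine ⟨-(b⁻¹ * a), ?_⟩
  have : g' = -(b⁻¹ • a • h') := by
    rw [eq_neg_iff_add_eq_zero, add_comm, ← smul_right_injective _ hb |>.eq_iff]
    rw [smul_add, smul_smul, mul_inv_cancel₀ hb, one_smul, e, smul_zero]
  rw [this]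
  ext y
  simp [mul_assoc]

variable {d r n : ℕ} {L : AddSubgroup (Config d)}

theorem eventually_mem_smoothPart {S : Set (Config d)} {x : Config d} (hx : x ∈ smoothPart r S) :
    ∀ᶠ y in 𝓝 x, y ∈ S → y ∈ smoothPart r S := by
  obtain ⟨hxS, f, hf, hf', hS⟩ := hx
  have h1 := hf.eventually (by simp)
  have h2 : ∀ᶠ y in 𝓝 x, fderiv ℝ f y ≠ 0 :=
    (hf.continuousAt_fderiv (by simp)).eventually_ne hf'
  filter_upwards [h1, h2, eventually_eventually_nhds.2 hS] with y h1 h2 h3 hy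
  exact ⟨hy, f, h1, h2, h3⟩

/-- The smooth points are relatively open in each closed boundary piece. -/
theorem BilliardTable.isClosed_corners (B : BilliardTable d r n L) : IsClosed B.corners := by
  refine isClosed_iUnion_of_finite fun i => isClosed_of_closure_subset fun x hx => ?_
  have hxS : x ∈ B.Γ i := closure_minimal sdiff_subset (B.isClosed_Γ i) hx
  refine ⟨hxS, fun hs => ?_⟩
  obtain ⟨y, hy, hy'⟩ := mem_closure_iff_nhds.1 hx _ (eventually_mem_smoothPart hs)
  exact hy'.2 (hy hy'.1)

/-- At a smooth boundary point `D` is locally `{σ (Q - level) ≥ 0}`, where `σ = ±1`. -/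
theorem exists_local_chart {B : BilliardTable d r n L} {P : PatternFunction B}
    (A : BarrierFunctions P) (hIIa : ConditionIIa A) (hIIc : ConditionIIc A)
    {q v : Config d} (hq : q ∈ frontier B.D) (hqc : q ∉ B.corners)
    (hv : IsInwardUnitNormal B.D q v) :
    ∃ (i : Fin n) (σ : ℝ), (σ = 1 ∨ σ = -1) ∧ q ∈ A.N i ∧ P.Q 0 q = A.level i ∧
      ∀ᶠ x in 𝓝 q, (x ∈ B.D ↔ 0 ≤ σ * (P.Q 0 x - A.level i)) := by
  have hqΓ := hq
  rw [B.frontier_eq] at hqΓ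
  obtain ⟨i, hi⟩ := mem_iUnion.1 hqΓ
  have hs : q ∈ smoothPart r (B.Γ i) := by
    by_contra h
    exact hqc (mem_iUnion.2 ⟨i, hi, h⟩)
  obtain ⟨-, h, hh, hh0, hΓ⟩ := hs
  obtain ⟨hv1, f, hf, hfq, hfv, hfD⟩ := hv
  have hN : q ∈ A.N i := A.Γ_subset i ⟨hi, hqc⟩
  have hG : ContDiffAt ℝ (r + 1 : ℕ) (P.Q 0) q :=
    (P.contDiffOn 0 le_rfl).contDiffAt (P.isOpen_dom.mem_nhds (A.N_subset i hN))
  have hone : ((r + 1 : ℕ) : WithTop ℕ∞) ≠ 0 := by simp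
  have hGs := hG.hasStrictFDerivAt hone
  have hhs := hh.hasStrictFDerivAt hone
  have hfs := hf.hasStrictFDerivAt (by simp)
  have hhq : h q = 0 := hΓ.self_of_nhds.1 hi
  set f' := fderiv ℝ f q with hf'
  set G' := fderiv ℝ (P.Q 0) q with hG'
  set h' := fderiv ℝ h q with hh'
  have hf'v : f' v = 1 := by
    rw [hf', hfv.hasFDerivAt.fderiv, InnerProductSpace.toDual_apply_apply,
      real_inner_self_eq_norm_sq, hv1]
    norm_num
  have hGN : G' ≠ 0 := hIIc.1 i 0 le_rfl q hN
  have hlev : P.Q 0 q = A.level i := hIIa i q ⟨hi, hqc⟩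
  have hcor : ∀ᶠ y in 𝓝 q, y ∉ B.corners := B.isClosed_corners.isOpen_compl.mem_nhds hqc
  have hG0 : ∀ᶠ y in 𝓝 q, h y = 0 → P.Q 0 y - A.level i = 0 := by
    filter_upwards [hΓ, hcor] with y hy hyc hy0
    rw [hIIa i y ⟨hy.2 hy0, hyc⟩, sub_self]
  have hfc : ∀ᶠ y in 𝓝 q, ContinuousAt f y := by
    filter_upwards [hf.eventually (by simp)] with y hy using hy.continuousAt
  -- A boundary point of D with f > 0 would have a neighbourhood inside D.
  have hf0 : ∀ᶠ y in 𝓝 q, h y = 0 → f y = 0 := by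
    filter_upwards [hΓ, eventually_eventually_nhds.2 hfD, hfc] with y hy hyD hyc hy0
    have hyf : y ∈ frontier B.D := by
      rw [B.frontier_eq]; exact mem_iUnion.2 ⟨i, hy.2 hy0⟩
    have h1 : 0 ≤ f y := hyD.self_of_nhds.1 (B.isClosed_D.frontier_subset hyf)
    refine le_antisymm (not_lt.1 fun hlt => hyf.2 ?_) h1
    rw [mem_interior_iff_mem_nhds]
    filter_upwards [hyD, hyc.eventually (lt_mem_nhds hlt)] with z hz hz' using hz.2 hz'.le
  obtain ⟨a, ha⟩ := exists_smul_of_vanishing hfs hhs hh0 hhq hf0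
  obtain ⟨b, hb⟩ := exists_smul_of_vanishing (hGs.sub_const (A.level i)) hhs hh0 hhq hG0
  have hav : a * h' v = 1 := by rw [← hf'v, ha]; rfl
  have hhv0 : h' v ≠ 0 := fun e => by simp [e] at hav
  have hb0 : b ≠ 0 := by
    rintro rfl
    exact hGN (by rw [hb, zero_smul])
  have hGv : G' v ≠ 0 := by
    rw [hb]
    exact mul_ne_zero hb0 hhv0
  -- The functions f, Q - level and h have proportional nonzero derivatives at q. The factors s and
  -- σ orient h and Q so that they increase along v, as f does.
  have key : ∀ s σ : ℝ, 0 < s * h' v → 0 < σ * G' v →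
      ∀ᶠ x in 𝓝 q, (x ∈ B.D ↔ 0 ≤ σ * (P.Q 0 x - A.level i)) := by
    intro s σ hs hσ
    have hs0 : s ≠ 0 := by rintro rfl; simp at hs
    have h1 := eventually_nonneg_iff_nonneg (h := fun x => s * h x)
      (g := fun x => σ * (P.Q 0 x - A.level i)) (v := v) hfs
      ((hGs.sub_const (A.level i)).const_mul σ) (hhs.const_mul s)
      (by rw [hf'v]; exact one_pos) (by simpa using hσ) (by simpa using hs)
      (by
        filter_upwards [hh.eventually (by simp)] with y hy
        exact hy.continuousAt.const_mul s) (by rw [hhq, mul_zero])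
      (by
        filter_upwards [hf0, hG0] with y h1 h2 h3
        have h4 := (mul_eq_zero.1 h3).resolve_left hs0
        exact ⟨h1 h4, by rw [h2 h4, mul_zero]⟩)
    filter_upwards [hfD, h1] with x hx hx'
    rw [hx, hx']
  have key2 : ∀ σ : ℝ, 0 < σ * G' v →
      ∀ᶠ x in 𝓝 q, (x ∈ B.D ↔ 0 ≤ σ * (P.Q 0 x - A.level i)) := fun σ hσ =>
    key (h' v) σ (mul_self_pos.2 hhv0) hσ
  rcases lt_or_gt_of_ne hGv with h1 | h1
  · exact ⟨i, -1, Or.inr rfl, hN, hlev, key2 _ (by linarith)⟩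
  · exact ⟨i, 1, Or.inl rfl, hN, hlev, key2 _ (by linarith)⟩

/-- If `D = {g ≥ 0}` near `q` and `g q = 0`, then the inward normal is `∇g(q) / ‖∇g(q)‖`. -/
theorem isInwardUnitNormal_gradient {D : Set (Config d)} {g : Config d → ℝ} {q : Config d}
    (hg : ContDiffAt ℝ 1 g q) (hq : g q = 0) (hne : gradient g q ≠ 0)
    (hD : ∀ᶠ x in 𝓝 q, (x ∈ D ↔ 0 ≤ g x)) :
    IsInwardUnitNormal D q (‖gradient g q‖⁻¹ • gradient g q) := by
  have hn : 0 < ‖gradient g q‖ := norm_pos_iff.2 hne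
  refine ⟨by rw [norm_smul, norm_inv, norm_norm, inv_mul_cancel₀ hn.ne'],
    fun x => ‖gradient g q‖⁻¹ * g x, contDiffAt_const.mul hg,
    mul_eq_zero_of_right _ hq, ?_, ?_⟩
  · rw [hasGradientAt_iff_hasFDerivAt]
    have h1 := (hg.differentiableAt (by simp)).hasGradientAt.hasFDerivAt.const_mul ‖gradient g q‖⁻¹
    rwa [map_smul]
  · filter_upwards [hD] with x hx
    rw [hx, mul_nonneg_iff_of_pos_left (inv_pos.2 hn)]

/-- At an interior point of `D` the function `g` would have a local minimum. -/
theorem mem_frontier_of_gradient_ne_zero {D : Set (Config d)}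
    {g : Config d → ℝ} {q : Config d} (hq : g q = 0) (hne : gradient g q ≠ 0)
    (hD : ∀ᶠ x in 𝓝 q, (x ∈ D ↔ 0 ≤ g x)) : q ∈ frontier D := by
  refine ⟨subset_closure (hD.self_of_nhds.2 hq.ge), fun hi => ?_⟩
  have h1 : IsLocalMin g q := by
    filter_upwards [mem_interior_iff_mem_nhds.1 hi, hD] with x hx hx'
    rw [hq]; exact hx'.1 hx
  have h2 := h1.fderiv_eq_zero
  rw [gradient, h2, map_zero] at hne
  exact hne rfl

theorem eventually_mem_interior_of_pos {D : Set (Config d)} {g : Config d → ℝ} {q : Config d}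
    (hg : ContDiffAt ℝ 1 g q) (hD : ∀ᶠ x in 𝓝 q, (x ∈ D ↔ 0 ≤ g x)) :
    ∀ᶠ x in 𝓝 q, 0 < g x → x ∈ interior D := by
  filter_upwards [eventually_eventually_nhds.2 hD, hg.eventually (by simp)] with x hx hgx hpos
  rw [mem_interior_iff_mem_nhds]
  filter_upwards [hx, hgx.continuousAt.eventually (lt_mem_nhds hpos)] with y hy hy' using
    hy.2 hy'.le

end Wall

/-! ### Steep one-dimensional barriers -/

section Barrier

open OnePoint MeasureTheory

/-- A convergent sequence of densities. -/
def DensityFamily.ofSeq {S : ℝ} (a : ℕ → ℝ → ℝ) (b : ℝ → ℝ) (M : ℝ) (ha : ∀ n s, |a n s| ≤ M)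
    (hb : ∀ s, |b s| ≤ M) (hai : ∀ n, IntervalIntegrable (a n) volume 0 S)
    (hbi : IntervalIntegrable b volume 0 S)
    (h : Tendsto (fun n => ∫ s in (0 : ℝ)..S, |a n s - b s|) atTop (𝓝 0)) :
    DensityFamily (OnePoint ℕ) S where
  a κ := κ.elim b a
  M := M
  bound κ := by
    induction κ using OnePoint.rec with
    | infty => exact hb
    | coe n => exact ha n
  integrable κ := by
    induction κ using OnePoint.rec with
    | infty => exact hbi
    | coe n => exact hai n
  tendsto κ₀ := by
    induction κ₀ using OnePoint.rec with
    | infty =>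
      intro s hs
      rw [mem_map]
      refine (OnePoint.eventually_nhds_infty (P := fun κ : OnePoint ℕ =>
        (∫ t in (0 : ℝ)..S, |(κ.elim b a : ℝ → ℝ) t - b t|) ∈ s)).2 ⟨?_, h hs⟩
      have : (0 : ℝ) ∈ s := mem_of_mem_nhds hs
      simpa using this
    | coe n =>
      rw [OnePoint.nhds_coe_eq, nhds_discrete, Filter.map_pure]
      refine (tendsto_pure_nhds _ _).mono_right (by simp)

/-- The densities `α + β a`. -/
def DensityFamily.affine {K : Type} [TopologicalSpace K] {S : ℝ} (A : DensityFamily K S)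
    (α β : ℝ) : DensityFamily K S where
  a κ s := α + β * A.a κ s
  M := |α| + |β| * A.M
  bound κ s := (abs_add_le _ _).trans (by
    rw [abs_mul]
    exact add_le_add le_rfl (mul_le_mul_of_nonneg_left (A.bound κ s) (abs_nonneg _)))
  integrable κ := intervalIntegrable_const.add ((A.integrable κ).const_mul β)
  tendsto κ₀ := by
    have := (A.tendsto κ₀).const_mul |β|
    rw [mul_zero] at this
    refine this.congr fun κ => ?_
    rw [← intervalIntegral.integral_const_mul]
    congr 1 with s
    rw [← abs_mul]
    congr 1
    ring

/-- The densities `a(S - s)`. -/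
def DensityFamily.reverse {K : Type} [TopologicalSpace K] {S : ℝ} (A : DensityFamily K S) :
    DensityFamily K S where
  a κ s := A.a κ (S - s)
  M := A.M
  bound κ s := A.bound κ _
  integrable κ := by
    have := (A.integrable κ).comp_sub_left S
    simpa using this.symm
  tendsto κ₀ := by
    refine (A.tendsto κ₀).congr fun κ => ?_
    have := intervalIntegral.integral_comp_sub_left (a := 0) (b := S)
      (fun s => |A.a κ s - A.a κ₀ s|) S
    simpa using this.symm

/-- The curve `(x, w(x))` parametrized by `c - x + w(x) - w(c)`. -/
theorem exists_graph_parametrization {w : ℝ → ℝ} {ρ c S : ℝ} (hc : 0 < c) (hcρ : c < ρ)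
    (hw : ∀ x ∈ Ioo (-ρ) ρ, ContDiffAt ℝ 1 w x ∧ deriv w x < 0) (hS : 0 ≤ S)
    (hb : S ≤ c + ρ / 2 + w (-(ρ / 2)) - w c) :
    ∃ x a : ℝ → ℝ, x 0 = c ∧ Continuous a ∧ (∀ σ, -1 ≤ a σ ∧ a σ < 0) ∧
      ∀ σ ∈ Icc 0 S, HasDerivWithinAt x (a σ) (Icc 0 S) σ ∧ x σ ∈ Ioo (-ρ) ρ ∧
        1 + a σ = deriv w (x σ) * a σ ∧ c - x σ + w (x σ) - w c = σ := by
  have hρ : 0 < ρ := hc.trans hcρ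
  set l := c + ρ / 2 with hl
  have hl0 : 0 ≤ l := by positivity
  have hmem : ∀ y ∈ Icc 0 l, c - y ∈ Ioo (-ρ) ρ := fun y hy =>
    ⟨by have := hy.2; rw [hl] at this; linarith, by linarith [hy.1]⟩
  -- Here y = c - x is the horizontal displacement and τ(y) the parameter σ. Its derivative 1 - w'
  -- exceeds 1, hence dx/dσ = 1/(w' - 1) lies in [-1, 0).
  set τ : ℝ → ℝ := fun y => y + w (c - y) - w c with hτ
  have hτd : ∀ y ∈ Icc 0 l, HasDerivWithinAt τ (1 - deriv w (c - y)) (Icc 0 l) y := by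
    intro y hy
    have h1 : HasDerivAt w (deriv w (c - y)) (c - y) :=
      ((hw _ (hmem y hy)).1.differentiableAt (by simp)).hasDerivAt
    have h2 := h1.comp_const_sub c y
    exact (((hasDerivAt_id y).add h2).sub_const (w c)).hasDerivWithinAt.congr_deriv (by ring)
  have hpos : ∀ y ∈ Icc 0 l, 0 < 1 - deriv w (c - y) := fun y hy => by
    linarith [(hw _ (hmem y hy)).2]
  obtain ⟨-, θ, hθ1, hθ2⟩ := exists_inverse_of_deriv_pos hl0 hτd hpos
  have hτ0 : τ 0 = 0 := by simp [hτ]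
  have hτl : S ≤ τ l := by
    have : c - l = -(ρ / 2) := by rw [hl]; ring
    simp only [hτ, this]; linarith
  rw [hτ0] at hθ2
  have hsub : Icc 0 S ⊆ Icc 0 (τ l) := Icc_subset_Icc_right hτl
  have hθ0 : θ 0 = 0 := by
    have := (hθ1 0 ⟨le_rfl, hl0⟩).1
    rwa [hτ0] at this
  have hxmem : ∀ σ ∈ Icc 0 S, c - θ σ ∈ Ioo (-ρ) ρ := fun σ hσ => hmem _ (hθ2 σ (hsub hσ)).1
  have hpr : ∀ σ : ℝ, (projIcc 0 S hS σ : ℝ) ∈ Icc 0 S := fun σ => (projIcc 0 S hS σ).2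
  have hneg : ∀ σ : ℝ, deriv w (c - θ (projIcc 0 S hS σ)) < 0 := fun σ =>
    (hw _ (hxmem _ (hpr σ))).2
  -- The projection to [0, S] makes the speed continuous and bounded on the whole line.
  refine ⟨fun σ => c - θ σ, fun σ => (deriv w (c - θ (projIcc 0 S hS σ)) - 1)⁻¹, by simp [hθ0],
    ?_, fun σ => ⟨?_, inv_lt_zero.2 (by linarith [hneg σ])⟩, fun σ hσ => ?_⟩
  · have h1 : Continuous (fun σ => θ (projIcc 0 S hS σ)) := by
      have : ContinuousOn θ (Icc 0 S) := fun σ hσ =>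
        ((hθ2 σ (hsub hσ)).2.2.continuousWithinAt).mono hsub
      exact this.comp_continuous (continuous_subtype_val.comp continuous_projIcc) hpr
    rw [continuous_iff_continuousAt]
    intro σ
    have h2 : ContinuousAt (deriv w) (c - θ (projIcc 0 S hS σ)) := by
      obtain ⟨u, hu, huw⟩ := (hw _ (hxmem _ (hpr σ))).1.eventually (by simp)
        |>.exists_mem
      have h3 := (hw _ (hxmem _ (hpr σ))).1.continuousAt_fderiv (by simp)
      exact h3.clm_apply continuousAt_const
    have h4 : ContinuousAt (fun σ => deriv w (c - θ (projIcc 0 S hS σ))) σ :=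
      ContinuousAt.comp (f := fun σ => c - θ (projIcc 0 S hS σ)) h2
        (continuous_const.sub h1).continuousAt
    exact (h4.sub continuousAt_const).inv₀ (by
      simp only [Pi.sub_apply]
      linarith [hneg σ])
  · rw [← neg_le_neg_iff, neg_neg, ← inv_neg]
    exact inv_le_one_of_one_le₀ (by linarith [hneg σ])
  · obtain ⟨h1, h2, h3⟩ := hθ2 σ (hsub hσ)
    have e : (projIcc 0 S hS σ : ℝ) = σ := by rw [projIcc_of_mem hS hσ]
    have hn : deriv w (c - θ σ) < 0 := (hw _ (hxmem σ hσ)).2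
    simp only [e]
    refine ⟨?_, hxmem σ hσ, ?_, ?_⟩
    · refine ((h3.mono hsub).const_sub c).congr_deriv ?_
      rw [← inv_neg, neg_sub]
    · have : deriv w (c - θ σ) - 1 ≠ 0 := by linarith
      field_simp
      ring
    · simp only [hτ] at h2
      linarith

/-- The functions `w n` decrease, and they converge to `0` on the right and exceed in the limit
every number below `𝓔` on the left of the origin. -/
structure SteepBarrier (ρ : ℝ) (𝓔 : EReal) (w : ℕ → ℝ → ℝ) : Prop where
  pos : 0 < ρ
  smooth : ∀ᶠ n in atTop, ∀ x ∈ Ioo (-ρ) ρ, ContDiffAt ℝ 1 (w n) x ∧ deriv (w n) x < 0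
  right : ∀ x ∈ Ioo 0 ρ, Tendsto (fun n => w n x) atTop (𝓝 0)
  left : ∀ x ∈ Ioo (-ρ) 0, ∀ m : ℝ, (m : EReal) < 𝓔 → ∀ᶠ n in atTop, m < w n x

theorem strictAntiOn_of_contDiffAt {w : ℝ → ℝ} {ρ : ℝ}
    (h : ∀ x ∈ Ioo (-ρ) ρ, ContDiffAt ℝ 1 w x ∧ deriv w x < 0) : StrictAntiOn w (Ioo (-ρ) ρ) :=
  strictAntiOn_of_deriv_neg (convex_Ioo _ _)
    (fun x hx => (h x hx).1.continuousAt.continuousWithinAt)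
    (fun x hx => (h x (interior_subset hx)).2)

namespace SteepBarrier

variable {ρ : ℝ} {𝓔 : EReal} {w : ℕ → ℝ → ℝ}

/-- The graphs of the decreasing functions `w n` approach an angle: the segment from (c, 0) to (0,
0), followed by the vertical segment up to (0, w₀). In the parameter of
`exists_graph_parametrization` the horizontal speeds converge in L¹ to those along the angle.
Monotonicity and pointwise limits suffice; nothing is needed about the size of the derivatives. -/
theorem exists_layer_curve (hw : SteepBarrier ρ 𝓔 w) {c w₀ : ℝ} (hc : 0 < c) (hcρ : c < ρ)
    (hw₀ : 0 < w₀) (hw₀' : (w₀ : EReal) < 𝓔) :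
    ∃ (A : DensityFamily (OnePoint ℕ) (c + w₀)) (x : OnePoint ℕ → ℝ → ℝ),
      (∀ κ, ContinuousOn (x κ) (Icc 0 (c + w₀)) ∧ x κ 0 = c ∧
        ∀ σ ∈ Ioo 0 (c + w₀) \ {c}, HasDerivAt (x κ) (A.a κ σ) σ) ∧
      (∀ σ, A.a ∞ σ = if σ < c then -1 else 0) ∧ (∀ σ, x ∞ σ = max (c - σ) 0) ∧
      (∀ᶠ n : ℕ in atTop, ContinuousOn (A.a n) (Icc 0 (c + w₀)) ∧ ∀ σ ∈ Icc 0 (c + w₀),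
        HasDerivWithinAt (x n) (A.a n σ) (Icc 0 (c + w₀)) σ ∧
        A.a n σ < 0 ∧ x n σ ∈ Ioo (-ρ) ρ ∧ 1 + A.a n σ = deriv (w n) (x n σ) * A.a n σ) ∧
      Tendsto (fun n : ℕ => x n (c + w₀)) atTop (𝓝 0) ∧
      Tendsto (fun n : ℕ => w n (x n (c + w₀))) atTop (𝓝 w₀) := by
  have hρ := hw.pos
  set S := c + w₀ with hSdef
  have hS : 0 ≤ S := by positivity
  -- The gap between w₀ and m absorbs the small height at c, so the graph over (-ρ/2, c) is long
  -- enough for the parameter to reach S.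
  obtain ⟨m, hm1, hm2⟩ := EReal.lt_iff_exists_real_btwn.1 hw₀'
  have hm1' : w₀ < m := by exact_mod_cast hm1
  have hwc := hw.right c ⟨hc, hcρ⟩
  have hev : ∀ᶠ n in atTop, (∀ x ∈ Ioo (-ρ) ρ, ContDiffAt ℝ 1 (w n) x ∧ deriv (w n) x < 0) ∧
      S ≤ c + ρ / 2 + w n (-(ρ / 2)) - w n c := by
    filter_upwards [hw.smooth, hw.left (-(ρ / 2)) ⟨by linarith, by linarith⟩ m hm2,
      hwc.eventually (gt_mem_nhds (sub_pos.2 hm1'))] with n h1 h2 h3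
    exact ⟨h1, by linarith⟩
  obtain ⟨n₀, hn₀⟩ := eventually_atTop.1 hev
  have hex : ∀ n, ∃ x a : ℝ → ℝ, n₀ ≤ n → x 0 = c ∧ Continuous a ∧
      (∀ σ, -1 ≤ a σ ∧ a σ < 0) ∧
      ∀ σ ∈ Icc 0 S, HasDerivWithinAt x (a σ) (Icc 0 S) σ ∧ x σ ∈ Ioo (-ρ) ρ ∧
        1 + a σ = deriv (w n) (x σ) * a σ ∧ c - x σ + w n (x σ) - w n c = σ := by
    intro n
    by_cases hn : n₀ ≤ n
    · obtain ⟨x, a, h⟩ := exists_graph_parametrization hc hcρ (hn₀ n hn).1 hS (hn₀ n hn).2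
      exact ⟨x, a, fun _ => h⟩
    · exact ⟨0, 0, fun h => absurd h hn⟩
  choose x a hxa using hex
  set a₀ : ℝ → ℝ := fun σ => if σ < c then -1 else 0 with ha₀
  set x₀ : ℝ → ℝ := fun σ => max (c - σ) 0 with hx₀
  -- For the finitely many indices at which the parametrization may fail, the limit curve is used as
  -- a filler.
  set a' : ℕ → ℝ → ℝ := fun n => if n₀ ≤ n then a n else a₀ with ha'
  set x' : ℕ → ℝ → ℝ := fun n => if n₀ ≤ n then x n else x₀ with hx'
  have ea : ∀ {n}, n₀ ≤ n → a' n = a n := fun h => if_pos h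
  have ex : ∀ {n}, n₀ ≤ n → x' n = x n := fun h => if_pos h
  have ea' : ∀ {n}, ¬ n₀ ≤ n → a' n = a₀ := fun h => if_neg h
  have ex' : ∀ {n}, ¬ n₀ ≤ n → x' n = x₀ := fun h => if_neg h
  have hcS : c ∈ Icc 0 S := ⟨hc.le, by linarith⟩
  have hSS : S ∈ Icc 0 S := ⟨hS, le_rfl⟩
  -- location of the curve
  have hlow : ∀ η ∈ Ioo 0 ρ, ∀ᶠ n in atTop, -η < x n S := by
    intro η hη
    filter_upwards [eventually_ge_atTop n₀,
      hw.left (-η) ⟨by linarith [hη.2], by linarith [hη.1]⟩ m hm2,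
      hwc.eventually (gt_mem_nhds (sub_pos.2 hm1'))] with n h1 h2 h3
    obtain ⟨-, -, -, h⟩ := hxa n h1
    obtain ⟨-, h5, -, h6⟩ := h S hSS
    by_contra hcon
    have h7 := (strictAntiOn_of_contDiffAt (hn₀ n h1).1).antitoneOn h5
      ⟨by linarith [hη.2], by linarith [hη.1]⟩ (not_lt.1 hcon)
    linarith [hη.1]
  have hanti : ∀ n, n₀ ≤ n → x n S ≤ x n c := by
    intro n hn
    obtain ⟨-, -, ha, h⟩ := hxa n hn
    have : AntitoneOn (x n) (Icc 0 S) := by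
      refine antitoneOn_of_deriv_nonpos (convex_Icc _ _)
        (fun σ hσ => (h σ hσ).1.continuousWithinAt) (fun σ hσ =>
          ((h σ (interior_subset hσ)).1.differentiableWithinAt).mono interior_subset)
        (fun σ hσ => ?_)
      rw [((h σ (interior_subset hσ)).1.hasDerivAt (mem_interior_iff_mem_nhds.1 hσ)).deriv]
      exact (ha σ).2.le
    exact this hcS hSS hcS.2
  -- At σ = c the parameter relation reads x = w(x) - w(c). If x ≥ η, monotonicity bounds the
  -- right-hand side by w(η) - w(c), which tends to 0.
  have hup : ∀ η ∈ Ioo 0 ρ, ∀ᶠ n in atTop, x n c < η := by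
    intro η hη
    filter_upwards [eventually_ge_atTop n₀, (hw.right η hη).eventually
      (gt_mem_nhds (show (0 : ℝ) < η / 2 by linarith [hη.1])),
      hwc.eventually (lt_mem_nhds (show -(η / 2) < (0 : ℝ) by linarith [hη.1]))] with n h1 h2 h3
    obtain ⟨-, -, -, h⟩ := hxa n h1
    obtain ⟨-, h5, -, h6⟩ := h c hcS
    by_contra hcon
    have h7 := (strictAntiOn_of_contDiffAt (hn₀ n h1).1).antitoneOn
      ⟨by linarith [hη.1], hη.2⟩ h5 (not_lt.1 hcon)
    linarith [hη.1]
  have hlim : ∀ y : ℕ → ℝ, (∀ᶠ n in atTop, x n S ≤ y n ∧ y n ≤ x n c) →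
      Tendsto y atTop (𝓝 0) := by
    intro y hy
    rw [Metric.tendsto_atTop']
    intro e he
    have hη : min e (ρ / 2) ∈ Ioo 0 ρ :=
      ⟨lt_min he (by positivity), (min_le_right _ _).trans_lt (by linarith)⟩
    obtain ⟨N, hN⟩ := eventually_atTop.1 ((hlow _ hη).and ((hup _ hη).and hy))
    refine ⟨N, fun n hn => ?_⟩
    obtain ⟨h1, h2, h3⟩ := hN n hn.le
    rw [Real.dist_eq, sub_zero, abs_lt]
    have := min_le_left e (ρ / 2)
    constructor <;> linarith
  have hge : ∀ᶠ n in atTop, n₀ ≤ n := eventually_ge_atTop n₀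
  have hlimc : Tendsto (fun n => x n c) atTop (𝓝 0) :=
    hlim _ (hge.mono fun n hn => ⟨hanti n hn, le_rfl⟩)
  have hlimS : Tendsto (fun n => x n S) atTop (𝓝 0) :=
    hlim _ (hge.mono fun n hn => ⟨le_rfl, hanti n hn⟩)
  have ha₀i : ∀ p q : ℝ, IntervalIntegrable a₀ volume p q := fun p q => by
    refine IntervalIntegrable.mono_fun (intervalIntegrable_const (c := (1 : ℝ))) ?_ ?_
    · exact (Measurable.ite measurableSet_Iio measurable_const
        measurable_const).aestronglyMeasurable
    · refine Eventually.of_forall fun s => ?_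
      simp only [ha₀]
      split_ifs <;> simp
  -- The difference of the speeds is 1 + a ≥ 0 before c and a < 0 after c, so the L¹ distance is
  -- computed exactly: it is x(c) + (x(c) - x(S)).
  have hint : ∀ n, n₀ ≤ n → ∫ s in (0 : ℝ)..S, |a n s - a₀ s| =
      (x n c + w n c - w n c) + (x n c - x n S) := by
    intro n hn
    obtain ⟨hx0, hac, ha, h⟩ := hxa n hn
    have hai : ∀ p q, IntervalIntegrable (fun s => |a n s - a₀ s|) volume p q := fun p q =>
      ((hac.intervalIntegrable p q).sub (ha₀i p q)).abs
    have hft : ∀ p ∈ Icc 0 S, ∀ q ∈ Icc 0 S, p ≤ q → ∫ s in p..q, a n s = x n q - x n p := by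
      intro p hp q hq hpq
      refine intervalIntegral.integral_eq_sub_of_hasDerivAt_of_le hpq
        (fun s hs => ((h s ⟨hp.1.trans hs.1, hs.2.trans hq.2⟩).1.continuousWithinAt).mono
          (Icc_subset_Icc hp.1 hq.2))
        (fun s hs => ?_) (hac.intervalIntegrable p q)
      have hs' : s ∈ Ioo 0 S := ⟨hp.1.trans_lt hs.1, hs.2.trans_le hq.2⟩
      exact (h s (Ioo_subset_Icc_self hs')).1.hasDerivAt (Icc_mem_nhds hs'.1 hs'.2)
    rw [← intervalIntegral.integral_add_adjacent_intervals (hai 0 c) (hai c S)]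
    have h1 : ∫ s in (0 : ℝ)..c, |a n s - a₀ s| = ∫ s in (0 : ℝ)..c, (1 + a n s) := by
      refine intervalIntegral.integral_congr_ae ?_
      have : ∀ᵐ s : ℝ, s ≠ c := by simp [ae_iff]
      filter_upwards [this] with s hs hsc
      rw [uIoc_of_le hc.le] at hsc
      have : s < c := lt_of_le_of_ne hsc.2 hs
      simp only [ha₀, this, if_true]
      rw [abs_of_nonneg (by linarith [(ha s).1])]
      ring
    have h2 : ∫ s in c..S, |a n s - a₀ s| = ∫ s in c..S, -a n s := by
      refine intervalIntegral.integral_congr fun s hs => ?_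
      rw [uIcc_of_le hcS.2] at hs
      simp only [ha₀, not_lt.2 hs.1, if_false, sub_zero]
      exact abs_of_neg (ha s).2
    rw [h1, h2, intervalIntegral.integral_add intervalIntegrable_const
      (hac.intervalIntegrable _ _), intervalIntegral.integral_neg,
      hft 0 ⟨le_rfl, hS⟩ c hcS hc.le, hft c hcS S hSS hcS.2, hx0]
    simp
  have hL1 : Tendsto (fun n => ∫ s in (0 : ℝ)..S, |a' n s - a₀ s|) atTop (𝓝 0) := by
    have h1 : Tendsto (fun n => (x n c + w n c - w n c) + (x n c - x n S)) atTop (𝓝 0) := by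
      simpa using hlimc.add (hlimc.sub hlimS)
    refine h1.congr' ?_
    filter_upwards [hge] with n hn
    rw [ea hn, hint n hn]
  have hb₀ : ∀ s, |a₀ s| ≤ 1 := fun s => by
    simp only [ha₀]
    split_ifs <;> simp
  refine ⟨DensityFamily.ofSeq a' a₀ 1 (fun n s => ?_) hb₀ (fun n => ?_) (ha₀i _ _) hL1,
    fun κ => κ.elim x₀ x', fun κ => ?_, fun σ => rfl, fun σ => rfl, ?_, ?_, ?_⟩
  · by_cases hn : n₀ ≤ n
    · rw [ea hn, abs_le]
      have := (hxa n hn).2.2.1 s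
      exact ⟨this.1, by linarith⟩
    · rw [ea' hn]; exact hb₀ s
  · by_cases hn : n₀ ≤ n
    · rw [ea hn]; exact (hxa n hn).2.1.intervalIntegrable _ _
    · rw [ea' hn]; exact ha₀i _ _
  · have hlim : ContinuousOn x₀ (Icc 0 S) ∧ x₀ 0 = c ∧
        ∀ σ ∈ Ioo 0 S \ {c}, HasDerivAt x₀ (a₀ σ) σ := by
      refine ⟨by fun_prop, by simp [hx₀, hc.le], fun σ hσ => ?_⟩
      rcases lt_or_gt_of_ne (show σ ≠ c from hσ.2) with h | h
      · have h1 : HasDerivAt (fun σ : ℝ => c - σ) (-1) σ := (hasDerivAt_id σ).const_sub c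
        simp only [ha₀, h, if_true]
        refine h1.congr_of_eventuallyEq ?_
        filter_upwards [gt_mem_nhds h] with s hs
        exact max_eq_left (by linarith)
      · simp only [ha₀, not_lt.2 h.le, if_false]
        refine (hasDerivAt_const σ (0 : ℝ)).congr_of_eventuallyEq ?_
        filter_upwards [lt_mem_nhds h] with s hs
        exact max_eq_right (by linarith)
    induction κ using OnePoint.rec with
    | infty => exact hlim
    | coe n =>
      by_cases hn : n₀ ≤ n
      · obtain ⟨h1, h2, h3, h4⟩ := hxa n hn
        change ContinuousOn (x' n) _ ∧ x' n 0 = c ∧ ∀ σ ∈ _, HasDerivAt (x' n) (a' n σ) σ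
        rw [ex hn, ea hn]
        refine ⟨fun σ hσ => (h4 σ hσ).1.continuousWithinAt, h1, fun σ hσ => ?_⟩
        exact (h4 σ (Ioo_subset_Icc_self hσ.1)).1.hasDerivAt (Icc_mem_nhds hσ.1.1 hσ.1.2)
      · change ContinuousOn (x' n) _ ∧ x' n 0 = c ∧ ∀ σ ∈ _, HasDerivAt (x' n) (a' n σ) σ
        rw [ex' hn, ea' hn]
        exact hlim
  · filter_upwards [hge] with n hn
    obtain ⟨h1, h2, h3, h4⟩ := hxa n hn
    change ContinuousOn (a' n) _ ∧ ∀ σ ∈ _, HasDerivWithinAt (x' n) (a' n σ) _ σ ∧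
      a' n σ < 0 ∧ x' n σ ∈ _ ∧ 1 + a' n σ = deriv (w n) (x' n σ) * a' n σ
    rw [ex hn, ea hn]
    exact ⟨h2.continuousOn, fun σ hσ => ⟨(h4 σ hσ).1, (h3 σ).2, (h4 σ hσ).2.1, (h4 σ hσ).2.2.1⟩⟩
  · refine hlimS.congr' ?_
    filter_upwards [hge] with n hn
    exact (congrFun (ex hn) S).symm
  · have h1 : Tendsto (fun n => S - c + x n S + w n c) atTop (𝓝 w₀) := by
      have := (hlimS.const_add (S - c)).add hwc
      simpa [hSdef] using this
    refine h1.congr' ?_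
    filter_upwards [hge] with n hn
    change _ = w n (x' n S)
    rw [ex hn]
    linarith [((hxa n hn).2.2.2 S hSS).2.2.2]

end SteepBarrier

end Barrier

/-! ### Collision charts -/

section CollisionChart

open OnePoint

theorem OnePoint.nhds_natCast (n : ℕ) : 𝓝 (n : OnePoint ℕ) = pure (n : OnePoint ℕ) := by
  rw [OnePoint.nhds_coe_eq, nhds_discrete, Filter.map_pure]

/-- Finite indices are isolated points of `OnePoint ℕ`, so joint continuity has content only at ∞,
where it follows from uniform convergence and continuity of the limit. -/
theorem ContDiffFamAt.of_tendstoUniformlyOn {E G : Type} [NormedAddCommGroup E] [NormedSpace ℝ E]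
    [NormedAddCommGroup G] [NormedSpace ℝ G] {F : OnePoint ℕ → E → G} {m : ℕ} {x : E} {O : Set E}
    (hO : O ∈ 𝓝 x) (hF : ∀ᶠ n : ℕ in atTop, ∀ z ∈ O, ContDiffAt ℝ m (F n) z)
    (hlim : ∀ z ∈ O, ContDiffAt ℝ m (F ∞) z)
    (hconv : ∀ k ≤ m, TendstoUniformlyOn (fun n : ℕ => iteratedFDeriv ℝ k (F n))
      (iteratedFDeriv ℝ k (F ∞)) atTop O) : ContDiffFamAt m F (∞, x) := by
  have h1 : ∀ᶠ κ in 𝓝 (∞ : OnePoint ℕ), ∀ z ∈ O, ContDiffAt ℝ m (F κ) z :=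
    OnePoint.eventually_nhds_infty.2 ⟨hlim, hF⟩
  have h2 : ∀ᶠ z in 𝓝 x, O ∈ 𝓝 z := eventually_mem_nhds_iff.2 hO
  rw [ContDiffFamAt, nhds_prod_eq]
  filter_upwards [h1.prod_mk h2] with ⟨κ, z⟩ ⟨hκ, hz⟩
  refine ⟨hκ z (mem_of_mem_nhds hz), fun k hk => ?_⟩
  have hk' : (k : WithTop ℕ∞) ≤ m := by exact_mod_cast hk
  have hc := (hκ z (mem_of_mem_nhds hz)).continuousAt_iteratedFDeriv hk'
  induction κ using OnePoint.rec with
  | coe n =>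
    rw [ContinuousAt, nhds_prod_eq, OnePoint.nhds_natCast, pure_prod, tendsto_map'_iff]
    exact hc
  | infty =>
    rw [Metric.continuousAt_iff']
    intro ε hε
    have h3 : ∀ᶠ κ in 𝓝 (∞ : OnePoint ℕ), ∀ z ∈ O,
        dist (iteratedFDeriv ℝ k (F ∞) z) (iteratedFDeriv ℝ k (F κ) z) < ε / 2 :=
      OnePoint.eventually_nhds_infty.2 ⟨fun z _ => by simpa using hε,
        Metric.tendstoUniformlyOn_iff.1 (hconv k hk) _ (half_pos hε)⟩
    have h4 := (Metric.continuousAt_iff'.1 hc _ (half_pos hε)).and hz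
    rw [nhds_prod_eq]
    filter_upwards [h3.prod_mk h4] with ⟨κ', z'⟩ ⟨h5, h6, h7⟩
    refine (dist_triangle_left _ _ (iteratedFDeriv ℝ k (F ∞) z')).trans_lt ?_
    linarith [h5 z' h7, h6]

variable {d r n : ℕ} {L : AddSubgroup (Config d)}

theorem exists_closedBall_subset {E : Type*} [PseudoMetricSpace E] [ProperSpace E] {O : Set E}
    {x : E} (hO : O ∈ 𝓝 x) : ∃ K ⊆ O, IsCompact K ∧ K ∈ 𝓝 x := by
  obtain ⟨η, hη, h⟩ := Metric.nhds_basis_closedBall.mem_iff.1 hO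
  exact ⟨_, h, isCompact_closedBall _ _, Metric.closedBall_mem_nhds _ hη⟩

/-- Condition I along a sequence of values of the parameter. -/
theorem ConditionI.contDiffFamAt {B : BilliardTable d r n L} {V : ℝ → Config d → ℝ}
    (hI : ConditionI B V) (hV : ∀ ε, 0 < ε → ContDiff ℝ (r + 1 : ℕ) (V ε)) {ε : ℕ → ℝ}
    (hε : Tendsto ε atTop (𝓝[>] 0)) {q : Config d} (hq : q ∈ interior B.D) :
    ContDiffFamAt (r + 1) (fun κ : OnePoint ℕ => κ.elim 0 fun n => V (ε n)) (∞, q) := by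
  obtain ⟨K, hKs, hK, hKq⟩ := exists_closedBall_subset (isOpen_interior.mem_nhds hq)
  have hpos : ∀ᶠ n in atTop, 0 < ε n := hε.eventually self_mem_nhdsWithin
  refine ContDiffFamAt.of_tendstoUniformlyOn hKq ?_ (fun z _ => contDiffAt_const) fun k hk => ?_
  · filter_upwards [hpos] with n hn z _ using (hV _ hn).contDiffAt
  · have e : iteratedFDeriv ℝ k ((∞ : OnePoint ℕ).elim (0 : Config d → ℝ) fun n => V (ε n)) = 0 :=
      iteratedFDeriv_fun_zero
    rw [e]
    exact fun u hu => hε.eventually (hI K hKs hK k hk u hu)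

theorem PatternFunction.contDiffFamAt {B : BilliardTable d r n L} (P : PatternFunction B)
    {ε : ℕ → ℝ} (hε : Tendsto ε atTop (𝓝[>] 0)) {q : Config d} (hq : q ∈ P.dom) :
    ContDiffFamAt (r + 1) (fun κ : OnePoint ℕ => P.Q (κ.elim 0 ε)) (∞, q) := by
  obtain ⟨K, hKs, hK, hKq⟩ := exists_closedBall_subset (P.isOpen_dom.mem_nhds hq)
  have hpos : ∀ᶠ n in atTop, 0 < ε n := hε.eventually self_mem_nhdsWithin
  have hε' : Tendsto ε atTop (𝓝[Ici 0] 0) := hε.mono_right (nhdsWithin_mono _ Ioi_subset_Ici_self)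
  refine ContDiffFamAt.of_tendstoUniformlyOn hKq ?_ (fun z hz => ?_) fun k hk => ?_
  · filter_upwards [hpos] with n hn z hz
    exact (P.contDiffOn _ hn.le).contDiffAt (P.isOpen_dom.mem_nhds (hKs hz))
  · exact (P.contDiffOn _ le_rfl).contDiffAt (P.isOpen_dom.mem_nhds (hKs hz))
  · exact fun u hu => hε'.eventually (P.continuous_param 0 le_rfl K hKs hK k hk u hu)

/-- Local data for a collision at `q`: there the table is `g ≥ 0`, the potential is `w ∘ g` with a
steep barrier `w`, and `χ` is the inverse of the barrier. -/
structure CollisionChart (r : ℕ) (D : Set (Config d)) (𝓔 : EReal) (U : ℕ → Config d → ℝ)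
    (q : Config d) where
  /-- half the width of the range of definition of the barrier -/
  ρ : ℝ
  /-- the barrier -/
  w : ℕ → ℝ → ℝ
  /-- the defining functions of the wall -/
  g : OnePoint ℕ → Config d → ℝ
  /-- the inverse of the barrier -/
  χ : OnePoint ℕ → ℝ → ℝ
  barrier : SteepBarrier ρ 𝓔 w
  g_family : ContDiffFamAt (r + 1) g (∞, q)
  g_zero : g ∞ q = 0
  gradient_ne_zero : gradient (g ∞) q ≠ 0
  domain : ∀ᶠ x in 𝓝 q, (x ∈ D ↔ 0 ≤ g ∞ x)
  potential : ∀ᶠ y in 𝓝 ((∞ : OnePoint ℕ), q), ∀ n : ℕ, y.1 = (n : OnePoint ℕ) → U n y.2 = w n (g n y.2)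
  χ_family : ∀ v : ℝ, 0 < v → (v : EReal) < 𝓔 → ContDiffFamAt (r + 1) χ (∞, v)
  χ_infty : ∀ v, χ ∞ v = 0
  χ_inverse : ∀ v : ℝ, 0 < v → (v : EReal) < 𝓔 → ∀ᶠ y in 𝓝 ((∞ : OnePoint ℕ), v),
    ∀ n : ℕ, y.1 = (n : OnePoint ℕ) → χ n y.2 ∈ Ioo (-ρ) ρ ∧ w n (χ n y.2) = y.2

/-- Darboux: derivatives have the intermediate value property. -/
theorem forall_neg_or_forall_pos {f : ℝ → ℝ} {a b : ℝ}
    (hf : ∀ x ∈ Ioo a b, DifferentiableAt ℝ f x) (h : ∀ x ∈ Ioo a b, deriv f x ≠ 0) :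
    (∀ x ∈ Ioo a b, deriv f x < 0) ∨ ∀ x ∈ Ioo a b, 0 < deriv f x :=
  hasDerivWithinAt_forall_lt_or_forall_gt_of_forall_ne (convex_Ioo a b)
    (fun x hx => (hf x hx).hasDerivAt.hasDerivWithinAt) h

theorem injOn_of_deriv_ne_zero {f : ℝ → ℝ} {a b : ℝ}
    (hf : ∀ x ∈ Ioo a b, DifferentiableAt ℝ f x) (h : ∀ x ∈ Ioo a b, deriv f x ≠ 0) :
    InjOn f (Ioo a b) := by
  have hc : ContinuousOn f (Ioo a b) := fun x hx => (hf x hx).continuousAt.continuousWithinAt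
  rcases forall_neg_or_forall_pos hf h with h' | h'
  · exact (strictAntiOn_of_deriv_neg (convex_Ioo a b) hc
      (fun x hx => h' x (interior_subset hx))).injOn
  · exact (strictMonoOn_of_deriv_pos (convex_Ioo a b) hc
      (fun x hx => h' x (interior_subset hx))).injOn

/-- A right inverse of a monotone function is smooth. -/
theorem contDiffAt_of_rightInverse {f χ : ℝ → ℝ} {a b W₁ W₂ v : ℝ} {m : WithTop ℕ∞} (hm : m ≠ 0)
    (hf : ∀ x ∈ Ioo a b, ContDiffAt ℝ m f x) (h : ∀ x ∈ Ioo a b, deriv f x ≠ 0)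
    (hχ : ∀ v ∈ Ioo W₁ W₂, χ v ∈ Ioo a b ∧ f (χ v) = v) (hv : v ∈ Ioo W₁ W₂) :
    ContDiffAt ℝ m χ v := by
  obtain ⟨hx, hfx⟩ := hχ v hv
  set x := χ v with hxdef
  have hd : HasDerivAt f (deriv f x) x := ((hf x hx).differentiableAt hm).hasDerivAt
  have hinj := injOn_of_deriv_ne_zero (fun x hx => (hf x hx).differentiableAt hm) h
  set e : ℝ ≃L[ℝ] ℝ := ContinuousLinearEquiv.unitsEquivAut ℝ (Units.mk0 _ (h x hx)) with he
  have hd' : HasFDerivAt f (e : ℝ →L[ℝ] ℝ) x := by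
    refine hd.hasFDerivAt.congr_fderiv ?_
    ext
    simp [he]
  have hs : HasStrictFDerivAt f (e : ℝ →L[ℝ] ℝ) x := (hf x hx).hasStrictFDerivAt' hd' hm
  have h1 : ∀ᶠ y in 𝓝 x, χ (f y) = y := by
    have h2 : ∀ᶠ y in 𝓝 x, f y ∈ Ioo W₁ W₂ :=
      (hf x hx).continuousAt.eventually_mem (by rw [hfx]; exact Ioo_mem_nhds hv.1 hv.2)
    filter_upwards [Ioo_mem_nhds hx.1 hx.2, h2] with y hy hy2
    exact hinj (hχ _ hy2).1 hy (hχ _ hy2).2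
  have h3 := hs.localInverse_unique h1
  have h4 := (hf x hx).to_localInverse hd' hm
  rw [hfx] at h3 h4
  exact h4.congr_of_eventuallyEq h3

/-- Condition III speaks of values of Q(·; 0) at points of the configuration space. The line through
`q` along the gradient enters the interior on one side and leaves the table on the other, so by the
intermediate value theorem all small positive and negative values occur at such points. The
derivative of the barrier has constant sign, and the sign is negative because the barrier is higher
outside. -/
theorem exists_steepBarrier {B : BilliardTable d r n L} {P : PatternFunction B}
    (A : BarrierFunctions P) (hIIc : ConditionIIc A) {𝓔 : EReal} (h𝓔 : 0 < 𝓔)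
    (hIII : ConditionIII A 𝓔) {ε : ℕ → ℝ} (hε : Tendsto ε atTop (𝓝[>] 0)) {i : Fin n} {σ : ℝ}
    (hσ : σ = 1 ∨ σ = -1) {q : Config d} (hq : q ∈ A.N i) (hlev : P.Q 0 q = A.level i)
    (hD : ∀ᶠ x in 𝓝 q, (x ∈ B.D ↔ 0 ≤ σ * (P.Q 0 x - A.level i))) :
    ∃ ρ ≤ A.w i, SteepBarrier ρ 𝓔 (fun n x => A.W i (ε n) (σ * x)) := by
  have hσσ : ∀ x : ℝ, σ * (σ * x) = x := fun x => by rcases hσ with rfl | rfl <;> ring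
  set G : Config d → ℝ := fun x => σ * (P.Q 0 x - A.level i) with hG
  have hQ : ContDiffAt ℝ (r + 1 : ℕ) (P.Q 0) q :=
    (P.contDiffOn 0 le_rfl).contDiffAt (P.isOpen_dom.mem_nhds (A.N_subset i hq))
  have hGc : ContDiffAt ℝ (r + 1 : ℕ) G q := contDiffAt_const.mul (hQ.sub contDiffAt_const)
  have hG1 : ContDiffAt ℝ 1 G q := hGc.of_le (by exact_mod_cast Nat.le_add_left 1 r)
  have hGq : G q = 0 := by simp [hG, hlev]
  have hne : gradient G q ≠ 0 := by
    have h1 : fderiv ℝ G q = σ • fderiv ℝ (P.Q 0) q := by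
      rw [hG, fderiv_const_mul ((hQ.differentiableAt (by simp)).sub_const _), fderiv_sub_const]
    have h2 : fderiv ℝ G q ≠ 0 := by
      rw [h1]
      refine smul_ne_zero ?_ (hIIc.1 i 0 le_rfl q hq)
      rcases hσ with rfl | rfl <;> norm_num
    intro h3
    rw [gradient, LinearIsometryEquiv.map_eq_zero_iff] at h3
    exact h2 h3
  set e := gradient G q with he
  have hline : HasDerivAt (fun t : ℝ => G (q + t • e)) (‖e‖ ^ 2) 0 := by
    have h1 : HasDerivAt (fun t : ℝ => q + t • e) e 0 := by
      simpa using ((hasDerivAt_id (0 : ℝ)).smul_const e).const_add q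
    have h2 : HasFDerivAt G (InnerProductSpace.toDual ℝ (Config d) e) (q + (0 : ℝ) • e) := by
      rw [zero_smul, add_zero]
      exact (hG1.differentiableAt (by simp)).hasGradientAt.hasFDerivAt
    have h3 := h2.comp_hasDerivAt (0 : ℝ) h1
    rw [InnerProductSpace.toDual_apply_apply, real_inner_self_eq_norm_sq] at h3
    exact h3
  have hepos : 0 < ‖e‖ ^ 2 := by have := norm_pos_iff.2 hne; positivity
  have hcont : Continuous (fun t : ℝ => q + t • e) := by fun_prop
  have htend : Tendsto (fun t : ℝ => q + t • e) (𝓝 0) (𝓝 q) := by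
    simpa using hcont.tendsto 0
  have hev := htend.eventually ((A.isOpen_N i).eventually_mem hq |>.and
    (hD.and ((eventually_mem_interior_of_pos hG1 hD).and (hG1.eventually (by simp)))))
  obtain ⟨η, hη, hball⟩ := Metric.eventually_nhds_iff_ball.1 hev
  have hslope := hline.tendsto_slope_zero_right
  have hslope' := hline.tendsto_slope_zero_left
  simp only [zero_add, zero_smul, add_zero, hGq, sub_zero, smul_eq_mul] at hslope hslope'
  have hp : ∀ᶠ t in 𝓝[>] (0 : ℝ), 0 < G (q + t • e) := by
    filter_upwards [hslope.eventually (lt_mem_nhds hepos), self_mem_nhdsWithin] with t ht ht0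
    have ht0' : (0 : ℝ) < t := ht0
    by_contra hcon
    exact absurd ht (not_lt.2 (mul_nonpos_of_nonneg_of_nonpos (inv_nonneg.2 ht0'.le)
      (not_lt.1 hcon)))
  have hm : ∀ᶠ t in 𝓝[<] (0 : ℝ), G (q + t • e) < 0 := by
    filter_upwards [hslope'.eventually (lt_mem_nhds hepos), self_mem_nhdsWithin] with t ht ht0
    have ht0' : t < 0 := ht0
    by_contra hcon
    exact absurd ht (not_lt.2 (mul_nonpos_of_nonpos_of_nonneg (inv_nonpos.2 ht0'.le)
      (not_lt.1 hcon)))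
  obtain ⟨s₁, hs₁, hs₁'⟩ := (hp.and (Ioo_mem_nhdsGT hη)).exists
  obtain ⟨s₂, hs₂, hs₂'⟩ := (hm.and (Ioo_mem_nhdsLT (neg_lt_zero.2 hη))).exists
  have hin : ∀ t ∈ Icc s₂ s₁, t ∈ Metric.ball (0 : ℝ) η := fun t ht => by
    rw [Metric.mem_ball, dist_zero_right, Real.norm_eq_abs, abs_lt]
    exact ⟨hs₂'.1.trans_le ht.1, ht.2.trans_lt hs₁'.2⟩
  have hco : ContinuousOn (fun t : ℝ => G (q + t • e)) (Icc s₂ s₁) := fun t ht =>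
    (ContinuousAt.comp (f := fun t : ℝ => q + t • e)
      (hball t (hin t ht)).2.2.2.continuousAt hcont.continuousAt).continuousWithinAt
  have hG0 : G (q + (0 : ℝ) • e) = 0 := by simpa using hGq
  -- All values in (-ρ, ρ) are taken on the segment between the two chosen points and lie in the
  -- range where W_i is smooth.
  set ρ := min (A.w i) (min (G (q + s₁ • e)) (-G (q + s₂ • e))) with hρ
  have hρ0 : 0 < ρ := lt_min (A.w_pos i) (lt_min hs₁ (by linarith))
  have hρw : ρ ≤ A.w i := min_le_left _ _
  have hpos : ∀ᶠ n in atTop, 0 < ε n := hε.eventually self_mem_nhdsWithin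
  have hright : ∀ x ∈ Ioo 0 ρ, Tendsto (fun n => A.W i (ε n) (σ * x)) atTop (𝓝 0) := by
    intro x hx
    have hx2 : x ≤ G (q + s₁ • e) := hx.2.le.trans ((min_le_right _ _).trans (min_le_left _ _))
    obtain ⟨t, ht, rfl⟩ := intermediate_value_Icc hs₁'.1.le
      (hco.mono (Icc_subset_Icc_left hs₂'.2.le)) (show x ∈ Icc _ _ from ⟨hG0.le.trans hx.1.le, hx2⟩)
    have hb := hball t (hin t ⟨hs₂'.2.le.trans ht.1, ht.2⟩)
    simp only [hG, hσσ]
    exact ((hIII i).1 _ ⟨hb.1, hb.2.2.1 hx.1⟩).comp hε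
  have hleft : ∀ x ∈ Ioo (-ρ) 0, ∀ m : ℝ, (m : EReal) < 𝓔 →
      ∀ᶠ n in atTop, m < A.W i (ε n) (σ * x) := by
    intro x hx m hm
    have hx2 : G (q + s₂ • e) ≤ x := by
      have : ρ ≤ -G (q + s₂ • e) := (min_le_right _ _).trans (min_le_right _ _)
      linarith [hx.1]
    obtain ⟨t, ht, rfl⟩ := intermediate_value_Icc hs₂'.2.le
      (hco.mono (Icc_subset_Icc_right hs₁'.1.le)) (show x ∈ Icc _ _ from ⟨hx2, hx.2.le.trans hG0.ge⟩)
    have hb := hball t (hin t ⟨ht.1, ht.2.trans hs₁'.1.le⟩)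
    simp only [hG, hσσ]
    have hnD : q + t • e ∉ B.D := fun h => absurd (hb.2.1.1 h) (not_le.2 hx.2)
    filter_upwards [(((hIII i).2 _ ⟨hb.1, hnD⟩).comp hε).eventually (lt_mem_nhds hm)] with n hn
    exact EReal.coe_lt_coe_iff.1 hn
  refine ⟨ρ, hρw, hρ0, ?_, hright, hleft⟩
  obtain ⟨m, hm1, hm2⟩ := EReal.lt_iff_exists_real_btwn.1 h𝓔
  have hm1' : 0 < m := by exact_mod_cast hm1
  filter_upwards [hpos, (hright (ρ / 2) ⟨by positivity, by linarith⟩).eventually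
    (gt_mem_nhds hm1'), hleft (-(ρ / 2)) ⟨by linarith, by linarith⟩ m hm2] with n hn h1 h2
  have hmem : ∀ x ∈ Ioo (-ρ) ρ, σ * x ∈ Ioo (-A.w i) (A.w i) := fun x hx => by
    rcases hσ with rfl | rfl
    · constructor <;> linarith [hx.1, hx.2]
    · constructor <;> linarith [hx.1, hx.2]
  have hsm : ∀ x ∈ Ioo (-ρ) ρ, ContDiffAt ℝ 1 (fun x => A.W i (ε n) (σ * x)) x := by
    intro x hx
    have h3 : ContDiffAt ℝ (r + 1 : ℕ) (A.W i (ε n)) (σ * x) :=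
      (A.contDiffOn_W i _ hn).contDiffAt (Ioo_mem_nhds (hmem x hx).1 (hmem x hx).2)
    exact ContDiffAt.comp x (h3.of_le (by exact_mod_cast Nat.le_add_left 1 r))
      (contDiffAt_const.mul contDiffAt_id)
  have hdn : ∀ x ∈ Ioo (-ρ) ρ, deriv (fun x => A.W i (ε n) (σ * x)) x ≠ 0 := by
    intro x hx
    rw [deriv_comp_mul_left]
    refine smul_ne_zero ?_ (hIIc.2 i _ hn _ (hmem x hx))
    rcases hσ with rfl | rfl <;> norm_num
  refine fun x hx => ⟨hsm x hx, ?_⟩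
  rcases forall_neg_or_forall_pos (fun x hx => (hsm x hx).differentiableAt (by simp)) hdn with h | h
  · exact h x hx
  · exfalso
    have h3 := strictMonoOn_of_deriv_pos (convex_Ioo (-ρ) ρ)
      (fun x hx => (hsm x hx).continuousAt.continuousWithinAt)
      (fun x hx => h x (interior_subset hx))
      (show -(ρ / 2) ∈ Ioo (-ρ) ρ from ⟨by linarith, by linarith⟩)
      (show ρ / 2 ∈ Ioo (-ρ) ρ from ⟨by linarith, by linarith⟩) (by linarith)
    simp only at h3
    linarith

/-- For large indices the barrier takes on [-ρ/2, ρ/2] all values of a compact interval around `v`,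
and by injectivity on (-w_i, w_i) the inverse of Condition IV picks these points. Smoothness comes
from the inverse function theorem, convergence to 0 from Condition IV. -/
theorem exists_barrier_inverse {B : BilliardTable d r n L} {P : PatternFunction B}
    (A : BarrierFunctions P) (hIIc : ConditionIIc A) {𝓔 : EReal}
    (hIV : ConditionIV A 𝓔) {ε : ℕ → ℝ} (hε : Tendsto ε atTop (𝓝[>] 0)) {i : Fin n} {σ ρ : ℝ}
    (hσ : σ = 1 ∨ σ = -1) (hρ : ρ ≤ A.w i)
    (hw : SteepBarrier ρ 𝓔 (fun n x => A.W i (ε n) (σ * x))) {v : ℝ} (hv : 0 < v)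
    (hv' : (v : EReal) < 𝓔) :
    ContDiffFamAt (r + 1) (fun (κ : OnePoint ℕ) v => σ * (κ.elim 0 fun n => A.inverse i (ε n) : ℝ → ℝ) v) (∞, v) ∧
    ∀ᶠ y in 𝓝 ((∞ : OnePoint ℕ), v), ∀ n : ℕ, y.1 = (n : OnePoint ℕ) →
      σ * A.inverse i (ε n) y.2 ∈ Ioo (-ρ) ρ ∧
        A.W i (ε n) (σ * (σ * A.inverse i (ε n) y.2)) = y.2 := by
  have hσσ : ∀ x : ℝ, σ * (σ * x) = x := fun x => by rcases hσ with rfl | rfl <;> ring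
  have hρ0 := hw.pos
  obtain ⟨W₂, h1, h2⟩ := EReal.lt_iff_exists_real_btwn.1 hv'
  have h1' : v < W₂ := by exact_mod_cast h1
  set W₁ := v / 2 with hW₁
  have hW₁0 : 0 < W₁ := by positivity
  have hW₁v : W₁ < v := by rw [hW₁]; linarith
  have hpos : ∀ᶠ n in atTop, 0 < ε n := hε.eventually self_mem_nhdsWithin
  have hmem : ∀ x ∈ Ioo (-ρ) ρ, σ * x ∈ Ioo (-A.w i) (A.w i) := fun x hx => by
    rcases hσ with rfl | rfl
    · constructor <;> linarith [hx.1, hx.2]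
    · constructor <;> linarith [hx.1, hx.2]
  have key : ∀ᶠ n in atTop, 0 < ε n ∧ (∀ v ∈ Icc W₁ W₂, σ * A.inverse i (ε n) v ∈ Ioo (-ρ) ρ ∧
      A.W i (ε n) (σ * (σ * A.inverse i (ε n) v)) = v) := by
    filter_upwards [hpos, hw.smooth, (hw.right (ρ / 2) ⟨by positivity, by linarith⟩).eventually
      (gt_mem_nhds hW₁0), hw.left (-(ρ / 2)) ⟨by linarith, by linarith⟩ W₂ h2] with n hn h3 h4 h5
    refine ⟨hn, fun v hv => ?_⟩
    have hc : ContinuousOn (fun x => A.W i (ε n) (σ * x)) (Icc (-(ρ / 2)) (ρ / 2)) := fun x hx =>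
      (h3 x ⟨by linarith [hx.1], by linarith [hx.2]⟩).1.continuousAt.continuousWithinAt
    obtain ⟨x, hx, hxv⟩ := intermediate_value_Icc' (by linarith) hc
      (show v ∈ Icc _ _ from ⟨h4.le.trans hv.1, hv.2.trans h5.le⟩)
    simp only at hxv
    have hx' : x ∈ Ioo (-ρ) ρ := ⟨by linarith [hx.1], by linarith [hx.2]⟩
    have hex : ∃ a ∈ Ioo (-A.w i) (A.w i), A.W i (ε n) a = v := ⟨σ * x, hmem x hx', hxv⟩
    have h6 : A.inverse i (ε n) v ∈ Ioo (-A.w i) (A.w i) := Function.invFunOn_mem hex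
    have h7 : A.W i (ε n) (A.inverse i (ε n) v) = v := Function.invFunOn_eq hex
    have hinj := injOn_of_deriv_ne_zero (fun x hx => ((A.contDiffOn_W i _ hn).contDiffAt
      (Ioo_mem_nhds hx.1 hx.2)).differentiableAt (by simp)) (hIIc.2 i _ hn)
    have h8 : A.inverse i (ε n) v = σ * x := hinj h6 (hmem x hx') (h7.trans hxv.symm)
    rw [hσσ, h7, h8, hσσ]
    exact ⟨hx', rfl⟩
  constructor
  · refine ContDiffFamAt.clm_comp (F := fun κ : OnePoint ℕ => (κ.elim 0 fun n =>
      A.inverse i (ε n) : ℝ → ℝ)) ?_ (σ • ContinuousLinearMap.id ℝ ℝ)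
    refine ContDiffFamAt.of_tendstoUniformlyOn (O := Ioo W₁ W₂) (Ioo_mem_nhds hW₁v h1') ?_
      (fun z _ => contDiffAt_const) fun k hk => ?_
    · filter_upwards [key] with n ⟨hn, hχ⟩ z hz
      have hsm : ∀ x ∈ Ioo (-A.w i) (A.w i), ContDiffAt ℝ (r + 1 : ℕ) (A.W i (ε n)) x :=
        fun x hx => (A.contDiffOn_W i _ hn).contDiffAt (Ioo_mem_nhds hx.1 hx.2)
      refine contDiffAt_of_rightInverse (by simp) hsm (hIIc.2 i _ hn) (fun v hv => ?_) hz
      have h3 := hχ v (Ioo_subset_Icc_self hv)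
      have h4 := hmem _ h3.1
      rw [hσσ] at h3 h4
      exact ⟨h4, h3.2⟩
    · have e : iteratedFDeriv ℝ k ((∞ : OnePoint ℕ).elim (0 : ℝ → ℝ) fun n =>
          A.inverse i (ε n)) = 0 := iteratedFDeriv_fun_zero
      rw [e, Metric.tendstoUniformlyOn_iff]
      intro η hη
      have h3 := hε.eventually (Metric.tendstoUniformlyOn_iff.1
        (hIV i W₁ W₂ hW₁0 (hW₁v.trans h1') h2 k hk) η hη)
      filter_upwards [h3] with n hn x hx
      have h4 := hn x (Ioo_subset_Icc_self hx)
      simp only [Pi.zero_apply, dist_zero_left] at h4 ⊢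
      rwa [← norm_iteratedFDeriv_eq_norm_iteratedDeriv] at h4
  · have h3 : ∀ᶠ κ in 𝓝 (∞ : OnePoint ℕ), ∀ n : ℕ, κ = (n : OnePoint ℕ) → ∀ v ∈ Icc W₁ W₂,
        σ * A.inverse i (ε n) v ∈ Ioo (-ρ) ρ ∧
          A.W i (ε n) (σ * (σ * A.inverse i (ε n) v)) = v := by
      refine OnePoint.eventually_nhds_infty.2 ⟨fun n hn => absurd hn (OnePoint.infty_ne_coe n), ?_⟩
      filter_upwards [key] with n hn m hm
      rw [← OnePoint.coe_injective hm]
      exact hn.2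
    rw [nhds_prod_eq]
    filter_upwards [h3.prod_mk (Icc_mem_nhds hW₁v h1')] with y hy n hn
    exact hy.1 n hn y.2 hy.2

/-- The sign σ, chosen so that g = σ(Q - Q_i) is nonnegative on the table, is compensated in the
barrier W_i(σx) and in its inverse. At ∞ the function Q is taken at ε = 0 and the inverse barrier is
0. -/
theorem exists_collisionChart {B : BilliardTable d r n L} {V : ℝ → Config d → ℝ}
    {P : PatternFunction B} {A : BarrierFunctions P} {𝓔 : EReal} (h𝓔 : 0 < 𝓔)
    (hIIa : ConditionIIa A) (hIIb : ConditionIIb A V) (hIIc : ConditionIIc A)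
    (hIII : ConditionIII A 𝓔) (hIV : ConditionIV A 𝓔)
    {ε : ℕ → ℝ} (hε : Tendsto ε atTop (𝓝[>] 0)) {q v : Config d} (hq : q ∈ frontier B.D)
    (hqc : q ∉ B.corners) (hv : IsInwardUnitNormal B.D q v) :
    Nonempty (CollisionChart r B.D 𝓔 (fun n => V (ε n)) q) := by
  obtain ⟨i, σ, hσ, hN, hlev, hD⟩ := exists_local_chart A hIIa hIIc hq hqc hv
  obtain ⟨ρ, hρ, hw⟩ := exists_steepBarrier A hIIc h𝓔 hIII hε hσ hN hlev hD
  have hσσ : ∀ x : ℝ, σ * (σ * x) = x := fun x => by rcases hσ with rfl | rfl <;> ring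
  have hpos : ∀ᶠ n in atTop, 0 < ε n := hε.eventually self_mem_nhdsWithin
  refine ⟨{ ρ := ρ, w := fun n x => A.W i (ε n) (σ * x)
            g := fun κ x => σ * (P.Q (κ.elim 0 ε) x - A.level i)
            χ := fun (κ : OnePoint ℕ) v => σ * (κ.elim 0 fun n => A.inverse i (ε n) : ℝ → ℝ) v
            barrier := hw, g_family := ?_, g_zero := ?_, gradient_ne_zero := ?_, domain := hD
            potential := ?_
            χ_family := fun v hv hv' => (exists_barrier_inverse A hIIc hIV hε hσ hρ hw hv hv').1
            χ_infty := fun v => mul_zero σ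
            χ_inverse := fun v hv hv' =>
              (exists_barrier_inverse A hIIc hIV hε hσ hρ hw hv hv').2 }⟩
  · exact ((P.contDiffFamAt hε (A.N_subset i hN)).sub
      (ContDiffFamAt.of_contDiffAt (contDiffAt_const (c := A.level i)) ∞)).clm_comp
      (σ • ContinuousLinearMap.id ℝ ℝ)
  · change σ * (P.Q 0 q - A.level i) = 0
    rw [hlev, sub_self, mul_zero]
  · intro h
    have hQ : ContDiffAt ℝ (r + 1 : ℕ) (P.Q 0) q :=
      (P.contDiffOn 0 le_rfl).contDiffAt (P.isOpen_dom.mem_nhds (A.N_subset i hN))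
    change gradient (fun x => σ * (P.Q 0 x - A.level i)) q = 0 at h
    rw [gradient, LinearIsometryEquiv.map_eq_zero_iff,
      fderiv_const_mul ((hQ.differentiableAt (by simp)).sub_const _), fderiv_sub_const] at h
    refine smul_ne_zero ?_ (hIIc.1 i 0 le_rfl q hN) h
    rcases hσ with rfl | rfl <;> norm_num
  · have h1 : ∀ᶠ κ in 𝓝 (∞ : OnePoint ℕ), ∀ n : ℕ, κ = (n : OnePoint ℕ) → 0 < ε n := by
      refine OnePoint.eventually_nhds_infty.2 ⟨fun n hn => absurd hn (OnePoint.infty_ne_coe n), ?_⟩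
      filter_upwards [hpos] with n hn m hm
      rw [← OnePoint.coe_injective hm]
      exact hn
    rw [nhds_prod_eq]
    filter_upwards [h1.prod_mk ((A.isOpen_N i).mem_nhds hN)] with y hy n hn
    rw [hσσ]
    exact hIIb i _ (hy.1 n hn) _ hy.2

end CollisionChart

/-! ### Families of flights, kicks and layer crossings -/

section PhaseFamilies

open OnePoint

namespace ContDiffFamAt

section

variable {K : Type} [TopologicalSpace K] {E G G' : Type} [NormedAddCommGroup E] [NormedSpace ℝ E]
  [NormedAddCommGroup G] [NormedSpace ℝ G] [NormedAddCommGroup G'] [NormedSpace ℝ G']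
  {r : ℕ} {F : K → E → G} {y : K × E}

theorem comp_right {F : K → G → G'} {φ : E → G} (hφ : ContDiff ℝ r φ)
    (h : ContDiffFamAt r F (y.1, φ y.2)) : ContDiffFamAt r (fun κ x => F κ (φ x)) y :=
  ContDiffFamAt.comp (F := fun _ => φ) h (of_contDiffAt hφ.contDiffAt y.1)

theorem of_contDiff {φ : E → G} (hφ : ContDiff ℝ r φ) : ContDiffFamAt r (fun _ => φ) y :=
  of_contDiffAt hφ.contDiffAt y.1

theorem smul {f : K → E → ℝ} (hf : ContDiffFamAt r f y) (h : ContDiffFamAt r F y) :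
    ContDiffFamAt r (fun κ x => f κ x • F κ x) y :=
  comp_contDiffAt (f := fun z : ℝ × G => z.1 • z.2) contDiff_smul.contDiffAt (hf.prodMk h)

theorem mul {f f' : K → E → ℝ} (hf : ContDiffFamAt r f y) (h : ContDiffFamAt r f' y) :
    ContDiffFamAt r (fun κ x => f κ x * f' κ x) y := hf.smul h

theorem inv {f : K → E → ℝ} (hf : ContDiffFamAt r f y) (h : f y.1 y.2 ≠ 0) :
    ContDiffFamAt r (fun κ x => (f κ x)⁻¹) y :=
  comp_contDiffAt (contDiffAt_inv ℝ h) hf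

theorem deriv_family {f : K → ℝ → ℝ} {y : K × ℝ} (hf : ContDiffFamAt (r + 1) f y) :
    ContDiffFamAt r (fun κ x => deriv (f κ) x) y :=
  hf.fderiv_family.clm_comp (ContinuousLinearMap.apply ℝ ℝ (1 : ℝ))

theorem inner {d : ℕ} {F F' : K → E → Config d} (h : ContDiffFamAt r F y)
    (h' : ContDiffFamAt r F' y) : ContDiffFamAt r (fun κ x => inner ℝ (F κ x) (F' κ x)) y :=
  comp_contDiffAt (f := fun z : Config d × Config d => (Inner.inner ℝ z.1 z.2 : ℝ))
    (contDiff_fst.inner ℝ contDiff_snd).contDiffAt (h.prodMk h')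

theorem gradient_family {d : ℕ} {f : K → Config d → ℝ} {y : K × Config d}
    (hf : ContDiffFamAt (r + 1) f y) : ContDiffFamAt r (fun κ x => gradient (f κ) x) y :=
  comp_contDiffAt (f := fun l => (InnerProductSpace.toDual ℝ (Config d)).symm l)
    (InnerProductSpace.toDual ℝ (Config d)).symm.toContinuousLinearEquiv.contDiff.contDiffAt
    hf.fderiv_family

/-- Needed for the heights at which the layer is entered, which vary continuously with κ. -/
theorem of_param {ω : K → G} (hω : Continuous ω) : ContDiffFamAt r (fun κ (_ : E) => ω κ) y := by
  have h0 : ∀ ω' : K → E → G, (∀ κ x, ω' κ x = ω κ) →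
      ∀ z, ContinuousAt (fun w : K × E => ω' w.1 w.2) z := fun ω' h z => by
    simp only [h]
    exact (hω.comp continuous_fst).continuousAt
  cases r with
  | zero => exact zero_iff.2 (Eventually.of_forall (h0 _ fun _ _ => rfl))
  | succ r =>
    refine succ_iff.2 ⟨Eventually.of_forall (h0 _ fun _ _ => rfl),
      Eventually.of_forall fun z => differentiableAt_const _, ?_⟩
    simp only [fderiv_fun_const]
    exact of_contDiff contDiff_const

end

end ContDiffFamAt

variable {d : ℕ}

theorem HasDerivWithinAt.fst' {E G : Type*} [NormedAddCommGroup E] [NormedSpace ℝ E]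
    [NormedAddCommGroup G] [NormedSpace ℝ G] {f : ℝ → E × G} {f' : E × G} {s : Set ℝ} {x : ℝ}
    (h : HasDerivWithinAt f f' s x) : HasDerivWithinAt (fun t => (f t).1) f'.1 s x :=
  (hasFDerivAt_fst (𝕜 := ℝ) (p := f x)).comp_hasDerivWithinAt x h

theorem HasDerivWithinAt.snd' {E G : Type*} [NormedAddCommGroup E] [NormedSpace ℝ E]
    [NormedAddCommGroup G] [NormedSpace ℝ G] {f : ℝ → E × G} {f' : E × G} {s : Set ℝ} {x : ℝ}
    (h : HasDerivWithinAt f f' s x) : HasDerivWithinAt (fun t => (f t).2) f'.2 s x :=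
  (hasFDerivAt_snd (𝕜 := ℝ) (p := f x)).comp_hasDerivWithinAt x h

theorem eq_left_of_hasDerivAt_zero {E : Type} [NormedAddCommGroup E] [NormedSpace ℝ E]
    [CompleteSpace E] {f : ℝ → E} {a b : ℝ} (hf : ContinuousOn f (Icc a b))
    (h : ∀ σ ∈ Ioo a b, HasDerivAt f 0 σ) : ∀ σ ∈ Icc a b, f σ = f a := by
  intro σ hσ
  have hm : MapsTo (fun s => a + s) (Icc 0 (b - a)) (Icc a b) := fun s hs =>
    ⟨by linarith [hs.1], by linarith [hs.2]⟩
  have := eq_of_hasDerivAt_zero_off_countable (f := fun s => f (a + s)) (S := b - a)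
    (hf.comp (by fun_prop) hm) countable_empty (fun s hs => by
      have hs' : a + s ∈ Ioo a b := ⟨by linarith [hs.1.1], by linarith [hs.1.2]⟩
      exact HasDerivAt.comp_const_add a s (h _ hs')) (σ - a)
    ⟨by linarith [hσ.1], by linarith [hσ.2]⟩
  simpa using this

theorem hasDerivAt_of_Icc {E : Type*} [NormedAddCommGroup E] [NormedSpace ℝ E] {f : ℝ → E}
    {f' : E} {a b σ : ℝ} (h : HasDerivWithinAt f f' (Icc a b) σ) (hσ : σ ∈ Ioo a b) :
    HasDerivAt f f' σ := h.hasDerivAt (Icc_mem_nhds hσ.1 hσ.2)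

/-- Smooth dependence and convergence for motions in a small potential, with a time change. -/
theorem exists_flight_family {r : ℕ} (hr : 1 ≤ r) {U : OnePoint ℕ → Config d → ℝ} (hU0 : U ∞ = 0)
    {m : OnePoint ℕ → (PhaseSpace d × ℝ) × ℝ → ℝ} {q p : Config d} {s δ : ℝ} {θ : ℝ → ℝ}
    (hU : ∀ σ ∈ Icc (0 : ℝ) 1, ContDiffFamAt (r + 1) U (∞, q + θ σ • p))
    (hm : ∀ σ ∈ Icc (0 : ℝ) 1, ContDiffFamAt r m (∞, (((q + θ σ • p, p), s + θ σ), δ)))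
    (hpos : ∀ σ ∈ Icc (0 : ℝ) 1, 0 < m ∞ (((q + θ σ • p, p), s + θ σ), δ))
    (hθ : ∀ σ ∈ Icc (0 : ℝ) 1, HasDerivAt θ (m ∞ (((q + θ σ • p, p), s + θ σ), δ)) σ)
    (hθ0 : θ 0 = 0) :
    ∃ Φ : OnePoint ℕ → (PhaseSpace d × ℝ) × ℝ → PhaseSpace d × ℝ,
      ContDiffFamAt r Φ (∞, (((q, p), s), δ)) ∧
      Φ ∞ (((q, p), s), δ) = ((q + θ 1 • p, p), s + θ 1) ∧
      ∀ P : OnePoint ℕ × ((PhaseSpace d × ℝ) × ℝ) → Prop,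
        (∀ σ ∈ Icc (0 : ℝ) 1, ∀ᶠ y in 𝓝 ((∞ : OnePoint ℕ), (((q + θ σ • p, p), s + θ σ), δ)),
          P y) →
        ∀ᶠ y in 𝓝 ((∞ : OnePoint ℕ), (((q, p), s), δ)), ∃ (q p : ℝ → Config d) (τ μ : ℝ → ℝ),
          y.2.1 = ((q 0, p 0), τ 0) ∧ Φ y.1 y.2 = ((q 1, p 1), τ 1) ∧
          ∀ σ ∈ Icc (0 : ℝ) 1, P (y.1, (((q σ, p σ), τ σ), y.2.2)) ∧
            μ σ = m y.1 (((q σ, p σ), τ σ), y.2.2) ∧ 0 < μ σ ∧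
            HasDerivWithinAt q (μ σ • p σ) (Icc 0 1) σ ∧
            HasDerivWithinAt p (-(μ σ • gradient (U y.1) (q σ))) (Icc 0 1) σ ∧
            HasDerivWithinAt τ (μ σ) (Icc 0 1) σ := by
  set b : ℝ → (PhaseSpace d × ℝ) × ℝ := fun σ => (((q + θ σ • p, p), s + θ σ), δ) with hb
  have hb0 : b 0 = (((q, p), s), δ) := by simp [hb, hθ0]
  -- The state consists of phase point, time and an auxiliary number δ at rest. With δ as a state
  -- variable, smooth dependence on durations or displacements is a case of dependence on initial
  -- values.
  set F : OnePoint ℕ → (PhaseSpace d × ℝ) × ℝ → (PhaseSpace d × ℝ) × ℝ := fun κ z =>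
    (((m κ z • z.1.1.2, -(m κ z • gradient (U κ) z.1.1.1)), m κ z), 0) with hF
  have hgr0 : ∀ x, gradient (U ∞) x = 0 := fun x => by
    rw [hU0]; exact gradient_fun_const x (0 : ℝ)
  obtain ⟨Z, h1, h2, h3, h4⟩ := exists_autonomous_flow_family (S := 1) hr zero_le_one F b
    (fun σ hσ => by
      simp only [hF, hgr0]
      refine HasDerivAt.prodMk (HasDerivAt.prodMk (HasDerivAt.prodMk ?_ ?_) ?_)
        (hasDerivAt_const _ _)
      · exact ((hθ σ hσ).smul_const p).const_add q
      · simpa using hasDerivAt_const σ p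
      · exact (hθ σ hσ).const_add s)
    (fun σ hσ => by
      have hp : ContDiffFamAt r (fun (_ : OnePoint ℕ) (z : (PhaseSpace d × ℝ) × ℝ) => z.1.1.2)
        (∞, b σ) := ContDiffFamAt.of_contDiff (by fun_prop)
      have hg : ContDiffFamAt r (fun κ (z : (PhaseSpace d × ℝ) × ℝ) => gradient (U κ) z.1.1.1)
          (∞, b σ) := ContDiffFamAt.comp_right (F := fun κ x => gradient (U κ) x)
        (φ := fun z : (PhaseSpace d × ℝ) × ℝ => z.1.1.1) (by fun_prop) (hU σ hσ).gradient_family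
      exact ((((hm σ hσ).smul hp).prodMk ((hm σ hσ).smul hg).neg).prodMk (hm σ hσ)).prodMk
        (ContDiffFamAt.of_contDiff contDiff_const))
  rw [hb0] at h1 h2 h3 h4
  have h11 : (1 : ℝ) ∈ Icc (0 : ℝ) 1 := ⟨zero_le_one, le_rfl⟩
  refine ⟨fun κ z => (Z κ z 1).1, (h1 1 h11).clm_comp (ContinuousLinearMap.fst ℝ _ _),
    by beta_reduce; rw [h2 1 h11], fun P hP => ?_⟩
  have h5 := h3 (fun y => 0 < m y.1 y.2 ∧ P y) fun σ hσ =>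
    ((hm σ hσ).continuousAt.eventually (lt_mem_nhds (hpos σ hσ))).and (hP σ hσ)
  filter_upwards [h4, h5] with y ⟨h40, h4⟩ h5
  have hcont : ContinuousOn (fun σ => (Z y.1 y.2 σ).2) (Icc 0 1) := fun σ hσ =>
    (h4 σ hσ).continuousWithinAt.snd
  have hδ : ∀ σ ∈ Icc (0 : ℝ) 1, (Z y.1 y.2 σ).2 = y.2.2 := fun σ hσ => by
    rw [eq_left_of_hasDerivAt_zero hcont
      (fun σ hσ => hasDerivAt_of_Icc (h4 σ (Ioo_subset_Icc_self hσ)).snd' hσ) σ hσ, h40]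
  refine ⟨fun σ => (Z y.1 y.2 σ).1.1.1, fun σ => (Z y.1 y.2 σ).1.1.2,
    fun σ => (Z y.1 y.2 σ).1.2, fun σ => m y.1 (Z y.1 y.2 σ), by beta_reduce; rw [h40], rfl, fun σ hσ => ?_⟩
  have e : (((((Z y.1 y.2 σ).1.1.1, (Z y.1 y.2 σ).1.1.2), (Z y.1 y.2 σ).1.2), y.2.2) :
      (PhaseSpace d × ℝ) × ℝ) = Z y.1 y.2 σ := by rw [← hδ σ hσ]
  rw [e]
  exact ⟨(h5 σ hσ).2, rfl, (h5 σ hσ).1, (h4 σ hσ).fst'.fst'.fst', (h4 σ hσ).fst'.fst'.snd',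
    (h4 σ hσ).fst'.snd'⟩

/-- Smooth dependence and convergence for motions inside the boundary layer, where the value `v`
of the potential is used as a coordinate and `χ` is the inverse of the barrier. -/
theorem exists_kick_family {r : ℕ} (hr : 1 ≤ r) {g : OnePoint ℕ → Config d → ℝ}
    {χ : OnePoint ℕ → ℝ → ℝ} (hχ0 : ∀ v, χ ∞ v = 0)
    {ν : OnePoint ℕ → (PhaseSpace d × ℝ) × (ℝ × ℝ) → ℝ} {q : Config d} {s δ S : ℝ} (hS : 0 ≤ S)
    {p : ℝ → Config d} {v : ℝ → ℝ}
    (hg : ContDiffFamAt (r + 1) g (∞, q))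
    (hχ : ∀ σ ∈ Icc 0 S, ContDiffFamAt (r + 1) χ (∞, v σ))
    (hν : ∀ σ ∈ Icc 0 S, ContDiffFamAt r ν (∞, (((q, p σ), s), (v σ, δ))))
    (hp : ∀ σ ∈ Icc 0 S,
      HasDerivAt p (-(ν ∞ (((q, p σ), s), (v σ, δ)) • gradient (g ∞) q)) σ)
    (hv : ∀ σ ∈ Icc 0 S,
      HasDerivAt v (ν ∞ (((q, p σ), s), (v σ, δ)) * inner ℝ (p σ) (gradient (g ∞) q)) σ) :
    ∃ Φ : OnePoint ℕ → (PhaseSpace d × ℝ) × (ℝ × ℝ) → (PhaseSpace d × ℝ) × ℝ,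
      ContDiffFamAt r Φ (∞, (((q, p 0), s), (v 0, δ))) ∧
      Φ ∞ (((q, p 0), s), (v 0, δ)) = (((q, p S), s), v S) ∧
      ∀ P : OnePoint ℕ × ((PhaseSpace d × ℝ) × (ℝ × ℝ)) → Prop,
        (∀ σ ∈ Icc 0 S, ∀ᶠ y in 𝓝 ((∞ : OnePoint ℕ), (((q, p σ), s), (v σ, δ))), P y) →
        ∀ᶠ y in 𝓝 ((∞ : OnePoint ℕ), (((q, p 0), s), (v 0, δ))),
          ∃ (q p : ℝ → Config d) (τ v ν' : ℝ → ℝ),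
          y.2.1 = ((q 0, p 0), τ 0) ∧ y.2.2.1 = v 0 ∧ Φ y.1 y.2 = (((q S, p S), τ S), v S) ∧
          ∀ σ ∈ Icc 0 S, P (y.1, (((q σ, p σ), τ σ), (v σ, y.2.2.2))) ∧
            ν' σ = ν y.1 (((q σ, p σ), τ σ), (v σ, y.2.2.2)) ∧
            HasDerivWithinAt q ((ν' σ * deriv (χ y.1) (v σ)) • p σ) (Icc 0 S) σ ∧
            HasDerivWithinAt p (-(ν' σ • gradient (g y.1) (q σ))) (Icc 0 S) σ ∧
            HasDerivWithinAt τ (ν' σ * deriv (χ y.1) (v σ)) (Icc 0 S) σ ∧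
            HasDerivWithinAt v (ν' σ * inner ℝ (p σ) (gradient (g y.1) (q σ))) (Icc 0 S) σ := by
  set b : ℝ → (PhaseSpace d × ℝ) × (ℝ × ℝ) := fun σ => (((q, p σ), s), (v σ, δ)) with hb
  -- Hamilton's equations multiplied by dt/dσ = ν χ'(v). Since w'χ' = 1 the slope of the barrier
  -- cancels from the force and from the rate of v; it survives only as χ' in the rates of position
  -- and time, which vanish in the limit.
  set F : OnePoint ℕ → (PhaseSpace d × ℝ) × (ℝ × ℝ) → (PhaseSpace d × ℝ) × (ℝ × ℝ) := fun κ z =>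
    ((((ν κ z * deriv (χ κ) z.2.1) • z.1.1.2, -(ν κ z • gradient (g κ) z.1.1.1)),
      ν κ z * deriv (χ κ) z.2.1), (ν κ z * inner ℝ z.1.1.2 (gradient (g κ) z.1.1.1), 0)) with hF
  have hd0 : ∀ x, deriv (χ ∞) x = 0 := fun x => by
    have : χ ∞ = fun _ => 0 := funext hχ0
    rw [this, deriv_const]
  obtain ⟨Z, h1, h2, h3, h4⟩ := exists_autonomous_flow_family hr hS F b
    (fun σ hσ => by
      simp only [hF, hd0, mul_zero, zero_smul]
      exact (((hasDerivAt_const σ q).prodMk (hp σ hσ)).prodMk (hasDerivAt_const σ s)).prodMk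
        ((hv σ hσ).prodMk (hasDerivAt_const σ δ)))
    (fun σ hσ => by
      have hp : ContDiffFamAt r (fun (_ : OnePoint ℕ) (z : (PhaseSpace d × ℝ) × (ℝ × ℝ)) =>
        z.1.1.2) (∞, b σ) := ContDiffFamAt.of_contDiff (by fun_prop)
      have hgr : ContDiffFamAt r (fun κ (z : (PhaseSpace d × ℝ) × (ℝ × ℝ)) =>
          gradient (g κ) z.1.1.1) (∞, b σ) :=
        ContDiffFamAt.comp_right (F := fun κ x => gradient (g κ) x)
          (φ := fun z : (PhaseSpace d × ℝ) × (ℝ × ℝ) => z.1.1.1) (by fun_prop) hg.gradient_family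
      have hd : ContDiffFamAt r (fun κ (z : (PhaseSpace d × ℝ) × (ℝ × ℝ)) =>
          deriv (χ κ) z.2.1) (∞, b σ) :=
        ContDiffFamAt.comp_right (F := fun κ x => deriv (χ κ) x)
          (φ := fun z : (PhaseSpace d × ℝ) × (ℝ × ℝ) => z.2.1) (by fun_prop)
          (hχ σ hσ).deriv_family
      have hμ := (hν σ hσ).mul hd
      exact (((hμ.smul hp).prodMk ((hν σ hσ).smul hgr).neg).prodMk hμ).prodMk
        (((hν σ hσ).mul (hp.inner hgr)).prodMk (ContDiffFamAt.of_contDiff contDiff_const)))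
  have hSS : S ∈ Icc 0 S := ⟨hS, le_rfl⟩
  refine ⟨fun κ z => ((Z κ z S).1, (Z κ z S).2.1),
    ((h1 S hSS).clm_comp (ContinuousLinearMap.fst ℝ _ _)).prodMk
      ((h1 S hSS).clm_comp ((ContinuousLinearMap.fst ℝ ℝ ℝ).comp (ContinuousLinearMap.snd ℝ _ _))),
    by simp only [show (((q, p 0), s), (v 0, δ)) = b 0 from rfl, h2 S hSS]; rfl, fun P hP => ?_⟩
  filter_upwards [h4, h3 P hP] with y ⟨h40, h4⟩ h5
  have hcont : ContinuousOn (fun σ => (Z y.1 y.2 σ).2.2) (Icc 0 S) := fun σ hσ =>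
    (h4 σ hσ).continuousWithinAt.snd.snd
  have hδ : ∀ σ ∈ Icc 0 S, (Z y.1 y.2 σ).2.2 = y.2.2.2 := fun σ hσ => by
    rw [eq_left_of_hasDerivAt_zero hcont
      (fun σ hσ => hasDerivAt_of_Icc (h4 σ (Ioo_subset_Icc_self hσ)).snd'.snd' hσ) σ hσ, h40]
  refine ⟨fun σ => (Z y.1 y.2 σ).1.1.1, fun σ => (Z y.1 y.2 σ).1.1.2,
    fun σ => (Z y.1 y.2 σ).1.2, fun σ => (Z y.1 y.2 σ).2.1, fun σ => ν y.1 (Z y.1 y.2 σ),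
    by beta_reduce; rw [h40], by beta_reduce; rw [h40], rfl, fun σ hσ => ?_⟩
  have e : (((((Z y.1 y.2 σ).1.1.1, (Z y.1 y.2 σ).1.1.2), (Z y.1 y.2 σ).1.2),
      ((Z y.1 y.2 σ).2.1, y.2.2.2)) : (PhaseSpace d × ℝ) × (ℝ × ℝ)) = Z y.1 y.2 σ := by
    rw [← hδ σ hσ]
  rw [e]
  exact ⟨h5 σ hσ, rfl, (h4 σ hσ).fst'.fst'.fst', (h4 σ hσ).fst'.fst'.snd', (h4 σ hσ).fst'.snd',
    (h4 σ hσ).snd'.fst'⟩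

/-- Smooth dependence and convergence for motions across the edge of the boundary layer. -/
theorem exists_crossing_family {r : ℕ} (hr : 1 ≤ r) {g : OnePoint ℕ → Config d → ℝ} {S : ℝ}
    (hS : 0 ≤ S) (A A' : DensityFamily (OnePoint ℕ) S) {q p : ℝ → Config d} {τ : ℝ → ℝ}
    (hcq : ContinuousOn q (Icc 0 S)) (hcp : ContinuousOn p (Icc 0 S))
    (hcτ : ContinuousOn τ (Icc 0 S))
    (hg : ∀ σ ∈ Icc 0 S, ContDiffFamAt (r + 1) g (∞, q σ))
    (hu : ∀ σ ∈ Icc 0 S, inner ℝ (p σ) (gradient (g ∞) (q σ)) ≠ 0)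
    {c : Set ℝ} (hc : c.Countable)
    (hd : ∀ σ ∈ Ioo 0 S \ c,
      HasDerivAt q ((A.a ∞ σ * (inner ℝ (p σ) (gradient (g ∞) (q σ)))⁻¹) • p σ) σ ∧
      HasDerivAt p (-((A'.a ∞ σ * (inner ℝ (p σ) (gradient (g ∞) (q σ)))⁻¹) •
        gradient (g ∞) (q σ))) σ ∧
      HasDerivAt τ (A.a ∞ σ * (inner ℝ (p σ) (gradient (g ∞) (q σ)))⁻¹) σ) :
    ∃ Φ : OnePoint ℕ → PhaseSpace d × ℝ → PhaseSpace d × ℝ,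
      ContDiffFamAt r Φ (∞, ((q 0, p 0), τ 0)) ∧
      Φ ∞ ((q 0, p 0), τ 0) = ((q S, p S), τ S) ∧
      ∀ P : OnePoint ℕ × (PhaseSpace d × ℝ) → Prop,
        (∀ σ ∈ Icc 0 S, ∀ᶠ y in 𝓝 ((∞ : OnePoint ℕ), ((q σ, p σ), τ σ)), P y) →
        ∀ᶠ y in 𝓝 ((∞ : OnePoint ℕ), ((q 0, p 0), τ 0)),
          ∃ (q p : ℝ → Config d) (τ : ℝ → ℝ),
          Continuous q ∧ Continuous p ∧ Continuous τ ∧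
          y.2 = ((q 0, p 0), τ 0) ∧ Φ y.1 y.2 = ((q S, p S), τ S) ∧
          ∀ σ ∈ Icc 0 S, P (y.1, ((q σ, p σ), τ σ)) ∧
            inner ℝ (p σ) (gradient (g y.1) (q σ)) ≠ 0 ∧
            (ContinuousWithinAt (A.a y.1) (Icc 0 S) σ → ContinuousWithinAt (A'.a y.1) (Icc 0 S) σ →
            HasDerivWithinAt q ((A.a y.1 σ * (inner ℝ (p σ) (gradient (g y.1) (q σ)))⁻¹) • p σ)
              (Icc 0 S) σ ∧
            HasDerivWithinAt p (-((A'.a y.1 σ * (inner ℝ (p σ) (gradient (g y.1) (q σ)))⁻¹) •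
              gradient (g y.1) (q σ))) (Icc 0 S) σ ∧
            HasDerivWithinAt τ (A.a y.1 σ * (inner ℝ (p σ) (gradient (g y.1) (q σ)))⁻¹)
              (Icc 0 S) σ) := by
  set b : ℝ → PhaseSpace d × ℝ := fun σ => ((q σ, p σ), τ σ) with hb
  set u : OnePoint ℕ → PhaseSpace d × ℝ → ℝ := fun κ z =>
    inner ℝ z.1.2 (gradient (g κ) z.1.1) with hu'
  -- Motion and force are separated, because each has its own density: dx/dσ for the motion and
  -- dw/dσ for the force. The fields themselves contain no derivative of the barrier.
  set F : Fin 2 → OnePoint ℕ → PhaseSpace d × ℝ → PhaseSpace d × ℝ :=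
    ![fun κ z => (((u κ z)⁻¹ • z.1.2, 0), (u κ z)⁻¹),
      fun κ z => ((0, -((u κ z)⁻¹ • gradient (g κ) z.1.1)), 0)] with hF
  have hsum : ∀ κ σ z, ∑ j, ((![A, A'] j).a κ σ) • F j κ z =
      (((A.a κ σ * (u κ z)⁻¹) • z.1.2, -((A'.a κ σ * (u κ z)⁻¹) • gradient (g κ) z.1.1)),
        A.a κ σ * (u κ z)⁻¹) := by
    intro κ σ z
    simp [hF, Fin.sum_univ_two, smul_smul]
  have hgr : ∀ σ ∈ Icc 0 S, ContDiffFamAt r (fun κ (z : PhaseSpace d × ℝ) =>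
      gradient (g κ) z.1.1) (∞, b σ) := fun σ hσ =>
    ContDiffFamAt.comp_right (F := fun κ x => gradient (g κ) x)
      (φ := fun z : PhaseSpace d × ℝ => z.1.1) (by fun_prop) (hg σ hσ).gradient_family
  have hp : ∀ σ, ContDiffFamAt r (fun (_ : OnePoint ℕ) (z : PhaseSpace d × ℝ) => z.1.2)
    (∞, b σ) := fun σ => ContDiffFamAt.of_contDiff (by fun_prop)
  have huf : ∀ σ ∈ Icc 0 S, ContDiffFamAt r u (∞, b σ) := fun σ hσ => (hp σ).inner (hgr σ hσ)
  obtain ⟨Z, h1, h2, h3, h4⟩ := exists_flow_family (ι := Fin 2) hr hS ![A, A'] F b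
    ((hcq.prodMk hcp).prodMk hcτ) hc
    (fun σ hσ => by
      rw [hsum]
      obtain ⟨h1, h2, h3⟩ := hd σ hσ
      exact (h1.prodMk h2).prodMk h3)
    (fun j σ hσ => by
      have hui := (huf σ hσ).inv (hu σ hσ)
      have h0 : ContDiffFamAt r (fun (_ : OnePoint ℕ) (_ : PhaseSpace d × ℝ) => (0 : Config d))
        (∞, b σ) := ContDiffFamAt.of_contDiff contDiff_const
      have h0' : ContDiffFamAt r (fun (_ : OnePoint ℕ) (_ : PhaseSpace d × ℝ) => (0 : ℝ))
        (∞, b σ) := ContDiffFamAt.of_contDiff contDiff_const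
      fin_cases j
      · exact ((hui.smul (hp σ)).prodMk h0).prodMk hui
      · exact (h0.prodMk (hui.smul (hgr σ hσ)).neg).prodMk h0')
  have hSS : S ∈ Icc 0 S := ⟨hS, le_rfl⟩
  refine ⟨fun κ z => Z κ z S, h1 S hSS, h2 S hSS, fun P hP => ?_⟩
  have h5 := h3 (fun y => u y.1 y.2 ≠ 0 ∧ P y) fun σ hσ =>
    ((huf σ hσ).continuousAt.eventually_ne (hu σ hσ)).and (hP σ hσ)
  filter_upwards [h4, h5] with y ⟨hZ, h40, h4⟩ h5
  refine ⟨fun σ => (Z y.1 y.2 σ).1.1, fun σ => (Z y.1 y.2 σ).1.2,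
    fun σ => (Z y.1 y.2 σ).2, by fun_prop, by fun_prop, by fun_prop, by beta_reduce; rw [h40], rfl,
    fun σ hσ => ⟨(h5 σ hσ).2, (h5 σ hσ).1, fun hA hA' => ?_⟩⟩
  have h6 := h4 σ hσ (by
    intro j
    fin_cases j
    · exact hA
    · exact hA')
  rw [hsum] at h6
  exact ⟨h6.fst'.fst', h6.fst'.snd', h6.snd'⟩

end PhaseFamilies

/-! ### Motion in a collision chart -/

section PathLemmas

open OnePoint

variable {d : ℕ}

theorem hasDerivWithinAt_comp_gradient {f : Config d → ℝ} {q : ℝ → Config d} {q' : Config d}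
    {s : Set ℝ} {σ : ℝ} (hf : DifferentiableAt ℝ f (q σ)) (hq : HasDerivWithinAt q q' s σ) :
    HasDerivWithinAt (fun t => f (q t)) (inner ℝ q' (gradient f (q σ))) s σ := by
  have h := hf.hasGradientAt.hasFDerivAt.comp_hasDerivWithinAt σ hq
  rw [InnerProductSpace.toDual_apply_apply, real_inner_comm] at h
  exact h

theorem hasDerivAt_comp_gradient {f : Config d → ℝ} {q : ℝ → Config d} {q' : Config d}
    {σ : ℝ} (hf : DifferentiableAt ℝ f (q σ)) (hq : HasDerivAt q q' σ) :
    HasDerivAt (fun t => f (q t)) (inner ℝ q' (gradient f (q σ))) σ := by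
  rw [← hasDerivWithinAt_univ] at *
  exact hasDerivWithinAt_comp_gradient hf hq

theorem gradient_comp_real {w : ℝ → ℝ} {g : Config d → ℝ} {U : Config d → ℝ} {x : Config d}
    (hU : U =ᶠ[𝓝 x] fun y => w (g y)) (hw : DifferentiableAt ℝ w (g x))
    (hg : DifferentiableAt ℝ g x) : gradient U x = deriv w (g x) • gradient g x := by
  have h1 : HasFDerivAt (fun y => w (g y)) (deriv w (g x) • fderiv ℝ g x) x :=
    hw.hasDerivAt.comp_hasFDerivAt x hg.hasFDerivAt
  rw [gradient, hU.fderiv_eq, h1.fderiv, gradient]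
  simp

/-- Free motion, with a time change. -/
theorem eq_of_free_motion {q p : ℝ → Config d} {τ μ : ℝ → ℝ} {a b : ℝ}
    (hq : ContinuousOn q (Icc a b)) (hp : ContinuousOn p (Icc a b)) (hτ : ContinuousOn τ (Icc a b))
    (h : ∀ σ ∈ Ioo a b, HasDerivAt q (μ σ • p σ) σ ∧ HasDerivAt p 0 σ ∧ HasDerivAt τ (μ σ) σ) :
    ∀ σ ∈ Icc a b, p σ = p a ∧ q σ = q a + (τ σ - τ a) • p a := by
  have h1 := eq_left_of_hasDerivAt_zero hp fun σ hσ => (h σ hσ).2.1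
  have h2 := eq_left_of_hasDerivAt_zero (f := fun σ => q σ - τ σ • p a)
    (hq.sub (hτ.smul continuousOn_const)) fun σ hσ => by
      have := (h σ hσ).1.sub ((h σ hσ).2.2.smul_const (p a))
      refine this.congr_deriv ?_
      rw [h1 σ (Ioo_subset_Icc_self hσ), sub_self]
  intro σ hσ
  refine ⟨h1 σ hσ, ?_⟩
  have := h2 σ hσ
  rw [sub_smul, ← sub_eq_iff_eq_add'.2 (sub_eq_iff_eq_add.1 this)]
  abel

theorem exists_time_of_continuousOn {τ : ℝ → ℝ} {a b u : ℝ} (hab : a ≤ b)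
    (hτ : ContinuousOn τ (Icc a b)) (hu : u ∈ Icc 0 (τ b - τ a)) :
    ∃ σ ∈ Icc a b, τ σ - τ a = u := by
  obtain ⟨σ, hσ, e⟩ := intermediate_value_Icc hab hτ
    (show τ a + u ∈ Icc _ _ from ⟨by linarith [hu.1], by linarith [hu.2]⟩)
  exact ⟨σ, hσ, by linarith⟩

theorem lt_of_hasDerivAt_pos {τ μ : ℝ → ℝ} {a b : ℝ} (hab : a < b) (hτ : ContinuousOn τ (Icc a b))
    (h : ∀ σ ∈ Ioo a b, HasDerivAt τ (μ σ) σ) (hμ : ∀ σ ∈ Ioo a b, 0 < μ σ) : τ a < τ b :=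
  strictMonoOn_of_deriv_pos (convex_Icc a b) hτ (fun σ hσ => by
    rw [interior_Icc] at hσ
    rw [(h σ hσ).deriv]; exact hμ σ hσ) (left_mem_Icc.2 hab.le) (right_mem_Icc.2 hab.le) hab

/-- A momentum changed by forces parallel to `N` moves along `N`. -/
theorem exists_eq_add_smul {p : ℝ → Config d} {k : ℝ → ℝ} {N : Config d} (hN : N ≠ 0) {a b : ℝ}
    (hab : a ≤ b) (hp : ContinuousOn p (Icc a b))
    (h : ∀ σ ∈ Ioo a b, HasDerivAt p (k σ • N) σ) : ∃ α : ℝ, p b = p a + α • N := by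
  have hn : (‖N‖ ^ 2 : ℝ) ≠ 0 := by
    have := norm_pos_iff.2 hN
    positivity
  -- Up to the factor ‖N‖² this is the tangential component of the momentum.
  have h1 := eq_left_of_hasDerivAt_zero (f := fun σ => (‖N‖ ^ 2) • p σ - (inner ℝ (p σ) N : ℝ) • N)
    (by fun_prop) (fun σ hσ => by
      have h2 := ((h σ hσ).inner ℝ (hasDerivAt_const σ N))
      have h3 := ((h σ hσ).const_smul (‖N‖ ^ 2)).sub (h2.smul_const N)
      refine h3.congr_deriv ?_
      rw [inner_zero_right, zero_add, inner_smul_left, real_inner_self_eq_norm_sq, smul_smul]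
      simp [mul_comm]) b ⟨hab, le_rfl⟩
  refine ⟨(‖N‖ ^ 2)⁻¹ * (inner ℝ (p b) N - inner ℝ (p a) N), ?_⟩
  rw [← smul_right_injective _ hn |>.eq_iff]
  simp only [smul_add, smul_smul, ← mul_assoc, mul_inv_cancel₀ hn, one_mul, sub_smul]
  rw [← sub_eq_iff_eq_add'.2 (sub_eq_iff_eq_add.1 h1)]
  abel

theorem energy_eq_of_hasDerivAt {p : ℝ → Config d} {v k : ℝ → ℝ} {N : Config d} {a b : ℝ}
    (hab : a ≤ b) (hp : ContinuousOn p (Icc a b)) (hv : ContinuousOn v (Icc a b))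
    (h : ∀ σ ∈ Ioo a b, HasDerivAt p (k σ • N) σ ∧ HasDerivAt v (-(k σ * inner ℝ (p σ) N)) σ) :
    ‖p b‖ ^ 2 / 2 + v b = ‖p a‖ ^ 2 / 2 + v a :=
  eq_left_of_hasDerivAt_zero (f := fun σ => ‖p σ‖ ^ 2 / 2 + v σ) (by fun_prop) (fun σ hσ => by
    have h2 := (((h σ hσ).1.norm_sq).div_const 2).add (h σ hσ).2
    refine h2.congr_deriv ?_
    rw [inner_smul_right]
    ring) b ⟨hab, le_rfl⟩

/-- The law of reflection is forced by the conservation of energy and of the tangential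
momentum. -/
theorem eq_reflection {p p' N : Config d} {α : ℝ} (h : p' = p + α • N) (hn : ‖p'‖ ^ 2 = ‖p‖ ^ 2)
    (hu : inner ℝ p N < 0) (hu' : 0 < inner ℝ p' N) :
    p' = p - (2 * inner ℝ p (‖N‖⁻¹ • N)) • (‖N‖⁻¹ • N) := by
  have hN : N ≠ 0 := by rintro rfl; simp at hu
  have hN' : 0 < ‖N‖ := norm_pos_iff.2 hN
  have h1 : ‖p'‖ ^ 2 = ‖p‖ ^ 2 + 2 * (α * inner ℝ p N) + α ^ 2 * ‖N‖ ^ 2 := by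
    rw [h, norm_add_sq_real, inner_smul_right, norm_smul, mul_pow, Real.norm_eq_abs, sq_abs]
  have hα : α ≠ 0 := by
    rintro rfl
    rw [h, zero_smul, add_zero] at hu'
    linarith
  have h2 : α * ‖N‖ ^ 2 = -(2 * inner ℝ p N) := by
    -- Equal norms leave two values of α. The value 0 is excluded by the change of sign of the
    -- normal component.
    have : α * (2 * inner ℝ p N + α * ‖N‖ ^ 2) = 0 := by linarith
    rcases mul_eq_zero.1 this with h3 | h3
    · exact absurd h3 hα
    · linarith
  have h3 : α = -(2 * (‖N‖⁻¹ * inner ℝ p N)) * ‖N‖⁻¹ := by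
    field_simp
    linarith
  rw [h, inner_smul_right, smul_smul, sub_eq_add_neg, ← neg_smul, ← neg_mul, ← h3]

namespace CollisionChart

variable {r : ℕ} {D : Set (Config d)} {𝓔 : EReal} {U : ℕ → Config d → ℝ} {q₀ : Config d}

/-- The points at which the local description is valid. -/
def IsRegular (C : CollisionChart r D 𝓔 U q₀) (y : OnePoint ℕ × Config d) : Prop :=
  ContDiffFamAt (r + 1) C.g y ∧
  (∀ᶠ z in 𝓝 y, ∀ n : ℕ, z.1 = (n : OnePoint ℕ) → U n z.2 = C.w n (C.g n z.2)) ∧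
  (∀ᶠ x in 𝓝 y.2, (x ∈ D ↔ 0 ≤ C.g ∞ x)) ∧ ContDiffFamAt (r + 1) C.g (∞, y.2) ∧
  gradient (C.g ∞) y.2 ≠ 0

theorem IsRegular.eventually {C : CollisionChart r D 𝓔 U q₀} {y : OnePoint ℕ × Config d}
    (h : C.IsRegular y) : ∀ᶠ z in 𝓝 y, C.IsRegular z := by
  obtain ⟨h1, h2, h3, h4, h5⟩ := h
  have ht : Tendsto (fun z : OnePoint ℕ × Config d => z.2) (𝓝 y) (𝓝 y.2) :=
    continuous_snd.tendsto y
  have ht' : Tendsto (fun x : Config d => ((∞ : OnePoint ℕ), x)) (𝓝 y.2) (𝓝 (∞, y.2)) :=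
    (Continuous.prodMk_right (∞ : OnePoint ℕ)).tendsto y.2
  filter_upwards [h1.eventually, eventually_eventually_nhds.2 h2,
    ht.eventually (eventually_eventually_nhds.2 h3), ht.eventually (ht'.eventually h4.eventually),
    ht.eventually (ht'.eventually (h4.gradient_family.continuousAt.eventually_ne h5))]
    with z h1 h2 h3 h4 h5 using ⟨h1, h2, h3, h4, h5⟩

theorem isRegular (C : CollisionChart r D 𝓔 U q₀) : C.IsRegular (∞, q₀) :=
  ⟨C.g_family, C.potential, C.domain, C.g_family, C.gradient_ne_zero⟩

theorem IsRegular.differentiableAt {C : CollisionChart r D 𝓔 U q₀} {y : OnePoint ℕ × Config d}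
    (h : C.IsRegular y) : DifferentiableAt ℝ (C.g y.1) y.2 :=
  h.1.contDiffAt.differentiableAt (by simp)

theorem IsRegular.contDiffAt {C : CollisionChart r D 𝓔 U q₀} {y : OnePoint ℕ × Config d}
    (h : C.IsRegular y) : ContDiffAt ℝ 1 (C.g ∞) y.2 :=
  h.2.2.2.1.contDiffAt.of_le (by exact_mod_cast Nat.le_add_left 1 r)

theorem IsRegular.mem_interior {C : CollisionChart r D 𝓔 U q₀} {y : OnePoint ℕ × Config d}
    (h : C.IsRegular y) (hpos : 0 < C.g ∞ y.2) : y.2 ∈ interior D :=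
  (eventually_mem_interior_of_pos h.contDiffAt h.2.2.1).self_of_nhds hpos

theorem IsRegular.mem_frontier {C : CollisionChart r D 𝓔 U q₀} {y : OnePoint ℕ × Config d}
    (h : C.IsRegular y) (h0 : C.g ∞ y.2 = 0) : y.2 ∈ frontier D :=
  mem_frontier_of_gradient_ne_zero h0 h.2.2.2.2 h.2.2.1

theorem IsRegular.isInwardUnitNormal {C : CollisionChart r D 𝓔 U q₀}
    {y : OnePoint ℕ × Config d} (h : C.IsRegular y) (h0 : C.g ∞ y.2 = 0) :
    IsInwardUnitNormal D y.2 (‖gradient (C.g ∞) y.2‖⁻¹ • gradient (C.g ∞) y.2) :=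
  isInwardUnitNormal_gradient h.contDiffAt h0 h.2.2.2.2 h.2.2.1

theorem IsRegular.gradient_eq {C : CollisionChart r D 𝓔 U q₀} {n : ℕ} {x : Config d}
    (h : C.IsRegular (n, x)) (hw : DifferentiableAt ℝ (C.w n) (C.g n x)) :
    gradient (U n) x = deriv (C.w n) (C.g n x) • gradient (C.g n) x := by
  refine gradient_comp_real ?_ hw h.differentiableAt
  have ht' : Tendsto (fun x : Config d => ((n : OnePoint ℕ), x)) (𝓝 x) (𝓝 (n, x)) :=
    (Continuous.prodMk_right (n : OnePoint ℕ)).tendsto x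
  filter_upwards [ht'.eventually h.2.1] with z hz using hz n rfl

/-- The values of the potential at which the inverse of the barrier is well behaved. -/
def IsRegularValue (C : CollisionChart r D 𝓔 U q₀) (y : OnePoint ℕ × ℝ) : Prop :=
  ContDiffFamAt (r + 1) C.χ y ∧
  ∀ᶠ z in 𝓝 y, ∀ n : ℕ, z.1 = (n : OnePoint ℕ) →
    C.χ n z.2 ∈ Ioo (-C.ρ) C.ρ ∧ C.w n (C.χ n z.2) = z.2

theorem IsRegularValue.eventually {C : CollisionChart r D 𝓔 U q₀} {y : OnePoint ℕ × ℝ}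
    (h : C.IsRegularValue y) : ∀ᶠ z in 𝓝 y, C.IsRegularValue z :=
  h.1.eventually.and (eventually_eventually_nhds.2 h.2)

theorem isRegularValue (C : CollisionChart r D 𝓔 U q₀) {v : ℝ} (hv : 0 < v)
    (hv' : (v : EReal) < 𝓔) : C.IsRegularValue (∞, v) :=
  ⟨C.χ_family v hv hv', C.χ_inverse v hv hv'⟩

/-- The barrier is smooth and decreasing for the parameter `n`. -/
def BarrierSmooth (C : CollisionChart r D 𝓔 U q₀) (n : ℕ) : Prop :=
  ∀ x ∈ Ioo (-C.ρ) C.ρ, ContDiffAt ℝ 1 (C.w n) x ∧ deriv (C.w n) x < 0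

/-- Differentiate w(χ(v)) = v. The sign is that of the decreasing barrier, and it makes time run
forward when ν < 0. -/
theorem IsRegularValue.deriv_mul {C : CollisionChart r D 𝓔 U q₀} {n : ℕ} {v : ℝ}
    (h : C.IsRegularValue (n, v)) (hn : C.BarrierSmooth n) :
    deriv (C.w n) (C.χ n v) * deriv (C.χ n) v = 1 ∧ deriv (C.χ n) v < 0 := by
  have hmem := (h.2.self_of_nhds n rfl).1
  simp only at hmem
  have h1 : HasDerivAt (C.χ n) (deriv (C.χ n) v) v :=
    (h.1.contDiffAt.differentiableAt (by simp)).hasDerivAt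
  have h2 : HasDerivAt (C.w n) (deriv (C.w n) (C.χ n v)) (C.χ n v) :=
    ((hn _ hmem).1.differentiableAt (by simp)).hasDerivAt
  have h3 : HasDerivAt (fun v => C.w n (C.χ n v))
    (deriv (C.w n) (C.χ n v) * deriv (C.χ n) v) v := h2.comp v h1
  have ht' : Tendsto (fun x : ℝ => ((n : OnePoint ℕ), x)) (𝓝 v) (𝓝 (n, v)) :=
    (Continuous.prodMk_right (n : OnePoint ℕ)).tendsto v
  have h4 : HasDerivAt (fun v => C.w n (C.χ n v)) 1 v :=
    (hasDerivAt_id v).congr_of_eventuallyEq (by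
      filter_upwards [ht'.eventually h.2] with z hz using (hz n rfl).2)
  have e := h3.unique h4
  refine ⟨e, ?_⟩
  have h5 := (hn _ hmem).2
  by_contra hcon
  have := mul_nonpos_of_nonpos_of_nonneg h5.le (not_lt.1 hcon)
  linarith

/-- Motion inside the boundary layer. -/
theorem kick_path (C : CollisionChart r D 𝓔 U q₀) {κ : OnePoint ℕ} {S : ℝ} (hS : 0 ≤ S)
    {q p : ℝ → Config d} {τ v ν : ℝ → ℝ} (hreg : ∀ σ ∈ Icc 0 S, C.IsRegular (κ, q σ))
    (hval : ∀ σ ∈ Icc 0 S, C.IsRegularValue (κ, v σ)) (hν : ∀ σ ∈ Icc 0 S, ν σ < 0)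
    (hn : ∀ n : ℕ, κ = (n : OnePoint ℕ) → C.BarrierSmooth n)
    (hq : ∀ σ ∈ Icc 0 S, HasDerivWithinAt q ((ν σ * deriv (C.χ κ) (v σ)) • p σ) (Icc 0 S) σ)
    (hp : ∀ σ ∈ Icc 0 S, HasDerivWithinAt p (-(ν σ • gradient (C.g κ) (q σ))) (Icc 0 S) σ)
    (hτ : ∀ σ ∈ Icc 0 S, HasDerivWithinAt τ (ν σ * deriv (C.χ κ) (v σ)) (Icc 0 S) σ)
    (hv : ∀ σ ∈ Icc 0 S,
      HasDerivWithinAt v (ν σ * inner ℝ (p σ) (gradient (C.g κ) (q σ))) (Icc 0 S) σ)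
    (h0 : C.g κ (q 0) = C.χ κ (v 0)) :
    C.g κ (q S) = C.χ κ (v S) ∧
    (∀ n : ℕ, κ = (n : OnePoint ℕ) → HamiltonianArc (U n) (q 0, p 0) (τ S - τ 0) (q S, p S)) ∧
    (κ = ∞ → q S = q 0 ∧ τ S = τ 0 ∧ (∃ α : ℝ, p S = p 0 + α • gradient (C.g ∞) (q 0)) ∧
      ‖p S‖ ^ 2 / 2 + v S = ‖p 0‖ ^ 2 / 2 + v 0) := by
  have h00 : (0 : ℝ) ∈ Icc 0 S := ⟨le_rfl, hS⟩
  have hSS : S ∈ Icc 0 S := ⟨hS, le_rfl⟩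
  -- The relation g(q) = χ(v) is invariant. Only on it is the extra coordinate v the potential, and
  -- the curve a genuine Hamiltonian trajectory.
  have hdiff : ∀ σ ∈ Icc 0 S, HasDerivWithinAt (fun σ => C.g κ (q σ) - C.χ κ (v σ)) 0
      (Icc 0 S) σ := fun σ hσ => by
    have h1 := hasDerivWithinAt_comp_gradient (hreg σ hσ).differentiableAt (hq σ hσ)
    have h2 : HasDerivAt (C.χ κ) (deriv (C.χ κ) (v σ)) (v σ) :=
      ((hval σ hσ).1.contDiffAt.differentiableAt (by simp)).hasDerivAt
    refine (h1.sub (h2.comp_hasDerivWithinAt σ (hv σ hσ))).congr_deriv ?_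
    rw [inner_smul_left, RCLike.conj_to_real]
    ring
  have hinv : ∀ σ ∈ Icc 0 S, C.g κ (q σ) = C.χ κ (v σ) := fun σ hσ => by
    have := eq_left_of_hasDerivAt_zero (fun σ hσ => (hdiff σ hσ).continuousWithinAt)
      (fun σ hσ => hasDerivAt_of_Icc (hdiff σ (Ioo_subset_Icc_self hσ)) hσ) σ hσ
    rw [h0, sub_self] at this
    exact sub_eq_zero.1 this
  refine ⟨hinv S hSS, ?_, ?_⟩
  · rintro n rfl
    refine HamiltonianArc.of_reparametrization hS hq (fun σ hσ => ?_) hτ (fun σ hσ =>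
      mul_pos_of_neg_of_neg (hν σ hσ) ((hval σ hσ).deriv_mul (hn n rfl)).2)
    refine (hp σ hσ).congr_deriv ?_
    have hmem := ((hval σ hσ).2.self_of_nhds n rfl).1
    simp only at hmem
    rw [(hreg σ hσ).gradient_eq (by
      rw [hinv σ hσ]
      exact (hn n rfl _ hmem).1.differentiableAt (by simp)), hinv σ hσ, smul_smul]
    congr 2
    have := ((hval σ hσ).deriv_mul (hn n rfl)).1
    rw [mul_assoc, mul_comm (deriv (C.χ n) (v σ)), this, mul_one]
  · rintro rfl
    have hd0 : ∀ x, deriv (C.χ ∞) x = 0 := fun x => by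
      have : C.χ ∞ = fun _ => 0 := funext C.χ_infty
      rw [this, deriv_const]
    have hqc := eq_left_of_hasDerivAt_zero (fun σ hσ => (hq σ hσ).continuousWithinAt)
      (fun σ hσ => by
        have := hasDerivAt_of_Icc (hq σ (Ioo_subset_Icc_self hσ)) hσ
        rwa [hd0, mul_zero, zero_smul] at this)
    have hτc := eq_left_of_hasDerivAt_zero (fun σ hσ => (hτ σ hσ).continuousWithinAt)
      (fun σ hσ => by
        have := hasDerivAt_of_Icc (hτ σ (Ioo_subset_Icc_self hσ)) hσ
        rwa [hd0, mul_zero] at this)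
    have hp' : ∀ σ ∈ Ioo 0 S, HasDerivAt p ((-ν σ) • gradient (C.g ∞) (q 0)) σ := fun σ hσ => by
      have := hasDerivAt_of_Icc (hp σ (Ioo_subset_Icc_self hσ)) hσ
      rwa [hqc σ (Ioo_subset_Icc_self hσ), ← neg_smul] at this
    refine ⟨hqc S hSS, hτc S hSS, exists_eq_add_smul (hreg 0 h00).2.2.2.2 hS
      (fun σ hσ => (hp σ hσ).continuousWithinAt) hp', energy_eq_of_hasDerivAt
      (k := fun σ => -ν σ) (N := gradient (C.g ∞) (q 0)) hS
      (fun σ hσ => (hp σ hσ).continuousWithinAt) (fun σ hσ => (hv σ hσ).continuousWithinAt)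
      fun σ hσ => ⟨hp' σ hσ, ?_⟩⟩
    have := hasDerivAt_of_Icc (hv σ (Ioo_subset_Icc_self hσ)) hσ
    rw [hqc σ (Ioo_subset_Icc_self hσ)] at this
    refine this.congr_deriv ?_
    ring

/-- Motion across the edge of the boundary layer, for a finite value of the parameter. -/
theorem crossing_path (C : CollisionChart r D 𝓔 U q₀) {n : ℕ} {S : ℝ} (hS : 0 ≤ S)
    {q p : ℝ → Config d} {τ x a b : ℝ → ℝ} (hreg : ∀ σ ∈ Icc 0 S, C.IsRegular (n, q σ))
    (hn : C.BarrierSmooth n) (hxm : ∀ σ ∈ Icc 0 S, x σ ∈ Ioo (-C.ρ) C.ρ)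
    (hgx : ∀ σ ∈ Icc 0 S, C.g n (q σ) = x σ)
    (hb : ∀ σ ∈ Icc 0 S, b σ = deriv (C.w n) (x σ) * a σ)
    (hpos : ∀ σ ∈ Icc 0 S, 0 < a σ * (inner ℝ (p σ) (gradient (C.g n) (q σ)))⁻¹)
    (hq : ∀ σ ∈ Icc 0 S, HasDerivWithinAt q
      ((a σ * (inner ℝ (p σ) (gradient (C.g n) (q σ)))⁻¹) • p σ) (Icc 0 S) σ)
    (hp : ∀ σ ∈ Icc 0 S, HasDerivWithinAt p
      (-((b σ * (inner ℝ (p σ) (gradient (C.g n) (q σ)))⁻¹) • gradient (C.g n) (q σ)))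
      (Icc 0 S) σ)
    (hτ : ∀ σ ∈ Icc 0 S, HasDerivWithinAt τ
      (a σ * (inner ℝ (p σ) (gradient (C.g n) (q σ)))⁻¹) (Icc 0 S) σ) :
    HamiltonianArc (U n) (q 0, p 0) (τ S - τ 0) (q S, p S) := by
  refine HamiltonianArc.of_reparametrization hS hq (fun σ hσ => ?_) hτ hpos
  refine (hp σ hσ).congr_deriv ?_
  have hw : DifferentiableAt ℝ (C.w n) (C.g n (q σ)) := by
    rw [hgx σ hσ]
    exact (hn _ (hxm σ hσ)).1.differentiableAt (by simp)
  rw [(hreg σ hσ).gradient_eq hw, hgx σ hσ, smul_smul, hb σ hσ]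
  congr 2
  ring

end CollisionChart

end PathLemmas

/-! ### Links between phase points -/

section Links

open OnePoint

/-- There is a family of maps, converging in `C^r`, which sends `z` to `z'` in the limit and whose
graph belongs to the relation `R`. -/
def FamilyLink (r : ℕ) {E E' : Type} [NormedAddCommGroup E] [NormedSpace ℝ E]
    [NormedAddCommGroup E'] [NormedSpace ℝ E'] (R : OnePoint ℕ → E → E' → Prop) (z : E) (z' : E') :
    Prop :=
  ∃ Φ : OnePoint ℕ → E → E', ContDiffFamAt r Φ (∞, z) ∧ Φ ∞ z = z' ∧
    ∀ᶠ y in 𝓝 ((∞ : OnePoint ℕ), z), R y.1 y.2 (Φ y.1 y.2)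

section

variable {r : ℕ} {E E' E'' : Type} [NormedAddCommGroup E] [NormedSpace ℝ E]
    [NormedAddCommGroup E'] [NormedSpace ℝ E'] [NormedAddCommGroup E''] [NormedSpace ℝ E'']
    {R : OnePoint ℕ → E → E' → Prop} {R' : OnePoint ℕ → E' → E'' → Prop} {z : E} {z' : E'}
    {z'' : E''}

theorem FamilyLink.trans (h : FamilyLink r R z z') (h' : FamilyLink r R' z' z'') :
    FamilyLink r (fun κ a c => ∃ b, R κ a b ∧ R' κ b c) z z'' := by
  obtain ⟨Φ, h1, h2, h3⟩ := h
  obtain ⟨Φ', h1', h2', h3'⟩ := h'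
  have ht : Tendsto (fun y : OnePoint ℕ × E => (y.1, Φ y.1 y.2)) (𝓝 (∞, z)) (𝓝 (∞, z')) := by
    have : ContinuousAt (fun y : OnePoint ℕ × E => (y.1, Φ y.1 y.2)) (∞, z) :=
      continuousAt_fst.prodMk h1.continuousAt
    rw [ContinuousAt, h2] at this
    exact this
  refine ⟨fun κ a => Φ' κ (Φ κ a), ContDiffFamAt.comp (by rwa [h2]) h1, by beta_reduce; rw [h2, h2'], ?_⟩
  filter_upwards [h3, ht.eventually h3'] with y hy hy' using ⟨_, hy, hy'⟩

theorem FamilyLink.mono {R₁ : OnePoint ℕ → E → E' → Prop} (h : FamilyLink r R z z')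
    (hR : ∀ κ a b, R κ a b → R₁ κ a b) : FamilyLink r R₁ z z' := by
  obtain ⟨Φ, h1, h2, h3⟩ := h
  exact ⟨Φ, h1, h2, h3.mono fun y hy => hR _ _ _ hy⟩

/-- Serves to fill in auxiliary variables, such as durations, displacements of g and heights, as
functions of κ and the initial point. -/
theorem FamilyLink.comp_left {f : OnePoint ℕ → E'' → E} {x : E''}
    (hf : ContDiffFamAt r f (∞, x)) (hx : f ∞ x = z) (h : FamilyLink r R z z') :
    FamilyLink r (fun κ a b => R κ (f κ a) b) x z' := by
  have h0 : FamilyLink r (fun κ a b => b = f κ a) x z := ⟨f, hf, hx, Eventually.of_forall fun _ => rfl⟩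
  refine (h0.trans h).mono ?_
  rintro κ a b ⟨m, rfl, hm⟩
  exact hm

end

theorem eventually_of_eventually_nat {E : Type} [TopologicalSpace E] {P : ℕ → Prop} {z : E}
    (h : ∀ᶠ n in atTop, P n) :
    ∀ᶠ y in 𝓝 ((∞ : OnePoint ℕ), z), ∀ n : ℕ, y.1 = (n : OnePoint ℕ) → P n := by
  have h1 : ∀ᶠ κ in 𝓝 (∞ : OnePoint ℕ), ∀ n : ℕ, κ = (n : OnePoint ℕ) → P n := by
    refine OnePoint.eventually_nhds_infty.2 ⟨fun n hn => absurd hn (OnePoint.infty_ne_coe n), ?_⟩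
    filter_upwards [h] with n hn m hm
    rw [← OnePoint.coe_injective hm]
    exact hn
  rw [nhds_prod_eq]
  filter_upwards [h1.prod_mk (Eventually.of_forall fun _ : E => trivial)] with y hy using hy.1

variable {d : ℕ} {D : Set (Config d)} {U : ℕ → Config d → ℝ}

/-- The potentials as a family indexed by `ℕ ∪ {∞}`, with limit `0`. -/
def potentialFamily (U : ℕ → Config d → ℝ) (κ : OnePoint ℕ) : Config d → ℝ := κ.elim 0 U

/-- At ∞ the potential vanishes, so the curve is straight. As τ takes all intermediate values, the
whole segment of flight is covered by the curve and lies in the interior. -/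
theorem flight_path {κ : OnePoint ℕ} {q p : ℝ → Config d} {τ μ : ℝ → ℝ}
    (h : ∀ σ ∈ Icc (0 : ℝ) 1, q σ ∈ interior D ∧ 0 < μ σ ∧
      HasDerivWithinAt q (μ σ • p σ) (Icc 0 1) σ ∧
      HasDerivWithinAt p (-(μ σ • gradient (potentialFamily U κ) (q σ))) (Icc 0 1) σ ∧
      HasDerivWithinAt τ (μ σ) (Icc 0 1) σ) :
    (∀ n : ℕ, κ = (n : OnePoint ℕ) → HamiltonianArc (U n) (q 0, p 0) (τ 1 - τ 0) (q 1, p 1)) ∧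
    (κ = ∞ → p 1 = p 0 ∧ q 1 = q 0 + (τ 1 - τ 0) • p 0 ∧ τ 0 < τ 1 ∧
      ∀ u ∈ Icc 0 (τ 1 - τ 0), q 0 + u • p 0 ∈ interior D) := by
  constructor
  · rintro n rfl
    exact HamiltonianArc.of_reparametrization zero_le_one (fun σ hσ => (h σ hσ).2.2.1)
      (fun σ hσ => (h σ hσ).2.2.2.1) (fun σ hσ => (h σ hσ).2.2.2.2) (fun σ hσ => (h σ hσ).2.1)
  · rintro rfl
    have hgr0 : ∀ x, gradient (potentialFamily U ∞) x = 0 := fun x =>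
      gradient_fun_const x (0 : ℝ)
    have hτc : ContinuousOn τ (Icc 0 1) := fun σ hσ => (h σ hσ).2.2.2.2.continuousWithinAt
    have hfree := eq_of_free_motion (μ := μ) (fun σ hσ => (h σ hσ).2.2.1.continuousWithinAt)
      (fun σ hσ => (h σ hσ).2.2.2.1.continuousWithinAt) hτc fun σ hσ => by
        obtain ⟨-, -, h1, h2, h3⟩ := h σ (Ioo_subset_Icc_self hσ)
        rw [hgr0, smul_zero, neg_zero] at h2
        exact ⟨hasDerivAt_of_Icc h1 hσ, hasDerivAt_of_Icc h2 hσ, hasDerivAt_of_Icc h3 hσ⟩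
    have h1 := hfree 1 ⟨zero_le_one, le_rfl⟩
    refine ⟨h1.1, h1.2, lt_of_hasDerivAt_pos one_pos hτc
      (fun σ hσ => hasDerivAt_of_Icc (h σ (Ioo_subset_Icc_self hσ)).2.2.2.2 hσ)
      fun σ hσ => (h σ (Ioo_subset_Icc_self hσ)).2.1, fun u hu => ?_⟩
    obtain ⟨σ, hσ, e⟩ := exists_time_of_continuousOn zero_le_one hτc hu
    rw [← e, ← (hfree σ hσ).2]
    exact (h σ hσ).1

/-- Free flight as a link; the duration of the flight is one of the variables. -/
theorem flight_link {r : ℕ} (hr : 1 ≤ r) (hU : ∀ x ∈ interior D,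
      ContDiffFamAt (r + 1) (potentialFamily U) (∞, x)) {q p : Config d} {s t : ℝ} (ht : 0 < t)
    (hin : ∀ u ∈ Icc 0 t, q + u • p ∈ interior D) :
    FamilyLink r (fun κ (a : (PhaseSpace d × ℝ) × ℝ) (b : PhaseSpace d × ℝ) =>
      b.2 = a.1.2 + a.2 ∧ 0 < a.2 ∧
      (∀ n : ℕ, κ = (n : OnePoint ℕ) → HamiltonianArc (U n) a.1.1 a.2 b.1) ∧
      (κ = ∞ → b.1 = (a.1.1.1 + a.2 • a.1.1.2, a.1.1.2) ∧
        ∀ u ∈ Icc 0 a.2, a.1.1.1 + u • a.1.1.2 ∈ interior D))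
      (((q, p), s), t) ((q + t • p, p), s + t) := by
  have hseg : ∀ σ ∈ Icc (0 : ℝ) 1, q + (t * σ) • p ∈ interior D := fun σ hσ =>
    hin _ ⟨mul_nonneg ht.le hσ.1, mul_le_of_le_one_right ht.le hσ.2⟩
  obtain ⟨Φ, h1, h2, h3⟩ := exists_flight_family hr (U := potentialFamily U) rfl
    (m := fun _ z => z.2) (q := q) (p := p) (s := s) (δ := t) (θ := fun σ => t * σ)
    (fun σ hσ => hU _ (hseg σ hσ)) (fun σ hσ => ContDiffFamAt.of_contDiff contDiff_snd)
    (fun _ _ => ht) (fun σ _ => by simpa using (hasDerivAt_id σ).const_mul t) (mul_zero t)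
  refine ⟨Φ, h1, by rw [h2, mul_one], ?_⟩
  have h4 := h3 (fun y => y.2.1.1.1 ∈ interior D) fun σ hσ => by
    have : Continuous (fun y : OnePoint ℕ × ((PhaseSpace d × ℝ) × ℝ) => y.2.1.1.1) := by fun_prop
    exact this.continuousAt.eventually (isOpen_interior.eventually_mem (hseg σ hσ))
  filter_upwards [h4] with y ⟨q, p, τ, μ, e1, e2, h⟩
  have hpath := flight_path (D := D) (U := U) (κ := y.1) (q := q) (p := p) (τ := τ) (μ := μ)
    fun σ hσ => ⟨(h σ hσ).1, (h σ hσ).2.2⟩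
  have h0 : (0 : ℝ) ∈ Icc (0 : ℝ) 1 := ⟨le_rfl, zero_le_one⟩
  have hpos : 0 < y.2.2 := by
    have := (h 0 h0).2.2.1
    rwa [(h 0 h0).2.1] at this
  have hdur : τ 1 = τ 0 + y.2.2 := by
    have h5 : ∀ σ ∈ Icc (0 : ℝ) 1, HasDerivWithinAt (fun σ => τ σ - y.2.2 * σ) 0 (Icc 0 1) σ :=
      fun σ hσ => by
        obtain ⟨-, hμ, -, -, -, hτ⟩ := h σ hσ
        refine (hτ.sub ((hasDerivWithinAt_id σ _).const_mul y.2.2)).congr_deriv ?_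
        rw [hμ, mul_one, sub_self]
    have := eq_left_of_hasDerivAt_zero (fun σ hσ => (h5 σ hσ).continuousWithinAt)
      (fun σ hσ => hasDerivAt_of_Icc (h5 σ (Ioo_subset_Icc_self hσ)) hσ) 1 ⟨zero_le_one, le_rfl⟩
    linarith
  rw [e1, e2]
  simp only
  rw [hdur, add_sub_cancel_left] at hpath
  refine ⟨hdur, hpos, hpath.1, fun hκ => ?_⟩
  obtain ⟨h6, h7, -, h8⟩ := hpath.2 hκ
  exact ⟨Prod.ext h7 h6, h8⟩

namespace CollisionChart

variable {r : ℕ} {𝓔 : EReal} {q₀ : Config d}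

/-- Flight to the section `g = c`. -/
theorem approach_link (C : CollisionChart r D 𝓔 U q₀) (hr : 1 ≤ r)
    (hU : ∀ x ∈ interior D, ContDiffFamAt (r + 1) (potentialFamily U) (∞, x))
    {q p : Config d} {s c c' : ℝ} (hc : c < c') {θ : ℝ → ℝ} (hθ0 : θ 0 = 0)
    (hreg : ∀ σ ∈ Icc (0 : ℝ) 1, C.IsRegular (∞, q + θ σ • p))
    (hint : ∀ σ ∈ Icc (0 : ℝ) 1, q + θ σ • p ∈ interior D)
    (hu : ∀ σ ∈ Icc (0 : ℝ) 1, inner ℝ p (gradient (C.g ∞) (q + θ σ • p)) < 0)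
    (hθ : ∀ σ ∈ Icc (0 : ℝ) 1, HasDerivAt θ
      ((c - c') * (inner ℝ p (gradient (C.g ∞) (q + θ σ • p)))⁻¹) σ) (hg0 : C.g ∞ q = c') :
    FamilyLink r (fun κ (a b : PhaseSpace d × ℝ) => C.g κ b.1.1 = c ∧
      (∀ n : ℕ, κ = (n : OnePoint ℕ) → HamiltonianArc (U n) a.1 (b.2 - a.2) b.1) ∧
      (κ = ∞ → b.1.2 = a.1.2 ∧ b.1.1 = a.1.1 + (b.2 - a.2) • a.1.2 ∧ a.2 < b.2 ∧
        ∀ u ∈ Icc 0 (b.2 - a.2), a.1.1 + u • a.1.2 ∈ interior D))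
      ((q, p), s) ((q + θ 1 • p, p), s + θ 1) := by
  have h00 : (0 : ℝ) ∈ Icc (0 : ℝ) 1 := ⟨le_rfl, zero_le_one⟩
  set u : OnePoint ℕ → (PhaseSpace d × ℝ) × ℝ → ℝ := fun κ z =>
    inner ℝ z.1.1.2 (gradient (C.g κ) z.1.1.1) with hu'
  have huf : ∀ σ ∈ Icc (0 : ℝ) 1, ContDiffFamAt r u
      (∞, (((q + θ σ • p, p), s + θ σ), c - c')) := fun σ hσ =>
    (ContDiffFamAt.of_contDiff (φ := fun z : (PhaseSpace d × ℝ) × ℝ => z.1.1.2)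
      (by fun_prop)).inner (ContDiffFamAt.comp_right (F := fun κ x => gradient (C.g κ) x)
        (φ := fun z : (PhaseSpace d × ℝ) × ℝ => z.1.1.1) (by fun_prop)
        (hreg σ hσ).1.gradient_family)
  have hneg : c - c' < 0 := sub_neg.2 hc
  have hlink : FamilyLink r (fun κ (a : (PhaseSpace d × ℝ) × ℝ) (b : PhaseSpace d × ℝ) =>
      C.g κ b.1.1 = C.g κ a.1.1.1 + a.2 ∧
      (∀ n : ℕ, κ = (n : OnePoint ℕ) → HamiltonianArc (U n) a.1.1 (b.2 - a.1.2) b.1) ∧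
      (κ = ∞ → b.1.2 = a.1.1.2 ∧ b.1.1 = a.1.1.1 + (b.2 - a.1.2) • a.1.1.2 ∧ a.1.2 < b.2 ∧
        ∀ u ∈ Icc 0 (b.2 - a.1.2), a.1.1.1 + u • a.1.1.2 ∈ interior D))
      (((q, p), s), c - c') ((q + θ 1 • p, p), s + θ 1) := by
    -- With the speed δ/⟨p, ∇g⟩ the function g changes at the constant rate δ, so that at σ = 1 it
    -- has changed by exactly δ.
    obtain ⟨Φ, h1, h2, h3⟩ := exists_flight_family hr (U := potentialFamily U) rfl
      (m := fun κ z => z.2 * (u κ z)⁻¹) (q := q) (p := p) (s := s) (δ := c - c') (θ := θ)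
      (fun σ hσ => hU _ (hint σ hσ))
      (fun σ hσ => (ContDiffFamAt.of_contDiff contDiff_snd).mul ((huf σ hσ).inv (hu σ hσ).ne))
      (fun σ hσ => mul_pos_of_neg_of_neg hneg (inv_lt_zero.2 (hu σ hσ))) hθ hθ0
    refine ⟨Φ, h1, h2, ?_⟩
    have h4 := h3 (fun y => y.2.1.1.1 ∈ interior D ∧ C.IsRegular (y.1, y.2.1.1.1) ∧
        u y.1 y.2 ≠ 0) fun σ hσ => by
      have hc1 : Continuous (fun y : OnePoint ℕ × ((PhaseSpace d × ℝ) × ℝ) => y.2.1.1.1) := by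
        fun_prop
      have hc2 : Continuous (fun y : OnePoint ℕ × ((PhaseSpace d × ℝ) × ℝ) =>
        (y.1, y.2.1.1.1)) := by fun_prop
      exact (hc1.continuousAt.eventually (isOpen_interior.eventually_mem (hint σ hσ))).and
        ((hc2.continuousAt.eventually (hreg σ hσ).eventually).and
          ((huf σ hσ).continuousAt.eventually_ne (hu σ hσ).ne))
    filter_upwards [h4] with y ⟨q, p, τ, μ, e1, e2, h⟩
    have hpath := flight_path (D := D) (U := U) (κ := y.1) (q := q) (p := p) (τ := τ) (μ := μ)
      fun σ hσ => ⟨(h σ hσ).1.1, (h σ hσ).2.2⟩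
    have h5 : ∀ σ ∈ Icc (0 : ℝ) 1, HasDerivWithinAt (fun σ => C.g y.1 (q σ) - y.2.2 * σ) 0
        (Icc 0 1) σ := fun σ hσ => by
      obtain ⟨⟨-, hr, hne⟩, hμ, -, hq, -⟩ := h σ hσ
      refine ((hasDerivWithinAt_comp_gradient hr.differentiableAt hq).sub
        ((hasDerivWithinAt_id σ _).const_mul y.2.2)).congr_deriv ?_
      rw [inner_smul_left, RCLike.conj_to_real, hμ, mul_assoc]
      simp only [hu'] at hne ⊢
      rw [inv_mul_cancel₀ hne, sub_self]
    have h6 := eq_left_of_hasDerivAt_zero (fun σ hσ => (h5 σ hσ).continuousWithinAt)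
      (fun σ hσ => hasDerivAt_of_Icc (h5 σ (Ioo_subset_Icc_self hσ)) hσ) 1 ⟨zero_le_one, le_rfl⟩
    rw [e1, e2]
    exact ⟨by simp only; linarith, hpath.1, hpath.2⟩
  have hq0 : C.IsRegular (∞, q) := by simpa [hθ0] using hreg 0 h00
  -- The displacement depends on the initial point and on κ so that every flight ends precisely on
  -- the section of its own function g.
  have hf : ContDiffFamAt r (fun κ (z : PhaseSpace d × ℝ) => (z, c - C.g κ z.1.1))
      (∞, ((q, p), s)) :=
    (ContDiffFamAt.of_contDiff contDiff_id).prodMk ((ContDiffFamAt.of_contDiff contDiff_const).sub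
      (ContDiffFamAt.comp_right (F := C.g) (φ := fun z : PhaseSpace d × ℝ => z.1.1)
        (by fun_prop) (hq0.1.mono (Nat.le_succ r))))
  refine (FamilyLink.comp_left hf (by simp only [hg0]) hlink).mono ?_
  rintro κ a b ⟨h1, h2, h3⟩
  exact ⟨by rw [h1]; ring, h2, h3⟩

/-- From outside the boundary layer to its inside, or back. -/
theorem crossing_link (C : CollisionChart r D 𝓔 U q₀) (hr : 1 ≤ r) {S : ℝ} (hS : 0 ≤ S)
    (A A' : DensityFamily (OnePoint ℕ) S) (x : OnePoint ℕ → ℝ → ℝ) {σ₁ sg : ℝ}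
    (hx : ∀ κ, ContinuousOn (x κ) (Icc 0 S) ∧
      ∀ σ ∈ Ioo 0 S \ {σ₁}, HasDerivAt (x κ) (A.a κ σ) σ)
    (hA : ∀ σ, σ ≠ σ₁ → ContinuousAt (A.a ∞) σ ∧ ContinuousAt (A'.a ∞) σ)
    (hn : ∀ᶠ n : ℕ in atTop, C.BarrierSmooth n ∧ ContinuousOn (A.a n) (Icc 0 S) ∧
      ContinuousOn (A'.a n) (Icc 0 S) ∧ ∀ σ ∈ Icc 0 S, 0 < sg * A.a n σ ∧
        x n σ ∈ Ioo (-C.ρ) C.ρ ∧ A'.a n σ = deriv (C.w n) (x n σ) * A.a n σ)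
    {q p : ℝ → Config d} {τ : ℝ → ℝ}
    (hcq : ContinuousOn q (Icc 0 S)) (hcp : ContinuousOn p (Icc 0 S))
    (hcτ : ContinuousOn τ (Icc 0 S)) (hreg : ∀ σ ∈ Icc 0 S, C.IsRegular (∞, q σ))
    (hu : ∀ σ ∈ Icc 0 S, 0 < sg * inner ℝ (p σ) (gradient (C.g ∞) (q σ)))
    (hd : ∀ σ ∈ Ioo 0 S \ {σ₁},
      HasDerivAt q ((A.a ∞ σ * (inner ℝ (p σ) (gradient (C.g ∞) (q σ)))⁻¹) • p σ) σ ∧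
      HasDerivAt p (-((A'.a ∞ σ * (inner ℝ (p σ) (gradient (C.g ∞) (q σ)))⁻¹) •
        gradient (C.g ∞) (q σ))) σ ∧
      HasDerivAt τ (A.a ∞ σ * (inner ℝ (p σ) (gradient (C.g ∞) (q σ)))⁻¹) σ) :
    FamilyLink r (fun κ (a b : PhaseSpace d × ℝ) => C.g κ a.1.1 = x κ 0 → C.g κ b.1.1 = x κ S ∧
      (∀ n : ℕ, κ = (n : OnePoint ℕ) → HamiltonianArc (U n) a.1 (b.2 - a.2) b.1) ∧
      (κ = ∞ → ∃ (q p : ℝ → Config d) (τ : ℝ → ℝ), Continuous q ∧ Continuous p ∧ Continuous τ ∧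
        a = ((q 0, p 0), τ 0) ∧ b = ((q S, p S), τ S) ∧ ∀ σ ∈ Icc 0 S, C.IsRegular (∞, q σ) ∧
        C.g ∞ (q σ) = x ∞ σ ∧ 0 < sg * inner ℝ (p σ) (gradient (C.g ∞) (q σ)) ∧
        (σ ∈ Ioo 0 S \ {σ₁} →
          HasDerivAt q ((A.a ∞ σ * (inner ℝ (p σ) (gradient (C.g ∞) (q σ)))⁻¹) • p σ) σ ∧
          HasDerivAt p (-((A'.a ∞ σ * (inner ℝ (p σ) (gradient (C.g ∞) (q σ)))⁻¹) •
            gradient (C.g ∞) (q σ))) σ ∧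
          HasDerivAt τ (A.a ∞ σ * (inner ℝ (p σ) (gradient (C.g ∞) (q σ)))⁻¹) σ)))
      ((q 0, p 0), τ 0) ((q S, p S), τ S) := by
  have hne : ∀ σ ∈ Icc 0 S, inner ℝ (p σ) (gradient (C.g ∞) (q σ)) ≠ 0 := fun σ hσ e => by
    have := hu σ hσ
    rw [e, mul_zero] at this
    exact lt_irrefl _ this
  obtain ⟨Φ, h1, h2, h3⟩ := exists_crossing_family hr hS A A' hcq hcp hcτ
    (fun σ hσ => (hreg σ hσ).1) hne (countable_singleton σ₁) hd
  refine ⟨Φ, h1, h2, ?_⟩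
  have h4 := h3 (fun y => C.IsRegular (y.1, y.2.1.1) ∧
      0 < sg * inner ℝ y.2.1.2 (gradient (C.g y.1) y.2.1.1)) fun σ hσ => by
    have hc2 : Continuous (fun y : OnePoint ℕ × (PhaseSpace d × ℝ) => (y.1, y.2.1.1)) := by
      fun_prop
    have huf : ContDiffFamAt r (fun κ (z : PhaseSpace d × ℝ) =>
        inner ℝ z.1.2 (gradient (C.g κ) z.1.1)) (∞, ((q σ, p σ), τ σ)) :=
      (ContDiffFamAt.of_contDiff (φ := fun z : PhaseSpace d × ℝ => z.1.2)
        (by fun_prop)).inner (ContDiffFamAt.comp_right (F := fun κ x => gradient (C.g κ) x)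
          (φ := fun z : PhaseSpace d × ℝ => z.1.1) (by fun_prop)
          (hreg σ hσ).1.gradient_family)
    exact (hc2.continuousAt.eventually (hreg σ hσ).eventually).and
      ((huf.continuousAt.const_mul sg).eventually (lt_mem_nhds (hu σ hσ)))
  filter_upwards [h4, eventually_of_eventually_nat hn] with y ⟨q, p, τ, hq, hp, hτ, e1, e2, h⟩ hyn
    hinit
  rw [e1, e2] at *
  simp only at hinit ⊢
  -- For finite indices the densities are continuous throughout; the jump at σ₁ occurs only in the
  -- limit.
  have hcont : ∀ σ ∈ Icc 0 S, σ ≠ σ₁ → ContinuousWithinAt (A.a y.1) (Icc 0 S) σ ∧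
      ContinuousWithinAt (A'.a y.1) (Icc 0 S) σ := by
    intro σ hσ hne
    rcases h' : y.1 with _ | n
    · exact ⟨(hA σ hne).1.continuousWithinAt, (hA σ hne).2.continuousWithinAt⟩
    · have := hyn n h'
      exact ⟨this.2.1 σ hσ, this.2.2.1 σ hσ⟩
  -- The densities were computed along the prescribed curve x. They describe the actual force only
  -- if g follows that curve, which holds as soon as it holds initially because both have the same
  -- rate.
  have hgx : ∀ σ ∈ Icc 0 S, C.g y.1 (q σ) = x y.1 σ := fun σ hσ => by
    have hgc : ContinuousOn (fun σ => C.g y.1 (q σ) - x y.1 σ) (Icc 0 S) := fun σ hσ =>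
      ((ContinuousAt.comp (f := q) (h σ hσ).1.1.differentiableAt.continuousAt
        hq.continuousAt).continuousWithinAt).sub ((hx y.1).1 σ hσ)
    have := eq_of_hasDerivAt_zero_off_countable hgc (countable_singleton σ₁) (fun σ hσ => by
      have hσ' := Ioo_subset_Icc_self hσ.1
      obtain ⟨⟨hr, -⟩, hne, hder⟩ := h σ hσ'
      have hc := hcont σ hσ' hσ.2
      have hq' := hasDerivAt_of_Icc (hder hc.1 hc.2).1 hσ.1
      refine ((hasDerivAt_comp_gradient hr.differentiableAt hq').sub
        ((hx y.1).2 σ hσ)).congr_deriv ?_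
      rw [inner_smul_left, RCLike.conj_to_real, mul_assoc]
      simp only
      rw [inv_mul_cancel₀ hne, mul_one, sub_self]) σ hσ
    rw [hinit, sub_self] at this
    exact sub_eq_zero.1 this
  refine ⟨hgx S ⟨hS, le_rfl⟩, ?_, ?_⟩
  · intro n hn
    obtain ⟨hb, hc1, hc2, h5⟩ := hyn n hn
    rw [hn] at h hgx
    exact C.crossing_path hS (fun σ hσ => (h σ hσ).1.1) hb (fun σ hσ => (h5 σ hσ).2.1) hgx
      (fun σ hσ => (h5 σ hσ).2.2) (fun σ hσ => by
        have h6 := mul_pos (h5 σ hσ).1 (h σ hσ).1.2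
        have h7 := (h σ hσ).2.1
        have hsg : sg ≠ 0 := fun e => by
          have := (h5 σ hσ).1
          rw [e, zero_mul] at this
          exact lt_irrefl _ this
        -- The horizontal speed and the normal velocity have the same sign `sg`, so time runs
        -- forward.
        have h8 : ∀ a u : ℝ, u ≠ 0 → a * u⁻¹ = sg * a * (sg * u) * ((sg * u) ^ 2)⁻¹ := by
          intro a u hu
          field_simp
        rw [h8 _ _ h7]
        exact mul_pos h6 (inv_pos.2 (by positivity)))
      (fun σ hσ => ((h σ hσ).2.2 (hc1 σ hσ) (hc2 σ hσ)).1)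
      (fun σ hσ => ((h σ hσ).2.2 (hc1 σ hσ) (hc2 σ hσ)).2.1)
      (fun σ hσ => ((h σ hσ).2.2 (hc1 σ hσ) (hc2 σ hσ)).2.2)
  · intro hκ
    rw [hκ] at h hgx hcont
    refine ⟨q, p, τ, hq, hp, hτ, rfl, rfl, fun σ hσ => ⟨(h σ hσ).1.1, hgx σ hσ, (h σ hσ).1.2,
      fun hσ' => ?_⟩⟩
    have hc := hcont σ hσ hσ'.2
    obtain ⟨h5, h6, h7⟩ := (h σ hσ).2.2 hc.1 hc.2
    exact ⟨hasDerivAt_of_Icc h5 hσ'.1, hasDerivAt_of_Icc h6 hσ'.1, hasDerivAt_of_Icc h7 hσ'.1⟩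

theorem eventually_barrierSmooth (C : CollisionChart r D 𝓔 U q₀) :
    ∀ᶠ n in atTop, C.BarrierSmooth n := C.barrier.smooth

/-- Motion inside the boundary layer during a given parameter interval. -/
theorem kick_in_link (C : CollisionChart r D 𝓔 U q₀) (hr : 1 ≤ r) {ω : OnePoint ℕ → ℝ}
    (hω : Continuous ω) {q : Config d} {s S : ℝ} (hS : 0 ≤ S) {p : ℝ → Config d} {v : ℝ → ℝ}
    (hreg : C.IsRegular (∞, q)) (hval : ∀ σ ∈ Icc 0 S, C.IsRegularValue (∞, v σ))
    (hp : ∀ σ ∈ Icc 0 S, HasDerivAt p (gradient (C.g ∞) q) σ)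
    (hv : ∀ σ ∈ Icc 0 S, HasDerivAt v (-inner ℝ (p σ) (gradient (C.g ∞) q)) σ)
    (hv0 : v 0 = ω ∞) :
    FamilyLink r (fun κ (a : PhaseSpace d × ℝ) (b : (PhaseSpace d × ℝ) × ℝ) =>
      C.g κ a.1.1 = C.χ κ (ω κ) → C.g κ b.1.1.1 = C.χ κ b.2 ∧
      (∀ n : ℕ, κ = (n : OnePoint ℕ) → HamiltonianArc (U n) a.1 (b.1.2 - a.2) b.1.1) ∧
      (κ = ∞ → b.1.1.1 = a.1.1 ∧ b.1.2 = a.2 ∧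
        (∃ α : ℝ, b.1.1.2 = a.1.2 + α • gradient (C.g ∞) a.1.1) ∧
        ‖b.1.1.2‖ ^ 2 / 2 + b.2 = ‖a.1.2‖ ^ 2 / 2 + ω ∞))
      ((q, p 0), s) (((q, p S), s), v S) := by
  -- The constant ν = -1 is regular at the turning point, where the normal velocity vanishes and the
  -- height cannot be the independent variable. The spare variable δ is set to 0.
  obtain ⟨Φ, h1, h2, h3⟩ := exists_kick_family hr (g := C.g) (χ := C.χ) C.χ_infty
    (ν := fun _ _ => -1) (q := q) (s := s) (δ := 0) hS (p := p) (v := v) hreg.1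
    (fun σ hσ => (hval σ hσ).1) (fun σ _ => ContDiffFamAt.of_contDiff contDiff_const)
    (fun σ hσ => by simpa using hp σ hσ) (fun σ hσ => by simpa using hv σ hσ)
  have h4 := h3 (fun y => C.IsRegular (y.1, y.2.1.1.1) ∧ C.IsRegularValue (y.1, y.2.2.1))
    fun σ hσ => by
      have hc1 : Continuous (fun y : OnePoint ℕ × ((PhaseSpace d × ℝ) × (ℝ × ℝ)) =>
        (y.1, y.2.1.1.1)) := by fun_prop
      have hc2 : Continuous (fun y : OnePoint ℕ × ((PhaseSpace d × ℝ) × (ℝ × ℝ)) =>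
        (y.1, y.2.2.1)) := by fun_prop
      exact (hc1.continuousAt.eventually hreg.eventually).and
        (hc2.continuousAt.eventually (hval σ hσ).eventually)
  have hlink : FamilyLink r (fun κ (a : (PhaseSpace d × ℝ) × (ℝ × ℝ))
      (b : (PhaseSpace d × ℝ) × ℝ) =>
      C.g κ a.1.1.1 = C.χ κ a.2.1 → C.g κ b.1.1.1 = C.χ κ b.2 ∧
      (∀ n : ℕ, κ = (n : OnePoint ℕ) → HamiltonianArc (U n) a.1.1 (b.1.2 - a.1.2) b.1.1) ∧
      (κ = ∞ → b.1.1.1 = a.1.1.1 ∧ b.1.2 = a.1.2 ∧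
        (∃ α : ℝ, b.1.1.2 = a.1.1.2 + α • gradient (C.g ∞) a.1.1.1) ∧
        ‖b.1.1.2‖ ^ 2 / 2 + b.2 = ‖a.1.1.2‖ ^ 2 / 2 + a.2.1))
      (((q, p 0), s), (v 0, 0)) (((q, p S), s), v S) := by
    refine ⟨Φ, h1, h2, ?_⟩
    filter_upwards [h4, eventually_of_eventually_nat C.eventually_barrierSmooth] with
      y ⟨q, p, τ, v, ν, e1, e2, e3, h⟩ hyn hinit
    rw [e1, e2] at *
    rw [e3]
    exact C.kick_path hS (fun σ hσ => (h σ hσ).1.1) (fun σ hσ => (h σ hσ).1.2)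
      (ν := ν) (fun σ hσ => by rw [(h σ hσ).2.1]; norm_num) hyn
      (fun σ hσ => (h σ hσ).2.2.1) (fun σ hσ => (h σ hσ).2.2.2.1)
      (fun σ hσ => (h σ hσ).2.2.2.2.1) (fun σ hσ => (h σ hσ).2.2.2.2.2) hinit
  have hf : ContDiffFamAt r (fun κ (z : PhaseSpace d × ℝ) => (z, (ω κ, (0 : ℝ))))
      (∞, ((q, p 0), s)) :=
    (ContDiffFamAt.of_contDiff contDiff_id).prodMk ((ContDiffFamAt.of_param hω).prodMk
      (ContDiffFamAt.of_contDiff contDiff_const))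
  refine (FamilyLink.comp_left hf (by simp only [hv0]) hlink).mono ?_
  intro κ a b h hinit
  obtain ⟨h5, h6, h7⟩ := h hinit
  refine ⟨h5, h6, fun hκ => ?_⟩
  have := h7 hκ
  rwa [hκ] at this

/-- Motion inside the boundary layer until the potential has the value `ω`. -/
theorem kick_out_link (C : CollisionChart r D 𝓔 U q₀) (hr : 1 ≤ r) {ω : OnePoint ℕ → ℝ}
    (hω : Continuous ω) {q : Config d} {s δ : ℝ} (hδ : δ < 0) {p : ℝ → Config d} {v : ℝ → ℝ}
    (hreg : C.IsRegular (∞, q)) (hval : ∀ σ ∈ Icc (0 : ℝ) 1, C.IsRegularValue (∞, v σ))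
    (hu : ∀ σ ∈ Icc (0 : ℝ) 1, 0 < inner ℝ (p σ) (gradient (C.g ∞) q))
    (hp : ∀ σ ∈ Icc (0 : ℝ) 1, HasDerivAt p
      (-((δ * (inner ℝ (p σ) (gradient (C.g ∞) q))⁻¹) • gradient (C.g ∞) q)) σ)
    (hv : ∀ σ ∈ Icc (0 : ℝ) 1, HasDerivAt v δ σ) (hδ' : ω ∞ - v 0 = δ) :
    FamilyLink r (fun κ (a : (PhaseSpace d × ℝ) × ℝ) (b : PhaseSpace d × ℝ) =>
      C.g κ a.1.1.1 = C.χ κ a.2 → C.g κ b.1.1 = C.χ κ (ω κ) ∧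
      (∀ n : ℕ, κ = (n : OnePoint ℕ) → HamiltonianArc (U n) a.1.1 (b.2 - a.1.2) b.1) ∧
      (κ = ∞ → b.1.1 = a.1.1.1 ∧ b.2 = a.1.2 ∧
        (∃ α : ℝ, b.1.2 = a.1.1.2 + α • gradient (C.g ∞) a.1.1.1) ∧
        ‖b.1.2‖ ^ 2 / 2 + ω ∞ = ‖a.1.1.2‖ ^ 2 / 2 + a.2))
      (((q, p 0), s), v 0) ((q, p 1), s) := by
  set u : OnePoint ℕ → (PhaseSpace d × ℝ) × (ℝ × ℝ) → ℝ := fun κ z =>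
    inner ℝ z.1.1.2 (gradient (C.g κ) z.1.1.1) with hu'
  have huf : ∀ σ, ContDiffFamAt r u (∞, (((q, p σ), s), (v σ, δ))) := fun σ =>
    (ContDiffFamAt.of_contDiff (φ := fun z : (PhaseSpace d × ℝ) × (ℝ × ℝ) => z.1.1.2)
      (by fun_prop)).inner (ContDiffFamAt.comp_right (F := fun κ x => gradient (C.g κ) x)
        (φ := fun z : (PhaseSpace d × ℝ) × (ℝ × ℝ) => z.1.1.1) (by fun_prop)
        hreg.1.gradient_family)
  -- Away from the turning point ν = δ/⟨p, ∇g⟩ is allowed; the height then changes at the constant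
  -- rate δ.
  obtain ⟨Φ, h1, h2, h3⟩ := exists_kick_family hr (g := C.g) (χ := C.χ) C.χ_infty
    (ν := fun κ z => z.2.2 * (u κ z)⁻¹) (q := q) (s := s) (δ := δ) zero_le_one (p := p) (v := v)
    hreg.1 (fun σ hσ => (hval σ hσ).1)
    (fun σ hσ => (ContDiffFamAt.of_contDiff
      (φ := fun z : (PhaseSpace d × ℝ) × (ℝ × ℝ) => z.2.2) (by fun_prop)).mul
      ((huf σ).inv (hu σ hσ).ne'))
    hp (fun σ hσ => (hv σ hσ).congr_deriv (by
      simp only [hu']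
      rw [mul_assoc, inv_mul_cancel₀ (hu σ hσ).ne', mul_one]))
  have h4 := h3 (fun y => C.IsRegular (y.1, y.2.1.1.1) ∧ C.IsRegularValue (y.1, y.2.2.1) ∧
      0 < u y.1 y.2 ∧ y.2.2.2 < 0) fun σ hσ => by
    have hc1 : Continuous (fun y : OnePoint ℕ × ((PhaseSpace d × ℝ) × (ℝ × ℝ)) =>
      (y.1, y.2.1.1.1)) := by fun_prop
    have hc2 : Continuous (fun y : OnePoint ℕ × ((PhaseSpace d × ℝ) × (ℝ × ℝ)) =>
      (y.1, y.2.2.1)) := by fun_prop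
    have hc3 : Continuous (fun y : OnePoint ℕ × ((PhaseSpace d × ℝ) × (ℝ × ℝ)) => y.2.2.2) := by
      fun_prop
    exact (hc1.continuousAt.eventually hreg.eventually).and
      ((hc2.continuousAt.eventually (hval σ hσ).eventually).and
        (((huf σ).continuousAt.eventually (lt_mem_nhds (hu σ hσ))).and
          (hc3.continuousAt.eventually (gt_mem_nhds hδ))))
  have hlink : FamilyLink r (fun κ (a : (PhaseSpace d × ℝ) × (ℝ × ℝ))
      (b : (PhaseSpace d × ℝ) × ℝ) =>
      C.g κ a.1.1.1 = C.χ κ a.2.1 → b.2 = a.2.1 + a.2.2 ∧ C.g κ b.1.1.1 = C.χ κ b.2 ∧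
      (∀ n : ℕ, κ = (n : OnePoint ℕ) → HamiltonianArc (U n) a.1.1 (b.1.2 - a.1.2) b.1.1) ∧
      (κ = ∞ → b.1.1.1 = a.1.1.1 ∧ b.1.2 = a.1.2 ∧
        (∃ α : ℝ, b.1.1.2 = a.1.1.2 + α • gradient (C.g ∞) a.1.1.1) ∧
        ‖b.1.1.2‖ ^ 2 / 2 + b.2 = ‖a.1.1.2‖ ^ 2 / 2 + a.2.1))
      (((q, p 0), s), (v 0, δ)) (((q, p 1), s), v 1) := by
    refine ⟨Φ, h1, h2, ?_⟩
    filter_upwards [h4, eventually_of_eventually_nat C.eventually_barrierSmooth] with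
      y ⟨q, p, τ, v, ν, e1, e2, e3, h⟩ hyn hinit
    rw [e1, e2] at hinit ⊢
    rw [e3]
    have hvd : ∀ σ ∈ Icc (0 : ℝ) 1, HasDerivWithinAt (fun σ => v σ - y.2.2.2 * σ) 0
        (Icc 0 1) σ := fun σ hσ => by
      obtain ⟨⟨-, -, hpos, -⟩, hν, -, -, -, hvσ⟩ := h σ hσ
      refine (hvσ.sub ((hasDerivWithinAt_id σ _).const_mul y.2.2.2)).congr_deriv ?_
      rw [hν]
      simp only [hu'] at hpos ⊢
      rw [mul_assoc, inv_mul_cancel₀ hpos.ne', sub_self]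
    have hv1 := eq_left_of_hasDerivAt_zero (fun σ hσ => (hvd σ hσ).continuousWithinAt)
      (fun σ hσ => hasDerivAt_of_Icc (hvd σ (Ioo_subset_Icc_self hσ)) hσ) 1 ⟨zero_le_one, le_rfl⟩
    refine ⟨by simp only; linarith, ?_⟩
    exact C.kick_path zero_le_one (fun σ hσ => (h σ hσ).1.1) (fun σ hσ => (h σ hσ).1.2.1)
      (ν := ν) (fun σ hσ => by
        rw [(h σ hσ).2.1]
        exact mul_neg_of_neg_of_pos (h σ hσ).1.2.2.2 (inv_pos.2 (h σ hσ).1.2.2.1)) hyn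
      (fun σ hσ => (h σ hσ).2.2.1) (fun σ hσ => (h σ hσ).2.2.2.1)
      (fun σ hσ => (h σ hσ).2.2.2.2.1) (fun σ hσ => (h σ hσ).2.2.2.2.2) hinit
  -- The rate is the height still to be lost, so that the motion ends at the height ω for each κ and
  -- the coordinate v may be dropped.
  have hf : ContDiffFamAt r (fun κ (z : (PhaseSpace d × ℝ) × ℝ) => (z.1, (z.2, ω κ - z.2)))
      (∞, (((q, p 0), s), v 0)) :=
    (ContDiffFamAt.of_contDiff contDiff_fst).prodMk ((ContDiffFamAt.of_contDiff
      contDiff_snd).prodMk ((ContDiffFamAt.of_param hω).sub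
        (ContDiffFamAt.of_contDiff contDiff_snd)))
  obtain ⟨Ψ, g1, g2, g3⟩ := FamilyLink.comp_left hf (by simp only [hδ']) hlink
  refine ⟨fun κ z => (Ψ κ z).1, g1.clm_comp (ContinuousLinearMap.fst ℝ _ _), by beta_reduce; rw [g2], ?_⟩
  filter_upwards [g3]
  rintro ⟨κ, z⟩ hy hinit
  obtain ⟨h4, h5, h6, h7⟩ := hy hinit
  have e : (Ψ κ z).2 = ω κ := by rw [h4]; simp
  simp only at h5 h6 h7
  rw [e] at h5 h7
  refine ⟨h5, h6, ?_⟩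
  rintro rfl
  exact h7 rfl

end CollisionChart

end Links

/-! ### Links through a collision -/

section CollisionLinks

open OnePoint

theorem FamilyLink.and_right {r : ℕ} {E E' : Type} [NormedAddCommGroup E] [NormedSpace ℝ E]
    [NormedAddCommGroup E'] [NormedSpace ℝ E'] {R : OnePoint ℕ → E → E' → Prop} {z : E} {z' : E'}
    {P : OnePoint ℕ → E' → Prop} (h : FamilyLink r R z z')
    (hP : ∀ᶠ y in 𝓝 ((∞ : OnePoint ℕ), z'), P y.1 y.2) :
    FamilyLink r (fun κ a b => R κ a b ∧ P κ b) z z' := by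
  obtain ⟨Φ, h1, h2, h3⟩ := h
  have ht : Tendsto (fun y : OnePoint ℕ × E => (y.1, Φ y.1 y.2)) (𝓝 (∞, z)) (𝓝 (∞, z')) := by
    have : ContinuousAt (fun y : OnePoint ℕ × E => (y.1, Φ y.1 y.2)) (∞, z) :=
      continuousAt_fst.prodMk h1.continuousAt
    rw [ContinuousAt, h2] at this
    exact this
  exact ⟨Φ, h1, h2, h3.and (ht.eventually hP)⟩

variable {d r n : ℕ} {L : AddSubgroup (Config d)} {B : BilliardTable d r n L}
  {U : ℕ → Config d → ℝ}

/-- Phase points with times are connected by arcs of trajectories: of the smooth flows for finite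
values of the parameter, of the billiard flow for the infinite one. -/
def TimedArc (B : BilliardTable d r n L) (U : ℕ → Config d → ℝ) (κ : OnePoint ℕ)
    (a b : PhaseSpace d × ℝ) : Prop :=
  (∀ m : ℕ, κ = (m : OnePoint ℕ) → HamiltonianArc (U m) a.1 (b.2 - a.2) b.1) ∧
  (κ = ∞ → BilliardArc B a.1 (b.2 - a.2) b.1)

theorem TimedArc.trans {κ : OnePoint ℕ} {a b c : PhaseSpace d × ℝ} (h : TimedArc B U κ a b)
    (h' : TimedArc B U κ b c) : TimedArc B U κ a c := by
  have e : c.2 - a.2 = b.2 - a.2 + (c.2 - b.2) := by ring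
  exact ⟨fun m hm => e ▸ (h.1 m hm).trans (h'.1 m hm), fun hκ => e ▸ (h.2 hκ).trans (h'.2 hκ)⟩

/-- The value of a function as a parameter on a transversal line. -/
theorem exists_line_parameter {g : Config d → ℝ} {q e : Config d} {O : Set (Config d)}
    (hO : O ∈ 𝓝 q) (hg : ContDiffAt ℝ 1 g q) (h0 : g q = 0) (he : 0 < inner ℝ e (gradient g q))
    {η : ℝ} (hη : 0 < η) :
    ∃ c₁ > 0, ∃ θ : ℝ → ℝ, θ 0 = 0 ∧ ContinuousOn θ (Icc 0 c₁) ∧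
      (∀ x ∈ Icc 0 c₁, θ x < η ∧ q + θ x • e ∈ O ∧ g (q + θ x • e) = x) ∧
      (∀ x ∈ Ioc 0 c₁, 0 < θ x) ∧
      ∀ x ∈ Ioo 0 c₁, HasDerivAt θ (inner ℝ e (gradient g (q + θ x • e)))⁻¹ x := by
  have hgc : ContinuousAt (gradient g) q := by
    have h1 : ContinuousAt (fderiv ℝ g) q :=
      (hg.fderiv_right (m := 0) (by norm_num)).continuousAt
    exact (InnerProductSpace.toDual ℝ (Config d)).symm.continuous.continuousAt.comp h1
  have hline : Continuous fun s : ℝ => q + s • e := by fun_prop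
  have hev : ∀ᶠ s : ℝ in 𝓝 0, q + s • e ∈ O ∧ DifferentiableAt ℝ g (q + s • e) ∧
      0 < inner ℝ e (gradient g (q + s • e)) := by
    have ht : Tendsto (fun s : ℝ => q + s • e) (𝓝 0) (𝓝 q) := by
      have := hline.tendsto 0
      rwa [zero_smul, add_zero] at this
    refine ht.eventually (p := fun x => x ∈ O ∧ DifferentiableAt ℝ g x ∧
      0 < inner ℝ e (gradient g x)) ?_
    have h2 : ContinuousAt (fun x => inner ℝ e (gradient g x)) q := continuousAt_const.inner hgc
    filter_upwards [hO, hg.eventually (by simp), h2.eventually (lt_mem_nhds he)] with x h1 h2 h3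
      using ⟨h1, h2.differentiableAt (by norm_num), h3⟩
  obtain ⟨s₁, hs₁, hball⟩ := Metric.eventually_nhds_iff_ball.1 hev
  set s₀ := min s₁ η / 2 with hs₀
  have hmin : 0 < min s₁ η := lt_min hs₁ hη
  have hs0 : 0 < s₀ := by positivity
  have hs0η : s₀ < η := by have := min_le_right s₁ η; linarith
  have hin : ∀ s ∈ Icc 0 s₀, q + s • e ∈ O ∧ DifferentiableAt ℝ g (q + s • e) ∧
      0 < inner ℝ e (gradient g (q + s • e)) := fun s hs => hball s (by
    rw [Metric.mem_ball, dist_zero_right, Real.norm_eq_abs, abs_of_nonneg hs.1]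
    have := min_le_left s₁ η
    linarith [hs.2])
  have hd : ∀ s ∈ Icc 0 s₀, HasDerivWithinAt (fun s => g (q + s • e))
      (inner ℝ e (gradient g (q + s • e))) (Icc 0 s₀) s := fun s hs => by
    have h1 : HasDerivAt (fun s : ℝ => q + s • e) e s := by
      simpa using ((hasDerivAt_id s).smul_const e).const_add q
    exact (hasDerivAt_comp_gradient (hin s hs).2.1 h1).hasDerivWithinAt
  obtain ⟨-, θ, h1, h2⟩ := exists_inverse_of_deriv_pos hs0.le hd fun s hs => (hin s hs).2.2
  have hτ0 : g (q + (0 : ℝ) • e) = 0 := by rw [zero_smul, add_zero, h0]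
  simp only [hτ0] at h1 h2
  have hc₁ : 0 < g (q + s₀ • e) := by
    rcases (h1 0 ⟨le_rfl, hs0.le⟩).2 with ⟨-, h3⟩
    rw [hτ0] at h3
    rcases h3.lt_or_eq with h4 | h4
    · exact h4
    · have h5 := (h1 s₀ ⟨hs0.le, le_rfl⟩).1
      have h6 := (h1 0 ⟨le_rfl, hs0.le⟩).1
      rw [← h4] at h5
      rw [hτ0] at h6
      linarith
  refine ⟨g (q + s₀ • e), hc₁, θ, ?_, fun x hx => (h2 x hx).2.2.continuousWithinAt,
    fun x hx => ⟨(h2 x hx).1.2.trans_lt hs0η, (hin _ (h2 x hx).1).1, (h2 x hx).2.1⟩,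
    fun x hx => ?_, fun x hx => hasDerivAt_of_Icc (h2 x (Ioo_subset_Icc_self hx)).2.2 hx⟩
  · have := (h1 0 ⟨le_rfl, hs0.le⟩).1
    rwa [hτ0] at this
  · obtain ⟨h3, h4, -⟩ := h2 x ⟨hx.1.le, hx.2⟩
    rcases h3.1.lt_or_eq with h5 | h5
    · exact h5
    · rw [← h5, hτ0] at h4
      exact absurd h4 hx.1.ne

/-- A momentum whose component along `N` is `ς √(a + b σ)`. -/
theorem hasDerivAt_sqrt_kick (p N : Config d) {u₀ G a b ς σ : ℝ} (hς : ς = 1 ∨ ς = -1)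
    (hσ : 0 < a + b * σ) :
    HasDerivAt (fun σ => p + ((ς * √(a + b * σ) - u₀) / G) • N)
      ((b / (2 * G) * (ς * √(a + b * σ))⁻¹) • N) σ := by
  have h1 : HasDerivAt (fun σ => a + b * σ) b σ := by
    simpa using ((hasDerivAt_id σ).const_mul b).const_add a
  have h2 := ((((h1.sqrt hσ.ne').const_mul ς).sub_const u₀).div_const G).smul_const N
  refine (h2.const_add p).congr_deriv ?_
  congr 1
  rcases hς with rfl | rfl
  · simp only [one_mul, mul_inv, div_eq_mul_inv]
    ring
  · simp only [neg_mul, one_mul, mul_inv, inv_neg, div_eq_mul_inv]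
    ring

theorem inner_add_smul_self {p N : Config d} (hN : N ≠ 0) (y : ℝ) :
    inner ℝ (p + ((y - inner ℝ p N) / ‖N‖ ^ 2) • N) N = y := by
  have : ‖N‖ ^ 2 ≠ 0 := by positivity
  rw [inner_add_left, inner_smul_left, RCLike.conj_to_real, real_inner_self_eq_norm_sq]
  field_simp
  ring

namespace CollisionChart

variable {𝓔 : EReal} {D : Set (Config d)} {q₀ : Config d}

/-- The limit of the motion into the boundary layer: a free flight, then a kick. -/
theorem crossing_infty (C : CollisionChart r D 𝓔 U q₀) {c w₀ : ℝ} (hc : 0 < c) (hw₀ : 0 < w₀)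
    {q p : ℝ → Config d} {τ a : ℝ → ℝ} (ha : ∀ σ, a σ = if σ < c then -1 else 0)
    (hq : Continuous q) (hp : Continuous p) (hτ : Continuous τ)
    (h : ∀ σ ∈ Icc 0 (c + w₀), C.IsRegular (∞, q σ) ∧ C.g ∞ (q σ) = max (c - σ) 0 ∧
      inner ℝ (p σ) (gradient (C.g ∞) (q σ)) < 0 ∧
      (σ ∈ Ioo 0 (c + w₀) \ {c} →
        HasDerivAt q ((a σ * (inner ℝ (p σ) (gradient (C.g ∞) (q σ)))⁻¹) • p σ) σ ∧
        HasDerivAt p (-(((1 + a σ) * (inner ℝ (p σ) (gradient (C.g ∞) (q σ)))⁻¹) •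
          gradient (C.g ∞) (q σ))) σ ∧
        HasDerivAt τ (a σ * (inner ℝ (p σ) (gradient (C.g ∞) (q σ)))⁻¹) σ)) :
    τ 0 < τ (c + w₀) ∧ q (c + w₀) = q 0 + (τ (c + w₀) - τ 0) • p 0 ∧
      (∀ u ∈ Ico 0 (τ (c + w₀) - τ 0), q 0 + u • p 0 ∈ interior D) ∧
      C.IsRegular (∞, q (c + w₀)) ∧ C.g ∞ (q (c + w₀)) = 0 ∧
      inner ℝ (p 0) (gradient (C.g ∞) (q (c + w₀))) < 0 ∧
      (∃ α : ℝ, p (c + w₀) = p 0 + α • gradient (C.g ∞) (q (c + w₀))) ∧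
      ‖p (c + w₀)‖ ^ 2 / 2 + w₀ = ‖p 0‖ ^ 2 / 2 := by
  set S := c + w₀ with hS
  have hcS : c < S := by linarith
  -- For σ < c the speed is -1 and the coefficient 1 + a of the force is 0: free flight with g as
  -- clock.
  have hfl : ∀ σ ∈ Ioo 0 c, HasDerivAt q (-(inner ℝ (p σ) (gradient (C.g ∞) (q σ)))⁻¹ • p σ) σ ∧
      HasDerivAt p 0 σ ∧ HasDerivAt τ (-(inner ℝ (p σ) (gradient (C.g ∞) (q σ)))⁻¹) σ := by
    intro σ hσ
    have := (h σ ⟨hσ.1.le, (hσ.2.trans hcS).le⟩).2.2.2 ⟨⟨hσ.1, hσ.2.trans hcS⟩, hσ.2.ne⟩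
    simpa [ha, hσ.2] using this
  -- For σ > c the speed is 0 and the coefficient of the force is 1: position and time stand still.
  have hki : ∀ σ ∈ Ioo c S, HasDerivAt q 0 σ ∧
      HasDerivAt p (-((inner ℝ (p σ) (gradient (C.g ∞) (q σ)))⁻¹ • gradient (C.g ∞) (q σ))) σ ∧
      HasDerivAt τ 0 σ := by
    intro σ hσ
    have := (h σ ⟨(hc.trans hσ.1).le, hσ.2.le⟩).2.2.2 ⟨⟨hc.trans hσ.1, hσ.2⟩, hσ.1.ne'⟩
    simpa [ha, not_lt.2 hσ.1.le] using this
  have hfree := eq_of_free_motion hq.continuousOn hp.continuousOn hτ.continuousOn hfl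
  have hτc : τ 0 < τ c := lt_of_hasDerivAt_pos hc hτ.continuousOn (fun σ hσ => (hfl σ hσ).2.2)
    fun σ hσ => neg_pos.2 (inv_lt_zero.2 (h σ ⟨hσ.1.le, (hσ.2.trans hcS).le⟩).2.2.1)
  have hqk : ∀ σ ∈ Icc c S, q σ = q c :=
    eq_left_of_hasDerivAt_zero hq.continuousOn fun σ hσ => (hki σ hσ).1
  have hτk : ∀ σ ∈ Icc c S, τ σ = τ c :=
    eq_left_of_hasDerivAt_zero hτ.continuousOn fun σ hσ => (hki σ hσ).2.2
  have hSS : S ∈ Icc c S := ⟨hcS.le, le_rfl⟩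
  have hcc : c ∈ Icc 0 c := ⟨hc.le, le_rfl⟩
  have hcS' : c ∈ Icc 0 S := ⟨hc.le, hcS.le⟩
  rw [hqk S hSS, hτk S hSS]
  set N := gradient (C.g ∞) (q c) with hN
  have hpc := (hfree c hcc).1
  have hkick : ∀ σ ∈ Ioo c S, HasDerivAt p ((-(inner ℝ (p σ) N)⁻¹) • N) σ := fun σ hσ => by
    have := (hki σ hσ).2.1
    rwa [hqk σ (Ioo_subset_Icc_self hσ), ← hN, ← neg_smul] at this
  have hne : ∀ σ ∈ Ioo c S, inner ℝ (p σ) N ≠ 0 := fun σ hσ => by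
    have := (h σ ⟨(hc.trans hσ.1).le, hσ.2.le⟩).2.2.1
    rw [hqk σ (Ioo_subset_Icc_self hσ)] at this
    exact this.ne
  have hN0 : N ≠ 0 := (h c hcS').1.2.2.2.2
  refine ⟨hτc, (hfree c hcc).2, fun u hu => ?_, (h c hcS').1, ?_, ?_, ?_, ?_⟩
  · obtain ⟨σ, hσ, e⟩ := exists_time_of_continuousOn hc.le hτ.continuousOn
      (u := u) ⟨hu.1, hu.2.le⟩
    rw [← e, ← (hfree σ hσ).2]
    have hσc : σ < c := lt_of_le_of_ne hσ.2 fun hc' => by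
      rw [hc'] at e
      exact hu.2.ne e.symm
    have h1 := h σ ⟨hσ.1, (hσc.trans hcS).le⟩
    exact h1.1.mem_interior (by
      simp only
      rw [h1.2.1]
      exact lt_max_of_lt_left (sub_pos.2 hσc))
  · rw [(h c hcS').2.1, sub_self, max_self]
  · rw [← hpc]
    exact (h c hcS').2.2.1
  · rw [← hpc]
    exact exists_eq_add_smul hN0 hcS.le hp.continuousOn hkick
  · have h2 := energy_eq_of_hasDerivAt (v := fun σ => σ) hcS.le hp.continuousOn
      continuousOn_id fun σ hσ => ⟨hkick σ hσ, (hasDerivAt_id σ).congr_deriv (by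
        rw [neg_mul, neg_neg, inv_mul_cancel₀ (hne σ hσ)])⟩
    rw [hpc] at h2
    linarith

/-- The limit of the motion out of the boundary layer: a kick, then a free flight. -/
theorem crossing_infty_reverse (C : CollisionChart r D 𝓔 U q₀) {c w₀ : ℝ} (hc : 0 < c)
    (hw₀ : 0 < w₀) {q p : ℝ → Config d} {τ a : ℝ → ℝ}
    (ha : ∀ σ, a σ = if c + w₀ - σ < c then -1 else 0)
    (hq : Continuous q) (hp : Continuous p) (hτ : Continuous τ)
    (h : ∀ σ ∈ Icc 0 (c + w₀), C.IsRegular (∞, q σ) ∧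
      C.g ∞ (q σ) = max (c - (c + w₀ - σ)) 0 ∧
      0 < inner ℝ (p σ) (gradient (C.g ∞) (q σ)) ∧
      (σ ∈ Ioo 0 (c + w₀) \ {w₀} →
        HasDerivAt q ((-a σ * (inner ℝ (p σ) (gradient (C.g ∞) (q σ)))⁻¹) • p σ) σ ∧
        HasDerivAt p (-((-(1 + a σ) * (inner ℝ (p σ) (gradient (C.g ∞) (q σ)))⁻¹) •
          gradient (C.g ∞) (q σ))) σ ∧
        HasDerivAt τ (-a σ * (inner ℝ (p σ) (gradient (C.g ∞) (q σ)))⁻¹) σ)) :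
    τ 0 < τ (c + w₀) ∧ q (c + w₀) = q 0 + (τ (c + w₀) - τ 0) • p (c + w₀) ∧
      (∀ u ∈ Ioc 0 (τ (c + w₀) - τ 0), q 0 + u • p (c + w₀) ∈ interior D) ∧
      0 < inner ℝ (p (c + w₀)) (gradient (C.g ∞) (q 0)) ∧
      (∃ α : ℝ, p (c + w₀) = p 0 + α • gradient (C.g ∞) (q 0)) ∧
      ‖p (c + w₀)‖ ^ 2 / 2 = ‖p 0‖ ^ 2 / 2 + w₀ := by
  set S := c + w₀ with hS
  have hrev : Continuous fun σ => S - σ := by fun_prop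
  -- Time reversal: reversing the parameter and the signs of momentum and time turns the way out
  -- into a way in.
  have key := C.crossing_infty hc hw₀ (q := fun σ => q (S - σ)) (p := fun σ => -p (S - σ))
    (τ := fun σ => -τ (S - σ)) (a := fun σ => a (S - σ)) (fun σ => by rw [ha]; simp)
    (hq.comp hrev) (hp.comp hrev).neg (hτ.comp hrev).neg (fun σ hσ => by
      obtain ⟨h1, h2, h3, h4⟩ := h (S - σ) ⟨by linarith [hσ.2], by linarith [hσ.1]⟩
      refine ⟨h1, by rw [h2]; simp, by rw [inner_neg_left]; linarith, fun hσ' => ?_⟩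
      obtain ⟨h5, h6, h7⟩ := h4 ⟨⟨by linarith [hσ'.1.2], by linarith [hσ'.1.1]⟩, fun e => hσ'.2 (by
        simp only [mem_singleton_iff] at e ⊢
        linarith)⟩
      have hd : HasDerivAt (fun σ => S - σ) (-1) σ := by
        simpa using (hasDerivAt_id σ).const_sub S
      refine ⟨(h5.scomp σ hd).congr_deriv ?_, (h6.scomp σ hd).neg.congr_deriv ?_,
        (h7.scomp σ hd).neg.congr_deriv ?_⟩
      · rw [inner_neg_left, inv_neg, smul_neg, ← neg_smul, smul_smul]
        congr 1
        ring
      · rw [inner_neg_left, inv_neg, ← neg_smul, ← neg_smul, smul_smul, ← neg_smul]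
        congr 1
        ring
      · rw [inner_neg_left, inv_neg, smul_eq_mul]
        ring)
  simp only [sub_zero, ← hS, sub_self] at key
  obtain ⟨h1, h2, h3, -, -, h6, ⟨α, h7⟩, h8⟩ := key
  rw [norm_neg, norm_neg] at h8
  have e : -τ 0 - -τ S = τ S - τ 0 := by ring
  rw [e] at h2 h3
  refine ⟨by linarith, ?_, fun u hu => ?_, ?_, ⟨α, ?_⟩, h8.symm⟩
  · rw [h2]
    module
  · have := h3 (τ S - τ 0 - u) ⟨by linarith [hu.2], by linarith [hu.1]⟩
    rw [h2]
    convert this using 1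
    module
  · rw [inner_neg_left] at h6
    linarith
  · have : p S = p 0 + α • gradient (C.g ∞) (q 0) := by
      have h9 : p S = -(-p S) := (neg_neg _).symm
      have h10 : -p S = -p 0 - α • gradient (C.g ∞) (q 0) := by rw [h7]; abel
      rw [h9, h10]
      abel
    exact this

end CollisionChart

end CollisionLinks

/-! ### Passage of the edge of the boundary layer, in both directions -/

namespace CollisionChart

open OnePoint

variable {d r : ℕ} {U : ℕ → Config d → ℝ} {𝓔 : EReal} {D : Set (Config d)} {q₀ : Config d}

/-- The values of the defining function during the passage of the edge of the boundary layer, in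
a parameter which measures first the distance to the wall and then the height of the barrier. -/
structure LayerCurve (C : CollisionChart r D 𝓔 U q₀) (c w₀ : ℝ) where
  /-- the speeds -/
  A : DensityFamily (OnePoint ℕ) (c + w₀)
  /-- the values -/
  x : OnePoint ℕ → ℝ → ℝ
  /-- the heights at the end -/
  ω : OnePoint ℕ → ℝ
  continuousOn : ∀ κ, ContinuousOn (x κ) (Icc 0 (c + w₀))
  start : ∀ κ, x κ 0 = c
  hasDerivAt : ∀ κ, ∀ σ ∈ Ioo 0 (c + w₀) \ {c}, HasDerivAt (x κ) (A.a κ σ) σ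
  A_infty : ∀ σ, A.a ∞ σ = if σ < c then -1 else 0
  x_infty : ∀ σ, x ∞ σ = max (c - σ) 0
  barrier : ∀ᶠ n : ℕ in atTop, C.BarrierSmooth n ∧ ContinuousOn (A.a n) (Icc 0 (c + w₀)) ∧
    ∀ σ ∈ Icc 0 (c + w₀), A.a n σ < 0 ∧ x n σ ∈ Ioo (-C.ρ) C.ρ ∧
      1 + A.a n σ = deriv (C.w n) (x n σ) * A.a n σ
  continuous_ω : Continuous ω
  ω_infty : ω ∞ = w₀
  end_eq : ∀ᶠ κ in 𝓝 (∞ : OnePoint ℕ), C.χ κ (ω κ) = x κ (c + w₀)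

theorem exists_layerCurve (C : CollisionChart r D 𝓔 U q₀) {c w₀ : ℝ} (hc : 0 < c) (hcρ : c < C.ρ)
    (hw₀ : 0 < w₀) (hw₀' : (w₀ : EReal) < 𝓔) : Nonempty (C.LayerCurve c w₀) := by
  obtain ⟨A, x, h1, h2, h3, h4, h5, h6⟩ := C.barrier.exists_layer_curve hc hcρ hw₀ hw₀'
  set ω : OnePoint ℕ → ℝ := fun κ => κ.elim w₀ fun n => C.w n (x n (c + w₀)) with hω
  have hωc : Continuous ω := (OnePoint.continuous_iff_from_nat ω).2 h6
  have hωi : ω ∞ = w₀ := rfl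
  refine ⟨⟨A, x, ω, fun κ => (h1 κ).1, fun κ => (h1 κ).2.1, fun κ => (h1 κ).2.2, h2, h3, ?_, hωc,
    hωi, ?_⟩⟩
  · filter_upwards [h4, C.eventually_barrierSmooth] with n h h'
    exact ⟨h', h.1, fun σ hσ => (h.2 σ hσ).2⟩
  · refine OnePoint.eventually_nhds_infty.2 ⟨?_, ?_⟩
    · rw [C.χ_infty, h3]
      exact (max_eq_right (by linarith)).symm
    · have ht : Tendsto (fun n : ℕ => ((n : OnePoint ℕ), ω n)) atTop (𝓝 (∞, w₀)) :=
        ((OnePoint.continuous_iff_from_nat id).1 continuous_id).prodMk_nhds h6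
      filter_upwards [h4, C.eventually_barrierSmooth, ht.eventually (C.χ_inverse w₀ hw₀ hw₀')]
        with n h h' h''
      obtain ⟨h7, h8⟩ := h'' n rfl
      -- Both points have barrier height ω, and the barrier is injective. This matches the edge
      -- regime with the regime in which the height is the coordinate.
      exact (strictAntiOn_of_contDiffAt h').injOn h7 (h.2 (c + w₀) ⟨by linarith, le_rfl⟩).2.2.1 h8

variable {C : CollisionChart r D 𝓔 U q₀} {c w₀ : ℝ}

theorem LayerCurve.continuousAt_infty (Λ : C.LayerCurve c w₀) {σ : ℝ} (hσ : σ ≠ c) :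
    ContinuousAt (Λ.A.a ∞) σ := by
  rcases hσ.lt_or_gt with h | h
  · refine (continuousAt_const (y := (-1 : ℝ))).congr ?_
    filter_upwards [gt_mem_nhds h] with s hs
    rw [Λ.A_infty, if_pos hs]
  · refine (continuousAt_const (y := (0 : ℝ))).congr ?_
    filter_upwards [lt_mem_nhds h] with s hs
    rw [Λ.A_infty, if_neg (not_lt.2 hs.le)]

/-- From the section `g = c` into the boundary layer. -/
theorem LayerCurve.in_link (Λ : C.LayerCurve c w₀) (hr : 1 ≤ r) (hc : 0 < c) (hw₀ : 0 < w₀)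
    {p N : Config d} (hN : N = gradient (C.g ∞) q₀) {T₀ u₀ : ℝ} (hu₀ : u₀ = inner ℝ p N)
    {θ : ℝ → ℝ} (hθ0 : θ 0 = 0) (hθc : ContinuousOn θ (Icc 0 c))
    (hreg : ∀ x ∈ Icc 0 c, C.IsRegular (∞, q₀ + θ x • -p) ∧
      inner ℝ p (gradient (C.g ∞) (q₀ + θ x • -p)) < 0)
    (hθ : ∀ x ∈ Ioo 0 c, HasDerivAt θ (inner ℝ (-p) (gradient (C.g ∞) (q₀ + θ x • -p)))⁻¹ x)
    (hw : 0 < u₀ ^ 2 - 2 * ‖N‖ ^ 2 * w₀) :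
    FamilyLink r (fun κ (a b : PhaseSpace d × ℝ) => C.g κ a.1.1 = c →
      C.g κ b.1.1 = Λ.x κ (c + w₀) ∧
      (∀ n : ℕ, κ = (n : OnePoint ℕ) → HamiltonianArc (U n) a.1 (b.2 - a.2) b.1) ∧
      (κ = ∞ → a.2 < b.2 ∧ b.1.1 = a.1.1 + (b.2 - a.2) • a.1.2 ∧
        (∀ u ∈ Ico 0 (b.2 - a.2), a.1.1 + u • a.1.2 ∈ interior D) ∧
        C.IsRegular (∞, b.1.1) ∧ C.g ∞ b.1.1 = 0 ∧ inner ℝ a.1.2 (gradient (C.g ∞) b.1.1) < 0 ∧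
        (∃ α : ℝ, b.1.2 = a.1.2 + α • gradient (C.g ∞) b.1.1) ∧
        ‖b.1.2‖ ^ 2 / 2 + w₀ = ‖a.1.2‖ ^ 2 / 2))
      ((q₀ + θ c • -p, p), T₀ - θ c)
      ((q₀, p + ((-1 * √(u₀ ^ 2 - 2 * ‖N‖ ^ 2 * w₀) - u₀) / ‖N‖ ^ 2) • N), T₀) := by
  have h00 : (0 : ℝ) ∈ Icc 0 c := ⟨le_rfl, hc.le⟩
  have hreg0 := hreg 0 h00
  rw [hθ0, zero_smul, add_zero, ← hN, ← hu₀] at hreg0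
  have hN0 : N ≠ 0 := by rw [hN]; exact C.gradient_ne_zero
  have hG : 0 < ‖N‖ ^ 2 := by have := norm_pos_iff.2 hN0; positivity
  set S := c + w₀ with hS
  -- The limit motion in one formula. For σ ≤ c it is the incoming line, with `θ x` the time left
  -- before the collision when g = x. For σ ≥ c it rests at the collision point, and the modulus y
  -- of ⟨P, N⟩ follows from conservation of energy at the height σ - c.
  set q : ℝ → Config d := fun σ => q₀ + θ (max (c - σ) 0) • -p with hq
  set y : ℝ → ℝ := fun σ => √(u₀ ^ 2 - 2 * ‖N‖ ^ 2 * max (σ - c) 0) with hy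
  set P : ℝ → Config d := fun σ => p + ((-1 * y σ - u₀) / ‖N‖ ^ 2) • N with hP
  set τ : ℝ → ℝ := fun σ => T₀ - θ (max (c - σ) 0) with hτ
  have hmax : ∀ σ ∈ Icc 0 S, max (c - σ) 0 ∈ Icc 0 c := fun σ hσ =>
    ⟨le_max_right _ _, max_le (by linarith [hσ.1]) hc.le⟩
  have hθmax : ContinuousOn (fun σ => θ (max (c - σ) 0)) (Icc 0 S) :=
    hθc.comp (by fun_prop) hmax
  have hyfar : ∀ σ ≤ c, y σ = -u₀ := fun σ hσ => by
    simp only [hy]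
    rw [max_eq_right (by linarith), mul_zero, sub_zero, Real.sqrt_sq_eq_abs, abs_of_neg hreg0.2]
  have hPfar : ∀ σ ≤ c, P σ = p := fun σ hσ => by
    simp only [hP]
    rw [hyfar σ hσ]
    simp
  have hqnear : ∀ σ, c ≤ σ → q σ = q₀ := fun σ hσ => by
    simp only [hq]
    rw [max_eq_right (by linarith), hθ0, zero_smul, add_zero]
  have hypos : ∀ σ ∈ Icc 0 S, 0 < y σ := fun σ hσ => by
    refine Real.sqrt_pos.2 (hw.trans_le ?_)
    have : max (σ - c) 0 ≤ w₀ := max_le (by linarith [hσ.2]) hw₀.le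
    gcongr
  have hPN : ∀ σ, inner ℝ (P σ) N = -y σ := fun σ => by
    simp only [hP]
    rw [hu₀, inner_add_smul_self hN0, neg_one_mul]
  have hu : ∀ σ ∈ Icc 0 S, inner ℝ (P σ) (gradient (C.g ∞) (q σ)) < 0 := fun σ hσ => by
    rcases le_total σ c with h | h
    · rw [hPfar σ h]
      exact (hreg _ (hmax σ hσ)).2
    · rw [hqnear σ h, ← hN, hPN]
      exact neg_lt_zero.2 (hypos σ hσ)
  have hd : ∀ σ ∈ Ioo 0 S \ {c},
      HasDerivAt q ((Λ.A.a ∞ σ * (inner ℝ (P σ) (gradient (C.g ∞) (q σ)))⁻¹) • P σ) σ ∧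
      HasDerivAt P (-(((Λ.A.affine 1 1).a ∞ σ *
        (inner ℝ (P σ) (gradient (C.g ∞) (q σ)))⁻¹) • gradient (C.g ∞) (q σ))) σ ∧
      HasDerivAt τ (Λ.A.a ∞ σ * (inner ℝ (P σ) (gradient (C.g ∞) (q σ)))⁻¹) σ := by
    intro σ hσ
    have hA' : (Λ.A.affine 1 1).a ∞ σ = 1 + 1 * Λ.A.a ∞ σ := rfl
    rcases lt_or_gt_of_ne (show σ ≠ c from hσ.2) with h | h
    · have hm : max (c - σ) 0 = c - σ := max_eq_left (by linarith)
      have hθσ : HasDerivAt (fun σ => θ (max (c - σ) 0))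
          (inner ℝ p (gradient (C.g ∞) (q σ)))⁻¹ σ := by
        have h1 := hθ (c - σ) ⟨by linarith, by linarith [hσ.1.1]⟩
        have h2 : HasDerivAt (fun σ => c - σ) (-1) σ := by
          simpa using (hasDerivAt_id σ).const_sub c
        refine ((h1.scomp σ h2).congr_deriv ?_).congr_of_eventuallyEq ?_
        · simp only [hq]
          rw [hm, inner_neg_left, inv_neg, smul_eq_mul]
          ring
        · filter_upwards [gt_mem_nhds h] with s hs
          have hm : max (c - s) 0 = c - s := max_eq_left (by linarith)
          simp [hm]
      rw [hA', Λ.A_infty, if_pos h, hPfar σ h.le]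
      refine ⟨((hθσ.smul_const (-p)).const_add q₀).congr_deriv ?_, ?_,
        (hθσ.const_sub T₀).congr_deriv ?_⟩
      · rw [smul_neg, neg_one_mul, neg_smul]
      · have : P =ᶠ[𝓝 σ] fun _ => p := by
          filter_upwards [gt_mem_nhds h] with s hs using hPfar s hs.le
        refine ((hasDerivAt_const σ p).congr_of_eventuallyEq this).congr_deriv ?_
        simp
      · ring
    · rw [hA', Λ.A_infty, if_neg (not_lt.2 h.le), hqnear σ h.le, ← hN, hPN]
      refine ⟨?_, ?_, ?_⟩
      · have : q =ᶠ[𝓝 σ] fun _ => q₀ := by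
          filter_upwards [lt_mem_nhds h] with s hs using hqnear s hs.le
        refine ((hasDerivAt_const σ q₀).congr_of_eventuallyEq this).congr_deriv ?_
        simp
      · have hrad : ∀ s, c < s → u₀ ^ 2 - 2 * ‖N‖ ^ 2 * max (s - c) 0 =
            (u₀ ^ 2 + 2 * ‖N‖ ^ 2 * c) + (-2 * ‖N‖ ^ 2) * s := fun s hs => by
          rw [max_eq_left (by linarith)]
          ring
        have hyσ := hypos σ (Ioo_subset_Icc_self hσ.1)
        have h1 := hasDerivAt_sqrt_kick p N (u₀ := u₀) (G := ‖N‖ ^ 2)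
          (a := u₀ ^ 2 + 2 * ‖N‖ ^ 2 * c) (b := -2 * ‖N‖ ^ 2) (ς := -1) (σ := σ) (Or.inr rfl) (by
            rw [← hrad σ h]
            exact Real.sqrt_pos.1 hyσ)
        refine (h1.congr_of_eventuallyEq ?_).congr_deriv ?_
        · filter_upwards [lt_mem_nhds h] with s hs
          simp only [hP, hy]
          rw [hrad s hs]
        · rw [← hrad σ h, ← neg_smul]
          congr 1
          simp only [hy]
          field_simp
          ring
      · have : τ =ᶠ[𝓝 σ] fun _ => T₀ := by
          filter_upwards [lt_mem_nhds h] with s hs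
          simp only [hτ]
          rw [max_eq_right (by linarith), hθ0, sub_zero]
        refine ((hasDerivAt_const σ T₀).congr_of_eventuallyEq this).congr_deriv ?_
        simp
  have hlink := C.crossing_link hr (by linarith : 0 ≤ S) Λ.A (Λ.A.affine 1 1) Λ.x (σ₁ := c)
    (sg := -1) (fun κ => ⟨Λ.continuousOn κ, Λ.hasDerivAt κ⟩)
    (fun σ hσ => ⟨Λ.continuousAt_infty hσ,
      continuousAt_const.add (continuousAt_const.mul (Λ.continuousAt_infty hσ))⟩)
    (by
      filter_upwards [Λ.barrier] with n ⟨h1, h2, h3⟩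
      refine ⟨h1, h2, continuousOn_const.add (continuousOn_const.mul h2), fun σ hσ => ?_⟩
      obtain ⟨h4, h5, h6⟩ := h3 σ hσ
      refine ⟨by linarith, h5, ?_⟩
      rw [← h6]
      change 1 + 1 * Λ.A.a n σ = _
      rw [one_mul])
    (q := q) (p := P) (τ := τ)
    (continuousOn_const.add (hθmax.smul continuousOn_const))
    (by fun_prop) (continuousOn_const.sub hθmax)
    (fun σ hσ => (hreg _ (hmax σ hσ)).1) (fun σ hσ => by linarith [hu σ hσ]) hd
  have e1 : ((q 0, P 0), τ 0) = ((q₀ + θ c • -p, p), T₀ - θ c) := by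
    simp only [hq, hτ]
    rw [hPfar 0 hc.le, sub_zero, max_eq_left hc.le]
  have e2 : ((q S, P S), τ S) =
      ((q₀, p + ((-1 * √(u₀ ^ 2 - 2 * ‖N‖ ^ 2 * w₀) - u₀) / ‖N‖ ^ 2) • N), T₀) := by
    have : S - c = w₀ := by rw [hS]; ring
    simp only [hτ, hP, hy]
    rw [hqnear S (by linarith), max_eq_right (by linarith : c - S ≤ 0), hθ0, sub_zero, this,
      max_eq_left hw₀.le]
  rw [e1, e2] at hlink
  refine hlink.mono fun κ a b h ha => ?_
  obtain ⟨h1, h2, h3⟩ := h (by rw [ha, Λ.start])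
  refine ⟨h1, h2, fun hκ => ?_⟩
  obtain ⟨q, p, τ, hq, hp, hτ, rfl, rfl, h4⟩ := h3 hκ
  exact C.crossing_infty hc hw₀ Λ.A_infty hq hp hτ fun σ hσ => by
    obtain ⟨h5, h6, h7, h8⟩ := h4 σ hσ
    refine ⟨h5, by rw [h6, Λ.x_infty], by linarith, fun hσ' => ?_⟩
    have h9 := h8 hσ'
    change _ ∧ HasDerivAt p (-(((1 + 1 * Λ.A.a ∞ σ) * _) • _)) σ ∧ _ at h9
    rwa [one_mul] at h9

/-- Out of the boundary layer to the section `g = c`. -/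
theorem LayerCurve.out_link (Λ : C.LayerCurve c w₀) (hr : 1 ≤ r) (hc : 0 < c) (hw₀ : 0 < w₀)
    {p p' N : Config d} (hN : N = gradient (C.g ∞) q₀) {T₀ u₀ : ℝ} (hu₀ : u₀ = inner ℝ p N)
    (hneg : u₀ < 0) (hp' : p' = p + ((-u₀ - u₀) / ‖N‖ ^ 2) • N)
    {θ : ℝ → ℝ} (hθ0 : θ 0 = 0) (hθc : ContinuousOn θ (Icc 0 c))
    (hreg : ∀ x ∈ Icc 0 c, C.IsRegular (∞, q₀ + θ x • p') ∧
      0 < inner ℝ p' (gradient (C.g ∞) (q₀ + θ x • p')))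
    (hθ : ∀ x ∈ Ioo 0 c, HasDerivAt θ (inner ℝ p' (gradient (C.g ∞) (q₀ + θ x • p')))⁻¹ x)
    (hw : 0 < u₀ ^ 2 - 2 * ‖N‖ ^ 2 * w₀) :
    FamilyLink r (fun κ (a b : PhaseSpace d × ℝ) => C.g κ a.1.1 = Λ.x κ (c + w₀) →
      (∀ n : ℕ, κ = (n : OnePoint ℕ) → HamiltonianArc (U n) a.1 (b.2 - a.2) b.1) ∧
      (κ = ∞ → a.2 < b.2 ∧ b.1.1 = a.1.1 + (b.2 - a.2) • b.1.2 ∧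
        (∀ u ∈ Ioc 0 (b.2 - a.2), a.1.1 + u • b.1.2 ∈ interior D) ∧
        0 < inner ℝ b.1.2 (gradient (C.g ∞) a.1.1) ∧
        (∃ α : ℝ, b.1.2 = a.1.2 + α • gradient (C.g ∞) a.1.1) ∧
        ‖b.1.2‖ ^ 2 / 2 = ‖a.1.2‖ ^ 2 / 2 + w₀))
      ((q₀, p + ((1 * √(u₀ ^ 2 - 2 * ‖N‖ ^ 2 * w₀) - u₀) / ‖N‖ ^ 2) • N), T₀)
      ((q₀ + θ c • p', p'), T₀ + θ c) := by
  have h00 : (0 : ℝ) ∈ Icc 0 c := ⟨le_rfl, hc.le⟩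
  have hN0 : N ≠ 0 := by rw [hN]; exact C.gradient_ne_zero
  have hG : 0 < ‖N‖ ^ 2 := by have := norm_pos_iff.2 hN0; positivity
  set S := c + w₀ with hS
  set q : ℝ → Config d := fun σ => q₀ + θ (max (σ - w₀) 0) • p' with hq
  set y : ℝ → ℝ := fun σ => √(u₀ ^ 2 - 2 * ‖N‖ ^ 2 * max (w₀ - σ) 0) with hy
  set P : ℝ → Config d := fun σ => p + ((1 * y σ - u₀) / ‖N‖ ^ 2) • N with hP
  set τ : ℝ → ℝ := fun σ => T₀ + θ (max (σ - w₀) 0) with hτ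
  have hmax : ∀ σ ∈ Icc 0 S, max (σ - w₀) 0 ∈ Icc 0 c := fun σ hσ =>
    ⟨le_max_right _ _, max_le (by linarith [hσ.2]) hc.le⟩
  have hθmax : ContinuousOn (fun σ => θ (max (σ - w₀) 0)) (Icc 0 S) :=
    hθc.comp (by fun_prop) hmax
  have hyfar : ∀ σ, w₀ ≤ σ → y σ = -u₀ := fun σ hσ => by
    simp only [hy]
    rw [max_eq_right (by linarith), mul_zero, sub_zero, Real.sqrt_sq_eq_abs, abs_of_neg hneg]
  have hPfar : ∀ σ, w₀ ≤ σ → P σ = p' := fun σ hσ => by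
    simp only [hP]
    rw [hyfar σ hσ, one_mul, hp']
  have hqnear : ∀ σ ≤ w₀, q σ = q₀ := fun σ hσ => by
    simp only [hq]
    rw [max_eq_right (by linarith), hθ0, zero_smul, add_zero]
  have hypos : ∀ σ ∈ Icc 0 S, 0 < y σ := fun σ hσ => by
    refine Real.sqrt_pos.2 (hw.trans_le ?_)
    have : max (w₀ - σ) 0 ≤ w₀ := max_le (by linarith [hσ.1]) hw₀.le
    gcongr
  have hPN : ∀ σ, inner ℝ (P σ) N = y σ := fun σ => by
    simp only [hP]
    rw [hu₀, inner_add_smul_self hN0, one_mul]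
  have hu : ∀ σ ∈ Icc 0 S, 0 < inner ℝ (P σ) (gradient (C.g ∞) (q σ)) := fun σ hσ => by
    rcases le_total σ w₀ with h | h
    · rw [hqnear σ h, ← hN, hPN]
      exact hypos σ hσ
    · rw [hPfar σ h]
      exact (hreg _ (hmax σ hσ)).2
  -- The layer curve is run backwards, so both densities change sign and the jump moves from c to S
  -- - c = w₀.
  have hA : ∀ κ σ, (Λ.A.reverse.affine 0 (-1)).a κ σ = -Λ.A.a κ (S - σ) := fun κ σ => by
    change 0 + -1 * Λ.A.a κ (S - σ) = _
    ring
  have hA' : ∀ κ σ, (Λ.A.reverse.affine (-1) (-1)).a κ σ = -(1 + Λ.A.a κ (S - σ)) := fun κ σ => by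
    change -1 + -1 * Λ.A.a κ (S - σ) = _
    ring
  have hlt : ∀ σ, S - σ < c ↔ w₀ < σ := fun σ => by
    rw [hS]
    constructor <;> intro <;> linarith
  have hd : ∀ σ ∈ Ioo 0 S \ {w₀},
      HasDerivAt q (((Λ.A.reverse.affine 0 (-1)).a ∞ σ *
        (inner ℝ (P σ) (gradient (C.g ∞) (q σ)))⁻¹) • P σ) σ ∧
      HasDerivAt P (-(((Λ.A.reverse.affine (-1) (-1)).a ∞ σ *
        (inner ℝ (P σ) (gradient (C.g ∞) (q σ)))⁻¹) • gradient (C.g ∞) (q σ))) σ ∧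
      HasDerivAt τ ((Λ.A.reverse.affine 0 (-1)).a ∞ σ *
        (inner ℝ (P σ) (gradient (C.g ∞) (q σ)))⁻¹) σ := by
    intro σ hσ
    rw [hA, hA', Λ.A_infty]
    rcases lt_or_gt_of_ne (show σ ≠ w₀ from hσ.2) with h | h
    · rw [if_neg (by rw [hlt]; exact not_lt.2 h.le), hqnear σ h.le, ← hN, hPN]
      refine ⟨?_, ?_, ?_⟩
      · have : q =ᶠ[𝓝 σ] fun _ => q₀ := by
          filter_upwards [gt_mem_nhds h] with s hs using hqnear s hs.le
        refine ((hasDerivAt_const σ q₀).congr_of_eventuallyEq this).congr_deriv ?_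
        simp
      · have hrad : ∀ s, s < w₀ → u₀ ^ 2 - 2 * ‖N‖ ^ 2 * max (w₀ - s) 0 =
            (u₀ ^ 2 - 2 * ‖N‖ ^ 2 * w₀) + (2 * ‖N‖ ^ 2) * s := fun s hs => by
          rw [max_eq_left (by linarith)]
          ring
        have hyσ := hypos σ (Ioo_subset_Icc_self hσ.1)
        have h1 := hasDerivAt_sqrt_kick p N (u₀ := u₀) (G := ‖N‖ ^ 2)
          (a := u₀ ^ 2 - 2 * ‖N‖ ^ 2 * w₀) (b := 2 * ‖N‖ ^ 2) (ς := 1) (σ := σ) (Or.inl rfl) (by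
            rw [← hrad σ h]
            exact Real.sqrt_pos.1 hyσ)
        refine (h1.congr_of_eventuallyEq ?_).congr_deriv ?_
        · filter_upwards [gt_mem_nhds h] with s hs
          simp only [hP, hy]
          rw [hrad s hs]
        · rw [← hrad σ h, ← neg_smul]
          congr 1
          simp only [hy]
          field_simp
          ring
      · have : τ =ᶠ[𝓝 σ] fun _ => T₀ := by
          filter_upwards [gt_mem_nhds h] with s hs
          simp only [hτ]
          rw [max_eq_right (by linarith), hθ0, add_zero]
        refine ((hasDerivAt_const σ T₀).congr_of_eventuallyEq this).congr_deriv ?_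
        simp
    · have hm : max (σ - w₀) 0 = σ - w₀ := max_eq_left (by linarith)
      have hθσ : HasDerivAt (fun σ => θ (max (σ - w₀) 0))
          (inner ℝ p' (gradient (C.g ∞) (q σ)))⁻¹ σ := by
        have h1 := hθ (σ - w₀) ⟨by linarith, by linarith [hσ.1.2]⟩
        have h2 : HasDerivAt (fun σ => σ - w₀) 1 σ := by
          simpa using (hasDerivAt_id σ).sub_const w₀
        refine ((h1.scomp σ h2).congr_deriv ?_).congr_of_eventuallyEq ?_
        · simp only [hq]
          rw [hm, one_smul]
        · filter_upwards [lt_mem_nhds h] with s hs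
          have hm : max (s - w₀) 0 = s - w₀ := max_eq_left (by linarith)
          simp [hm]
      rw [if_pos ((hlt σ).2 h), hPfar σ h.le]
      refine ⟨((hθσ.smul_const p').const_add q₀).congr_deriv ?_, ?_,
        (hθσ.const_add T₀).congr_deriv ?_⟩
      · rw [neg_neg, one_mul]
      · have : P =ᶠ[𝓝 σ] fun _ => p' := by
          filter_upwards [lt_mem_nhds h] with s hs using hPfar s hs.le
        refine ((hasDerivAt_const σ p').congr_of_eventuallyEq this).congr_deriv ?_
        simp
      · ring
  have hrev : MapsTo (fun σ => S - σ) (Icc 0 S) (Icc 0 S) := fun σ hσ =>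
    ⟨by linarith [hσ.2], by linarith [hσ.1]⟩
  have hrevc : Continuous fun σ : ℝ => S - σ := by fun_prop
  have hlink := C.crossing_link hr (by linarith : 0 ≤ S) (Λ.A.reverse.affine 0 (-1))
    (Λ.A.reverse.affine (-1) (-1)) (fun κ σ => Λ.x κ (S - σ)) (σ₁ := w₀) (sg := 1)
    (fun κ => ⟨(Λ.continuousOn κ).comp hrevc.continuousOn hrev, fun σ hσ => by
      have h2 : HasDerivAt (fun σ => S - σ) (-1) σ := by
        simpa using (hasDerivAt_id σ).const_sub S
      refine ((Λ.hasDerivAt κ (S - σ) ⟨⟨by linarith [hσ.1.2], by linarith [hσ.1.1]⟩, fun e =>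
        hσ.2 (by simp only [mem_singleton_iff] at e ⊢; linarith)⟩).scomp σ h2).congr_deriv ?_
      rw [hA, smul_eq_mul, neg_one_mul]⟩)
    (fun σ hσ => by
      have h1 : ContinuousAt (fun σ => Λ.A.a ∞ (S - σ)) σ :=
        ContinuousAt.comp (f := fun σ => S - σ) (Λ.continuousAt_infty fun e => hσ (by linarith))
          hrevc.continuousAt
      exact ⟨continuousAt_const.add (continuousAt_const.mul h1),
        continuousAt_const.add (continuousAt_const.mul h1)⟩)
    (by
      filter_upwards [Λ.barrier] with n ⟨h1, h2, h3⟩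
      have h2' := h2.comp hrevc.continuousOn hrev
      refine ⟨h1, continuousOn_const.add (continuousOn_const.mul h2'),
        continuousOn_const.add (continuousOn_const.mul h2'), fun σ hσ => ?_⟩
      obtain ⟨h4, h5, h6⟩ := h3 (S - σ) (hrev hσ)
      rw [hA, hA']
      exact ⟨by linarith, h5, by rw [h6]; ring⟩)
    (q := q) (p := P) (τ := τ)
    (continuousOn_const.add (hθmax.smul continuousOn_const))
    (by fun_prop) (continuousOn_const.add hθmax)
    (fun σ hσ => (hreg _ (hmax σ hσ)).1) (fun σ hσ => by linarith [hu σ hσ]) hd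
  have e1 : ((q 0, P 0), τ 0) =
      ((q₀, p + ((1 * √(u₀ ^ 2 - 2 * ‖N‖ ^ 2 * w₀) - u₀) / ‖N‖ ^ 2) • N), T₀) := by
    simp only [hτ, hP, hy]
    rw [hqnear 0 hw₀.le, sub_zero, max_eq_left hw₀.le, max_eq_right (by linarith : 0 - w₀ ≤ 0),
      hθ0, add_zero]
  have e2 : ((q S, P S), τ S) = ((q₀ + θ c • p', p'), T₀ + θ c) := by
    have : S - w₀ = c := by rw [hS]; ring
    simp only [hτ, hq]
    rw [hPfar S (by linarith), this, max_eq_left hc.le]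
  rw [e1, e2] at hlink
  refine hlink.mono fun κ a b h ha => ?_
  obtain ⟨-, h2, h3⟩ := h (by rw [ha, sub_zero])
  refine ⟨h2, fun hκ => ?_⟩
  obtain ⟨q, p, τ, hq, hp, hτ, rfl, rfl, h4⟩ := h3 hκ
  exact C.crossing_infty_reverse hc hw₀ (a := fun σ => Λ.A.a ∞ (S - σ)) (fun σ => Λ.A_infty _)
    hq hp hτ fun σ hσ => by
      obtain ⟨h5, h6, h7, h8⟩ := h4 σ hσ
      refine ⟨h5, by rw [h6, Λ.x_infty], by linarith, fun hσ' => ?_⟩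
      have h9 := h8 hσ'
      rwa [hA, hA'] at h9

end CollisionChart

/-! ### Composition of the pieces of a collision -/

namespace CollisionChart

open OnePoint

variable {d r n : ℕ} {L : AddSubgroup (Config d)} {B : BilliardTable d r n L}
  {U : ℕ → Config d → ℝ} {𝓔 : EReal} {q₀ : Config d}

/-- All four changes of momentum take place at one boundary point and along the same normal, and the
heights w₀ and v cancel from the energy balance. The total change preserves the norm and reverses
the normal direction, so it is the elastic reflection. -/
theorem arc_of_links (C : CollisionChart r B.D 𝓔 U q₀) {w₀ : ℝ}
    {a₀ a₁ a₂ a₃ a₄ a₅ : PhaseSpace d × ℝ} {v : ℝ}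
    (h₁ : a₁.1.2 = a₀.1.2 ∧ a₁.1.1 = a₀.1.1 + (a₁.2 - a₀.2) • a₀.1.2 ∧ a₀.2 < a₁.2 ∧
        ∀ u ∈ Icc 0 (a₁.2 - a₀.2), a₀.1.1 + u • a₀.1.2 ∈ interior B.D)
    (h₂ : a₁.2 < a₂.2 ∧ a₂.1.1 = a₁.1.1 + (a₂.2 - a₁.2) • a₁.1.2 ∧
        (∀ u ∈ Ico 0 (a₂.2 - a₁.2), a₁.1.1 + u • a₁.1.2 ∈ interior B.D) ∧
        C.IsRegular (∞, a₂.1.1) ∧ C.g ∞ a₂.1.1 = 0 ∧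
        inner ℝ a₁.1.2 (gradient (C.g ∞) a₂.1.1) < 0 ∧
        (∃ α : ℝ, a₂.1.2 = a₁.1.2 + α • gradient (C.g ∞) a₂.1.1) ∧
        ‖a₂.1.2‖ ^ 2 / 2 + w₀ = ‖a₁.1.2‖ ^ 2 / 2)
    (hcor : a₂.1.1 ∉ B.corners)
    (h₃ : a₃.1.1 = a₂.1.1 ∧ a₃.2 = a₂.2 ∧
        (∃ α : ℝ, a₃.1.2 = a₂.1.2 + α • gradient (C.g ∞) a₂.1.1) ∧
        ‖a₃.1.2‖ ^ 2 / 2 + v = ‖a₂.1.2‖ ^ 2 / 2 + w₀)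
    (h₄ : a₄.1.1 = a₃.1.1 ∧ a₄.2 = a₃.2 ∧
        (∃ α : ℝ, a₄.1.2 = a₃.1.2 + α • gradient (C.g ∞) a₃.1.1) ∧
        ‖a₄.1.2‖ ^ 2 / 2 + w₀ = ‖a₃.1.2‖ ^ 2 / 2 + v)
    (h₅ : a₄.2 < a₅.2 ∧ a₅.1.1 = a₄.1.1 + (a₅.2 - a₄.2) • a₅.1.2 ∧
        (∀ u ∈ Ioc 0 (a₅.2 - a₄.2), a₄.1.1 + u • a₅.1.2 ∈ interior B.D) ∧
        0 < inner ℝ a₅.1.2 (gradient (C.g ∞) a₄.1.1) ∧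
        (∃ α : ℝ, a₅.1.2 = a₄.1.2 + α • gradient (C.g ∞) a₄.1.1) ∧
        ‖a₅.1.2‖ ^ 2 / 2 = ‖a₄.1.2‖ ^ 2 / 2 + w₀) :
    BilliardArc B a₀.1 (a₅.2 - a₀.2) a₅.1 := by
  obtain ⟨e11, e12, e13, e14⟩ := h₁
  obtain ⟨e21, e22, e23, e24, e25, e26, ⟨α, e27⟩, e28⟩ := h₂
  obtain ⟨e31, e32, ⟨β, e33⟩, e34⟩ := h₃
  obtain ⟨e41, e42, ⟨γ, e43⟩, e44⟩ := h₄
  obtain ⟨e51, e52, e53, e54, ⟨δ, e55⟩, e56⟩ := h₅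
  rw [e41, e31] at e52 e53 e54 e55
  rw [e31] at e43
  rw [e42, e32] at e51 e52 e53
  set N := gradient (C.g ∞) a₂.1.1
  have hfree : BilliardArc B a₀.1 (a₁.2 - a₀.2) a₁.1 := by
    have e : a₁.1 = (a₀.1.1 + (a₁.2 - a₀.2) • a₀.1.2, a₀.1.2) := Prod.ext e12 e11
    rw [e]
    exact BilliardArc.of_free (sub_pos.2 e13).le e14
  have hrefl := eq_reflection (p' := a₅.1.2) (p := a₁.1.2) (N := N) (α := α + β + γ + δ)
    (by rw [e55, e43, e33, e27]; module) (by linarith) e26 e54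
  have hnorm := e24.isInwardUnitNormal e25
  simp only at hnorm
  have hN0 : 0 < ‖N‖ := norm_pos_iff.2 e24.2.2.2.2
  have hcol := BilliardArc.of_collision (B := B) (q := a₁.1.1) (p := a₁.1.2) (p' := a₅.1.2)
    (v := ‖N‖⁻¹ • N) (t := a₂.2 - a₁.2) (t' := a₅.2 - a₂.2) (sub_pos.2 e21) (sub_pos.2 e51) e23
    (by rw [← e22]; exact e24.mem_frontier e25) (by rwa [← e22]) (by rw [← e22]; exact hnorm)
    (by rw [inner_smul_right]; exact mul_ne_zero (inv_ne_zero hN0.ne') e26.ne) hrefl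
    (by rw [← e22]; exact e53)
  rw [← e22, ← e52] at hcol
  have e : a₅.2 - a₀.2 = a₁.2 - a₀.2 + (a₂.2 - a₁.2 + (a₅.2 - a₂.2)) := by ring
  rw [e]
  exact hfree.trans hcol

set_option maxHeartbeats 1600000 in
/-- The passage through a collision. -/
theorem collision_link (C : CollisionChart r B.D 𝓔 U q₀) (hr : 1 ≤ r)
    (hU : ∀ x ∈ interior B.D, ContDiffFamAt (r + 1) (potentialFamily U) (∞, x))
    (hcor : q₀ ∉ B.corners) {p p' N : Config d} (hE : ((‖p‖ ^ 2 / 2 : ℝ) : EReal) < 𝓔)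
    (hN : N = gradient (C.g ∞) q₀) (hneg : inner ℝ p N < 0)
    (hp' : p' = p + ((-inner ℝ p N - inner ℝ p N) / ‖N‖ ^ 2) • N) (T₀ : ℝ) {η : ℝ} (hη : 0 < η) :
    ∃ x ∈ Ioo 0 η, ∃ x' ∈ Ioo 0 η, FamilyLink r (TimedArc B U) ((q₀ + x • -p, p), T₀ - x)
      ((q₀ + x' • p', p'), T₀ + x') := by
  have hN0 : N ≠ 0 := by rw [hN]; exact C.gradient_ne_zero
  have hG : 0 < ‖N‖ ^ 2 := by have := norm_pos_iff.2 hN0; positivity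
  set u₀ := inner ℝ p N with hu₀
  set G := ‖N‖ ^ 2 with hGdef
  have hp'N : inner ℝ p' N = -u₀ := by rw [hp', hu₀, inner_add_smul_self hN0]
  have hu2 : 0 < u₀ ^ 2 := by have := hneg.ne; positivity
  -- the regular neighbourhood
  set O : Set (Config d) := {x | C.IsRegular (∞, x) ∧ inner ℝ p (gradient (C.g ∞) x) < 0 ∧
    0 < inner ℝ p' (gradient (C.g ∞) x)} with hO
  have hOn : O ∈ 𝓝 q₀ := by
    have ht : Tendsto (fun x : Config d => ((∞ : OnePoint ℕ), x)) (𝓝 q₀) (𝓝 (∞, q₀)) :=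
      (Continuous.prodMk_right (∞ : OnePoint ℕ)).tendsto q₀
    have hgc : Tendsto (fun x => gradient (C.g ∞) x) (𝓝 q₀) (𝓝 N) := by
      rw [hN]
      exact C.g_family.gradient_family.continuousAt.tendsto.comp ht
    filter_upwards [ht.eventually C.isRegular.eventually,
      ((tendsto_const_nhds (x := p)).inner hgc).eventually (gt_mem_nhds hneg),
      ((tendsto_const_nhds (x := p')).inner hgc).eventually
        (lt_mem_nhds (show 0 < inner ℝ p' N by rw [hp'N]; linarith))] with x h1 h2 h3
      using ⟨h1, h2, h3⟩
  have hg1 : ContDiffAt ℝ 1 (C.g ∞) q₀ := C.isRegular.contDiffAt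
  obtain ⟨c₁, hc₁, θ, hθ0, hθc, hθ1, hθ2, hθ3⟩ := exists_line_parameter hOn hg1 C.g_zero
    (e := -p) (by rw [← hN, inner_neg_left]; linarith) hη
  obtain ⟨c₂, hc₂, ϑ, hϑ0, hϑc, hϑ1, hϑ2, hϑ3⟩ := exists_line_parameter hOn hg1 C.g_zero
    (e := p') (by rw [← hN, hp'N]; linarith) hη
  -- The approach starts at g = 2c and ends at g = c: the edge passage applies only to points of the
  -- section, whereas a link has to accept a full neighbourhood of its initial point. The factor 3
  -- keeps 2c below c₁.
  set c := min (min c₁ c₂) C.ρ / 3 with hc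
  have hρ := C.barrier.pos
  have hmpos : 0 < min (min c₁ c₂) C.ρ := lt_min (lt_min hc₁ hc₂) hρ
  have hc0 : 0 < c := by positivity
  have hcc₁ : 2 * c < c₁ := by
    have := (min_le_left (min c₁ c₂) C.ρ).trans (min_le_left _ _)
    linarith
  have hcc₂ : c < c₂ := by
    have := (min_le_left (min c₁ c₂) C.ρ).trans (min_le_right _ _)
    linarith
  have hcρ : c < C.ρ := by
    have := min_le_right (min c₁ c₂) C.ρ
    linarith
  -- the heights
  have hwmax : u₀ ^ 2 / (2 * G) ≤ ‖p‖ ^ 2 / 2 := by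
    have h1 : u₀ ^ 2 ≤ ‖p‖ ^ 2 * G := by
      rw [hGdef, ← mul_pow, ← sq_abs]
      gcongr
      exact abs_real_inner_le_norm p N
    rw [div_le_div_iff₀ (by positivity) two_pos]
    linarith
  have hval : ∀ v, 0 < v → v ≤ u₀ ^ 2 / (2 * G) → C.IsRegularValue (∞, v) := fun v hv hv' =>
    C.isRegularValue hv ((EReal.coe_le_coe_iff.2 (hv'.trans hwmax)).trans_lt hE)
  -- Three quarters of the maximal height u₀²/(2G) reached in the limit; there the normal product
  -- has dropped from u₀ to u₀/2.
  set w₀ := 3 * u₀ ^ 2 / (8 * G) with hw₀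
  have hw₀0 : 0 < w₀ := by positivity
  have hw₀' : w₀ ≤ u₀ ^ 2 / (2 * G) := by
    rw [hw₀, div_le_div_iff₀ (by positivity) (by positivity)]
    nlinarith
  obtain ⟨Λ⟩ := C.exists_layerCurve hc0 hcρ hw₀0
    ((EReal.coe_le_coe_iff.2 (hw₀'.trans hwmax)).trans_lt hE)
  have hrad : u₀ ^ 2 - 2 * G * w₀ = (-u₀ / 2) ^ 2 := by
    rw [hw₀]
    field_simp
    ring
  have hw : 0 < u₀ ^ 2 - 2 * G * w₀ := by
    rw [hrad]
    exact pow_pos (by linarith) 2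
  have hsqrt : √(u₀ ^ 2 - 2 * G * w₀) = -u₀ / 2 := by
    rw [hrad, Real.sqrt_sq (by linarith)]
  -- the links
  have h₁ := C.approach_link hr hU (q := q₀ + θ (2 * c) • -p) (p := p) (s := T₀ - θ (2 * c))
    (c := c) (c' := 2 * c) (by linarith) (θ := fun σ => θ (2 * c) - θ (2 * c - σ * c))
  have hline : ∀ σ, q₀ + θ (2 * c) • -p + (θ (2 * c) - θ (2 * c - σ * c)) • p =
      q₀ + θ (2 * c - σ * c) • -p := fun σ => by module
  simp only [hline] at h₁
  have hmem : ∀ σ ∈ Icc (0 : ℝ) 1, 2 * c - σ * c ∈ Ioo 0 c₁ := fun σ hσ =>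
    ⟨by nlinarith [hσ.2], by nlinarith [hσ.1]⟩
  have hmem' : ∀ σ ∈ Icc (0 : ℝ) 1, 2 * c - σ * c ∈ Icc 0 c₁ := fun σ hσ =>
    Ioo_subset_Icc_self (hmem σ hσ)
  replace h₁ := h₁ (by simp) (fun σ hσ => (hθ1 _ (hmem' σ hσ)).2.1.1)
    (fun σ hσ => (hθ1 _ (hmem' σ hσ)).2.1.1.mem_interior (by
      simp only
      rw [(hθ1 _ (hmem' σ hσ)).2.2]
      exact (hmem σ hσ).1))
    (fun σ hσ => (hθ1 _ (hmem' σ hσ)).2.1.2.1)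
    (fun σ hσ => by
      have h2 : HasDerivAt (fun σ => 2 * c - σ * c) (-c) σ := by
        simpa using ((hasDerivAt_id σ).mul_const c).const_sub (2 * c)
      refine (((hθ3 _ (hmem σ hσ)).scomp σ h2).const_sub (θ (2 * c))).congr_deriv ?_
      rw [inner_neg_left, inv_neg, smul_eq_mul]
      ring)
    (by
      have := (hθ1 (2 * c) ⟨by linarith, hcc₁.le⟩).2.2
      exact this)
  have e1 : 2 * c - 1 * c = c := by ring
  have e2 : T₀ - θ (2 * c) + (θ (2 * c) - θ c) = T₀ - θ c := by ring
  rw [e1, e2] at h₁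
  -- Two conditions are attached to the point reached: the matching of the edge curve with the
  -- inverse barrier, needed to begin the kick, and avoidance of the closed corner set.
  have h₂ := (Λ.in_link hr hc0 hw₀0 hN (T₀ := T₀) hu₀ hθ0
    (hθc.mono (Icc_subset_Icc le_rfl (by linarith)))
    (fun x hx => ⟨(hθ1 x ⟨hx.1, by linarith [hx.2]⟩).2.1.1, (hθ1 x ⟨hx.1, by linarith [hx.2]⟩).2.1.2.1⟩)
    (fun x hx => hθ3 x ⟨hx.1, by linarith [hx.2]⟩) hw).and_right
    (P := fun κ b => C.χ κ (Λ.ω κ) = Λ.x κ (c + w₀) ∧ b.1.1 ∉ B.corners) (by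
      have hc1 : Continuous (fun y : OnePoint ℕ × (PhaseSpace d × ℝ) => y.1) := by fun_prop
      have hc2 : Continuous (fun y : OnePoint ℕ × (PhaseSpace d × ℝ) => y.2.1.1) := by fun_prop
      exact ((hc1.tendsto (∞, ((q₀, _), T₀))).eventually Λ.end_eq).and
        ((hc2.tendsto (∞, ((q₀, _), T₀))).eventually
          (B.isClosed_corners.isOpen_compl.eventually_mem hcor)))
  have h₅ := Λ.out_link hr hc0 hw₀0 hN (T₀ := T₀) hu₀ hneg hp' hϑ0
    (hϑc.mono (Icc_subset_Icc le_rfl (by linarith)))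
    (fun x hx => ⟨(hϑ1 x ⟨hx.1, by linarith [hx.2]⟩).2.1.1, (hϑ1 x ⟨hx.1, by linarith [hx.2]⟩).2.1.2.2⟩)
    (fun x hx => hϑ3 x ⟨hx.1, by linarith [hx.2]⟩) hw
  -- During the first kick the normal product grows at the rate G from u₀/2 < 0 to -u₀/4 > 0. It
  -- stops beyond the turning point, at the height 15u₀²/(32G), still above w₀.
  have hS₁ : 0 ≤ -(3 / 4) * u₀ / G := div_nonneg (by linarith) hG.le
  have h₃ := C.kick_in_link hr Λ.continuous_ω (q := q₀) (s := T₀) hS₁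
    (p := fun σ => p + ((u₀ / 2 + σ * G - u₀) / G) • N)
    (v := fun σ => (u₀ ^ 2 - (u₀ / 2 + σ * G) ^ 2) / (2 * G)) C.isRegular
    (fun σ hσ => by
      have h1 : u₀ / 2 + σ * G ≤ -u₀ / 4 := by
        have h2 := mul_le_mul_of_nonneg_right hσ.2 hG.le
        rw [div_mul_cancel₀ _ hG.ne'] at h2
        linarith
      have h2 : 0 ≤ σ * G := mul_nonneg hσ.1 hG.le
      refine hval _ (div_pos (by nlinarith) (by positivity)) ?_
      gcongr
      nlinarith [sq_nonneg (u₀ / 2 + σ * G)])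
    (fun σ hσ => by
      have h2 : HasDerivAt (fun σ => (u₀ / 2 + σ * G - u₀) / G) (1 * G / G) σ :=
        ((((hasDerivAt_id σ).mul_const G).const_add (u₀ / 2)).sub_const u₀).div_const G
      refine ((h2.smul_const N).const_add p).congr_deriv ?_
      rw [one_mul, div_self hG.ne', one_smul, hN])
    (fun σ hσ => by
      have h2 : HasDerivAt (fun σ => u₀ / 2 + σ * G) (1 * G) σ :=
        ((hasDerivAt_id σ).mul_const G).const_add (u₀ / 2)
      refine (((h2.pow 2).const_sub (u₀ ^ 2)).div_const (2 * G)).congr_deriv ?_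
      rw [← hN, hu₀, inner_add_smul_self hN0, ← hu₀]
      field_simp
      ring)
    (by
      rw [Λ.ω_infty, hw₀]
      field_simp
      ring)
  -- In units of u₀²/G the height falls from 15/32 to w₀ = 12/32, while the square of the normal
  -- product rises from u₀²/16 to u₀²/4.
  have h₄ := C.kick_out_link hr Λ.continuous_ω (q := q₀) (s := T₀)
    (δ := -(3 / 32) * u₀ ^ 2 / G) (div_neg_of_neg_of_pos (by linarith) hG)
    (p := fun σ => p + ((1 * √(u₀ ^ 2 / 16 + 3 / 16 * u₀ ^ 2 * σ) - u₀) / G) • N)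
    (v := fun σ => 15 / 32 * u₀ ^ 2 / G + -(3 / 32) * u₀ ^ 2 / G * σ) C.isRegular
    (fun σ hσ => by
      have h1 : 15 / 32 * u₀ ^ 2 / G + -(3 / 32) * u₀ ^ 2 / G * σ =
          (15 - 3 * σ) / 32 * (u₀ ^ 2 / G) := by ring
      have h2 : u₀ ^ 2 / (2 * G) = 1 / 2 * (u₀ ^ 2 / G) := by field_simp
      have h3 : 0 < u₀ ^ 2 / G := by positivity
      refine hval _ ?_ ?_
      · rw [h1]
        exact mul_pos (by linarith [hσ.2]) h3
      · rw [h1, h2]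
        exact mul_le_mul_of_nonneg_right (by linarith [hσ.1]) h3.le)
    (fun σ hσ => by
      rw [← hN, hu₀, inner_add_smul_self hN0, ← hu₀, one_mul]
      have := hσ.1
      exact Real.sqrt_pos.2 (by positivity))
    (fun σ hσ => by
      have h0 := hσ.1
      have h1 : 0 < u₀ ^ 2 / 16 + 3 / 16 * u₀ ^ 2 * σ := by positivity
      refine (hasDerivAt_sqrt_kick p N (u₀ := u₀) (G := G) (ς := 1) (Or.inl rfl)
        h1).congr_deriv ?_
      rw [← hN, hu₀, inner_add_smul_self hN0, ← hu₀, ← neg_smul]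
      congr 1
      have := Real.sqrt_pos.2 h1
      field_simp
      ring)
    (fun σ hσ => by
      exact (((hasDerivAt_id σ).const_mul (-(3 / 32) * u₀ ^ 2 / G)).const_add
        (15 / 32 * u₀ ^ 2 / G)).congr_deriv (mul_one _))
    (by
      rw [Λ.ω_infty, hw₀]
      field_simp
      ring)
  have f1 : √(u₀ ^ 2 / 16) = -u₀ / 4 := by
    rw [show u₀ ^ 2 / 16 = (-u₀ / 4) ^ 2 by ring,
      Real.sqrt_sq (by linarith)]
  have f2 : √(u₀ ^ 2 / 16 + 3 / 16 * u₀ ^ 2) = -u₀ / 2 := by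
    rw [show u₀ ^ 2 / 16 + 3 / 16 * u₀ ^ 2 = (-u₀ / 2) ^ 2 by ring,
      Real.sqrt_sq (by linarith)]
  have f3 : u₀ / 2 + -(3 / 4) * u₀ / G * G = -u₀ / 4 := by
    field_simp
    ring
  have f4 : (u₀ ^ 2 - (-u₀ / 4) ^ 2) / (2 * G) = 15 / 32 * u₀ ^ 2 / G := by
    field_simp
    ring
  have f5 : -1 * (-u₀ / 2) = u₀ / 2 := by ring
  simp only [f3, f4, zero_mul, add_zero] at h₃
  simp only [f1, f2, one_mul, mul_one, mul_zero, add_zero] at h₄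
  simp only [← hGdef, hsqrt, f5] at h₂
  simp only [← hGdef, hsqrt, one_mul] at h₅
  refine ⟨θ (2 * c), ⟨hθ2 _ ⟨by linarith, hcc₁.le⟩, (hθ1 _ ⟨by linarith, hcc₁.le⟩).1⟩, ϑ c,
    ⟨hϑ2 _ ⟨hc0, hcc₂.le⟩, (hϑ1 _ ⟨hc0.le, hcc₂.le⟩).1⟩, ?_⟩
  refine ((((h₁.trans h₂).trans h₃).trans h₄).trans h₅).mono ?_
  rintro κ a e ⟨a₄, ⟨a₃, ⟨a₂, ⟨a₁, k₁, k₂, hχ, hcor⟩, k₃⟩, k₄⟩, k₅⟩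
  obtain ⟨i₁, i₂, i₃⟩ := k₁
  obtain ⟨j₁, j₂, j₃⟩ := k₂ i₁
  obtain ⟨l₁, l₂, l₃⟩ := k₃ (by rw [j₁, hχ])
  obtain ⟨m₁, m₂, m₃⟩ := k₄ l₁
  obtain ⟨o₂, o₃⟩ := k₅ (by rw [m₁, hχ])
  constructor
  · intro m hm
    have e : e.2 - a.2 = a₁.2 - a.2 + (a₂.2 - a₁.2 + (a₃.1.2 - a₂.2 + (a₄.2 - a₃.1.2 +
        (e.2 - a₄.2)))) := by ring
    rw [e]
    exact (i₂ m hm).trans ((j₂ m hm).trans ((l₂ m hm).trans ((m₂ m hm).trans (o₂ m hm))))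
  · rintro rfl
    rw [Λ.ω_infty] at l₃ m₃
    exact C.arc_of_links (i₃ rfl) (j₃ rfl) hcor (l₃ rfl) (m₃ rfl) (o₃ rfl)

end CollisionChart

/-! ### Composition along the billiard trajectory -/

section TrajectoryLinks

open OnePoint

variable {d r n : ℕ} {L : AddSubgroup (Config d)} {B : BilliardTable d r n L}
  {U : ℕ → Config d → ℝ} {𝓔 : EReal} {T : ℝ} {γ : ℝ → PhaseSpace d}

theorem HamiltonianArc.refl (V : Config d → ℝ) (ρ : PhaseSpace d) : HamiltonianArc V ρ 0 ρ := by
  refine ⟨le_rfl, fun _ => ρ, rfl, rfl, fun s hs => ?_⟩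
  rw [Icc_self] at hs ⊢
  rw [mem_singleton_iff.1 hs]
  exact hasDerivWithinAt_iff_hasFDerivWithinAt.2 .singleton

theorem TimedArc.link_refl {a : PhaseSpace d × ℝ} (ha : a.1.1 ∈ interior B.D) :
    FamilyLink r (TimedArc B U) a a := by
  refine ⟨fun _ a => a, ContDiffFamAt.of_contDiff contDiff_id, rfl, ?_⟩
  have hc : Continuous (fun y : OnePoint ℕ × (PhaseSpace d × ℝ) => y.2.1.1) := by fun_prop
  filter_upwards [(hc.tendsto (∞, a)).eventually (isOpen_interior.eventually_mem ha)] with y hy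
  constructor
  · intro m _
    rw [sub_self]
    exact HamiltonianArc.refl _ _
  · intro _
    have := BilliardArc.of_free (B := B) (q := y.2.1.1) (p := y.2.1.2) le_rfl fun u hu => by
      rw [le_antisymm hu.2 hu.1, zero_smul, add_zero]
      exact hy
    rw [zero_smul, add_zero] at this
    rwa [sub_self]

theorem TimedArc.link_trans {a b c : PhaseSpace d × ℝ} (h : FamilyLink r (TimedArc B U) a b)
    (h' : FamilyLink r (TimedArc B U) b c) : FamilyLink r (TimedArc B U) a c :=
  (h.trans h').mono fun _ _ _ ⟨_, h1, h2⟩ => h1.trans h2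

theorem TimedArc.link_of_free (hr : 1 ≤ r)
    (hU : ∀ x ∈ interior B.D, ContDiffFamAt (r + 1) (potentialFamily U) (∞, x))
    {q p : Config d} {s t : ℝ} (ht : 0 < t) (hin : ∀ u ∈ Icc 0 t, q + u • p ∈ interior B.D) :
    FamilyLink r (TimedArc B U) ((q, p), s) ((q + t • p, p), s + t) := by
  refine (FamilyLink.comp_left (f := fun _ (a : PhaseSpace d × ℝ) => (a, t)) (x := ((q, p), s))
    (ContDiffFamAt.of_contDiff (by fun_prop)) rfl (flight_link hr hU ht hin)).mono ?_
  rintro κ a b ⟨h1, h2, h3, h4⟩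
  simp only at h1 h2 h3 h4
  have e : b.2 - a.2 = t := by rw [h1]; ring
  rw [TimedArc, e]
  refine ⟨h3, fun hκ => ?_⟩
  obtain ⟨h5, h6⟩ := h4 hκ
  rw [h5]
  exact BilliardArc.of_free h2.le h6

theorem IsBilliardTrajectory.link_of_free (h : IsBilliardTrajectory B T γ) (hr : 1 ≤ r)
    (hU : ∀ x ∈ interior B.D, ContDiffFamAt (r + 1) (potentialFamily U) (∞, x))
    {a b : ℝ} (ha : 0 ≤ a) (hab : a < b) (hb : b ≤ T)
    (hin : ∀ u ∈ Icc a b, (γ u).1 ∈ interior B.D) :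
    FamilyLink r (TimedArc B U) (γ a, a) (γ b, b) ∧ (γ b).2 = (γ a).2 := by
  obtain ⟨p, -, h2, h3, h4⟩ := h.free_segment ha hab hb fun u hu => hin u (Ioo_subset_Icc_self hu)
  replace h3 := h3 (hin a ⟨le_rfl, hab.le⟩)
  replace h4 := h4 (hin b ⟨hab.le, le_rfl⟩)
  have hlink := TimedArc.link_of_free (B := B) (U := U) hr hU (q := (γ a).1) (p := p) (s := a)
    (t := b - a) (sub_pos.2 hab) fun u hu => by
      have := h2 (a + u) ⟨by linarith [hu.1], by linarith [hu.2]⟩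
      rw [add_sub_cancel_left] at this
      rw [← this]
      exact hin _ ⟨by linarith [hu.1], by linarith [hu.2]⟩
  have e1 : ((γ a).1, p) = γ a := Prod.ext rfl h3.symm
  have e2 : ((γ a).1 + (b - a) • p, p) = γ b := Prod.ext (h2 b ⟨hab.le, le_rfl⟩).symm h4.symm
  rw [e1, e2, add_sub_cancel] at hlink
  exact ⟨hlink, by rw [h3, h4]⟩

/-- The momentum at a transversal collision points out of the domain. -/
theorem CollisionChart.inner_neg {D : Set (Config d)} {q₀ : Config d}
    (C : CollisionChart r D 𝓔 U q₀) {p : Config d} {δ : ℝ} (hδ : 0 < δ)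
    (hin : ∀ x ∈ Ioo 0 δ, q₀ + x • -p ∈ D) (hne : inner ℝ p (gradient (C.g ∞) q₀) ≠ 0) :
    inner ℝ p (gradient (C.g ∞) q₀) < 0 := by
  refine lt_of_le_of_ne (not_lt.1 fun hpos => ?_) hne
  have hline : HasDerivAt (fun x : ℝ => q₀ + x • -p) (-p) 0 := by
    simpa using ((hasDerivAt_id (0 : ℝ)).smul_const (-p)).const_add q₀
  have e0 : q₀ + (0 : ℝ) • -p = q₀ := by rw [zero_smul, add_zero]
  have hd := hasDerivAt_comp_gradient (f := C.g ∞) (by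
    rw [e0]
    exact C.isRegular.differentiableAt) hline
  rw [e0] at hd
  -- With a positive normal component the incoming segment would have g < 0, hence lie outside D,
  -- just before the collision.
  have hs := eventually_nhdsWithin_sign_eq_of_deriv_neg (f := fun x : ℝ => C.g ∞ (q₀ + x • -p))
    (x₀ := 0) (by
      rw [hd.deriv, inner_neg_left]
      linarith) (by rw [e0, C.g_zero])
  have hdom : ∀ᶠ x : ℝ in 𝓝 0, (q₀ + x • -p ∈ D ↔ 0 ≤ C.g ∞ (q₀ + x • -p)) := by
    have ht := hline.continuousAt.tendsto
    rw [e0] at ht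
    exact ht.eventually C.domain
  have hev : ∀ᶠ x in 𝓝[>] (0 : ℝ), False := by
    filter_upwards [hs.filter_mono nhdsWithin_le_nhds, hdom.filter_mono nhdsWithin_le_nhds,
      Ioo_mem_nhdsGT hδ] with x h1 h2 h3
    have h4 := h2.1 (hin x h3)
    rw [zero_sub, sign_neg (neg_lt_zero.2 h3.1), sign_eq_neg_one_iff] at h1
    linarith
  exact (hev.exists).elim fun _ h => h

/-- The passage through the chart can be confined to an arbitrarily short time interval around the
collision; the rest on both sides is free flight. Conservation of the norm of the momentum is
recorded for use at the next collision. -/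
theorem IsBilliardTrajectory.link_of_collision (h : IsBilliardTrajectory B T γ)
    (hreg : NoTangency B T γ) (hr : 1 ≤ r)
    (hU : ∀ x ∈ interior B.D, ContDiffFamAt (r + 1) (potentialFamily U) (∞, x))
    (hC : ∀ q ∈ frontier B.D, q ∉ B.corners → ∀ v, IsInwardUnitNormal B.D q v →
      Nonempty (CollisionChart r B.D 𝓔 U q))
    {a s b : ℝ} (ha : 0 ≤ a) (has : a < s) (hsb : s < b) (hb : b ≤ T)
    (hf : (γ s).1 ∈ frontier B.D) (hin : ∀ u ∈ Icc a b, u ≠ s → (γ u).1 ∈ interior B.D)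
    (hE : ((‖(γ a).2‖ ^ 2 / 2 : ℝ) : EReal) < 𝓔) :
    FamilyLink r (TimedArc B U) (γ a, a) (γ b, b) ∧ ‖(γ b).2‖ = ‖(γ a).2‖ := by
  have hsI : s ∈ Icc 0 T := ⟨ha.trans has.le, hsb.le.trans hb⟩
  have hinL : ∀ u ∈ Ico a s, (γ u).1 ∈ interior B.D := fun u hu =>
    hin u ⟨hu.1, (hu.2.trans hsb).le⟩ hu.2.ne
  have hinR : ∀ u ∈ Ioc s b, (γ u).1 ∈ interior B.D := fun u hu =>
    hin u ⟨(has.trans hu.1).le, hu.2⟩ hu.1.ne'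
  obtain ⟨p, hp1, hp2, hp3, -⟩ := h.free_segment ha has (hsb.le.trans hb) fun u hu =>
    hinL u ⟨hu.1.le, hu.2⟩
  obtain ⟨p', hp1', hp2', -, hp4'⟩ := h.free_segment hsI.1 hsb hb fun u hu =>
    hinR u ⟨hu.1, hu.2.le⟩
  replace hp3 := hp3 (hinL a ⟨le_rfl, has⟩)
  replace hp4' := hp4' (hinR b ⟨hsb, le_rfl⟩)
  obtain ⟨v, pin, pout, hv, hpin, hpout, hrefl⟩ :=
    h.reflection s ⟨ha.trans_lt has, hsb.trans_le hb⟩ hf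
  have hvp := hreg s ⟨ha.trans_lt has, hsb.trans_le hb⟩ hf v pin hv hpin
  have e1 : pin = p := tendsto_nhds_unique hpin (tendsto_const_nhds.congr' (by
    filter_upwards [Ioo_mem_nhdsLT has] with u hu using (hp1 u hu).symm))
  have e2 : pout = p' := tendsto_nhds_unique hpout (tendsto_const_nhds.congr' (by
    filter_upwards [Ioo_mem_nhdsGT hsb] with u hu using (hp1' u hu).symm))
  rw [e1] at hvp
  rw [e1, e2] at hrefl
  set q₀ := (γ s).1 with hq₀
  have hcor : q₀ ∉ B.corners := (h.mem s hsI).2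
  obtain ⟨C⟩ := hC q₀ hf hcor v hv
  set N := gradient (C.g ∞) q₀ with hN
  have hN0 : 0 < ‖N‖ := norm_pos_iff.2 C.gradient_ne_zero
  have hvN : v = ‖N‖⁻¹ • N := hv.unique (C.isRegular.isInwardUnitNormal C.g_zero)
  have hposL : ∀ x, q₀ + x • -p = (γ a).1 + (s - x - a) • p := fun x => by
    rw [hq₀, hp2 s ⟨has.le, le_rfl⟩]
    module
  have hmemL : ∀ u, 0 ≤ u → u < s - a → (γ a).1 + u • p ∈ interior B.D := fun u hu hu' => by
    have := hp2 (a + u) ⟨by linarith, by linarith⟩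
    rw [add_sub_cancel_left] at this
    rw [← this]
    exact hinL _ ⟨by linarith, by linarith⟩
  have hmemR : ∀ u, 0 < u → u ≤ b - s → q₀ + u • p' ∈ interior B.D := fun u hu hu' => by
    have := hp2' (s + u) ⟨by linarith, by linarith⟩
    rw [add_sub_cancel_left] at this
    rw [← this]
    exact hinR _ ⟨by linarith, by linarith⟩
  have hneg : inner ℝ p N < 0 := C.inner_neg (sub_pos.2 has) (fun x hx => by
      rw [hposL]
      exact interior_subset (hmemL _ (by linarith [hx.2]) (by linarith [hx.1])))
    fun e => hvp (by rw [hvN, inner_smul_right, e, mul_zero])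
  have hrefl' : p' = p + ((-inner ℝ p N - inner ℝ p N) / ‖N‖ ^ 2) • N := by
    rw [hrefl, hvN, inner_smul_right, smul_smul, sub_eq_add_neg, ← neg_smul]
    congr 2
    field_simp
    ring
  have hnorm : ‖p'‖ = ‖p‖ := by
    have h1 : ‖v‖ = 1 := hv.1
    have h2 : ‖p'‖ ^ 2 = ‖p‖ ^ 2 := by
      rw [hrefl, norm_sub_sq_real, inner_smul_right, norm_smul, h1, mul_one, Real.norm_eq_abs,
        sq_abs]
      ring
    exact (sq_eq_sq₀ (norm_nonneg _) (norm_nonneg _)).1 h2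
  rw [hp3] at hE
  obtain ⟨x, hx, x', hx', hlink⟩ := C.collision_link hr hU hcor hE hN hneg hrefl' s
    (lt_min (sub_pos.2 has) (sub_pos.2 hsb))
  have hxa := hx.2.trans_le (min_le_left _ _)
  have hxb := hx'.2.trans_le (min_le_right _ _)
  have hL := TimedArc.link_of_free (B := B) (U := U) hr hU (q := (γ a).1) (p := p) (s := a)
    (t := s - x - a) (by linarith) fun u hu => hmemL u hu.1 (by linarith [hu.2, hx.1])
  have hR := TimedArc.link_of_free (B := B) (U := U) hr hU (q := q₀ + x' • p') (p := p')
    (s := s + x') (t := b - (s + x')) (by linarith) fun u hu => by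
      rw [add_assoc, ← add_smul]
      exact hmemR _ (by linarith [hu.1, hx'.1]) (by linarith [hu.2])
  rw [add_sub_cancel] at hL hR
  rw [← hposL] at hL
  have f1 : ((γ a).1, p) = γ a := Prod.ext rfl hp3.symm
  have f2 : (q₀ + x' • p' + (b - (s + x')) • p', p') = γ b := by
    refine Prod.ext ?_ hp4'.symm
    rw [hp2' b ⟨hsb.le, le_rfl⟩]
    module
  rw [f1] at hL
  rw [f2] at hR
  exact ⟨TimedArc.link_trans hL (TimedArc.link_trans hlink hR), by rw [hp4', hp3, hnorm]⟩

/-- The flow along a billiard trajectory. -/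
theorem IsBilliardTrajectory.link (h : IsBilliardTrajectory B T γ)
    (hreg : NoTangency B T γ) (hr : 1 ≤ r)
    (hU : ∀ x ∈ interior B.D, ContDiffFamAt (r + 1) (potentialFamily U) (∞, x))
    (hC : ∀ q ∈ frontier B.D, q ∉ B.corners → ∀ v, IsInwardUnitNormal B.D q v →
      Nonempty (CollisionChart r B.D 𝓔 U q))
    (hE : ((‖(γ 0).2‖ ^ 2 / 2 : ℝ) : EReal) < 𝓔) {s : ℝ} (hs : s ∈ Icc 0 T)
    (hin : (γ s).1 ∈ interior B.D) : FamilyLink r (TimedArc B U) (γ 0, 0) (γ s, s) := by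
  have hT : 0 ≤ T := hs.1.trans hs.2
  -- Collisions are isolated, so near s at most one can occur, namely at s itself. The norm of the
  -- momentum is propagated because the energy bound is needed at each collision.
  have hlocal : ∀ s ∈ Icc 0 T, ∃ δ > 0, ∀ a ∈ Icc 0 T, ∀ b ∈ Icc 0 T, s - δ < a → b < s + δ →
      a ≤ b → (γ a).1 ∈ interior B.D → (γ b).1 ∈ interior B.D →
      ‖(γ a).2‖ = ‖(γ 0).2‖ →
      FamilyLink r (TimedArc B U) (γ a, a) (γ b, b) ∧ ‖(γ b).2‖ = ‖(γ 0).2‖ := by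
    intro s hs
    obtain ⟨δ, hδ, hball⟩ := Metric.eventually_nhds_iff_ball.1
      (eventually_nhdsWithin_iff.1 (h.eventually_mem_interior s))
    refine ⟨δ, hδ, fun a ha b hb has hbs hab hia hib hna => ?_⟩
    have hI : ∀ u ∈ Icc a b, u ≠ s → (γ u).1 ∈ interior B.D := fun u hu hne => by
      refine hball u ?_ hne ⟨ha.1.trans hu.1, hu.2.trans hb.2⟩
      rw [Metric.mem_ball, Real.dist_eq, abs_lt]
      constructor <;> linarith [hu.1, hu.2]
    rcases hab.eq_or_lt with rfl | hab
    · exact ⟨TimedArc.link_refl hia, hna⟩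
    by_cases hs' : s ∈ Icc a b ∧ (γ s).1 ∉ interior B.D
    · obtain ⟨hsab, hsi⟩ := hs'
      have h1 : a < s := lt_of_le_of_ne hsab.1 (by rintro rfl; exact hsi hia)
      have h2 : s < b := lt_of_le_of_ne hsab.2 (by rintro rfl; exact hsi hib)
      have h3 := (BilliardTable.mem_interior_or_frontier (h.mem s hs).1).resolve_left hsi
      have := h.link_of_collision hreg hr hU hC ha.1 h1 h2 hb.2 h3 hI (by rwa [hna])
      exact ⟨this.1, this.2.trans hna⟩
    · have hI' : ∀ u ∈ Icc a b, (γ u).1 ∈ interior B.D := fun u hu => by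
        by_cases hus : u = s
        · by_contra hni
          exact hs' ⟨hus ▸ hu, hus ▸ hni⟩
        · exact hI u hu hus
      obtain ⟨h1, h2⟩ := h.link_of_free hr hU ha.1 hab hb.2 hI'
      exact ⟨h1, by rw [h2, hna]⟩
  -- Continuation by a supremum. Links are demanded at inner instants only, since they end at inner
  -- phase points.
  set R : Set ℝ := {s | s ∈ Icc 0 T ∧ ∀ s' ∈ Icc 0 s, (γ s').1 ∈ interior B.D →
    FamilyLink r (TimedArc B U) (γ 0, 0) (γ s', s') ∧ ‖(γ s').2‖ = ‖(γ 0).2‖} with hR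
  have h0R : (0 : ℝ) ∈ R := ⟨⟨le_rfl, hT⟩, fun s' hs' hi => by
    obtain rfl : s' = 0 := le_antisymm hs'.2 hs'.1
    exact ⟨TimedArc.link_refl hi, rfl⟩⟩
  have hbdd : BddAbove R := ⟨T, fun s hs => hs.1.2⟩
  set m := sSup R with hm
  have hm0 : 0 ≤ m := le_csSup hbdd h0R
  have hmT : m ≤ T := csSup_le ⟨0, h0R⟩ fun s hs => hs.1.2
  obtain ⟨δ, hδ, hloc⟩ := hlocal m ⟨hm0, hmT⟩
  obtain ⟨s₁, hs₁, hms₁⟩ := exists_lt_of_lt_csSup ⟨0, h0R⟩ (sub_lt_self m hδ)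
  have hs₁m : s₁ ≤ m := le_csSup hbdd hs₁
  -- The instant s₁ may itself be a collision; an inner instant slightly before it is used as the
  -- junction.
  obtain ⟨a, ha, haδ, hai⟩ : ∃ a ∈ Icc 0 s₁, m - δ < a ∧ (γ a).1 ∈ interior B.D := by
    rcases hs₁.1.1.eq_or_lt with h0 | h0
    · exact ⟨s₁, ⟨hs₁.1.1, le_rfl⟩, hms₁, by rw [← h0]; exact h.start_inner⟩
    · obtain ⟨a, ha, hfree⟩ := h.exists_free_left ⟨h0, hs₁.1.2⟩
      obtain ⟨u, hu⟩ := nonempty_Ioo.2 (max_lt ha.2 hms₁)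
      exact ⟨u, ⟨ha.1.trans ((le_max_left _ _).trans hu.1.le), hu.2.le⟩,
        (le_max_right _ _).trans_lt hu.1, hfree u ⟨(le_max_left _ _).trans_lt hu.1, hu.2⟩⟩
  obtain ⟨hla, hna⟩ := hs₁.2 a ha hai
  have hext : ∀ s' ∈ Icc 0 T, s' < m + δ → (γ s').1 ∈ interior B.D →
      FamilyLink r (TimedArc B U) (γ 0, 0) (γ s', s') ∧ ‖(γ s').2‖ = ‖(γ 0).2‖ := by
    intro s' hs' hs'm hi
    rcases le_total s' a with hle | hle
    · exact hs₁.2 s' ⟨hs'.1, hle.trans ha.2⟩ hi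
    · obtain ⟨h1, h2⟩ := hloc a ⟨ha.1, ha.2.trans hs₁.1.2⟩ s' hs' haδ hs'm hle hai hi hna
      exact ⟨TimedArc.link_trans hla h1, h2⟩
  have hmem : min (m + δ / 2) T ∈ R := by
    refine ⟨⟨le_min (by linarith) hT, min_le_right _ _⟩, fun s' hs' hi => hext s'
      ⟨hs'.1, hs'.2.trans (min_le_right _ _)⟩ ?_ hi⟩
    have := hs'.2.trans (min_le_left _ _)
    linarith
  have hle := le_csSup hbdd hmem
  have hTm : T ≤ m := by
    rcases min_le_iff.1 hle with h1 | h1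
    · linarith
    · exact h1
  exact (hext s hs (by linarith [hs.2]) hin).1

/-- The flow along a billiard trajectory, with the time as a variable. -/
theorem IsBilliardTrajectory.flow_link (h : IsBilliardTrajectory B T γ)
    (hreg : NoTangency B T γ) (hr : 1 ≤ r) (hT : 0 < T)
    (hU : ∀ x ∈ interior B.D, ContDiffFamAt (r + 1) (potentialFamily U) (∞, x))
    (hC : ∀ q ∈ frontier B.D, q ∉ B.corners → ∀ v, IsInwardUnitNormal B.D q v →
      Nonempty (CollisionChart r B.D 𝓔 U q))
    (hE : ((‖(γ 0).2‖ ^ 2 / 2 : ℝ) : EReal) < 𝓔) :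
    FamilyLink r (fun κ (a : ℝ × PhaseSpace d) (b : PhaseSpace d) =>
      (∀ m : ℕ, κ = (m : OnePoint ℕ) → HamiltonianArc (U m) a.2 a.1 b) ∧
      (κ = ∞ → BilliardArc B a.2 a.1 b)) (T, γ 0) (γ T) := by
  -- The motion is cut in the last free interval. The final flight has variable duration, so the
  -- total time becomes an independent variable.
  obtain ⟨a, ha, hfree⟩ := h.exists_free_left ⟨hT, le_rfl⟩
  obtain ⟨s, hs⟩ := nonempty_Ioo.2 ha.2
  have hin : ∀ u ∈ Icc s T, (γ u).1 ∈ interior B.D := fun u hu => by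
    rcases hu.2.eq_or_lt with rfl | hu'
    · exact h.end_inner
    · exact hfree u ⟨hs.1.trans_le hu.1, hu'⟩
  have hs0 : 0 ≤ s := ha.1.trans hs.1.le
  have hlink := h.link hreg hr hU hC hE ⟨hs0, hs.2.le⟩ (hin s ⟨le_rfl, hs.2.le⟩)
  obtain ⟨p, -, h2, h3, h4⟩ := h.free_segment hs0 hs.2 le_rfl fun u hu =>
    hin u (Ioo_subset_Icc_self hu)
  replace h3 := h3 (hin s ⟨le_rfl, hs.2.le⟩)
  replace h4 := h4 h.end_inner
  have hfl := flight_link hr hU (q := (γ s).1) (p := p) (s := s) (t := T - s) (sub_pos.2 hs.2)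
    fun u hu => by
      have := h2 (s + u) ⟨by linarith [hu.1], by linarith [hu.2]⟩
      rw [add_sub_cancel_left] at this
      rw [← this]
      exact hin _ ⟨by linarith [hu.1], by linarith [hu.2]⟩
  have e1 : ((γ s).1, p) = γ s := Prod.ext rfl h3.symm
  have e2 : ((γ s).1 + (T - s) • p, p) = γ T := Prod.ext (h2 T ⟨hs.2.le, le_rfl⟩).symm h4.symm
  rw [e1, e2, add_sub_cancel] at hfl
  -- The target time is passed on unchanged; the last flight then takes whatever remains after the
  -- arrival time, which depends on the point and on κ.
  have h₁ : FamilyLink r (fun κ (a : ℝ × PhaseSpace d) (b : (PhaseSpace d × ℝ) × ℝ) =>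
      TimedArc B U κ (a.2, 0) b.1 ∧ b.2 = a.1) (T, γ 0) ((γ s, s), T) := by
    obtain ⟨Ψ, g1, g2, g3⟩ := FamilyLink.comp_left
      (f := fun _ (a : ℝ × PhaseSpace d) => (a.2, (0 : ℝ))) (x := (T, γ 0))
      (ContDiffFamAt.of_contDiff (by fun_prop)) rfl hlink
    refine ⟨fun κ a => (Ψ κ a, a.1), g1.prodMk (ContDiffFamAt.of_contDiff contDiff_fst),
      by beta_reduce; rw [g2], ?_⟩
    filter_upwards [g3] with y hy using ⟨hy, rfl⟩
  have h₂ := FamilyLink.comp_left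
    (f := fun _ (a : (PhaseSpace d × ℝ) × ℝ) => (a.1, a.2 - a.1.2)) (x := ((γ s, s), T))
    (ContDiffFamAt.of_contDiff (by fun_prop)) rfl hfl
  obtain ⟨Φ, k1, k2, k3⟩ := h₁.trans h₂
  refine ⟨fun κ a => (Φ κ a).1, k1.clm_comp (ContinuousLinearMap.fst ℝ _ _),
    by beta_reduce; rw [k2], ?_⟩
  filter_upwards [k3]
  rintro ⟨κ, a⟩ ⟨⟨b, t⟩, ⟨l1, l2⟩, l3, l4, l5, l6⟩
  simp only at l1 l2 l3 l4 l5 l6 ⊢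
  subst l2
  have e : a.1 = b.2 - 0 + (a.1 - b.2) := by ring
  constructor
  · intro m hm
    rw [e]
    exact (l1.1 m hm).trans (l5 m hm)
  · intro hκ
    rw [e, (l6 hκ).1]
    exact (l1.2 hκ).trans (BilliardArc.of_free l4.le (l6 hκ).2)

end TrajectoryLinks

/-! ### From links to uniform convergence of the flow maps -/

section Convergence

open OnePoint

variable {d r n : ℕ} {L : AddSubgroup (Config d)} {B : BilliardTable d r n L}

/-- The map of the smooth flow for the potential `U`, the time `x.1` and the initial point `x.2`
exists and is `e`-close to that of the billiard flow in `C^r`. -/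
def IsCloseFlow (B : BilliardTable d r n L) (e : ℝ) (U : Config d → ℝ) (x : ℝ × PhaseSpace d) :
    Prop :=
  (∃ b, HamiltonianArc U x.2 x.1 b) ∧ ContDiffAt ℝ r (hamiltonianFlow U x.1) x.2 ∧
  ∀ k ≤ r, dist (iteratedFDeriv ℝ k (billiardFlow B x.1) x.2)
    (iteratedFDeriv ℝ k (hamiltonianFlow U x.1) x.2) < e

/-- By uniqueness of both motions the members of the family coincide, as germs in the phase point,
with the flow maps. Smoothness and closeness of the derivatives are then properties of the family
alone. -/
theorem eventually_isCloseFlow {U : ℕ → Config d → ℝ} (hU : ∀ᶠ m in atTop, ContDiff ℝ 2 (U m))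
    {x : ℝ × PhaseSpace d} {b : PhaseSpace d}
    (h : FamilyLink r (fun κ (a : ℝ × PhaseSpace d) (b : PhaseSpace d) =>
      (∀ m : ℕ, κ = (m : OnePoint ℕ) → HamiltonianArc (U m) a.2 a.1 b) ∧
      (κ = ∞ → BilliardArc B a.2 a.1 b)) x b) :
    (∀ᶠ y in 𝓝 x, (∃ b, BilliardArc B y.2 y.1 b) ∧ ContDiffAt ℝ r (billiardFlow B y.1) y.2) ∧
    ∀ e > 0, ∀ᶠ y in 𝓝 ((∞ : OnePoint ℕ), x), ∀ m : ℕ, y.1 = (m : OnePoint ℕ) →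
      IsCloseFlow B e (U m) y.2 := by
  obtain ⟨Φ, h1, -, h3⟩ := h
  -- Time is moved from the variables to the parameters: derivatives are wanted in the phase point
  -- only, but jointly continuous in time.
  have hΨ : ContDiffFamAt r (fun (κ : OnePoint ℕ × ℝ) ρ => Φ κ.1 (κ.2, ρ)) ((∞, x.1), x.2) :=
    ContDiffFamAt.partial_snd (t := x.1) (x := x.2) h1
  have hsmooth : ∀ᶠ y in 𝓝 ((∞ : OnePoint ℕ), x), ContDiffAt ℝ r (fun ρ => Φ y.1 (y.2.1, ρ))
      y.2.2 := by
    have hc : Continuous fun y : OnePoint ℕ × (ℝ × PhaseSpace d) => ((y.1, y.2.1), y.2.2) := by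
      fun_prop
    exact ((hc.tendsto (∞, x)).eventually (hΨ.eventually)).mono fun y hy => hy.contDiffAt
  have hline : ∀ y : OnePoint ℕ × (ℝ × PhaseSpace d), Tendsto
      (fun ρ : PhaseSpace d => (y.1, (y.2.1, ρ))) (𝓝 y.2.2) (𝓝 y) := fun y =>
    (show Continuous fun ρ : PhaseSpace d => (y.1, (y.2.1, ρ)) by fun_prop).tendsto y.2.2
  have hham : ∀ᶠ y in 𝓝 ((∞ : OnePoint ℕ), x), ∀ m : ℕ, y.1 = (m : OnePoint ℕ) →
      (∃ b, HamiltonianArc (U m) y.2.2 y.2.1 b) ∧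
      hamiltonianFlow (U m) y.2.1 =ᶠ[𝓝 y.2.2] fun ρ => Φ y.1 (y.2.1, ρ) := by
    filter_upwards [eventually_eventually_nhds.2 h3, eventually_of_eventually_nat hU]
      with y hy hym m hm
    refine ⟨⟨_, hy.self_of_nhds.1 m hm⟩, ?_⟩
    filter_upwards [(hline y).eventually hy] with ρ hρ
    exact (hρ.1 m hm).hamiltonianFlow_eq (hym m hm)
  have hinf : Tendsto (fun a : ℝ × PhaseSpace d => ((∞ : OnePoint ℕ), a)) (𝓝 x) (𝓝 (∞, x)) :=
    (Continuous.prodMk_right (∞ : OnePoint ℕ)).tendsto x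
  have hbil : ∀ᶠ y in 𝓝 x, (∃ b, BilliardArc B y.2 y.1 b) ∧
      billiardFlow B y.1 =ᶠ[𝓝 y.2] fun ρ => Φ ∞ (y.1, ρ) := by
    filter_upwards [hinf.eventually (eventually_eventually_nhds.2 h3)] with y hy
    refine ⟨⟨_, hy.self_of_nhds.2 rfl⟩, ?_⟩
    filter_upwards [(hline (∞, y)).eventually hy] with ρ hρ
    exact (hρ.2 rfl).billiardFlow_eq
  refine ⟨?_, fun e he => ?_⟩
  · filter_upwards [hbil, hinf.eventually hsmooth] with y h1 h2
    exact ⟨h1.1, h2.congr_of_eventuallyEq h1.2⟩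
  · have hclose : ∀ᶠ y in 𝓝 ((∞ : OnePoint ℕ), x), ∀ k ∈ Iic r,
        dist (iteratedFDeriv ℝ k (fun ρ => Φ ∞ (y.2.1, ρ)) y.2.2)
          (iteratedFDeriv ℝ k (fun ρ => Φ y.1 (y.2.1, ρ)) y.2.2) < e := by
      refine (eventually_all_finite (finite_Iic r)).2 fun k hk => ?_
      have hk' := hΨ.self_of_nhds.2 k hk
      have t1 : Tendsto (fun y : OnePoint ℕ × (ℝ × PhaseSpace d) =>
          (((∞ : OnePoint ℕ), y.2.1), y.2.2)) (𝓝 (∞, x)) (𝓝 ((∞, x.1), x.2)) :=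
        (show Continuous fun y : OnePoint ℕ × (ℝ × PhaseSpace d) =>
          (((∞ : OnePoint ℕ), y.2.1), y.2.2) by fun_prop).tendsto (∞, x)
      have t2 : Tendsto (fun y : OnePoint ℕ × (ℝ × PhaseSpace d) => ((y.1, y.2.1), y.2.2))
          (𝓝 (∞, x)) (𝓝 ((∞, x.1), x.2)) :=
        (show Continuous fun y : OnePoint ℕ × (ℝ × PhaseSpace d) => ((y.1, y.2.1), y.2.2) by
          fun_prop).tendsto (∞, x)
      have t3 := (hk'.tendsto.comp t1).dist (hk'.tendsto.comp t2)
      rw [dist_self] at t3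
      exact t3.eventually (gt_mem_nhds he)
    have hbil' : ∀ᶠ y in 𝓝 ((∞ : OnePoint ℕ), x),
        billiardFlow B y.2.1 =ᶠ[𝓝 y.2.2] fun ρ => Φ ∞ (y.2.1, ρ) :=
      ((continuous_snd.tendsto ((∞ : OnePoint ℕ), x)).eventually hbil).mono fun y hy => hy.2
    filter_upwards [hham, hsmooth, hclose, hbil'] with y h4 h5 h6 h7 m hm
    obtain ⟨h8, h9⟩ := h4 m hm
    refine ⟨h8, h5.congr_of_eventuallyEq h9, fun k hk => ?_⟩
    rw [(h7.iteratedFDeriv ℝ k).self_of_nhds, (h9.iteratedFDeriv ℝ k).self_of_nhds]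
    exact h6 k hk

/-- Convergence along all sequences, near all points of a compact set, is uniform. -/
theorem eventually_forall_of_sequences {X : Type*} [TopologicalSpace X] [FirstCountableTopology X]
    {K : Set X} (hK : IsCompact K) {P : ℝ → X → Prop}
    (h : ∀ ε : ℕ → ℝ, Tendsto ε atTop (𝓝[>] 0) → ∀ x ∈ K, ∀ᶠ y in 𝓝 ((∞ : OnePoint ℕ), x),
      ∀ m : ℕ, y.1 = (m : OnePoint ℕ) → P (ε m) y.2) :
    ∀ᶠ ε in 𝓝[>] (0 : ℝ), ∀ x ∈ K, P ε x := by
  by_contra hcon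
  obtain ⟨ε, hε, hε'⟩ := exists_seq_forall_of_frequently (not_eventually.1 hcon)
  push Not at hε'
  choose y hyK hy using hε'
  obtain ⟨x, hx, φ, hφ, hlim⟩ := hK.tendsto_subseq hyK
  -- The hypothesis is applied to the subsequence of parameters at the limit of the bad points,
  -- which contradicts their choice.
  have ht : Tendsto (fun m : ℕ => ((m : OnePoint ℕ), y (φ m))) atTop (𝓝 (∞, x)) :=
    ((OnePoint.continuous_iff_from_nat id).1 continuous_id).prodMk_nhds hlim
  obtain ⟨m, hm⟩ := (ht.eventually (h (ε ∘ φ) (hε.comp hφ.tendsto_atTop) x hx)).exists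
  exact hy (φ m) (hm m rfl)

end Convergence

/-! ### The convergence theorem -/

theorem theorem2 {d r n : ℕ} (hr : 1 ≤ r)
    (L : AddSubgroup (Config d)) [DiscreteTopology L]
    (B : BilliardTable d r n L)
    (V : ℝ → Config d → ℝ)
    (hV : ∀ ε, 0 < ε → ContDiff ℝ (r + 1 : ℕ) (V ε))
    (hVper : ∀ ε, 0 < ε → ∀ l ∈ L, ∀ q, V ε (q + l) = V ε q)
    (P : PatternFunction B) (A : BarrierFunctions P)
    (𝓔 : EReal) (h𝓔 : 0 < 𝓔)
    (hI : ConditionI B V)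
    (hIIa : ConditionIIa A) (hIIb : ConditionIIb A V) (hIIc : ConditionIIc A)
    (hIII : ConditionIII A 𝓔) (hIV : ConditionIV A 𝓔)
    (T : ℝ) (hT : 0 < T)
    (γ : ℝ → PhaseSpace d)
    (hγ : IsBilliardTrajectory B T γ) (hreg : NoTangency B T γ)
    (hEnergy : ((‖(γ 0).2‖ ^ 2 / 2 : ℝ) : EReal) < 𝓔) :
    ∃ δ : ℝ, 0 < δ ∧ δ < T ∧
      -- the billiard flow is defined and `C^r` near `γ 0`, for times close to `T`
      (∀ t ∈ Ioo (T - δ) (T + δ),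
        (∀ ρ ∈ Metric.ball (γ 0) δ, ∃ β : ℝ → PhaseSpace d, β 0 = ρ ∧
          IsBilliardTrajectory B t β ∧ NoTangency B t β) ∧
        ContDiffOn ℝ r (billiardFlow B t) (Metric.ball (γ 0) δ)) ∧
      -- so is the smooth Hamiltonian flow, for small `ε > 0`
      (∀ᶠ ε in 𝓝[>] (0 : ℝ), ∀ t ∈ Ioo (T - δ) (T + δ),
        (∀ ρ ∈ Metric.ball (γ 0) δ, ∃ η : ℝ → PhaseSpace d, η 0 = ρ ∧
          IsHamiltonianTrajectory (V ε) t η) ∧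
        ContDiffOn ℝ r (hamiltonianFlow (V ε) t) (Metric.ball (γ 0) δ)) ∧
      -- all derivatives of order at most `r` converge, uniformly in the phase point and in `t`
      (∀ k ≤ r, TendstoUniformlyOn
        (fun ε (x : ℝ × PhaseSpace d) => iteratedFDeriv ℝ k (hamiltonianFlow (V ε) x.1) x.2)
        (fun x => iteratedFDeriv ℝ k (billiardFlow B x.1) x.2)
        (𝓝[>] 0) (Ioo (T - δ) (T + δ) ×ˢ Metric.ball (γ 0) δ)) := by
  have hlink : ∀ ε : ℕ → ℝ, Tendsto ε atTop (𝓝[>] 0) → ∀ (t : ℝ) (β : ℝ → PhaseSpace d), 0 < t →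
      IsBilliardTrajectory B t β → NoTangency B t β →
      ((‖(β 0).2‖ ^ 2 / 2 : ℝ) : EReal) < 𝓔 →
      FamilyLink r (fun κ (a : ℝ × PhaseSpace d) (b : PhaseSpace d) =>
        (∀ m : ℕ, κ = (m : OnePoint ℕ) → HamiltonianArc (V (ε m)) a.2 a.1 b) ∧
        (κ = OnePoint.infty → BilliardArc B a.2 a.1 b)) (t, β 0) (β t) :=
    fun ε hε t β ht hβ hβ' hE => hβ.flow_link (U := fun m => V (ε m)) hβ' hr ht
      (fun x hx => hI.contDiffFamAt hV hε hx)
      (fun q hq hqc v hv => exists_collisionChart h𝓔 hIIa hIIb hIIc hIII hIV hε hq hqc hv) hE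
  have hsm : ∀ ε : ℕ → ℝ, Tendsto ε atTop (𝓝[>] 0) →
      ∀ᶠ m in atTop, ContDiff ℝ 2 (V (ε m)) := fun ε hε => by
    filter_upwards [hε.eventually self_mem_nhdsWithin] with m hm
    exact (hV _ hm).of_le (by exact_mod_cast Nat.succ_le_succ hr)
  -- A sample sequence, used only for assertions about the billiard flow, in which ε does not occur.
  have hseq : Tendsto (fun m : ℕ => 1 / ((m : ℝ) + 1)) atTop (𝓝[>] 0) :=
    tendsto_nhdsWithin_iff.2 ⟨tendsto_one_div_add_atTop_nhds_zero_nat,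
      Eventually.of_forall fun m => mem_Ioi.2 Nat.one_div_pos_of_nat⟩
  have hgood : ∀ᶠ y in 𝓝 (T, γ 0), ((∃ b, BilliardArc B y.2 y.1 b) ∧
      ContDiffAt ℝ r (billiardFlow B y.1) y.2) ∧ 0 < y.1 ∧
      ((‖y.2.2‖ ^ 2 / 2 : ℝ) : EReal) < 𝓔 := by
    have hc : Continuous fun y : ℝ × PhaseSpace d => ((‖y.2.2‖ ^ 2 / 2 : ℝ) : EReal) :=
      continuous_coe_real_ereal.comp (by fun_prop)
    exact (eventually_isCloseFlow (hsm _ hseq) (hlink _ hseq T γ hT hγ hreg hEnergy)).1.and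
      (((continuous_fst.tendsto (T, γ 0)).eventually (lt_mem_nhds hT)).and
        ((hc.tendsto (T, γ 0)).eventually (gt_mem_nhds hEnergy)))
  obtain ⟨δ₀, hδ₀, hball⟩ := Metric.eventually_nhds_iff_ball.1 hgood
  have hmin : 0 < min δ₀ T := lt_min hδ₀ hT
  set δ := min δ₀ T / 2 with hδ
  have hδ0 : 0 < δ := by positivity
  have hδT : δ < T := by have := min_le_right δ₀ T; linarith
  have hδδ : δ < δ₀ := by have := min_le_left δ₀ T; linarith
  set K := Metric.closedBall (T, γ 0) δ with hK
  have hKgood : ∀ y ∈ K, _ := fun y hy => hball y (Metric.closedBall_subset_ball hδδ hy)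
  have hsub : ∀ t ∈ Ioo (T - δ) (T + δ), ∀ ρ ∈ Metric.ball (γ 0) δ, (t, ρ) ∈ K :=
    fun t ht ρ hρ => by
      rw [hK, Metric.mem_closedBall, Prod.dist_eq]
      refine max_le ?_ (Metric.mem_ball.1 hρ).le
      rw [Real.dist_eq, abs_le]
      constructor <;> linarith [ht.1, ht.2]
  -- Each (t, ρ) in the compact set has its own billiard trajectory with transversal collisions and
  -- energy below 𝓔, so the local result applies at each of them, for every sequence of parameters.
  have hclose : ∀ e > 0, ∀ᶠ ε in 𝓝[>] (0 : ℝ), ∀ y ∈ K, IsCloseFlow B e (V ε) y :=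
    fun e he => eventually_forall_of_sequences (isCompact_closedBall _ _) fun ε hε y hy => by
      obtain ⟨⟨⟨b, -, β, hβ0, -, hβ, hβ'⟩, -⟩, ht, hE⟩ := hKgood y hy
      have h1 := hlink ε hε y.1 β ht hβ hβ' (by rwa [hβ0])
      rw [hβ0] at h1
      exact (eventually_isCloseFlow (hsm ε hε) h1).2 e he
  refine ⟨δ, hδ0, hδT, fun t ht => ⟨fun ρ hρ => ?_, fun ρ hρ => ?_⟩, ?_, fun k hk => ?_⟩
  · obtain ⟨⟨⟨b, -, β, hβ0, -, hβ, hβ'⟩, -⟩, -⟩ := hKgood _ (hsub t ht ρ hρ)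
    exact ⟨β, hβ0, hβ, hβ'⟩
  · exact (hKgood _ (hsub t ht ρ hρ)).1.2.contDiffWithinAt
  · filter_upwards [hclose 1 one_pos] with ε h t ht
    refine ⟨fun ρ hρ => ?_, fun ρ hρ => (h _ (hsub t ht ρ hρ)).2.1.contDiffWithinAt⟩
    obtain ⟨⟨b, -, η, hη0, -, hη⟩, -⟩ := h _ (hsub t ht ρ hρ)
    exact ⟨η, hη0, hη⟩
  · refine Metric.tendstoUniformlyOn_iff.2 fun e he => ?_
    filter_upwards [hclose e he] with ε h x hx
    exact (h x (hsub x.1 hx.1 x.2 hx.2)).2.2 k hk
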